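/- Let $\Bbbk$ be a field. Let $A=\bigoplus_{n\ge 0}A_n$ be a Koszul algebra, that is, a quadratic graded algebra ($A=T(V)/(R)$ with $V=A_1$ finite dimensional and $R\subseteq V\otimes V$) such that the trivial left $A$-module $\Bbbk$ has a graded projective resolution $P$ with $P_m$ generated in degree $m$ for all $m\ge 0$. Let $H$ be a finite dimensional semisimple Hopf algebra (comultiplication $h\mapsto\sum h_{1}\otimes h_{2}$, counit $\varepsilon$, antipode $S$) such that $A$ is a left $H$-module algebra with $H\triangleright A_n\subseteq A_n$ for all $n$. Let $B=A\# H$ be the smash product, with $(a\# h)(b\# g)=\sum a(h_1\triangleright b)\# h_2g$, and write $A^e=A\otimes A^{\mathrm{op}}$, $B^e=B\otimes B^{\mathrm{op}}$. Let $\mathbf H^\bullet(A,N)$ denote Hochschild cohomology, $\mathbf{HH}^\bullet(B)=\mathbf H^\bullet(B,B)$, and let the cup products on $\mathbf H^\bullet(A,B)$ and $\mathbf{HH}^\bullet(B)$ be given on Hochschild cochains by $(f\smallsmile g)(a_1,\dots,a_{m+n})=f(a_1,\dots,a_m)\,g(a_{m+1},\dots,a_{m+n})$. The algebra $H$ acts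 from the right on $\mathbf H^\bullet(A,B)$, on cochains by $(f\leftharpoonup h)(a_1,\dots,a_m)=\sum S(h_1)\,f\bigl(h_2\triangleright(a_1\otimes\cdots\otimes a_m)\bigr)\,h_3$ with the diagonal action of $H$ on $A^{\otimes m}$; let $\mathbf H^\bullet(A,B)^H$ be the space of invariants. Let $\Gamma\subseteq B^e$ be the subalgebra of all $\sum x\otimes y$ with $\sum x_{[0]}\otimes x_{[1]}\otimes y=\sum x\otimes S^{-1}y_{[1]}\otimes y_{[0]}$, where $\sum b_{[0]}\otimes b_{[1]}$ is the coaction $a\# h\mapsto\sum (a\# h_1)\otimes h_2$. It contains $A^e$ and the elements $\sum h_1\otimes S h_2$, $h\in H$. Let $K=K(A)$ be the Koszul bimodule complex of $A$, with terms $K_m=A\otimes (A^!_m)^*\otimes A$, where $(A^!_0)^*=\Bbbk$, $(A^!_1)^*=V$ and $(A^!_m)^*=\bigcap_{u+v=m-2}V^{\otimes u}\otimes R\otimes V^{\otimes v}$ for $m\ge 2$, with differential $$1\otimes (v_1\otimes\cdots\otimes v_m)\otimes 1\mapsto v_1\otimes (v_2\otimes\cdots\otimes v_m)\otimes 1+(-1)^m\,1\otimes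 (v_1\otimes\cdots\otimes v_{m-1})\otimes v_m$$ (extended linearly to $(A_m^!)^*$), augmented by the multiplication $K_0=A\otimes A\to A$. Then: 1. There is a left $\Gamma$-module structure on each $K_m$ that extends the $A^e$-module structure and in which $\sum h_1\otimes Sh_2$ acts by $a\otimes\alpha\otimes a'\mapsto\sum (h_1\triangleright a)\otimes (h_2\triangleright\alpha)\otimes (h_3\triangleright a')$. With it $K$ is a complex of $\Gamma$-modules, and a resolution of $A$ by $\Gamma$-modules that are projective over $A^e$; here $\Gamma$ acts on $A\subseteq B$ by $(\sum x\otimes y)\cdot a=\sum xay$. 2. $\mathcal K=B^e\otimes_\Gamma K$ is a projective resolution of $B$ over $B^e$, with augmentation $b\otimes b'\otimes_\Gamma k\mapsto b\,\bar k\,b'$, where $\bar k\in A$ is the image of $k\in K_0$; and the rule $\Theta(f)(b\otimes b'\otimes_\Gamma k)=b f(k)b'$ gives a well-defined bijection $$\Theta\colon \operatorname{Hom}_{A^e}(K_m,B)^H\longrightarrow\operatorname{Hom}_{B^e}(\mathcal K_m,B)$$ for every $m$, where the invariants are taken for $(f\leftharpoonup h)(k)=\sum S(h_1)f\bigl((h_2\otimes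 Sh_3)k\bigr)h_4$. 3. There is an isomorphism of graded vector spaces $E\colon\mathbf H^\bullet(A,B)^H\cong\mathbf{HH}^\bullet(B)$ induced by $\Theta$: if $f\in\operatorname{Hom}_{A^e}(K_m,B)^H$ is a cocycle, then $E$ maps the class of $f$ to the class of $\Theta(f)$, where the cohomologies of $\operatorname{Hom}_{A^e}(K,B)$ and $\operatorname{Hom}_{B^e}(\mathcal K,B)$ are identified with $\mathbf H^\bullet(A,B)$ and $\mathbf{HH}^\bullet(B)$ through comparison morphisms (which exist) from the bar resolutions of $A$ and $B$ to $K$ and $\mathcal K$. The isomorphism $E$ preserves cup products: if $x\in\mathbf H^m(A,B)^H$ and $y\in\mathbf H^n(A,B)^H$, then $x\smallsmile y\in\mathbf H^{m+n}(A,B)^H$ and $E(x\smallsmile y)=E(x)\smallsmile E(y)$. -/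

import Mathlib

open scoped TensorProduct

noncomputable section

namespace KoszulSmash

/-! ### Enveloping algebras, resolutions and Hochschild cohomology -/

/-- The enveloping algebra `A ⊗ Aᵒᵖ`; its left modules are the `A`-bimodules. -/
abbrev Env (k A : Type*) [Field k] [Ring A] [Algebra k A] : Type _ := A ⊗[k] Aᵐᵒᵖ

section Bimodule

variable {k A : Type*} [Field k] [Ring A] [Algebra k A]

/-- `A`, regarded as a bimodule over itself. (A type synonym, as the bimodule structure of `A`
must not interfere with the left regular module structure of `A ⊗ Aᵒᵖ`.) -/
def Reg (A : Type*) : Type _ := A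

instance (A : Type*) [Ring A] : Ring (Reg A) := inferInstanceAs (Ring A)
instance (k A : Type*) [Field k] [Ring A] [Algebra k A] : Algebra k (Reg A) :=
  inferInstanceAs (Algebra k A)

variable (k A) in
/-- The identity map `A → A`, as an isomorphism of algebras onto the synonym. -/
def toReg : A ≃ₐ[k] Reg A := (AlgEquiv.refl : A ≃ₐ[k] A)

/-- The bimodule structure `(a ⊗ a') • x = a x a'`. -/
instance regBimod : Module (Env k A) (Reg A) :=
  Module.compHom A (AlgHom.mulLeftRight k A).toRingHom

theorem reg_smul (a b x : A) :
    (a ⊗ₜ MulOpposite.op b : Env k A) • toReg k A x = toReg k A (a * x * b) :=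
  AlgHom.mulLeftRight_apply k A a (MulOpposite.op b) x

instance regBimod_tower : IsScalarTower k (Env k A) (Reg A) where
  smul_assoc c e x :=
    congrArg (fun f : Module.End k A => f x) (map_smul (AlgHom.mulLeftRight k A) c e)

end Bimodule

/-- `⋯ → X 1 → X 0 → M → 0` is a projective resolution of the `R`-module `M`. -/
structure IsProjRes (R : Type*) [Ring R] {M : Type*} [AddCommGroup M] [Module R M]
    (X : ℕ → Type*) [∀ m, AddCommGroup (X m)] [∀ m, Module R (X m)]
    (d : ∀ m, X (m + 1) →ₗ[R] X m) (aug : X 0 →ₗ[R] M) : Prop where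
  projective : ∀ m, Module.Projective R (X m)
  surjective : Function.Surjective aug
  exact_zero : Function.Exact (d 0) aug
  exact_succ : ∀ m, Function.Exact (d (m + 1)) (d m)

section Hochschild

variable (k : Type*) {A N : Type*} [Field k] [Ring A] [Algebra k A]
  [AddCommGroup N] [Module (Env k A) N]

/-- The Hochschild differential of a function of `m` variables with values in a bimodule:
`a₀ f(a₁,…,aₘ) + ∑ (-1)^{i+1} f(…,aᵢaᵢ₊₁,…) + (-1)^{m+1} f(a₀,…,aₘ₋₁) aₘ`. -/
def hochD {m : ℕ} (f : (Fin m → A) → N) (a : Fin (m + 1) → A) : N :=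
  (a 0 ⊗ₜ 1 : Env k A) • f (Fin.tail a)
    + ∑ i : Fin m, (-1 : ℤ) ^ ((i : ℕ) + 1) • f (Fin.contractNth i.castSucc (· * ·) a)
    + (-1 : ℤ) ^ (m + 1) • ((1 ⊗ₜ MulOpposite.op (a (Fin.last m)) : Env k A) • f (Fin.init a))

theorem hochD_zero {m : ℕ} : hochD k (0 : (Fin m → A) → N) = 0 := by
  funext a; simp [hochD]

theorem hochD_add {m : ℕ} (f g : (Fin m → A) → N) :
    hochD k (f + g) = hochD k f + hochD k g := by
  funext a
  simp only [hochD, Pi.add_apply, smul_add, Finset.sum_add_distrib]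
  abel

variable [Module k N]

variable (A N) in
/-- Hochschild `m`-cochains `Hom(A^{⊗ m}, N)`. -/
abbrev Cochain (m : ℕ) : Type _ := MultilinearMap k (fun _ : Fin m => A) N

theorem hochD_smul [IsScalarTower k (Env k A) N] {m : ℕ} (c : k) (f : (Fin m → A) → N) :
    hochD k (c • f) = c • hochD k f := by
  funext a
  simp only [hochD, Pi.smul_apply, smul_add, Finset.smul_sum]
  simp only [smul_comm _ c]

/-- `f` is a Hochschild coboundary. -/
def IsCobdry : {m : ℕ} → ((Fin m → A) → N) → Prop
  | 0, f => f = 0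
  | m + 1, f => ∃ g : Cochain k A N m, f = hochD k g

theorem IsCobdry.zero {m : ℕ} : IsCobdry k (0 : (Fin m → A) → N) := by
  cases m with
  | zero => rfl
  | succ m => exact ⟨0, (hochD_zero k).symm⟩

theorem IsCobdry.add {m : ℕ} {f g : (Fin m → A) → N} (hf : IsCobdry k f) (hg : IsCobdry k g) :
    IsCobdry k (f + g) := by
  cases m with
  | zero =>
    simp only [IsCobdry] at hf hg ⊢
    simp [hf, hg]
  | succ m =>
    obtain ⟨f', rfl⟩ := hf
    obtain ⟨g', rfl⟩ := hg
    exact ⟨f' + g', by rw [← hochD_add]; rfl⟩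

theorem IsCobdry.smul [IsScalarTower k (Env k A) N] {m : ℕ} (c : k) {f : (Fin m → A) → N}
    (hf : IsCobdry k f) : IsCobdry k (c • f) := by
  cases m with
  | zero =>
    simp only [IsCobdry] at hf ⊢
    simp [hf]
  | succ m =>
    obtain ⟨f', rfl⟩ := hf
    exact ⟨c • f', by rw [← hochD_smul]; rfl⟩

variable (A N) [IsScalarTower k (Env k A) N]

/-- Hochschild `m`-cocycles. -/
def cocycles (m : ℕ) : Submodule k (Cochain k A N m) where
  carrier := {f | hochD k f = 0}
  zero_mem' := hochD_zero k
  add_mem' {f g} hf hg := by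
    change hochD k (⇑f + ⇑g) = 0
    rw [hochD_add, hf, hg, add_zero]
  smul_mem' c f hf := by
    change hochD k (c • ⇑f) = 0
    rw [hochD_smul, hf, smul_zero]

/-- Hochschild `m`-coboundaries, inside the cocycles. -/
def coboundaries (m : ℕ) : Submodule k (cocycles k A N m) where
  carrier := {f | IsCobdry k (f : Cochain k A N m)}
  zero_mem' := IsCobdry.zero k
  add_mem' hf hg := IsCobdry.add k hf hg
  smul_mem' c _ hf := IsCobdry.smul k c hf

/-- The Hochschild cohomology group `H^m(A, N)`. -/
abbrev HochCoh (m : ℕ) : Type _ := cocycles k A N m ⧸ coboundaries k A N m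

variable {A N}

/-- The function `f` is a cocycle whose class is `x`. -/
def IsRep {m : ℕ} (f : (Fin m → A) → N) (x : HochCoh k A N m) : Prop :=
  ∃ z : cocycles k A N m, ⇑(z : Cochain k A N m) = f ∧ Submodule.Quotient.mk z = x

/-- The cup product `(f ⌣ g)(a₁,…,aₘ₊ₙ) = f(a₁,…,aₘ) g(aₘ₊₁,…,aₘ₊ₙ)`, for values in a ring. -/
def cup {A B : Type*} [Mul B] {m n : ℕ} (f : (Fin m → A) → B) (g : (Fin n → A) → B)
    (a : Fin (m + n) → A) : B :=
  f (fun i => a (Fin.castAdd n i)) * g (fun j => a (Fin.natAdd m j))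

/-- A morphism from the bar resolution of `A` to the complex `X` of `A`-bimodules that lifts the
identity of `A`. A bimodule map from `A ⊗ A^{⊗ m} ⊗ A` to `X m` is the same as an `m`-cochain with
values in `X m`, and composition with the bar differential is the Hochschild differential. -/
structure IsComparison (X : ℕ → Type*) [∀ m, AddCommGroup (X m)] [∀ m, Module k (X m)]
    [∀ m, Module (Env k A) (X m)] (d : ∀ m, X (m + 1) →ₗ[Env k A] X m)
    (aug : X 0 →ₗ[Env k A] Reg A) (ψ : ∀ m, Cochain k A (X m) m) : Prop where
  comm : ∀ m a, d m (ψ (m + 1) a) = hochD k (ψ m) a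
  aug_eq : ∀ a, aug (ψ 0 a) = 1

end Hochschild

/-! ### Sweedler notation, module algebras and smash products -/

section Sweedler

variable (k : Type*) {H M : Type*} [Field k] [Ring H] [HopfAlgebra k H]
  [AddCommGroup M] [Module k M]

/-- `∑ F(h₁, h₂)`, to be used for bilinear `F`. -/
def sw₂ (h : H) (F : H → H → M) : M :=
  ∑ i ∈ (Coalgebra.Repr.arbitrary k h).index,
    F ((Coalgebra.Repr.arbitrary k h).left i) ((Coalgebra.Repr.arbitrary k h).right i)

/-- `∑ F(h₁, h₂, h₃)`, to be used for trilinear `F`. -/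
def sw₃ (h : H) (F : H → H → H → M) : M :=
  sw₂ k h fun x h' => sw₂ k h' fun y z => F x y z

theorem sw₂_eq (h : H) (F : H →ₗ[k] H →ₗ[k] M) :
    sw₂ k h (fun x y => F x y) = TensorProduct.lift F (Coalgebra.comul h) := by
  conv_rhs => rw [← (Coalgebra.Repr.arbitrary k h).eq]
  simp [sw₂, map_sum]

end Sweedler

/-- `A` is a left `H`-module algebra: `h(ab) = (h₁a)(h₂b)` and `h1 = ε(h)1`. -/
class HModuleAlgebra (k H A : Type*) [Field k] [Ring H] [HopfAlgebra k H] [Ring A] [Algebra k A]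
    [Module H A] [IsScalarTower k H A] : Prop where
  smul_mul' : ∀ (h : H) (a b : A), h • (a * b) = sw₂ k h fun x y => (x • a) * (y • b)
  smul_one' : ∀ h : H, h • (1 : A) = Coalgebra.counit (R := k) h • (1 : A)

/-- The underlying vector space `A ⊗ H` of the smash product `A # H`. -/
def Smash (k A H : Type*) [Field k] [Ring A] [Algebra k A] [Ring H] [HopfAlgebra k H] : Type _ :=
  A ⊗[k] H

section Smash

variable (k A H : Type*) [Field k] [Ring A] [Algebra k A] [Ring H] [HopfAlgebra k H]

instance : AddCommGroup (Smash k A H) := inferInstanceAs (AddCommGroup (A ⊗[k] H))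
instance : Module k (Smash k A H) := inferInstanceAs (Module k (A ⊗[k] H))

variable {k A H} in
/-- The element `a # h`. -/
def Smash.mk (a : A) (h : H) : Smash k A H := (a ⊗ₜ[k] h : A ⊗[k] H)

variable [Module H A] [IsScalarTower k H A]

/-- The action of `H` on `A`, as an algebra map. -/
def hEnd : H →ₐ[k] Module.End k A :=
  AlgHom.ofLinearMap
    { toFun := fun h =>
        { toFun := fun a => h • a
          map_add' := smul_add h
          map_smul' := fun c a => by
            rw [RingHom.id_apply, ← smul_one_smul H c a, ← smul_one_smul H c (h • a), smul_smul,
              smul_smul, Algebra.smul_def, mul_one, Algebra.commutes] }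
      map_add' := fun x y => by ext; simp [add_smul]
      map_smul' := fun c x => by ext; simp }
    (by ext; simp) (fun x y => by ext; simp [mul_smul])

/-- The action `h(b ⊗ g) = h₁b ⊗ h₂g` of `H` on `A ⊗ H`. -/
def diagEnd : H →ₐ[k] Module.End k (A ⊗[k] H) :=
  (Module.endTensorEndAlgHom (R := k) (S := k) (A := k) (M := A) (N := H)).comp
    ((Algebra.TensorProduct.map (hEnd k A H) (Algebra.lmul k H)).comp (Bialgebra.comulAlgHom k H))

/-- Left multiplication `(a # h)(b # g) = a(h₁b) # h₂g` of the smash product. -/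
def smashMul : A ⊗[k] H →ₗ[k] Module.End k (A ⊗[k] H) :=
  TensorProduct.lift (LinearMap.mk₂ k
    (fun a h => (LinearMap.rTensor H (LinearMap.mulLeft k a)) ∘ₗ diagEnd k A H h)
    (fun a b h => by
      rw [show LinearMap.mulLeft k (a + b) = LinearMap.mulLeft k a + LinearMap.mulLeft k b from
        by ext; simp [add_mul], LinearMap.rTensor_add, LinearMap.add_comp])
    (fun c a h => by
      rw [show LinearMap.mulLeft k (c • a) = c • LinearMap.mulLeft k a from
        by ext; simp, LinearMap.rTensor_smul, LinearMap.smul_comp])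
    (fun a h h' => by rw [map_add, LinearMap.comp_add])
    (fun c a h => by rw [map_smul, LinearMap.comp_smul]))

theorem smashMul_tmul (a b : A) (h g : H) :
    smashMul k A H (a ⊗ₜ h) (b ⊗ₜ g) =
      ∑ i ∈ (Coalgebra.Repr.arbitrary k h).index,
        (a * ((Coalgebra.Repr.arbitrary k h).left i • b)) ⊗ₜ
          ((Coalgebra.Repr.arbitrary k h).right i * g) := by
  have : diagEnd k A H h = ∑ i ∈ (Coalgebra.Repr.arbitrary k h).index,
      TensorProduct.map (hEnd k A H ((Coalgebra.Repr.arbitrary k h).left i))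
        (LinearMap.mulLeft k ((Coalgebra.Repr.arbitrary k h).right i)) := by
    change Module.endTensorEndAlgHom (R := k) (S := k) (A := k) (M := A) (N := H)
      (Algebra.TensorProduct.map (hEnd k A H) (Algebra.lmul k H) (Coalgebra.comul h)) = _
    conv_lhs => rw [← (Coalgebra.Repr.arbitrary k h).eq]
    rw [map_sum, map_sum]
    rfl
  simp only [smashMul, TensorProduct.lift.tmul, LinearMap.mk₂_apply, LinearMap.comp_apply, this,
    LinearMap.sum_apply, map_sum]
  rfl

theorem smashMul_one_left (x : A ⊗[k] H) : smashMul k A H ((1 : A) ⊗ₜ (1 : H)) x = x := by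
  simp only [smashMul, TensorProduct.lift.tmul, LinearMap.mk₂_apply, map_one]
  rw [show LinearMap.mulLeft k (1 : A) = LinearMap.id from by ext; simp, LinearMap.rTensor_id]
  rfl

theorem diagEnd_mulLeft [HModuleAlgebra k H A] (h : H) (b : A) :
    diagEnd k A H h ∘ₗ LinearMap.rTensor H (LinearMap.mulLeft k b) =
      smashMul k A H (smashMul k A H (1 ⊗ₜ h) (b ⊗ₜ 1)) := by
  let R := fun x : H => Coalgebra.Repr.arbitrary k x
  have key := Coalgebra.sum_tmul_tmul_eq (R h) (fun i => R ((R h).left i))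
    (fun i => R ((R h).right i))
  ext c e
  have h1 : ∀ x : A ⊗[k] H, diagEnd k A H h x = smashMul k A H (1 ⊗ₜ h) x := by
    intro x
    simp only [smashMul, TensorProduct.lift.tmul, LinearMap.mk₂_apply, LinearMap.comp_apply]
    rw [show LinearMap.mulLeft k (1 : A) = LinearMap.id from by ext; simp]
    simp
  let G : H ⊗[k] (H ⊗[k] H) →ₗ[k] A ⊗[k] H :=
    TensorProduct.map (LinearMap.mul' k A) LinearMap.id ∘ₗ
      (TensorProduct.assoc k A A H).symm.toLinearMap ∘ₗ
      TensorProduct.map ((LinearMap.toSpanSingleton H A b).restrictScalars k)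
        (TensorProduct.map ((LinearMap.toSpanSingleton H A c).restrictScalars k)
          (LinearMap.mulRight k e))
  have hG : ∀ x y z : H, G (x ⊗ₜ (y ⊗ₜ z)) = ((x • b) * (y • c)) ⊗ₜ (z * e) := by
    intro x y z; simp [G]
  have key' := congrArg G key
  simp only [map_sum, hG] at key'
  simp only [TensorProduct.AlgebraTensorModule.curry_apply, TensorProduct.curry_apply,
    LinearMap.restrictScalars_self, LinearMap.comp_apply, LinearMap.rTensor_tmul,
    LinearMap.mulLeft_apply, h1, smashMul_tmul, one_mul, mul_one, map_sum, LinearMap.sum_apply]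
  rw [← key']
  refine Finset.sum_congr rfl fun i _ => ?_
  rw [HModuleAlgebra.smul_mul' (k := k), sw₂, TensorProduct.sum_tmul]

theorem smashMul_mul [HModuleAlgebra k H A] (x y : A ⊗[k] H) :
    smashMul k A H (smashMul k A H x y) = smashMul k A H x ∘ₗ smashMul k A H y := by
  induction x with
  | zero => simp
  | add x x' hx hx' => simp only [map_add, LinearMap.add_apply, hx, hx', LinearMap.add_comp]
  | tmul a h =>
    induction y with
    | zero => simp
    | add y y' hy hy' => simp only [map_add, hy, hy', LinearMap.comp_add]
    | tmul b g =>
      have e1 : ∀ (a : A) (h : H), smashMul k A H (a ⊗ₜ h) =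
          LinearMap.rTensor H (LinearMap.mulLeft k a) ∘ₗ diagEnd k A H h := fun a h => by
        simp [smashMul]
      have e2 := diagEnd_mulLeft k A H h b
      simp only [smashMul_tmul, one_mul, mul_one, map_sum] at e2
      rw [smashMul_tmul, map_sum]
      have e3 : smashMul k A H (a ⊗ₜ h) ∘ₗ smashMul k A H (b ⊗ₜ g) =
          LinearMap.rTensor H (LinearMap.mulLeft k a) ∘ₗ
            (diagEnd k A H h ∘ₗ LinearMap.rTensor H (LinearMap.mulLeft k b)) ∘ₗ
              diagEnd k A H g := by
        rw [e1, e1]; rfl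
      rw [e3, e2]
      ext c e
      simp only [LinearMap.sum_apply, LinearMap.comp_apply, map_sum,
        TensorProduct.AlgebraTensorModule.curry_apply, TensorProduct.curry_apply,
        LinearMap.restrictScalars_self]
      refine Finset.sum_congr rfl fun i _ => ?_
      rw [e1, e1, map_mul, LinearMap.mulLeft_mul, LinearMap.rTensor_comp]
      rfl

variable [HModuleAlgebra k H A]

theorem diagEnd_one_tmul (h g : H) :
    diagEnd k A H h ((1 : A) ⊗ₜ g) = (1 : A) ⊗ₜ (h * g) := by
  have : diagEnd k A H h ((1 : A) ⊗ₜ g) = smashMul k A H (1 ⊗ₜ h) (1 ⊗ₜ g) := by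
    simp only [smashMul, TensorProduct.lift.tmul, LinearMap.mk₂_apply, LinearMap.comp_apply]
    rw [show LinearMap.mulLeft k (1 : A) = LinearMap.id from by ext; simp]
    simp
  rw [this, smashMul_tmul]
  simp only [one_mul, HModuleAlgebra.smul_one' (k := k), TensorProduct.smul_tmul, ← smul_mul_assoc]
  rw [← TensorProduct.tmul_sum, ← Finset.sum_mul, Coalgebra.sum_counit_smul]

theorem smashMul_one_right (x : A ⊗[k] H) : smashMul k A H x ((1 : A) ⊗ₜ (1 : H)) = x := by
  induction x with
  | zero => simp
  | add x y hx hy => simp only [map_add, LinearMap.add_apply, hx, hy]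
  | tmul a h =>
    simp only [smashMul, TensorProduct.lift.tmul, LinearMap.mk₂_apply, LinearMap.comp_apply,
      diagEnd_one_tmul]
    simp

/-- The smash product `A # H`: multiplication `(a # h)(b # g) = ∑ a(h₁b) # h₂g`. -/
instance : Ring (Smash k A H) :=
  { (inferInstance : AddCommGroup (Smash k A H)) with
    mul := fun x y => smashMul k A H x y
    one := Smash.mk 1 1
    left_distrib := fun x y z => map_add (smashMul k A H x) y z
    right_distrib := fun x y z => congrArg (fun f => f z) (map_add (smashMul k A H) x y)
    zero_mul := fun x => congrArg (fun f => f x) (map_zero (smashMul k A H))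
    mul_zero := fun x => map_zero (smashMul k A H x)
    mul_assoc := fun x y z => congrArg (fun f => f z) (smashMul_mul k A H x y)
    one_mul := smashMul_one_left k A H
    mul_one := smashMul_one_right k A H }

instance : Algebra k (Smash k A H) :=
  Algebra.ofModule
    (fun c x y => congrArg (fun f => f y) (map_smul (smashMul k A H) c x))
    (fun c x y => map_smul (smashMul k A H x) c y)

theorem Smash.mk_mul_mk (a b : A) (h g : H) :
    (Smash.mk a h * Smash.mk b g : Smash k A H) =
      sw₂ k h fun x y => Smash.mk (a * (x • b)) (y * g) :=
  smashMul_tmul k A H a b h g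

/-- The inclusion `a ↦ a # 1`. -/
def inA : A →ₐ[k] Smash k A H :=
  AlgHom.ofLinearMap
    { toFun := fun a => Smash.mk a 1
      map_add' := fun a b => TensorProduct.add_tmul a b 1
      map_smul' := fun _ _ => rfl }
    rfl
    (fun a b => by
      change _ = smashMul k A H (a ⊗ₜ 1) (b ⊗ₜ 1)
      simp [smashMul]; rfl)

/-- The inclusion `h ↦ 1 # h`. -/
def inH : H →ₐ[k] Smash k A H :=
  AlgHom.ofLinearMap
    { toFun := fun h => Smash.mk 1 h
      map_add' := fun a b => TensorProduct.tmul_add 1 a b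
      map_smul' := fun c h => TensorProduct.tmul_smul c 1 h }
    rfl
    (fun g h => by
      change _ = smashMul k A H (1 ⊗ₜ g) (1 ⊗ₜ h)
      simp only [smashMul, TensorProduct.lift.tmul, LinearMap.mk₂_apply, LinearMap.comp_apply,
        diagEnd_one_tmul]
      simp; rfl)

/-- The linear map `a # h ↦ ∑ (a # h₁) ⊗ h₂`. -/
def coactLin : Smash k A H →ₗ[k] Smash k A H ⊗[k] H :=
  (TensorProduct.assoc k A H H).symm.toLinearMap ∘ₗ LinearMap.lTensor A Coalgebra.comul

theorem coactLin_mk (a : A) (h : H) :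
    coactLin k A H (Smash.mk a h) = sw₂ k h fun x y => Smash.mk a x ⊗ₜ y := by
  change (TensorProduct.assoc k A H H).symm (a ⊗ₜ Coalgebra.comul h) = _
  conv_lhs => rw [← (Coalgebra.Repr.arbitrary k h).eq]
  rw [TensorProduct.tmul_sum, map_sum]
  rfl

theorem Smash.induction {P : Smash k A H → Prop} (x : Smash k A H) (zero : P 0)
    (mk : ∀ a h, P (Smash.mk a h)) (add : ∀ x y, P x → P y → P (x + y)) : P x :=
  TensorProduct.induction_on (motive := P) x zero mk add

theorem coactLin_mul (x y : Smash k A H) :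
    coactLin k A H (x * y) = coactLin k A H x * coactLin k A H y := by
  refine Smash.induction k A H (P := fun x => coactLin k A H (x * y) =
    coactLin k A H x * coactLin k A H y) x ?_ (fun a h => ?_) (fun x x' hx hx' => ?_)
  · simp
  · refine Smash.induction k A H (P := fun y => coactLin k A H (Smash.mk a h * y) =
      coactLin k A H (Smash.mk a h) * coactLin k A H y) y ?_ (fun b g => ?_)
      (fun y y' hy hy' => ?_)
    · simp
    · let R := fun x : H => Coalgebra.Repr.arbitrary k x
      have key := Coalgebra.sum_tmul_tmul_eq (R h) (fun i => R ((R h).left i))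
        (fun i => R ((R h).right i))
      let G : H × H → H ⊗[k] (H ⊗[k] H) →ₗ[k] Smash k A H ⊗[k] H := fun p =>
        (TensorProduct.assoc k A H H).symm.toLinearMap ∘ₗ
          TensorProduct.map (LinearMap.mulLeft k a ∘ₗ
              (LinearMap.toSpanSingleton H A b).restrictScalars k)
            (TensorProduct.map (LinearMap.mulRight k p.1) (LinearMap.mulRight k p.2))
      have hG : ∀ p x y z, G p (x ⊗ₜ (y ⊗ₜ z)) =
          (Smash.mk (a * (x • b)) (y * p.1) : Smash k A H) ⊗ₜ (z * p.2) := fun _ _ _ _ => rfl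
      have hL : coactLin k A H (Smash.mk a h * Smash.mk b g) =
          ∑ j ∈ (R g).index, G ((R g).left j, (R g).right j)
            (∑ i ∈ (R h).index, ∑ l ∈ (R ((R h).right i)).index,
              (R h).left i ⊗ₜ[k] ((R ((R h).right i)).left l ⊗ₜ[k] (R ((R h).right i)).right l)) := by
        rw [Smash.mk_mul_mk, sw₂, map_sum]
        simp only [map_sum, hG]
        rw [Finset.sum_comm]
        refine Finset.sum_congr rfl fun i _ => ?_
        change (TensorProduct.assoc k A H H).symm (_ ⊗ₜ Coalgebra.comul _) = _
        rw [Bialgebra.comul_mul, ← (R ((R h).right i)).eq, ← (R g).eq, Finset.sum_mul_sum,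
          TensorProduct.tmul_sum, map_sum, Finset.sum_comm]
        simp only [TensorProduct.tmul_sum, map_sum, Algebra.TensorProduct.tmul_mul_tmul]
        rfl
      rw [hL, ← key, coactLin_mk, coactLin_mk, sw₂, sw₂, Finset.sum_mul_sum, Finset.sum_comm]
      refine Finset.sum_congr rfl fun j _ => ?_
      simp only [map_sum, hG]
      refine Finset.sum_congr rfl fun i _ => ?_
      rw [Algebra.TensorProduct.tmul_mul_tmul, Smash.mk_mul_mk, sw₂, TensorProduct.sum_tmul]
    · simp only [mul_add, map_add, hy, hy']
  · simp only [add_mul, map_add, hx, hx']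

/-- The right coaction `ρ(a # h) = ∑ (a # h₁) ⊗ h₂`, which is an algebra map. -/
def coact : Smash k A H →ₐ[k] Smash k A H ⊗[k] H :=
  AlgHom.ofLinearMap (coactLin k A H)
    (by
      change (TensorProduct.assoc k A H H).symm (1 ⊗ₜ Coalgebra.comul (1 : H)) = _
      rw [Bialgebra.comul_one]
      rfl)
    (coactLin_mul k A H)

end Smash

/-- The antipode reverses the comultiplication. -/
theorem comul_antipode (k H : Type*) [Field k] [Ring H] [HopfAlgebra k H] :
    (Coalgebra.comul ∘ₗ HopfAlgebra.antipode k : H →ₗ[k] H ⊗[k] H) =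
      TensorProduct.map (HopfAlgebra.antipode k) (HopfAlgebra.antipode k) ∘ₗ
        (TensorProduct.comm k H H).toLinearMap ∘ₗ Coalgebra.comul := by
  let R := fun x : H => Coalgebra.Repr.arbitrary k x
  have key := fun h => Coalgebra.sum_tmul_tmul_eq (R h) (fun i => R ((R h).left i))
    (fun i => R ((R h).right i))
  have e1 : ∀ w : H, ∑ i ∈ (R w).index,
      (HopfAlgebra.antipode k ((R w).left i) ⊗ₜ[k] (1 : H)) * Coalgebra.comul ((R w).right i) =
        (1 : H) ⊗ₜ[k] w := by
    intro w
    let F : H ⊗[k] (H ⊗[k] H) →ₗ[k] H ⊗[k] H :=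
      TensorProduct.map (LinearMap.mul' k H ∘ₗ
        TensorProduct.map (HopfAlgebra.antipode k) LinearMap.id) LinearMap.id ∘ₗ
        (TensorProduct.assoc k H H H).symm.toLinearMap
    have hF : ∀ x y z : H, F (x ⊗ₜ (y ⊗ₜ z)) = (HopfAlgebra.antipode k x * y) ⊗ₜ z :=
      fun _ _ _ => rfl
    have := congrArg F (key w)
    simp only [map_sum, hF] at this
    have l : ∀ i, (HopfAlgebra.antipode k ((R w).left i) ⊗ₜ[k] (1 : H)) *
        Coalgebra.comul ((R w).right i) = ∑ j ∈ (R ((R w).right i)).index,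
          (HopfAlgebra.antipode k ((R w).left i) * (R ((R w).right i)).left j) ⊗ₜ[k]
            (R ((R w).right i)).right j := by
      intro i
      rw [← (R ((R w).right i)).eq, Finset.mul_sum]
      simp
    simp only [l]
    rw [← this]
    simp only [← TensorProduct.sum_tmul, HopfAlgebra.sum_antipode_mul_eq_smul,
      TensorProduct.smul_tmul]
    rw [← TensorProduct.tmul_sum, Coalgebra.sum_counit_smul]
  apply WithConv.toConv_injective
  symm
  refine left_inv_eq_right_inv (a := WithConv.toConv (Coalgebra.comul : H →ₗ[k] H ⊗[k] H)) ?_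
    LinearMap.comul_right_inv
  ext h
  rw [(R h).convMul_apply]
  let F : H ⊗[k] (H ⊗[k] H) →ₗ[k] H ⊗[k] H :=
    LinearMap.mul' k (H ⊗[k] H) ∘ₗ
      TensorProduct.map (TensorProduct.map (HopfAlgebra.antipode k) (HopfAlgebra.antipode k) ∘ₗ
        (TensorProduct.comm k H H).toLinearMap) Coalgebra.comul ∘ₗ
        (TensorProduct.assoc k H H H).symm.toLinearMap
  have hF : ∀ x y z : H, F (x ⊗ₜ (y ⊗ₜ z)) =
      (HopfAlgebra.antipode k y ⊗ₜ HopfAlgebra.antipode k x) * Coalgebra.comul z :=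
    fun _ _ _ => rfl
  have := congrArg F (key h)
  simp only [map_sum, hF] at this
  have l : ∀ i, TensorProduct.map (HopfAlgebra.antipode k) (HopfAlgebra.antipode k)
      (TensorProduct.comm k H H (Coalgebra.comul ((R h).left i))) *
        Coalgebra.comul ((R h).right i) = ∑ j ∈ (R ((R h).left i)).index,
      (HopfAlgebra.antipode k ((R ((R h).left i)).right j) ⊗ₜ[k]
        HopfAlgebra.antipode k ((R ((R h).left i)).left j)) *
        Coalgebra.comul ((R h).right i) := by
    intro i
    conv_lhs => rw [← (R ((R h).left i)).eq]
    simp only [map_sum, Finset.sum_mul]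
    rfl
  have r : ∀ i, ∑ j ∈ (R ((R h).right i)).index,
      (HopfAlgebra.antipode k ((R ((R h).right i)).left j) ⊗ₜ[k]
        HopfAlgebra.antipode k ((R h).left i)) *
        Coalgebra.comul ((R ((R h).right i)).right j) =
      (1 : H) ⊗ₜ (HopfAlgebra.antipode k ((R h).left i) * (R h).right i) := by
    intro i
    have : ∀ x : H, x ⊗ₜ[k] HopfAlgebra.antipode k ((R h).left i) =
        ((1 : H) ⊗ₜ[k] HopfAlgebra.antipode k ((R h).left i)) * (x ⊗ₜ[k] (1 : H)) := by
      intro x; simp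
    rw [Finset.sum_congr rfl fun j _ => by rw [this, mul_assoc], ← Finset.mul_sum, e1]
    simp
  refine (Finset.sum_congr rfl fun i _ => l i).trans (this.trans ?_)
  simp only [r, ← TensorProduct.tmul_sum, HopfAlgebra.sum_antipode_mul_eq_smul]
  simp [Algebra.algebraMap_eq_smul_one, Algebra.TensorProduct.one_def]

section Gamma

variable (k A H : Type*) [Field k] [Ring A] [Algebra k A] [Ring H] [HopfAlgebra k H]
  [Module H A] [IsScalarTower k H A] [HModuleAlgebra k H A]

/-- The inclusion `Aᵉ → Bᵉ` for `B = A # H`. -/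
def envIn : Env k A →ₐ[k] Env k (Smash k A H) :=
  Algebra.TensorProduct.map (inA k A H) (AlgHom.op (inA k A H))

/-- `A # H` as an `A`-bimodule: `(a ⊗ a') • x = a x a'`. -/
instance smashBimod : Module (Env k A) (Smash k A H) :=
  Module.compHom (Smash k A H)
    ((AlgHom.mulLeftRight k (Smash k A H)).comp (envIn k A H)).toRingHom

theorem smash_smul (a b : A) (x : Smash k A H) :
    (a ⊗ₜ MulOpposite.op b : Env k A) • x = inA k A H a * x * inA k A H b :=
  AlgHom.mulLeftRight_apply k _ (inA k A H a) (MulOpposite.op (inA k A H b)) x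

instance smashBimod_tower : IsScalarTower k (Env k A) (Smash k A H) where
  smul_assoc c e x := by
    change AlgHom.mulLeftRight k (Smash k A H) (envIn k A H (c • e)) x =
      c • AlgHom.mulLeftRight k (Smash k A H) (envIn k A H e) x
    rw [map_smul, map_smul, LinearMap.smul_apply]

/-- The algebra map `x ⊗ y ↦ ∑ x₀ ⊗ S x₁ ⊗ y`. -/
def gammaLeft : Env k (Smash k A H) →ₐ[k] Smash k A H ⊗[k] (Hᵐᵒᵖ ⊗[k] (Smash k A H)ᵐᵒᵖ) :=
  (Algebra.TensorProduct.assoc k k k (Smash k A H) Hᵐᵒᵖ (Smash k A H)ᵐᵒᵖ).toAlgHom.comp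
    (Algebra.TensorProduct.map
      ((Algebra.TensorProduct.map (AlgHom.id k _) (HopfAlgebra.antipodeAlgHomOp k H)).comp
        (coact k A H))
      (AlgHom.id k _))

/-- The algebra map `x ⊗ y ↦ ∑ x ⊗ y₁ ⊗ y₀`. -/
def gammaRight : Env k (Smash k A H) →ₐ[k] Smash k A H ⊗[k] (Hᵐᵒᵖ ⊗[k] (Smash k A H)ᵐᵒᵖ) :=
  Algebra.TensorProduct.map (AlgHom.id k _)
    ((Algebra.TensorProduct.comm k (Smash k A H)ᵐᵒᵖ Hᵐᵒᵖ).toAlgHom.comp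
      ((Algebra.TensorProduct.opAlgEquiv k k (Smash k A H) H).symm.toAlgHom.comp
        (AlgHom.op (coact k A H))))

/-- The subalgebra `Γ = B □_H Bᵒᵖ` of `Bᵉ`, `B = A # H`: the elements `∑ x ⊗ y` with
`∑ x₀ ⊗ x₁ ⊗ y = ∑ x ⊗ S⁻¹ y₁ ⊗ y₀`, equivalently `∑ x₀ ⊗ S x₁ ⊗ y = ∑ x ⊗ y₁ ⊗ y₀`
(the antipode `S` being bijective). -/
def Gam : Subalgebra k (Env k (Smash k A H)) :=
  AlgHom.equalizer (gammaLeft k A H) (gammaRight k A H)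

theorem envIn_mem (e : Env k A) : envIn k A H e ∈ Gam k A H := by
  have : (gammaLeft k A H).comp (envIn k A H) = (gammaRight k A H).comp (envIn k A H) := by
    have h : ∀ a : A, coact k A H (inA k A H a) = inA k A H a ⊗ₜ 1 := by
      intro a
      change (TensorProduct.assoc k A H H).symm (a ⊗ₜ Coalgebra.comul (1 : H)) = _
      rw [Bialgebra.comul_one]
      rfl
    apply Algebra.TensorProduct.ext
    · ext a
      simp [envIn, gammaLeft, gammaRight, h, Algebra.TensorProduct.one_def]
    · ext a
      simp [envIn, gammaLeft, gammaRight, h, Algebra.TensorProduct.one_def]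
  exact congrArg (fun f => f e) this

/-- The inclusion `Aᵉ → Γ`. -/
def envGam : Env k A →ₐ[k] Gam k A H :=
  (envIn k A H).codRestrict (Gam k A H) (envIn_mem k A H)

theorem sw_mem (h : H) : (sw₂ k h fun x y =>
    (inH k A H x ⊗ₜ MulOpposite.op (inH k A H (HopfAlgebra.antipode k y)) :
      Env k (Smash k A H))) ∈ Gam k A H := by
  change gammaLeft k A H _ = gammaRight k A H _
  let R := fun x : H => Coalgebra.Repr.arbitrary k x
  have key := Coalgebra.sum_tmul_tmul_eq (R h) (fun i => R ((R h).left i))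
    (fun i => R ((R h).right i))
  let F : H ⊗[k] (H ⊗[k] H) →ₗ[k] Smash k A H ⊗[k] (Hᵐᵒᵖ ⊗[k] (Smash k A H)ᵐᵒᵖ) :=
    TensorProduct.map (inH k A H).toLinearMap (TensorProduct.map
      ((MulOpposite.opLinearEquiv k).toLinearMap ∘ₗ HopfAlgebra.antipode k)
      ((MulOpposite.opLinearEquiv k).toLinearMap ∘ₗ (inH k A H).toLinearMap ∘ₗ
        HopfAlgebra.antipode k))
  have hF : ∀ x y z : H, F (x ⊗ₜ (y ⊗ₜ z)) = inH k A H x ⊗ₜ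
    (MulOpposite.op (HopfAlgebra.antipode k y) ⊗ₜ
      MulOpposite.op (inH k A H (HopfAlgebra.antipode k z))) := fun _ _ _ => rfl
  have hc : ∀ (h : H), coact k A H (inH k A H h) =
      TensorProduct.map (inH k A H).toLinearMap LinearMap.id (Coalgebra.comul h) := by
    intro h
    refine (coactLin_mk k A H 1 h).trans ?_
    conv_rhs => rw [← (Coalgebra.Repr.arbitrary k h).eq]
    rw [map_sum]
    rfl
  have key' := congrArg F key
  simp only [map_sum, hF] at key'
  rw [sw₂, map_sum, map_sum]
  refine Eq.trans (Finset.sum_congr rfl fun i _ => ?_)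
    (key'.trans (Finset.sum_congr rfl fun i _ => ?_))
  · simp only [gammaLeft, AlgHom.comp_apply,
      Algebra.TensorProduct.map_tmul, hc]
    rw [← (R ((R h).left i)).eq]
    simp only [map_sum, TensorProduct.map_tmul, TensorProduct.sum_tmul,
      Algebra.TensorProduct.map_tmul]
    rfl
  · simp only [gammaRight, AlgHom.comp_apply,
      Algebra.TensorProduct.map_tmul, AlgHom.op_apply_apply, MulOpposite.unop_op, hc]
    have e := congrArg (fun f => f ((R h).right i)) (comul_antipode k H)
    simp only [LinearMap.comp_apply] at e
    rw [e, ← (R ((R h).right i)).eq]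
    simp only [map_sum, TensorProduct.tmul_sum, Finset.op_sum]
    rfl

/-- The element `∑ h₁ ⊗ S h₂` of `Γ`. -/
def hopfGam (h : H) : Gam k A H :=
  ⟨sw₂ k h fun x y => inH k A H x ⊗ₜ MulOpposite.op (inH k A H (HopfAlgebra.antipode k y)),
    sw_mem k A H h⟩

end Gamma

/-! ### Quadratic and Koszul algebras -/

section Koszul

variable {k A : Type*} [Field k] [Ring A] [Algebra k A]

/-- The graded algebra `A` is quadratic: `A = T(V)/(R)` with `V = A₁` finite dimensional and
`R ⊆ V ⊗ V`. -/
structure IsQuadratic (𝒜 : ℕ → Submodule k A) : Prop where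
  finite : FiniteDimensional k (𝒜 1)
  generated : Function.Surjective (TensorAlgebra.lift k (𝒜 1).subtype)
  relations : ∀ t, TensorAlgebra.lift k (𝒜 1).subtype t = 0 →
    t ∈ TwoSidedIdeal.span {r : TensorAlgebra k (𝒜 1) |
      r ∈ LinearMap.range (TensorAlgebra.ι k (M := 𝒜 1)) ^ 2 ∧
        TensorAlgebra.lift k (𝒜 1).subtype r = 0}

/-- A graded projective resolution `⋯ → P 1 → P 0 → k → 0` of the trivial left `A`-module `k`,
such that `P m` is generated in degree `m`. -/
structure LinearResolution.{v} {A : Type v} [Ring A] [Algebra k A] (𝒜 : ℕ → Submodule k A) where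
  P : ℕ → Type v
  [addCommGroup : ∀ m, AddCommGroup (P m)]
  [moduleK : ∀ m, Module k (P m)]
  [module : ∀ m, Module A (P m)]
  [tower : ∀ m, IsScalarTower k A (P m)]
  /-- the component of degree `j` of `P m` -/
  gr : ∀ m, ℕ → Submodule k (P m)
  internal : ∀ m, DirectSum.IsInternal (gr m)
  smul_mem : ∀ m i j a x, a ∈ 𝒜 i → x ∈ gr m j → a • x ∈ gr m (i + j)
  projective : ∀ m, Module.Projective A (P m)
  generated : ∀ m, Submodule.span A (gr m m : Set (P m)) = ⊤
  d : ∀ m, P (m + 1) →ₗ[A] P m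
  d_mem : ∀ m j x, x ∈ gr (m + 1) j → d m x ∈ gr m j
  /-- the augmentation; `A` acts on `k` by killing all elements of positive degree -/
  aug : P 0 →ₗ[k] k
  aug_smul : ∀ i a x, 0 < i → a ∈ 𝒜 i → aug (a • x) = 0
  aug_gr : ∀ j x, 0 < j → x ∈ gr 0 j → aug x = 0
  surjective : Function.Surjective aug
  exact_zero : Function.Exact (d 0) aug
  exact_succ : ∀ m, Function.Exact (d (m + 1)) (d m)

/-- The graded algebra `A` is Koszul. -/
structure IsKoszul (𝒜 : ℕ → Submodule k A) : Prop where
  quadratic : IsQuadratic 𝒜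
  resolution : Nonempty (LinearResolution 𝒜)

section Tensor

/-- The additive group structure of `Aᵉ ⊗ T(A)` that extends its additive monoid structure
definitionally. -/
instance barGroup : AddCommGroup (Env k A ⊗[k] TensorAlgebra k A) :=
  Module.addCommMonoidToAddCommGroup k

variable (k A)

/-- Auxiliary action on pairs, used to split off the first letter of a tensor. -/
def splitLAux : TensorAlgebra k A →ₐ[k]
    Module.End k (TensorAlgebra k A × (A ⊗[k] TensorAlgebra k A)) :=
  TensorAlgebra.lift k
    { toFun := fun a => ((LinearMap.mulLeft k (TensorAlgebra.ι k a)).prod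
        (TensorProduct.mk k A (TensorAlgebra k A) a)) ∘ₗ LinearMap.fst k _ _
      map_add' := fun a b => by
        apply LinearMap.ext; rintro ⟨s, x⟩; simp [add_mul]
      map_smul' := fun c a => by
        apply LinearMap.ext; rintro ⟨s, x⟩; simp [TensorProduct.smul_tmul'] }

/-- Auxiliary action on pairs, used to split off the last letter of a tensor. -/
def splitRAux : TensorAlgebra k A →ₐ[k]
    (Module.End k (TensorAlgebra k A × (TensorAlgebra k A ⊗[k] A)))ᵐᵒᵖ :=
  TensorAlgebra.lift k
    ((MulOpposite.opLinearEquiv k).toLinearMap ∘ₗ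
    { toFun := fun a => ((LinearMap.mulRight k (TensorAlgebra.ι k a)).prod
        ((TensorProduct.mk k (TensorAlgebra k A) A).flip a)) ∘ₗ LinearMap.fst k _ _
      map_add' := fun a b => by
        apply LinearMap.ext; rintro ⟨s, x⟩; simp [mul_add]
      map_smul' := fun c a => by
        apply LinearMap.ext; rintro ⟨s, x⟩; simp })

/-- `a₁ ⊗ ⋯ ⊗ aₘ ↦ a₁ ⊗ (a₂ ⊗ ⋯ ⊗ aₘ)`, and `1 ↦ 0`. -/
def splitL : TensorAlgebra k A →ₗ[k] A ⊗[k] TensorAlgebra k A where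
  toFun t := (splitLAux k A t (1, 0)).2
  map_add' x y := by simp
  map_smul' c x := by simp

/-- `a₁ ⊗ ⋯ ⊗ aₘ ↦ (a₁ ⊗ ⋯ ⊗ aₘ₋₁) ⊗ aₘ`, and `1 ↦ 0`. -/
def splitR : TensorAlgebra k A →ₗ[k] TensorAlgebra k A ⊗[k] A where
  toFun t := ((splitRAux k A t).unop (1, 0)).2
  map_add' x y := by simp
  map_smul' c x := by simp

variable {k A}

theorem splitLAux_fst (t s : TensorAlgebra k A) (x) : (splitLAux k A t (s, x)).1 = t * s := by
  induction t using TensorAlgebra.induction generalizing s x with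
  | algebraMap c => simp [Algebra.smul_def]
  | ι a => simp [splitLAux]
  | mul t t' h h' => rw [map_mul, Module.End.mul_apply, ← Prod.mk.eta (p := splitLAux k A t' _),
      h, h', mul_assoc]
  | add t t' h h' => simp [h, h', add_mul]

theorem splitRAux_fst (t s : TensorAlgebra k A) (x) :
    ((splitRAux k A t).unop (s, x)).1 = s * t := by
  induction t using TensorAlgebra.induction generalizing s x with
  | algebraMap c => simp [Algebra.smul_def, Algebra.commutes]
  | ι a => simp [splitRAux]
  | mul t t' h h' => rw [map_mul, MulOpposite.unop_mul, Module.End.mul_apply,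
      ← Prod.mk.eta (p := (splitRAux k A t).unop _), h', h, mul_assoc]
  | add t t' h h' => simp [h, h', mul_add]

theorem splitL_ι_mul (a : A) (t : TensorAlgebra k A) :
    splitL k A (TensorAlgebra.ι k a * t) = a ⊗ₜ t := by
  change (splitLAux k A _ _).2 = _
  rw [map_mul, Module.End.mul_apply, ← Prod.mk.eta (p := splitLAux k A t _), splitLAux_fst]
  simp [splitLAux]

theorem splitR_mul_ι (a : A) (t : TensorAlgebra k A) :
    splitR k A (t * TensorAlgebra.ι k a) = t ⊗ₜ a := by
  change ((splitRAux k A _).unop _).2 = _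
  rw [map_mul, MulOpposite.unop_mul, Module.End.mul_apply,
    ← Prod.mk.eta (p := (splitRAux k A t).unop _), splitRAux_fst]
  simp [splitRAux]

theorem splitL_one : splitL k A 1 = 0 := by
  change (splitLAux k A _ _).2 = _
  simp

theorem splitR_one : splitR k A 1 = 0 := by
  change ((splitRAux k A _).unop _).2 = _
  simp

end Tensor

variable (𝒜 : ℕ → Submodule k A)

/-- `V = A₁`, as a space of tensors of length one. -/
def vSp : Submodule k (TensorAlgebra k A) := (𝒜 1).map (TensorAlgebra.ι k)

/-- The space of quadratic relations `R = ker (V ⊗ V → A)`, as a space of tensors of length two. -/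
def relSp : Submodule k (TensorAlgebra k A) :=
  vSp 𝒜 ^ 2 ⊓ LinearMap.ker (TensorAlgebra.lift k (LinearMap.id : A →ₗ[k] A)).toLinearMap

/-- `(A^!_m)^* = ⋂_{u+v=m-2} V^{⊗ u} ⊗ R ⊗ V^{⊗ v} ⊆ A^{⊗ m}`, with the values `k` and `V` for
`m = 0` and `m = 1`. The space `A^{⊗ m}` is the component of degree `m` of the tensor algebra. -/
def koszulSp (m : ℕ) : Submodule k (TensorAlgebra k A) :=
  vSp 𝒜 ^ m ⊓ ⨅ (u : ℕ) (v : ℕ) (_ : u + v + 2 = m), vSp 𝒜 ^ u * relSp 𝒜 * vSp 𝒜 ^ v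

/-- The term `A ⊗ (A^!_m)^* ⊗ A` of the Koszul bimodule complex of `A`, as a subbimodule of
`A ⊗ T(A) ⊗ A`. The latter is written as the free left `Aᵉ`-module `Aᵉ ⊗ T(A)`, the element
`(a ⊗ a') ⊗ t` standing for `a ⊗ t ⊗ a'`. -/
abbrev koszul (m : ℕ) : Submodule (Env k A) (Env k A ⊗[k] TensorAlgebra k A) :=
  (koszulSp 𝒜 m).baseChange (Env k A)

variable (k A) in
/-- `a₁ ⊗ ⋯ ⊗ aₘ ↦ a₁ ⊗ (a₂ ⊗ ⋯ ⊗ aₘ) ⊗ 1`. -/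
def dL : TensorAlgebra k A →ₗ[k] Env k A ⊗[k] TensorAlgebra k A :=
  LinearMap.rTensor _ (Algebra.TensorProduct.includeLeft : A →ₐ[k] Env k A).toLinearMap ∘ₗ
    splitL k A

variable (k A) in
/-- `a₁ ⊗ ⋯ ⊗ aₘ ↦ 1 ⊗ (a₁ ⊗ ⋯ ⊗ aₘ₋₁) ⊗ aₘ`. -/
def dR : TensorAlgebra k A →ₗ[k] Env k A ⊗[k] TensorAlgebra k A :=
  LinearMap.rTensor _ ((Algebra.TensorProduct.includeRight : Aᵐᵒᵖ →ₐ[k] Env k A).toLinearMap ∘ₗ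
    (MulOpposite.opLinearEquiv k).toLinearMap) ∘ₗ
    (TensorProduct.comm k (TensorAlgebra k A) A).toLinearMap ∘ₗ splitR k A

/-- A tensor in `A ⊗ T` all of whose contractions lie in `W ⊆ T` lies in `A ⊗ W`. -/
theorem mem_baseChange_of_contr {T : Type*} [AddCommGroup T] [Module k T] (W : Submodule k T)
    (j : A →ₗ[k] Env k A) (z : A ⊗[k] T)
    (hz : ∀ φ : A →ₗ[k] k, TensorProduct.lid k T (LinearMap.rTensor T φ z) ∈ W) :
    LinearMap.rTensor T j z ∈ W.baseChange (Env k A) := by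
  classical
  let b := Module.Basis.ofVectorSpace k A
  have h : ∀ z i, TensorProduct.equivFinsuppOfBasisLeft (N := T) b z i =
      TensorProduct.lid k T (LinearMap.rTensor T (b.coord i) z) := by
    intro z i
    induction z with
    | zero => simp
    | add x y hx hy => simp only [map_add, Finsupp.add_apply, hx, hy]
    | tmul a t => simp
  rw [← (TensorProduct.equivFinsuppOfBasisLeft (N := T) b).symm_apply_apply z,
    TensorProduct.equivFinsuppOfBasisLeft_symm_apply, Finsupp.sum, map_sum]
  refine Submodule.sum_mem _ fun i _ => ?_
  rw [LinearMap.rTensor_tmul]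
  refine Submodule.tmul_mem_baseChange_of_mem _ ?_
  rw [h]
  exact hz _

theorem dL_mem {m : ℕ} {t : TensorAlgebra k A} (ht : t ∈ koszulSp 𝒜 (m + 1)) :
    dL k A t ∈ koszul 𝒜 m := by
  refine mem_baseChange_of_contr _ _ _ fun φ => ?_
  have key : ∀ Z : Submodule k (TensorAlgebra k A), t ∈ vSp 𝒜 * Z →
      TensorProduct.lid k _ (LinearMap.rTensor _ φ (splitL k A t)) ∈ Z := by
    intro Z h
    have : vSp 𝒜 * Z ≤ Z.comap ((TensorProduct.lid k _).toLinearMap ∘ₗ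
        LinearMap.rTensor _ φ ∘ₗ splitL k A) := by
      refine Submodule.mul_le.2 fun x hx y hy => ?_
      obtain ⟨a, -, rfl⟩ := hx
      simpa [splitL_ι_mul] using Z.smul_mem _ hy
    exact this h
  simp only [koszulSp, Submodule.mem_inf, Submodule.mem_iInf] at ht ⊢
  refine ⟨key _ (by rw [← pow_succ']; exact ht.1), fun u v h => key _ ?_⟩
  have := ht.2 (u + 1) v (by omega)
  rwa [pow_succ', mul_assoc, mul_assoc, ← mul_assoc (vSp 𝒜 ^ u)] at this

theorem dR_mem {m : ℕ} {t : TensorAlgebra k A} (ht : t ∈ koszulSp 𝒜 (m + 1)) :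
    dR k A t ∈ koszul 𝒜 m := by
  refine mem_baseChange_of_contr _ _ (TensorProduct.comm k _ _ (splitR k A t)) fun φ => ?_
  have key : ∀ Z : Submodule k (TensorAlgebra k A), t ∈ Z * vSp 𝒜 →
      TensorProduct.lid k _ (LinearMap.rTensor _ φ (TensorProduct.comm k _ _ (splitR k A t)))
        ∈ Z := by
    intro Z h
    have : Z * vSp 𝒜 ≤ Z.comap ((TensorProduct.lid k _).toLinearMap ∘ₗ
        LinearMap.rTensor _ φ ∘ₗ (TensorProduct.comm k _ _).toLinearMap ∘ₗ splitR k A) := by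
      refine Submodule.mul_le.2 fun x hx y hy => ?_
      obtain ⟨a, -, rfl⟩ := hy
      simpa [splitR_mul_ι] using Z.smul_mem _ hx
    exact this h
  simp only [koszulSp, Submodule.mem_inf, Submodule.mem_iInf] at ht ⊢
  refine ⟨key _ (by rw [← pow_succ]; exact ht.1), fun u v h => key _ ?_⟩
  have := ht.2 u (v + 1) (by omega)
  rwa [pow_succ, ← mul_assoc] at this

variable (k A) in
/-- The `A`-bimodule map of `A ⊗ T(A) ⊗ A` with
`1 ⊗ t ⊗ 1 ↦ dL t + (-1)^{m+1} dR t`. -/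
def dTotal (m : ℕ) :
    Env k A ⊗[k] TensorAlgebra k A →ₗ[Env k A] Env k A ⊗[k] TensorAlgebra k A :=
  TensorProduct.AlgebraTensorModule.lift
    (LinearMap.toSpanSingleton (Env k A) (TensorAlgebra k A →ₗ[k] _)
      (dL k A + (-1 : k) ^ (m + 1) • dR k A))

theorem dTotal_mem (m : ℕ) : ∀ x ∈ koszul 𝒜 (m + 1), dTotal k A m x ∈ koszul 𝒜 m := by
  suffices h : koszul 𝒜 (m + 1) ≤ (koszul 𝒜 m).comap (dTotal k A m) from h
  rw [koszul, Submodule.baseChange_eq_span, Submodule.span_le]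
  rintro _ ⟨t, ht, rfl⟩
  have : dTotal k A m ((1 : Env k A) ⊗ₜ t) = dL k A t + (-1 : k) ^ (m + 1) • dR k A t := by
    simp only [dTotal, TensorProduct.AlgebraTensorModule.lift_tmul,
      LinearMap.toSpanSingleton_apply]
    exact one_smul (Env k A) (dL k A t + (-1 : k) ^ (m + 1) • dR k A t)
  change dTotal k A m ((1 : Env k A) ⊗ₜ t) ∈ koszul 𝒜 m
  rw [this]
  exact add_mem (dL_mem 𝒜 ht)
    (Submodule.smul_of_tower_mem _ _ (dR_mem 𝒜 ht))

/-- The term of degree `m` of the Koszul bimodule complex `K(A)`, as a type. -/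
def KC (m : ℕ) : Type _ := koszul 𝒜 m

instance (m : ℕ) : AddCommGroup (KC 𝒜 m) := inferInstanceAs (AddCommGroup (koszul 𝒜 m))
instance (m : ℕ) : Module (Env k A) (KC 𝒜 m) := inferInstanceAs (Module (Env k A) (koszul 𝒜 m))
instance (m : ℕ) : Module k (KC 𝒜 m) := inferInstanceAs (Module k (koszul 𝒜 m))

/-- The inclusion of `A ⊗ (A^!_m)^* ⊗ A` into `A ⊗ T(A) ⊗ A`. -/
def KC.val {m : ℕ} : KC 𝒜 m →ₗ[Env k A] Env k A ⊗[k] TensorAlgebra k A :=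
  (koszul 𝒜 m).subtype

/-- The differential `A ⊗ (A^!_{m+1})^* ⊗ A → A ⊗ (A^!_m)^* ⊗ A` of the Koszul bimodule complex. -/
def koszulD (m : ℕ) : KC 𝒜 (m + 1) →ₗ[Env k A] KC 𝒜 m :=
  (dTotal k A m).restrict (dTotal_mem 𝒜 m)

/-- The augmentation `A ⊗ (A^!_0)^* ⊗ A = A ⊗ k ⊗ A → A`, which is the multiplication. -/
def koszulAug : KC 𝒜 0 →ₗ[Env k A] Reg A :=
  (TensorProduct.AlgebraTensorModule.lift
    (LinearMap.toSpanSingleton (Env k A) (TensorAlgebra k A →ₗ[k] Reg A)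
      (Algebra.linearMap k (Reg A) ∘ₗ TensorAlgebra.algebraMapInv.toLinearMap))).comp
    (KC.val 𝒜)

end Koszul

/-! ### Actions of the Hopf algebra -/

section Actions

variable (k A H : Type*) [Field k] [Ring A] [Algebra k A] [Ring H] [HopfAlgebra k H]
  [Module H A] [IsScalarTower k H A]

/-- The diagonal action of `H` on tensors, `h(a₁ ⊗ ⋯ ⊗ aₘ) = h₁a₁ ⊗ ⋯ ⊗ hₘaₘ`, as a map
`t ↦ (h ↦ ht)`. The product of `Hom(H, T(A))` is convolution: `h(tt') = (h₁t)(h₂t')`. -/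
def tensorAct : TensorAlgebra k A →ₐ[k] WithConv (H →ₗ[k] TensorAlgebra k A) :=
  TensorAlgebra.lift k
    { toFun := fun a => WithConv.toConv (TensorAlgebra.ι k ∘ₗ
        (LinearMap.toSpanSingleton H A a).restrictScalars k)
      map_add' := fun a b => by
        apply WithConv.ofConv_injective; ext h; simp
      map_smul' := fun c a => by
        apply WithConv.ofConv_injective; ext h
        have : h • c • a = c • h • a := map_smul (hEnd k A H h) c a
        simp [this] }

variable {k A H} in
/-- The tensor `h t`. -/
def tAct (h : H) : TensorAlgebra k A →ₗ[k] TensorAlgebra k A where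
  toFun t := (tensorAct k A H t).ofConv h
  map_add' t t' := by simp
  map_smul' c t := by simp

variable {k A H} in
/-- The diagonal action `h(a ⊗ t ⊗ a') = h₁a ⊗ h₂t ⊗ h₃a'` on `A ⊗ T(A) ⊗ A`. -/
def barAct (h : H) : Env k A ⊗[k] TensorAlgebra k A →ₗ[k] Env k A ⊗[k] TensorAlgebra k A :=
  sw₃ k h fun x y z =>
    TensorProduct.map
      (TensorProduct.map (hEnd k A H x)
        ((MulOpposite.opLinearEquiv k).toLinearMap ∘ₗ hEnd k A H z ∘ₗ
          (MulOpposite.opLinearEquiv k).symm.toLinearMap))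
      (tAct y)

variable [HModuleAlgebra k H A]

variable {k A H} in
/-- The value at the tensor `t` of length `m` of an `m`-cochain. -/
def evalT {m : ℕ} (f : Cochain k A (Smash k A H) m) : TensorAlgebra k A →ₗ[k] Smash k A H :=
  PiTensorProduct.lift f ∘ₗ DirectSum.component k ℕ (fun n => ⨂[k]^n A) m ∘ₗ
    TensorAlgebra.equivDirectSum.toLinearMap

variable {k A H} in
/-- The right action of `H` on Hochschild cochains with values in `A # H`:
`(f ↼ h)(a₁,…,aₘ) = ∑ S(h₁) f(h₂(a₁ ⊗ ⋯ ⊗ aₘ)) h₃`. -/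
def hochAct {m : ℕ} (f : Cochain k A (Smash k A H) m) (h : H) (a : Fin m → A) : Smash k A H :=
  sw₃ k h fun x y z => inH k A H (HopfAlgebra.antipode k x) *
    evalT f (tAct y (TensorAlgebra.tprod k A m a)) * inH k A H z

theorem hochAct_add {m : ℕ} (f g : Cochain k A (Smash k A H) m) (h : H) :
    hochAct (f + g) h = hochAct f h + hochAct g h := by
  have e : ∀ t, evalT (f + g) t = evalT f t + evalT g t := by
    intro t; simp [evalT]
  funext a
  simp [hochAct, sw₃, sw₂, e, mul_add, add_mul, Finset.sum_add_distrib]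

theorem hochAct_smul {m : ℕ} (c : k) (f : Cochain k A (Smash k A H) m) (h : H) :
    hochAct (c • f) h = c • hochAct f h := by
  have e : ∀ t, evalT (c • f) t = c • evalT f t := by
    intro t; simp [evalT]
  funext a
  simp [hochAct, sw₃, sw₂, e, Finset.smul_sum]

/-- The space of invariants `H^m(A, A # H)^H`: the classes `x` with `x ↼ h = ε(h) x`. -/
def hochInv (m : ℕ) : Submodule k (HochCoh k A (Smash k A H) m) where
  carrier := {x | ∃ f : cocycles k A (Smash k A H) m, Submodule.Quotient.mk f = x ∧ ∀ h : H,
    IsCobdry k (hochAct (f : Cochain k A (Smash k A H) m) h -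
      Coalgebra.counit (R := k) h • ⇑(f : Cochain k A (Smash k A H) m))}
  zero_mem' := ⟨0, rfl, fun h => by
    have := hochAct_smul k A H 0 (0 : Cochain k A (Smash k A H) m) h
    rw [zero_smul, zero_smul] at this
    have e : hochAct ((0 : cocycles k A (Smash k A H) m) : Cochain k A (Smash k A H) m) h = 0 :=
      this
    rw [e]
    convert IsCobdry.zero k (A := A) (N := Smash k A H) (m := m) using 1
    funext a; simp⟩
  add_mem' := by
    rintro _ _ ⟨f, rfl, hf⟩ ⟨g, rfl, hg⟩
    refine ⟨f + g, rfl, fun h => ?_⟩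
    convert IsCobdry.add k (hf h) (hg h) using 1
    rw [Submodule.coe_add, hochAct_add]
    funext a; simp; abel
  smul_mem' := by
    rintro c _ ⟨f, rfl, hf⟩
    refine ⟨c • f, rfl, fun h => ?_⟩
    convert IsCobdry.smul k c (hf h) using 1
    rw [Submodule.coe_smul, hochAct_smul]
    funext a; simp [smul_sub, smul_comm c]

end Actions

/-! ### Induction from `Γ` to `Bᵉ` and the map `Θ` -/

section Theta

variable {k A H : Type*} [Field k] [Ring A] [Algebra k A] [Ring H] [HopfAlgebra k H]
  [Module H A] [IsScalarTower k H A] [HModuleAlgebra k H A]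
  {M : Type*} [AddCommGroup M] [Module k M] (act : Gam k A H →ₐ[k] Module.End k M)

/-- The submodule of `Bᵉ ⊗ M` generated by the elements `eγ ⊗ x - e ⊗ γx` with `γ ∈ Γ`, for a left
`Γ`-module `M` with structure map `act`. -/
def indRel : Submodule (Env k (Smash k A H)) (Env k (Smash k A H) ⊗[k] M) :=
  Submodule.span _ {w | ∃ (e : Env k (Smash k A H)) (γ : Gam k A H) (x : M),
    w = (e * (γ : Env k (Smash k A H))) ⊗ₜ x - e ⊗ₜ act γ x}

/-- The induced `B`-bimodule `Bᵉ ⊗_Γ M`, for `B = A # H`. -/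
def Ind : Type _ := (Env k (Smash k A H) ⊗[k] M) ⧸ indRel act

instance : AddCommGroup (Ind act) :=
  inferInstanceAs (AddCommGroup ((Env k (Smash k A H) ⊗[k] M) ⧸ indRel act))
instance : Module (Env k (Smash k A H)) (Ind act) :=
  inferInstanceAs (Module _ ((Env k (Smash k A H) ⊗[k] M) ⧸ indRel act))
instance : Module k (Ind act) :=
  inferInstanceAs (Module k ((Env k (Smash k A H) ⊗[k] M) ⧸ indRel act))

/-- The element `e ⊗_Γ x` of `Bᵉ ⊗_Γ M`. -/
def Ind.mk (e : Env k (Smash k A H)) (x : M) : Ind act :=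
  Submodule.Quotient.mk (e ⊗ₜ x)

/-- `f` is an `H`-invariant of `Hom_{Aᵉ}(M, B)`, i.e. `f ↼ h = ε(h) f` for all `h`, where
`(f ↼ h)(x) = ∑ S(h₁) f((h₂ ⊗ S h₃) x) h₄`. -/
def IsHInv [Module (Env k A) M] (f : M →ₗ[Env k A] Smash k A H) : Prop :=
  ∀ (h : H) (x : M),
    (sw₃ k h fun a b c => inH k A H (HopfAlgebra.antipode k a) *
      f (act (hopfGam k A H b) x) * inH k A H c) = Coalgebra.counit (R := k) h • f x

/-- `g = Θ(f)`, i.e. `g(b ⊗ b' ⊗_Γ x) = b f(x) b'`. -/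
def IsTheta [Module (Env k A) M] (f : M →ₗ[Env k A] Smash k A H)
    (g : Ind act →ₗ[Env k (Smash k A H)] Reg (Smash k A H)) : Prop :=
  ∀ (b b' : Smash k A H) (x : M),
    g (Ind.mk act (b ⊗ₜ MulOpposite.op b') x) = toReg k _ (b * f x * b')

end Theta

end KoszulSmash

end

open KoszulSmash

open scoped TensorProduct

noncomputable section

namespace KoszulSmash

/-! ### Lifting chain maps and homotopies -/

section Homological

variable {R : Type*} [Ring R]

/-! Four ingredients carry the theorem: exactness of `K`, a concrete model of `Bᵉ ⊗_Γ K`, the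
reading of invariance as `H`-equivariance, and the restriction of cochains from `B` to `A`.

Exactness of `K`. Koszulity is given through an arbitrary linear resolution `P` of the trivial left
module. A graded projective module generated in one degree is free on its component of that degree
(`extA_bijective`). Since `P_{m+1}` vanishes in degree `m`, the differential is injective on the
generators of `P_m`. Hence the generators of `P_{m+1}` are the cycles of degree one over `(A^!_m)^*`
in `A ⊗ (A^!_m)^*`, and these form `(A^!_{m+1})^*` (`exists_lkD₀_eq`). So `P` is the left Koszul
complex, which is therefore exact (`leftKoszul_exact`). In the bimodule complex, splitting off the
first letter raises the degree of the left factor by one and splitting off the last letter preserves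
it. The component of highest left degree of a cycle is thus a cycle of the left Koszul complex
tensored with `A`, and it can be removed by induction (`exists_of_top_component`,
`koszul_isProjRes`).

The complex `K` is a subcomplex of the bar resolution, because the inner products of adjacent
letters vanish on tensors built from relations (`tailD_of_mem`). The diagonal action of `H` commutes
with the bar differential, hence with that of `K`, and the inclusion `toBar` is an equivariant
comparison map.

Induction. An `A`-bimodule `M` with a compatible `H`-action makes `M ⊗ H` a `B`-bimodule, in which
`x ⊗ g` plays the role of `xg`. The algebra `Γ` is spanned by products of elements of `Aᵉ` with
elements `∑ h₁ ⊗ S h₂` (`Gam.induction`), and both kinds preserve `M ⊗ 1`. This defines the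
`Γ`-action on `M`, and it gives `Bᵉ ⊗_Γ M ≅ M ⊗ H`. So `Bᵉ ⊗_Γ K` is exact, being `K ⊗ H` over a
field. Bimodule maps from `Bᵉ ⊗_Γ K_m` amount to `H`-linear maps from `(A^!_m)^*`, and over a
semisimple `H` these lift along surjections; this gives projectivity (`ind_projective`).

Invariants. In the convolution algebra `Hom(H, B)` the inclusion of `H` and its composite with `S`
are mutually inverse. Hence `f ↼ h = ε(h) f` for all `h` says exactly that `f` intertwines the
action on `M` with `b ↦ ∑ h₁ b S(h₂)`, that is, that `f` is a morphism of `Γ`-modules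
(`isHInv_iff`). The map `Θ` is then the adjunction between induction and restriction.

Cohomology. The map `E` is constructed as the inverse of the restriction `HH^•(B) → H^•(A, B)`. The
restriction of the class of `Θ(f)` is the class of `f`, because both come from maps of the bar
resolution of `A` to the exact complex `Bᵉ ⊗_Γ K` that lift the inclusion `A → B`
(`isCobdry_comparison_sub_resC`). Averaging over a normalized right integral of `H` replaces
cochains by invariant ones without changing invariant classes. This shows that restriction is
injective with image the invariants (`exists_resHoch_equiv`). Restriction respects cup products
already on cochains, hence so does `E`. -/

theorem exists_lift_of_range {P Y Z : Type*} [AddCommGroup P] [Module R P] [Module.Projective R P]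
    [AddCommGroup Y] [Module R Y] [AddCommGroup Z] [Module R Z] (e : Y →ₗ[R] Z) (h : P →ₗ[R] Z)
    (hr : ∀ x, ∃ y, e y = h x) : ∃ f : P →ₗ[R] Y, ∀ x, e (f x) = h x := by
  obtain ⟨f, hf⟩ := Module.projective_lifting_property e.rangeRestrict
    (h.codRestrict (LinearMap.range e) hr) e.surjective_rangeRestrict
  exact ⟨f, fun x => congrArg Subtype.val (LinearMap.congr_fun hf x)⟩

variable {X Y : ℕ → Type*} [∀ m, AddCommGroup (X m)] [∀ m, Module R (X m)]
  [∀ m, AddCommGroup (Y m)] [∀ m, Module R (Y m)]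
  {M M' : Type*} [AddCommGroup M] [Module R M] [AddCommGroup M'] [Module R M']

/-- A map between augmented modules lifts to a chain map from a complex of projectives to an exact
complex. -/
theorem exists_chainMap (hX : ∀ m, Module.Projective R (X m))
    (dX : ∀ m, X (m + 1) →ₗ[R] X m) (augX : X 0 →ₗ[R] M)
    (dY : ∀ m, Y (m + 1) →ₗ[R] Y m) (augY : Y 0 →ₗ[R] M')
    (hX0 : ∀ x, augX (dX 0 x) = 0) (hXd : ∀ m x, dX m (dX (m + 1) x) = 0)
    (hYs : Function.Surjective augY) (hY0 : Function.Exact (dY 0) augY)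
    (hYd : ∀ m, Function.Exact (dY (m + 1)) (dY m)) (φ : M →ₗ[R] M') :
    ∃ f : ∀ m, X m →ₗ[R] Y m, (∀ x, augY (f 0 x) = φ (augX x)) ∧
      ∀ m x, dY m (f (m + 1) x) = f m (dX m x) := by
  -- The recursion has to carry, with the component in degree `m`, the fact that its composite with
  -- `dX m` takes values in the range of `dY m`; this is what makes the next lift possible.
  let Q : ∀ m, (X m →ₗ[R] Y m) → Prop := fun m f => ∀ x, ∃ y, dY m y = f (dX m x)
  have base : ∃ f : X 0 →ₗ[R] Y 0, ∀ x, augY (f x) = φ (augX x) := by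
    have := hX 0
    exact exists_lift_of_range augY (φ ∘ₗ augX) fun x => hYs _
  obtain ⟨f0, hf0⟩ := base
  have q0 : Q 0 f0 := fun x => (hY0 _).1 (by rw [hf0, hX0, map_zero])
  have step : ∀ m (f : {f // Q m f}), ∃ f' : {f // Q (m + 1) f},
      ∀ x, dY m (f'.1 x) = f.1 (dX m x) := by
    rintro m ⟨f, hf⟩
    have := hX (m + 1)
    obtain ⟨f', hf'⟩ := exists_lift_of_range (dY m) (f ∘ₗ dX m) hf
    refine ⟨⟨f', fun x => (hYd m _).1 ?_⟩, hf'⟩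
    rw [hf']
    simp [hXd]
  choose nxt hnxt using step
  let s : ∀ m, {f // Q m f} := fun m => Nat.rec ⟨f0, q0⟩ (fun m f => nxt m f) m
  exact ⟨fun m => (s m).1, hf0, fun m x => hnxt m (s m) x⟩

/-- A chain map from a complex of projectives to an exact complex which lifts zero is
null-homotopic. -/
theorem exists_homotopy (hX : ∀ m, Module.Projective R (X m))
    (dX : ∀ m, X (m + 1) →ₗ[R] X m) (hXd : ∀ m x, dX m (dX (m + 1) x) = 0)
    (dY : ∀ m, Y (m + 1) →ₗ[R] Y m) (augY : Y 0 →ₗ[R] M')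
    (hY0 : Function.Exact (dY 0) augY) (hYd : ∀ m, Function.Exact (dY (m + 1)) (dY m))
    (f : ∀ m, X m →ₗ[R] Y m) (hf0 : ∀ x, augY (f 0 x) = 0)
    (hf : ∀ m x, dY m (f (m + 1) x) = f m (dX m x)) :
    ∃ h : ∀ m, X m →ₗ[R] Y (m + 1), (∀ x, f 0 x = dY 0 (h 0 x)) ∧
      ∀ m x, f (m + 1) x = dY (m + 1) (h (m + 1) x) + h m (dX m x) := by
  -- Solvability of the equation that defines the next component of the homotopy; it is carried
  -- along the recursion.
  let Q : ∀ m, (X m →ₗ[R] Y (m + 1)) → Prop := fun m h =>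
    ∀ x, ∃ y, dY (m + 1) y = f (m + 1) x - h (dX m x)
  obtain ⟨h0, hh0⟩ : ∃ h : X 0 →ₗ[R] Y 1, ∀ x, dY 0 (h x) = f 0 x := by
    have := hX 0
    exact exists_lift_of_range (dY 0) (f 0) fun x => (hY0 _).1 (hf0 x)
  have q0 : Q 0 h0 := fun x => (hYd 0 _).1 (by rw [map_sub, hf, hh0, sub_self])
  have step : ∀ m (h : {h // Q m h}), ∃ h' : {h // Q (m + 1) h},
      ∀ x, dY (m + 1) (h'.1 x) = f (m + 1) x - h.1 (dX m x) := by
    rintro m ⟨h, hh⟩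
    have := hX (m + 1)
    obtain ⟨h', hh'⟩ := exists_lift_of_range (dY (m + 1)) (f (m + 1) - h ∘ₗ dX m) hh
    simp only [LinearMap.sub_apply, LinearMap.comp_apply] at hh'
    refine ⟨⟨h', fun x => (hYd (m + 1) _).1 ?_⟩, hh'⟩
    rw [map_sub, hf, hh', hXd, map_zero, sub_zero, sub_self]
  choose nxt hnxt using step
  let s : ∀ m, {h // Q m h} := fun m => Nat.rec ⟨h0, q0⟩ (fun m f => nxt m f) m
  refine ⟨fun m => (s m).1, fun x => (hh0 x).symm, fun m x => ?_⟩
  have : dY (m + 1) ((s (m + 1)).1 x) = f (m + 1) x - (s m).1 (dX m x) := hnxt m (s m) x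
  rw [this, sub_add_cancel]

end Homological

/-! ### The bar resolution -/

section HochT

variable (k : Type*) {A N : Type*} [Field k] [Ring A] [Algebra k A]
  [AddCommGroup N] [Module (Env k A) N]

/-- The Hochschild differential without its first term. -/
def hochT {m : ℕ} (f : (Fin m → A) → N) (a : Fin (m + 1) → A) : N :=
  ∑ i : Fin m, (-1 : ℤ) ^ ((i : ℕ) + 1) • f (Fin.contractNth i.castSucc (· * ·) a)
    + (-1 : ℤ) ^ (m + 1) • ((1 ⊗ₜ MulOpposite.op (a (Fin.last m)) : Env k A) • f (Fin.init a))

theorem hochD_eq {m : ℕ} (f : (Fin m → A) → N) (a : Fin (m + 1) → A) :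
    hochD k f a = (a 0 ⊗ₜ 1 : Env k A) • f (Fin.tail a) + hochT k f a := by
  rw [hochD, hochT, add_assoc]

theorem contractNth_zero_cons {m : ℕ} (a : A) (v : Fin (m + 1) → A) :
    Fin.contractNth (0 : Fin (m + 1 + 1)) (· * ·) (Fin.cons a v : Fin (m + 1 + 1) → A) =
      Fin.cons (a * v 0) (Fin.tail v) := by
  funext i
  refine Fin.cases ?_ (fun i => ?_) i
  · simp [Fin.contractNth]
  · simp [Fin.contractNth, Fin.tail]

theorem contractNth_succ_cons {m : ℕ} (a : A) (v : Fin (m + 1) → A) (j : Fin (m + 1)) :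
    Fin.contractNth j.succ (· * ·) (Fin.cons a v : Fin (m + 1 + 1) → A) =
      Fin.cons a (Fin.contractNth j (· * ·) v) := by
  funext i
  refine Fin.cases ?_ (fun i => ?_) i
  · simp [Fin.contractNth]
  · simp only [Fin.contractNth, Fin.cons_succ, Fin.val_succ, add_lt_add_iff_right,
      add_left_inj, Fin.castSucc_succ]

theorem hochT_zero (f : (Fin 0 → A) → N) (a : Fin 1 → A) :
    hochT k f a = -((1 ⊗ₜ MulOpposite.op (a 0) : Env k A) • f Fin.elim0) := by
  have : Fin.init a = Fin.elim0 := Subsingleton.elim _ _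
  simp [hochT, this]

/-- A recursion on the first letter: either it is multiplied with the second letter, or it is kept
in front while the rest is treated, with the opposite sign. The recursion allows the bar
differential to be defined on all of `T(A)` at once, and it yields the contracting homotopy. -/
theorem hochT_cons {m : ℕ} (f : (Fin (m + 1) → A) → N) (a : A) (v : Fin (m + 1) → A) :
    hochT k f (Fin.cons a v) =
      -f (Fin.cons (a * v 0) (Fin.tail v)) - hochT k (fun w => f (Fin.cons a w)) v := by
  simp only [hochT]
  rw [Fin.sum_univ_succ]
  have h1 : Fin.init (Fin.cons a v : Fin (m + 1 + 1) → A) = Fin.cons a (Fin.init v) :=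
    by
    funext i
    refine Fin.cases rfl (fun i => ?_) i
    simp [Fin.init]
  have h2 : (Fin.cons a v : Fin (m + 1 + 1) → A) (Fin.last (m + 1)) = v (Fin.last m) := by
    rw [← Fin.succ_last, Fin.cons_succ]
  rw [h1, h2, Fin.castSucc_zero, contractNth_zero_cons]
  simp only [← Fin.succ_castSucc, contractNth_succ_cons, Fin.val_succ, Fin.val_zero,
    pow_succ _ (_ + 1), mul_neg_one, neg_smul, Finset.sum_neg_distrib]
  simp only [zero_add, pow_one, neg_smul, one_smul]
  abel

theorem hochD_cons {m : ℕ} (f : (Fin (m + 1) → A) → N) (a : A) (v : Fin (m + 1) → A) :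
    hochD k f (Fin.cons a v) = (a ⊗ₜ 1 : Env k A) • f v
      - f (Fin.cons (a * v 0) (Fin.tail v)) - hochT k (fun w => f (Fin.cons a w)) v := by
  rw [hochD_eq, hochT_cons, Fin.cons_zero, Fin.tail_cons]
  abel

theorem hochD_comp {N' : Type*} [AddCommGroup N'] [Module (Env k A) N'] {m : ℕ}
    (g : N →ₗ[Env k A] N') (f : (Fin m → A) → N) (a : Fin (m + 1) → A) :
    hochD k (fun v => g (f v)) a = g (hochD k f a) := by
  simp only [hochD, map_add, map_sum, map_zsmul, map_smul]

end HochT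

/-! ### The bar differential on the tensor algebra. -/

section TensorLevel

variable {k A : Type*} [Field k] [Ring A] [Algebra k A]
  {N : Type*} [AddCommGroup N] [Module k N]

/-- The value at a tensor of length `m` of an `m`-cochain, extended by zero. -/
def evT {m : ℕ} (f : Cochain k A N m) : TensorAlgebra k A →ₗ[k] N :=
  PiTensorProduct.lift f ∘ₗ DirectSum.component k ℕ (fun n => ⨂[k]^n A) m ∘ₗ
    TensorAlgebra.equivDirectSum.toLinearMap

theorem evT_tprod {m : ℕ} (f : Cochain k A N m) (a : Fin m → A) :
    evT f (TensorAlgebra.tprod k A m a) = f a := by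
  change PiTensorProduct.lift f (DirectSum.component k ℕ _ m (TensorAlgebra.toDirectSum _)) = _
  rw [TensorAlgebra.toDirectSum_tensorPower_tprod]
  change PiTensorProduct.lift f ((DirectSum.of (fun n => ⨂[k]^n A) m _) m) = _
  rw [DirectSum.of_eq_same]
  simp

theorem evT_tprod_of_ne {m n : ℕ} (h : n ≠ m) (f : Cochain k A N m) (a : Fin n → A) :
    evT f (TensorAlgebra.tprod k A n a) = 0 := by
  change PiTensorProduct.lift f (DirectSum.component k ℕ _ m (TensorAlgebra.toDirectSum _)) = _
  rw [TensorAlgebra.toDirectSum_tensorPower_tprod]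
  change PiTensorProduct.lift f ((DirectSum.of (fun n => ⨂[k]^n A) n _) m) = _
  rw [DirectSum.of_eq_of_ne _ _ _ h.symm, map_zero]

theorem tprod_cons {m : ℕ} (a : A) (v : Fin m → A) :
    TensorAlgebra.tprod k A (m + 1) (Fin.cons a v) =
      TensorAlgebra.ι k a * TensorAlgebra.tprod k A m v := by
  simp [TensorAlgebra.tprod_apply, List.ofFn_succ]

theorem tprod_elim0 {M : Type*} [AddCommMonoid M] [Module k M] (v : Fin 0 → M) :
    TensorAlgebra.tprod k M 0 v = 1 := by
  simp [TensorAlgebra.tprod_apply]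

/-- The tensor algebra is spanned by the pure tensors. -/
theorem tensor_induction {M : Type*} [AddCommMonoid M] [Module k M]
    {P : TensorAlgebra k M → Prop} (t : TensorAlgebra k M)
    (tprod : ∀ m (a : Fin m → M), P (TensorAlgebra.tprod k M m a))
    (add : ∀ x y, P x → P y → P (x + y)) (smul : ∀ (c : k) x, P x → P (c • x)) : P t := by
  have zero : P 0 := by simpa using smul 0 _ (tprod 0 Fin.elim0)
  rw [← TensorAlgebra.ofDirectSum_toDirectSum t]
  induction TensorAlgebra.toDirectSum t using DirectSum.induction_on with
  | zero => simpa using zero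
  | add x y hx hy => rw [map_add]; exact add _ _ hx hy
  | of n x =>
    induction x using PiTensorProduct.induction_on with
    | smul_tprod c a =>
      have : (DirectSum.of (fun n => ⨂[k]^n M) n) (c • PiTensorProduct.tprod k a) =
          c • (DirectSum.of (fun n => ⨂[k]^n M) n) (PiTensorProduct.tprod k a) :=
        (DirectSum.lof k ℕ (fun n => ⨂[k]^n M) n).map_smul c _
      rw [this, map_smul, TensorAlgebra.ofDirectSum_of_tprod]
      exact smul _ _ (tprod _ _)
    | add x y hx hy => rw [map_add, map_add]; exact add _ _ hx hy

theorem linearMap_ext_tprod {f g : TensorAlgebra k A →ₗ[k] N}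
    (h : ∀ m (a : Fin m → A), f (TensorAlgebra.tprod k A m a) = g (TensorAlgebra.tprod k A m a)) :
    f = g := by
  ext t
  induction t using tensor_induction with
  | tprod m a => exact h m a
  | add x y hx hy => rw [map_add, map_add, hx, hy]
  | smul c x hx => rw [map_smul, map_smul, hx]

theorem evT_ι_mul {m : ℕ} (f : Cochain k A N (m + 1)) (a : A) (t : TensorAlgebra k A) :
    evT f (TensorAlgebra.ι k a * t) = evT (f.curryLeft a) t := by
  induction t using tensor_induction with
  | tprod n v =>
    rw [← tprod_cons]
    by_cases h : n = m
    · subst h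
      rw [evT_tprod, evT_tprod, MultilinearMap.curryLeft_apply]
    · rw [evT_tprod_of_ne h, evT_tprod_of_ne (by omega)]
  | add x y hx hy => simp only [mul_add, map_add, hx, hy]
  | smul c x hx => simp only [mul_smul_comm, map_smul, hx]

variable [Module (Env k A) N] [IsScalarTower k (Env k A) N]

/-- The map of bimodules `e ⊗ t ↦ e f(t)`. -/
def ext {T : Type*} [AddCommGroup T] [Module k T] (f : T →ₗ[k] N) :
    Env k A ⊗[k] T →ₗ[Env k A] N :=
  TensorProduct.AlgebraTensorModule.lift
    (LinearMap.toSpanSingleton (Env k A) (T →ₗ[k] N) f)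

@[simp]
theorem ext_tmul {T : Type*} [AddCommGroup T] [Module k T] (f : T →ₗ[k] N) (e : Env k A) (t : T) :
    ext f (e ⊗ₜ t) = e • f t := rfl

variable (k A) in
/-- Left multiplication of the middle factor of `A ⊗ T(A) ⊗ A` by an element of `A`. -/
def midMul (a : A) : Env k A ⊗[k] TensorAlgebra k A →ₗ[Env k A] Env k A ⊗[k] TensorAlgebra k A :=
  TensorProduct.AlgebraTensorModule.map LinearMap.id (LinearMap.mulLeft k (TensorAlgebra.ι k a))

@[simp]
theorem midMul_tmul (a : A) (e : Env k A) (t : TensorAlgebra k A) :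
    midMul k A a (e ⊗ₜ t) = e ⊗ₜ (TensorAlgebra.ι k a * t) := rfl

variable (k A) in
/-- `a ⊗ (a₁ ⊗ t) ↦ aa₁ ⊗ t`, on tensors. -/
def contr : A →ₗ[k] A ⊗[k] TensorAlgebra k A →ₗ[k] TensorAlgebra k A :=
  LinearMap.mk₂ k (fun a z => LinearMap.mul' k (TensorAlgebra k A)
      (LinearMap.rTensor _ (TensorAlgebra.ι k ∘ₗ LinearMap.mulLeft k a) z))
    (fun a b z => by
      induction z with
      | zero => simp
      | add x y hx hy => simp only [map_add, hx, hy]; abel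
      | tmul c t => simp [add_mul])
    (fun c a z => by
      induction z with
      | zero => simp
      | add x y hx hy => simp only [map_add, hx, hy, smul_add]
      | tmul d t => simp)
    (fun a z z' => by simp) (fun c a z => by simp)

@[simp]
theorem contr_tmul (a b : A) (t : TensorAlgebra k A) :
    contr k A a (b ⊗ₜ t) = TensorAlgebra.ι k (a * b) * t := by
  simp [contr]

variable (k A) in
/-- `a ⊗ (a₁ ⊗ ⋯ ⊗ aₘ) ↦ 1 ⊗ (aa₁ ⊗ a₂ ⊗ ⋯ ⊗ aₘ) ⊗ 1`, and `a ⊗ 1 ↦ 1 ⊗ 1 ⊗ a`. -/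
def headMul : A →ₗ[k] TensorAlgebra k A →ₗ[k] Env k A ⊗[k] TensorAlgebra k A :=
  LinearMap.mk₂ k (fun a t => (TensorAlgebra.algebraMapInv (R := k) t) •
      ((1 ⊗ₜ MulOpposite.op a : Env k A) ⊗ₜ[k] (1 : TensorAlgebra k A)) +
        (1 : Env k A) ⊗ₜ[k] contr k A a (splitL k A t))
    (fun a b t => by
      simp only [MulOpposite.op_add, TensorProduct.tmul_add, TensorProduct.add_tmul, smul_add,
        map_add, LinearMap.add_apply]; abel)
    (fun c a t => by
      simp only [MulOpposite.op_smul, TensorProduct.tmul_smul, ← TensorProduct.smul_tmul',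
        map_smul, LinearMap.smul_apply, smul_add, smul_comm c])
    (fun a t t' => by
      simp only [map_add, add_smul, TensorProduct.tmul_add]; abel)
    (fun c a t => by
      simp only [map_smul, smul_eq_mul, mul_smul, TensorProduct.tmul_smul, smul_add])

end TensorLevel

section TailD

/-- Subtraction on `A ⊗ T(A) ⊗ A`, as given by `barGroup`. -/
instance barSub (k A : Type*) [Field k] [Ring A] [Algebra k A] :
    Sub (Env k A ⊗[k] TensorAlgebra k A) := barGroup.toSub

/-- Negation on `A ⊗ T(A) ⊗ A`, as given by `barGroup`. -/
instance barNeg (k A : Type*) [Field k] [Ring A] [Algebra k A] :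
    Neg (Env k A ⊗[k] TensorAlgebra k A) := barGroup.toNeg

/-- The additive group structure of `A ⊗ T(A) ⊗ A`, as given by `barGroup`. -/
instance barAddGroup (k A : Type*) [Field k] [Ring A] [Algebra k A] :
    AddGroup (Env k A ⊗[k] TensorAlgebra k A) := barGroup.toAddGroup

variable {k A : Type*} [Field k] [Ring A] [Algebra k A]

theorem headMul_one (a : A) : headMul k A a 1 = (1 ⊗ₜ MulOpposite.op a : Env k A) ⊗ₜ 1 := by
  simp [headMul, splitL_one]

theorem headMul_ι_mul (a b : A) (t : TensorAlgebra k A) :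
    headMul k A a (TensorAlgebra.ι k b * t) = 1 ⊗ₜ (TensorAlgebra.ι k (a * b) * t) := by
  simp [headMul, splitL_ι_mul, TensorAlgebra.algebraMapInv]

theorem dL_ι_mul (a : A) (t : TensorAlgebra k A) :
    dL k A (TensorAlgebra.ι k a * t) = (a ⊗ₜ 1 : Env k A) ⊗ₜ t := by
  simp [dL, splitL_ι_mul]

theorem dL_one : dL k A 1 = 0 := by
  simp [dL, splitL_one]

variable (k A) in
/-- Auxiliary action on pairs, used to define `tailD`. -/
def tailAux : TensorAlgebra k A →ₐ[k]
    Module.End k (TensorAlgebra k A × (Env k A ⊗[k] TensorAlgebra k A)) :=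
  TensorAlgebra.lift k
    -- The second component follows the recursion `hochT_cons`, and the first keeps the tensor read
    -- so far, which the head product needs. The tensor algebra is free, so any such rule for single
    -- letters extends to an action.
    { toFun := fun a => (LinearMap.mulLeft k (TensorAlgebra.ι k a) ∘ₗ LinearMap.fst k _ _).prod
        (-(headMul k A a ∘ₗ LinearMap.fst k _ _)
          - (midMul k A a).restrictScalars k ∘ₗ LinearMap.snd k _ _)
      map_add' := fun a b => by
        apply LinearMap.ext; rintro ⟨s, x⟩
        have : midMul k A (a + b) x = midMul k A a x + midMul k A b x := by
          induction x with
          | zero => simp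
          | add x y hx hy => simp only [map_add, hx, hy]; abel
          | tmul e t => simp [add_mul, TensorProduct.tmul_add]
        ext1
        · simp [add_mul]
        · simp [this]; abel
      map_smul' := fun c a => by
        apply LinearMap.ext; rintro ⟨s, x⟩
        have : midMul k A (c • a) x = c • midMul k A a x := by
          induction x with
          | zero => simp
          | add x y hx hy => simp only [map_add, hx, hy, smul_add]
          | tmul e t => simp
        ext1
        · simp
        · simp [this, smul_sub] }

theorem tailAux_fst (t s : TensorAlgebra k A) (x) : (tailAux k A t (s, x)).1 = t * s := by
  induction t using TensorAlgebra.induction generalizing s x with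
  | algebraMap c => simp [Algebra.smul_def]
  | ι a => simp [tailAux]
  | mul t t' h h' => rw [map_mul, Module.End.mul_apply, ← Prod.mk.eta (p := tailAux k A t' _),
      h, h', mul_assoc]
  | add t t' h h' => simp [h, h', add_mul]

variable (k A) in
/-- The bar differential `A^{⊗ m} → A ⊗ A^{⊗ (m-1)} ⊗ A` without its first term. -/
def tailD : TensorAlgebra k A →ₗ[k] Env k A ⊗[k] TensorAlgebra k A where
  toFun t := (tailAux k A t (1, 0)).2
  map_add' x y := by simp
  map_smul' c x := by simp

theorem tailD_ι_mul (a : A) (t : TensorAlgebra k A) :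
    tailD k A (TensorAlgebra.ι k a * t) = -headMul k A a t - midMul k A a (tailD k A t) := by
  change (tailAux k A _ _).2 = -headMul k A a t - midMul k A a ((tailAux k A t _).2)
  rw [map_mul, Module.End.mul_apply, ← Prod.mk.eta (p := tailAux k A t _), tailAux_fst]
  rw [tailAux, TensorAlgebra.lift_ι_apply]
  simp

theorem tailD_one : tailD k A 1 = 0 := by
  change (tailAux k A _ _).2 = _
  simp

variable (k A) in
/-- The bar differential `A^{⊗ m} → A ⊗ A^{⊗ (m-1)} ⊗ A`. -/
def barD : TensorAlgebra k A →ₗ[k] Env k A ⊗[k] TensorAlgebra k A :=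
  dL k A + tailD k A

variable {N : Type*} [AddCommGroup N] [Module k N] [Module (Env k A) N]
  [IsScalarTower k (Env k A) N]

theorem ext_evT_midMul {m : ℕ} (f : Cochain k A N (m + 1)) (a : A)
    (z : Env k A ⊗[k] TensorAlgebra k A) :
    ext (evT f) (midMul k A a z) = ext (evT (f.curryLeft a)) z := by
  induction z with
  | zero => simp
  | add x y hx hy => simp only [map_add, hx, hy]
  | tmul e t => simp [evT_ι_mul]

/-- The differential on tensors and the one on functions of several variables satisfy the same
recursion. In this way `hochD` of a cochain is seen to be multilinear, which is used in `hochDM`. -/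
theorem ext_tailD_tprod {m : ℕ} (f : Cochain k A N m) (a : Fin (m + 1) → A) :
    ext (evT f) (tailD k A (TensorAlgebra.tprod k A (m + 1) a)) = hochT k f a := by
  induction m with
  | zero =>
    rw [← Fin.cons_self_tail a, tprod_cons, tprod_elim0, tailD_ι_mul, tailD_one, headMul_one,
      hochT_zero]
    simp only [map_zero, sub_zero, map_neg, ext_tmul, Fin.cons_zero]
    rw [← tprod_elim0 (k := k) (M := A) Fin.elim0, evT_tprod]
  | succ m ih =>
    rw [← Fin.cons_self_tail a, tprod_cons, tailD_ι_mul, hochT_cons, map_sub, map_neg,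
      ext_evT_midMul, ih]
    congr 2
    rw [← Fin.cons_self_tail (Fin.tail a), tprod_cons, headMul_ι_mul, ext_tmul, one_smul,
      ← tprod_cons, evT_tprod]
    simp

theorem ext_barD_tprod {m : ℕ} (f : Cochain k A N m) (a : Fin (m + 1) → A) :
    ext (evT f) (barD k A (TensorAlgebra.tprod k A (m + 1) a)) = hochD k f a := by
  rw [barD, LinearMap.add_apply, map_add, ext_tailD_tprod, hochD_eq]
  congr 1
  conv_lhs => rw [← Fin.cons_self_tail a]
  rw [tprod_cons, dL_ι_mul, ext_tmul, evT_tprod]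

/-- The Hochschild differential of a cochain, as a cochain. -/
def hochDM {m : ℕ} (f : Cochain k A N m) : Cochain k A N (m + 1) :=
  ((ext (evT f)).restrictScalars k ∘ₗ barD k A).compMultilinearMap (TensorAlgebra.tprod k A (m + 1))

theorem hochDM_apply {m : ℕ} (f : Cochain k A N m) (a : Fin (m + 1) → A) :
    hochDM f a = hochD k f a := ext_barD_tprod f a

end TailD

section Bar

variable (k A : Type*) [Field k] [Ring A] [Algebra k A]

/-- The term `A ⊗ A^{⊗ m} ⊗ A` of the bar resolution. -/
def BarC (m : ℕ) : Type _ := Env k A ⊗[k] (⨂[k]^m A)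

instance (m : ℕ) : AddCommGroup (BarC k A m) :=
  inferInstanceAs (AddCommGroup (Env k A ⊗[k] (⨂[k]^m A)))
instance (m : ℕ) : Module (Env k A) (BarC k A m) :=
  inferInstanceAs (Module (Env k A) (Env k A ⊗[k] (⨂[k]^m A)))
instance (m : ℕ) : Module k (BarC k A m) :=
  inferInstanceAs (Module k (Env k A ⊗[k] (⨂[k]^m A)))
instance (m : ℕ) : IsScalarTower k (Env k A) (BarC k A m) :=
  inferInstanceAs (IsScalarTower k (Env k A) (Env k A ⊗[k] (⨂[k]^m A)))
instance (m : ℕ) : Module.Projective (Env k A) (BarC k A m) :=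
  inferInstanceAs (Module.Projective (Env k A) (Env k A ⊗[k] (⨂[k]^m A)))

/-- The universal cochain `a ↦ 1 ⊗ a ⊗ 1`. -/
def barU (m : ℕ) : Cochain k A (BarC k A m) m :=
  (TensorProduct.mk k (Env k A) (⨂[k]^m A) 1).compMultilinearMap (PiTensorProduct.tprod k)

variable {k A}

theorem barU_apply {m : ℕ} (a : Fin m → A) :
    barU k A m a = ((1 : Env k A) ⊗ₜ PiTensorProduct.tprod k a : Env k A ⊗[k] (⨂[k]^m A)) := rfl

theorem smul_barU {m : ℕ} (e : Env k A) (a : Fin m → A) :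
    e • barU k A m a = (e ⊗ₜ PiTensorProduct.tprod k a : Env k A ⊗[k] (⨂[k]^m A)) := by
  change e • ((1 : Env k A) ⊗ₜ PiTensorProduct.tprod k a : Env k A ⊗[k] (⨂[k]^m A)) = _
  rw [TensorProduct.smul_tmul', smul_eq_mul, mul_one]

theorem barC_induction {m : ℕ} {P : BarC k A m → Prop} (z : BarC k A m)
    (tmul : ∀ (a : A) (b : Aᵐᵒᵖ) (v : Fin m → A), P ((a ⊗ₜ b : Env k A) • barU k A m v))
    (add : ∀ x y, P x → P y → P (x + y)) : P z := by
  have zero : P 0 := by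
    have := tmul 0 0 0
    rwa [smul_barU, TensorProduct.zero_tmul, TensorProduct.zero_tmul] at this
  refine TensorProduct.induction_on (motive := P) z zero (fun e t => ?_) add
  refine TensorProduct.induction_on
    (motive := fun e : Env k A => P (e ⊗ₜ t : Env k A ⊗[k] (⨂[k]^m A))) e ?_ (fun a b => ?_)
    (fun x y hx hy => ?_)
  · rw [TensorProduct.zero_tmul]; exact zero
  · induction t using PiTensorProduct.induction_on with
    | smul_tprod c v =>
      have := tmul (c • a) b v
      rwa [smul_barU, ← TensorProduct.smul_tmul', TensorProduct.smul_tmul] at this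
    | add x y hx hy => rw [TensorProduct.tmul_add]; exact add _ _ hx hy
  · rw [TensorProduct.add_tmul]; exact add _ _ hx hy

variable {N : Type*} [AddCommGroup N] [Module k N] [Module (Env k A) N]
  [IsScalarTower k (Env k A) N]

/-- The map of bimodules on `A ⊗ A^{⊗ m} ⊗ A` which corresponds to a cochain. -/
def barHom {m : ℕ} (f : Cochain k A N m) : BarC k A m →ₗ[Env k A] N := ext (PiTensorProduct.lift f)

@[simp]
theorem barHom_barU {m : ℕ} (f : Cochain k A N m) (a : Fin m → A) :
    barHom f (barU k A m a) = f a := by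
  rw [barU_apply]
  refine (ext_tmul _ _ _).trans ?_
  rw [one_smul, PiTensorProduct.lift.tprod]

theorem barC_hom_ext {m : ℕ} {N : Type*} [AddCommGroup N] [Module (Env k A) N]
    {f g : BarC k A m →ₗ[Env k A] N}
    (h : ∀ a, f (barU k A m a) = g (barU k A m a)) : f = g := by
  ext1 z
  induction z using barC_induction with
  | tmul a b v => rw [map_smul, map_smul, h]
  | add x y hx hy => rw [map_add, map_add, hx, hy]

variable (k A) in
/-- The differential of the bar resolution. -/
def barDC (m : ℕ) : BarC k A (m + 1) →ₗ[Env k A] BarC k A m := barHom (hochDM (barU k A m))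

theorem barDC_barU {m : ℕ} (a : Fin (m + 1) → A) :
    barDC k A m (barU k A (m + 1) a) = hochD k (barU k A m) a := by
  rw [barDC, barHom_barU, hochDM_apply]

theorem hom_barDC {m : ℕ} {N : Type*} [AddCommGroup N] [Module (Env k A) N]
    (g : BarC k A m →ₗ[Env k A] N) (a : Fin (m + 1) → A) :
    g (barDC k A m (barU k A (m + 1) a)) = hochD k (fun v => g (barU k A m v)) a := by
  rw [barDC_barU, ← hochD_comp]

variable (k A) in
/-- The augmentation of the bar resolution. -/
def barAug : BarC k A 0 →ₗ[Env k A] Reg A := barHom (MultilinearMap.constOfIsEmpty k _ 1)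

theorem barAug_barU (a : Fin 0 → A) : barAug k A (barU k A 0 a) = 1 := by
  rw [barAug, barHom_barU]; rfl

variable (k A) in
/-- The contracting homotopy `(a ⊗ a') ⊗ v ↦ (1 ⊗ a') ⊗ (a ⊗ v)`. -/
def barS (m : ℕ) : BarC k A m →ₗ[k] BarC k A (m + 1) :=
  TensorProduct.map (Algebra.TensorProduct.includeRight : Aᵐᵒᵖ →ₐ[k] Env k A).toLinearMap
      (TensorProduct.lift (PiTensorProduct.lift.toLinearMap ∘ₗ
        (PiTensorProduct.tprod k : MultilinearMap k (fun _ : Fin (m + 1) => A) _).curryLeft)) ∘ₗ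
    (TensorProduct.leftComm k A Aᵐᵒᵖ (⨂[k]^m A)).toLinearMap ∘ₗ
    (TensorProduct.assoc k A Aᵐᵒᵖ (⨂[k]^m A)).toLinearMap

theorem barS_smul_barU {m : ℕ} (a : A) (b : Aᵐᵒᵖ) (v : Fin m → A) :
    barS k A m ((a ⊗ₜ b : Env k A) • barU k A m v) =
      (1 ⊗ₜ b : Env k A) • barU k A (m + 1) (Fin.cons a v) := by
  rw [smul_barU, smul_barU]
  change (1 ⊗ₜ b : Env k A) ⊗ₜ[k] PiTensorProduct.lift
    ((PiTensorProduct.tprod k : MultilinearMap k (fun _ : Fin (m + 1) => A) _).curryLeft a)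
      (PiTensorProduct.tprod k v) = _
  rw [PiTensorProduct.lift.tprod]
  rfl

/-- The homotopy only moves the left coefficient into the tensor, so it passes through every term of
the differential that does not touch this coefficient. -/
theorem barS_smul_hochT {m : ℕ} (a : A) (b : Aᵐᵒᵖ) (v : Fin (m + 1) → A) :
    barS k A m ((a ⊗ₜ b : Env k A) • hochT k (barU k A m) v) =
      (1 ⊗ₜ b : Env k A) • hochT k (fun w => barU k A (m + 1) (Fin.cons a w)) v := by
  simp only [hochT, smul_add, Finset.smul_sum, map_add, map_sum, smul_comm (_ : Env k A) (_ : ℤ),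
    map_zsmul, barS_smul_barU]
  congr 2
  rw [smul_smul, Algebra.TensorProduct.tmul_mul_tmul, mul_one, barS_smul_barU, smul_smul,
    Algebra.TensorProduct.tmul_mul_tmul, mul_one]

/-- By `hochD_cons`, the first term of the differential of `1 ⊗ (a, v) ⊗ b` is the given element,
and all other terms cancel those obtained from the homotopy after the differential. -/
theorem barDC_barS {m : ℕ} (x : BarC k A (m + 1)) :
    barDC k A (m + 1) (barS k A (m + 1) x) + barS k A m (barDC k A m x) = x := by
  induction x using barC_induction with
  | add x y hx hy =>
    simp only [map_add]
    conv_rhs => rw [← hx, ← hy]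
    abel
  | tmul a b v =>
    rw [barS_smul_barU, map_smul, map_smul, barDC_barU, barDC_barU, hochD_cons, hochD_eq, smul_add,
      map_add, barS_smul_hochT, smul_smul, Algebra.TensorProduct.tmul_mul_tmul, mul_one,
      barS_smul_barU, smul_sub, smul_sub, smul_smul, Algebra.TensorProduct.tmul_mul_tmul, one_mul,
      mul_one]
    abel

end Bar

section BarExact

variable {k A : Type*} [Field k] [Ring A] [Algebra k A]

theorem hochD_zero_apply {N : Type*} [AddCommGroup N] [Module (Env k A) N]
    (f : (Fin 0 → A) → N) (a : Fin 1 → A) : hochD k f a =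
      (a 0 ⊗ₜ 1 : Env k A) • f Fin.elim0
        - (1 ⊗ₜ MulOpposite.op (a 0) : Env k A) • f Fin.elim0 := by
  have : Fin.tail a = Fin.elim0 := Subsingleton.elim _ _
  rw [hochD_eq, hochT_zero, this, sub_eq_add_neg]

theorem reg_smul_one (a : A) (b : Aᵐᵒᵖ) :
    (a ⊗ₜ b : Env k A) • (1 : Reg A) = toReg k A (a * b.unop) := by
  have := reg_smul (k := k) a b.unop 1
  rw [mul_one] at this
  exact this

theorem barAug_barDC (x : BarC k A 1) : barAug k A (barDC k A 0 x) = 0 := by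
  have : barAug k A ∘ₗ barDC k A 0 = 0 := by
    refine barC_hom_ext fun a => ?_
    rw [LinearMap.comp_apply, hom_barDC, hochD_zero_apply, barAug_barU, reg_smul_one, reg_smul_one]
    simp
  exact LinearMap.congr_fun this x

variable (k A) in
/-- The contraction `a ↦ 1 ⊗ a` of the augmented bar resolution. -/
def barS₀ : Reg A →ₗ[k] BarC k A 0 where
  toFun a := (1 ⊗ₜ MulOpposite.op ((toReg k A).symm a) : Env k A) • barU k A 0 Fin.elim0
  map_add' a b := by
    rw [map_add, MulOpposite.op_add, TensorProduct.tmul_add, add_smul]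
  map_smul' c a := by
    rw [map_smul, MulOpposite.op_smul, TensorProduct.tmul_smul, smul_assoc]
    rfl

theorem barDC_barS_zero (x : BarC k A 0) :
    barDC k A 0 (barS k A 0 x) + barS₀ k A (barAug k A x) = x := by
  induction x using barC_induction with
  | add x y hx hy =>
    simp only [map_add]
    conv_rhs => rw [← hx, ← hy]
    abel
  | tmul a b v =>
    obtain rfl : v = Fin.elim0 := Subsingleton.elim _ _
    rw [barS_smul_barU, map_smul, map_smul, barDC_barU, hochD_zero_apply, barAug_barU, reg_smul_one]
    change _ + (1 ⊗ₜ MulOpposite.op (a * b.unop) : Env k A) • barU k A 0 Fin.elim0 = _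
    rw [smul_sub, smul_smul, smul_smul, Algebra.TensorProduct.tmul_mul_tmul,
      Algebra.TensorProduct.tmul_mul_tmul]
    simp

/-- The homotopy identity `ds + sd = 1` replaces a computation with signs: it gives `dds = d - dsd =
sdd`, so `dd` vanishes on values of `s` once it vanishes one degree lower, and these values generate
the next term as a bimodule. -/
theorem barDC_barDC (m : ℕ) (x : BarC k A (m + 2)) : barDC k A m (barDC k A (m + 1) x) = 0 := by
  have key : ∀ m (y : BarC k A (m + 1)),
      barDC k A m (barDC k A (m + 1) (barS k A (m + 1) y)) =
        barDC k A m y - barDC k A m (barS k A m (barDC k A m y)) := fun m y => by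
    rw [eq_sub_iff_add_eq, ← map_add, barDC_barS]
  have red : ∀ m, (∀ y : BarC k A (m + 1),
      barDC k A m (barDC k A (m + 1) (barS k A (m + 1) y)) = 0) →
        ∀ x : BarC k A (m + 2), barDC k A m (barDC k A (m + 1) x) = 0 := by
    intro m h x
    induction x using barC_induction with
    | add x y hx hy => rw [map_add, map_add, hx, hy, add_zero]
    | tmul a b v =>
      have : (a ⊗ₜ b : Env k A) • barU k A (m + 2) v = (a ⊗ₜ 1 : Env k A) •
          barS k A (m + 1) ((v 0 ⊗ₜ b : Env k A) • barU k A (m + 1) (Fin.tail v)) := by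
        rw [barS_smul_barU, smul_smul, Algebra.TensorProduct.tmul_mul_tmul, mul_one, one_mul,
          Fin.cons_self_tail]
      rw [this, map_smul, map_smul, h, smul_zero]
  induction m with
  | zero =>
    refine red 0 (fun y => ?_) x
    have := barDC_barS_zero (barDC k A 0 y)
    rw [barAug_barDC, map_zero, add_zero] at this
    rw [key, this, sub_self]
  | succ m ih =>
    refine red (m + 1) (fun y => ?_) x
    have := barDC_barS (barDC k A (m + 1) y)
    rw [ih, map_zero, add_zero] at this
    rw [key, this, sub_self]

variable (k A) in
/-- The bar resolution. -/
theorem bar_isProjRes : IsProjRes (Env k A) (BarC k A) (barDC k A) (barAug k A) where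
  projective m := inferInstance
  surjective a := by
    refine ⟨((toReg k A).symm a ⊗ₜ 1 : Env k A) • barU k A 0 Fin.elim0, ?_⟩
    rw [map_smul, barAug_barU, reg_smul_one]
    simp
  exact_zero x := by
    refine ⟨fun h => ⟨barS k A 0 x, ?_⟩, ?_⟩
    · simpa [h] using barDC_barS_zero x
    · rintro ⟨y, rfl⟩
      exact barAug_barDC y
  exact_succ m x := by
    refine ⟨fun h => ⟨barS k A (m + 1) x, ?_⟩, ?_⟩
    · simpa [h] using barDC_barS x
    · rintro ⟨y, rfl⟩
      exact barDC_barDC m y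

end BarExact

/-! ### Comparison of resolutions with the bar resolution. -/

section Comparison

variable {k A : Type*} [Field k] [Ring A] [Algebra k A]
  {Y : ℕ → Type*} [∀ m, AddCommGroup (Y m)] [∀ m, Module k (Y m)] [∀ m, Module (Env k A) (Y m)]
  [∀ m, IsScalarTower k (Env k A) (Y m)]
  {N : Type*} [AddCommGroup N] [Module k N] [Module (Env k A) N] [IsScalarTower k (Env k A) N]

/-- Composition of a cochain with a map of bimodules. -/
def compCochain {N N' : Type*} [AddCommGroup N] [Module k N] [Module (Env k A) N]
    [IsScalarTower k (Env k A) N] [AddCommGroup N'] [Module k N'] [Module (Env k A) N']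
    [IsScalarTower k (Env k A) N'] (g : N →ₗ[Env k A] N') {m : ℕ} (f : Cochain k A N m) :
    Cochain k A N' m := (g.restrictScalars k).compMultilinearMap f

@[simp]
theorem compCochain_apply {N N' : Type*} [AddCommGroup N] [Module k N] [Module (Env k A) N]
    [IsScalarTower k (Env k A) N] [AddCommGroup N'] [Module k N'] [Module (Env k A) N']
    [IsScalarTower k (Env k A) N'] (g : N →ₗ[Env k A] N') {m : ℕ} (f : Cochain k A N m)
    (a : Fin m → A) : compCochain g f a = g (f a) := rfl

theorem barHom_comp_barDC {m : ℕ} (f : Cochain k A N m) (a : Fin (m + 1) → A) :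
    barHom f (barDC k A m (barU k A (m + 1) a)) = hochD k f a := by
  rw [hom_barDC]
  simp

theorem barHom_chainMap {dY : ∀ m, Y (m + 1) →ₗ[Env k A] Y m} {ψ : ∀ m, Cochain k A (Y m) m}
    (hψ : ∀ m a, dY m (ψ (m + 1) a) = hochD k (ψ m) a) (m : ℕ) (x : BarC k A (m + 1)) :
    dY m (barHom (ψ (m + 1)) x) = barHom (ψ m) (barDC k A m x) := by
  have : dY m ∘ₗ barHom (ψ (m + 1)) = barHom (ψ m) ∘ₗ barDC k A m := by
    refine barC_hom_ext fun a => ?_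
    rw [LinearMap.comp_apply, LinearMap.comp_apply, barHom_barU, hψ, barHom_comp_barDC]
  exact LinearMap.congr_fun this x

/-- A comparison morphism from the bar resolution exists. -/
theorem exists_isComparison (dY : ∀ m, Y (m + 1) →ₗ[Env k A] Y m) (augY : Y 0 →ₗ[Env k A] Reg A)
    (hYs : Function.Surjective augY) (hY0 : Function.Exact (dY 0) augY)
    (hYd : ∀ m, Function.Exact (dY (m + 1)) (dY m)) :
    ∃ ψ, IsComparison k Y dY augY ψ := by
  obtain ⟨f, hf0, hf⟩ := exists_chainMap (bar_isProjRes k A).projective (barDC k A) (barAug k A)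
    dY augY barAug_barDC barDC_barDC hYs hY0 hYd LinearMap.id
  refine ⟨fun m => compCochain (f m) (barU k A m), fun m a => ?_, fun a => ?_⟩
  · rw [compCochain_apply, hf, hom_barDC]
    rfl
  · rw [compCochain_apply, hf0, barAug_barU]
    rfl

/-- Two comparison morphisms from the bar resolution are homotopic. -/
theorem isCobdry_comparison_sub {M' : Type*} [AddCommGroup M'] [Module (Env k A) M']
    (dY : ∀ m, Y (m + 1) →ₗ[Env k A] Y m) (augY : Y 0 →ₗ[Env k A] M')
    (hY0 : Function.Exact (dY 0) augY) (hYd : ∀ m, Function.Exact (dY (m + 1)) (dY m))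
    {ψ ψ' : ∀ m, Cochain k A (Y m) m}
    (hψ : ∀ m a, dY m (ψ (m + 1) a) = hochD k (ψ m) a)
    (hψ' : ∀ m a, dY m (ψ' (m + 1) a) = hochD k (ψ' m) a)
    (haug : ∀ a, augY (ψ 0 a) = augY (ψ' 0 a)) {m : ℕ} (f : Y m →ₗ[Env k A] N)
    (hf : ∀ x, f (dY m x) = 0) :
    IsCobdry k (fun a => f (ψ m a) - f (ψ' m a)) := by
  obtain ⟨h, h0, h1⟩ := exists_homotopy (bar_isProjRes k A).projective (barDC k A) barDC_barDC
    dY augY hY0 hYd (fun m => barHom (ψ m) - barHom (ψ' m)) (fun x => by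
      have : augY ∘ₗ (barHom (ψ 0) - barHom (ψ' 0)) = 0 := by
        refine barC_hom_ext fun a => ?_
        simp [haug]
      exact LinearMap.congr_fun this x) (fun m x => by
      rw [LinearMap.sub_apply, LinearMap.sub_apply, map_sub, barHom_chainMap hψ,
        barHom_chainMap hψ'])
  cases m with
  | zero =>
    funext a
    have := h0 (barU k A 0 a)
    simp only [LinearMap.sub_apply, barHom_barU] at this
    rw [← map_sub, this, hf]
    rfl
  | succ m =>
    refine ⟨compCochain f (compCochain (h m) (barU k A m)), funext fun a => ?_⟩
    have := h1 m (barU k A (m + 1) a)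
    simp only [LinearMap.sub_apply, barHom_barU] at this
    rw [← map_sub, this, map_add, hf, zero_add]
    exact hom_barDC (f ∘ₗ h m) a

variable {X : ℕ → Type*} [∀ m, AddCommGroup (X m)] [∀ m, Module k (X m)]
  [∀ m, Module (Env k A) (X m)] [∀ m, IsScalarTower k (Env k A) (X m)]
  {dX : ∀ m, X (m + 1) →ₗ[Env k A] X m} {augX : X 0 →ₗ[Env k A] Reg A}

/-- A chain map to the bar resolution that lifts the identity. -/
structure IsToBar (dX : ∀ m, X (m + 1) →ₗ[Env k A] X m) (augX : X 0 →ₗ[Env k A] Reg A)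
    (κ : ∀ m, X m →ₗ[Env k A] BarC k A m) : Prop where
  comm : ∀ m x, barDC k A m (κ (m + 1) x) = κ m (dX m x)
  aug_eq : ∀ x, barAug k A (κ 0 x) = augX x

theorem IsProjRes.aug_d {R : Type*} [Ring R] {M : Type*} [AddCommGroup M] [Module R M]
    {X : ℕ → Type*} [∀ m, AddCommGroup (X m)] [∀ m, Module R (X m)]
    {d : ∀ m, X (m + 1) →ₗ[R] X m} {aug : X 0 →ₗ[R] M} (h : IsProjRes R X d aug) (x) :
    aug (d 0 x) = 0 := (h.exact_zero _).2 ⟨x, rfl⟩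

theorem IsProjRes.d_d {R : Type*} [Ring R] {M : Type*} [AddCommGroup M] [Module R M]
    {X : ℕ → Type*} [∀ m, AddCommGroup (X m)] [∀ m, Module R (X m)]
    {d : ∀ m, X (m + 1) →ₗ[R] X m} {aug : X 0 →ₗ[R] M} (h : IsProjRes R X d aug) (m) (x) :
    d m (d (m + 1) x) = 0 := (h.exact_succ m _).2 ⟨x, rfl⟩

theorem exists_isToBar (hX : IsProjRes (Env k A) X dX augX) : ∃ κ, IsToBar dX augX κ := by
  obtain ⟨f, hf0, hf⟩ := exists_chainMap hX.projective dX augX (barDC k A) (barAug k A)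
    hX.aug_d hX.d_d (bar_isProjRes k A).surjective (bar_isProjRes k A).exact_zero
    (bar_isProjRes k A).exact_succ LinearMap.id
  exact ⟨f, hf, hf0⟩

/-- Every Hochschild cocycle is cohomologous to one that factors through a given resolution. -/
theorem isCobdry_sub_comparison {κ : ∀ m, X m →ₗ[Env k A] BarC k A m} (hκ : IsToBar dX augX κ)
    {ψ : ∀ m, Cochain k A (X m) m} (hψ : IsComparison k X dX augX ψ) {m : ℕ}
    (f : Cochain k A N m) (hf : hochD k f = 0) :
    IsCobdry k (fun a => f a - barHom f (κ m (ψ m a))) := by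
  have := isCobdry_comparison_sub (barDC k A) (barAug k A) (bar_isProjRes k A).exact_zero
    (bar_isProjRes k A).exact_succ (ψ := barU k A) (ψ' := fun m => compCochain (κ m) (ψ m))
    (fun m a => barDC_barU a)
    (fun m a => by
      rw [compCochain_apply, hκ.comm, hψ.comm, ← hochD_comp]
      rfl)
    (fun a => by rw [barAug_barU, compCochain_apply, hκ.aug_eq, hψ.aug_eq]) (barHom f)
    (fun x => by
      have : barHom f ∘ₗ barDC k A m = 0 := by
        refine barC_hom_ext fun a => ?_
        rw [LinearMap.comp_apply, barHom_comp_barDC, hf]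
        rfl
      exact LinearMap.congr_fun this x)
  simpa using this

theorem barHom_comp_eq {m : ℕ} (f : X m →ₗ[Env k A] N) (ψ : Cochain k A (X m) m)
    (x : BarC k A m) : f (barHom ψ x) = barHom (compCochain f ψ) x := by
  have : f ∘ₗ barHom ψ = barHom (compCochain f ψ) := by
    refine barC_hom_ext fun a => ?_
    simp
  exact LinearMap.congr_fun this x

/-- `f` is a coboundary of the complex of homomorphisms from a complex `X`. -/
def IsHomCobdry {R : Type*} [Ring R] {X : ℕ → Type*} [∀ m, AddCommGroup (X m)]
    [∀ m, Module R (X m)] {N : Type*} [AddCommGroup N] [Module R N]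
    (dX : ∀ m, X (m + 1) →ₗ[R] X m) : {m : ℕ} → (X m →ₗ[R] N) → Prop
  | 0, f => f = 0
  | m + 1, f => ∃ g : X m →ₗ[R] N, f = g ∘ₗ dX m

theorem IsHomCobdry.comp {m : ℕ} {f : X m →ₗ[Env k A] N} (hf : IsHomCobdry dX f)
    {ψ : ∀ m, Cochain k A (X m) m} (hψ : ∀ m a, dX m (ψ (m + 1) a) = hochD k (ψ m) a) :
    IsCobdry k (fun a => f (ψ m a)) := by
  cases m with
  | zero => simp only [IsHomCobdry] at hf; subst hf; rfl
  | succ m =>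
    obtain ⟨g, rfl⟩ := hf
    refine ⟨compCochain g (ψ m), funext fun a => ?_⟩
    rw [LinearMap.comp_apply, hψ, ← hochD_comp]
    rfl

/-- The restriction of a Hochschild coboundary to a resolution is a coboundary. -/
theorem IsCobdry.isHomCobdry {κ : ∀ m, X m →ₗ[Env k A] BarC k A m} (hκ : IsToBar dX augX κ)
    {m : ℕ} (f : Cochain k A N m) (hf : IsCobdry k f) :
    IsHomCobdry dX (barHom f ∘ₗ κ m) := by
  cases m with
  | zero =>
    have : f = 0 := by ext a; exact congrFun hf a
    subst this
    change _ = _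
    have : barHom (0 : Cochain k A N 0) = 0 := by
      refine barC_hom_ext fun a => ?_
      simp
    rw [this, LinearMap.zero_comp]
  | succ m =>
    obtain ⟨g, hg⟩ := hf
    refine ⟨barHom g ∘ₗ κ m, ?_⟩
    have : barHom f = barHom g ∘ₗ barDC k A m := by
      refine barC_hom_ext fun a => ?_
      rw [LinearMap.comp_apply, barHom_comp_barDC, ← hg, barHom_barU]
    ext x
    simp [this, hκ.comm]

/-- A cocycle on a projective resolution whose Hochschild cocycle is a coboundary is a
coboundary. -/
theorem isHomCobdry_sub (hX : IsProjRes (Env k A) X dX augX)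
    {κ : ∀ m, X m →ₗ[Env k A] BarC k A m} (hκ : IsToBar dX augX κ)
    {ψ : ∀ m, Cochain k A (X m) m} (hψ : IsComparison k X dX augX ψ) {m : ℕ}
    (f : X m →ₗ[Env k A] N) (hf : ∀ x, f (dX m x) = 0) :
    IsHomCobdry dX (f - barHom (compCochain f (ψ m)) ∘ₗ κ m) := by
  -- The composite of `X → bar → X` lifts the identity of `A`, so it is homotopic to the identity of
  -- `X`; the part of the homotopy that ends in a differential is killed by the cocycle `f`.
  obtain ⟨h, h0, h1⟩ := exists_homotopy hX.projective dX hX.d_d dX augX hX.exact_zero hX.exact_succ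
    (fun m => LinearMap.id - barHom (ψ m) ∘ₗ κ m) (fun x => by
      have : augX ∘ₗ barHom (ψ 0) = barAug k A := by
        refine barC_hom_ext fun a => ?_
        simp [hψ.aug_eq, barAug_barU]
      have := LinearMap.congr_fun this (κ 0 x)
      rw [LinearMap.comp_apply, hκ.aug_eq] at this
      simp [this]) (fun m x => by
      simp [barHom_chainMap hψ.comm, hκ.comm])
  cases m with
  | zero =>
    ext x
    have := congrArg f (h0 x)
    rw [hf] at this
    simpa [← barHom_comp_eq] using this
  | succ m =>
    refine ⟨f ∘ₗ h m, ?_⟩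
    ext x
    have := congrArg f (h1 m x)
    rw [map_add, hf, zero_add] at this
    simpa [← barHom_comp_eq] using this

theorem IsHomCobdry.add {m : ℕ} {f g : X m →ₗ[Env k A] N} (hf : IsHomCobdry dX f)
    (hg : IsHomCobdry dX g) : IsHomCobdry dX (f + g) := by
  cases m with
  | zero => simp only [IsHomCobdry] at hf hg ⊢; simp [hf, hg]
  | succ m =>
    obtain ⟨f', rfl⟩ := hf
    obtain ⟨g', rfl⟩ := hg
    exact ⟨f' + g', (LinearMap.add_comp _ _ _).symm⟩

/-- Carrying `f` to the bar complex and back changes it by a coboundary (`isHomCobdry_sub`), while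
the transported cochain is a coboundary by `IsCobdry.isHomCobdry`. -/
theorem isHomCobdry_of_isCobdry (hX : IsProjRes (Env k A) X dX augX)
    {ψ : ∀ m, Cochain k A (X m) m} (hψ : IsComparison k X dX augX ψ) {m : ℕ}
    (f : X m →ₗ[Env k A] N) (hf : ∀ x, f (dX m x) = 0) (h : IsCobdry k (fun a => f (ψ m a))) :
    IsHomCobdry dX f := by
  obtain ⟨κ, hκ⟩ := exists_isToBar hX
  have h1 := isHomCobdry_sub hX hκ hψ f hf
  have h2 := IsCobdry.isHomCobdry hκ (compCochain f (ψ m)) h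
  simpa using h1.add h2

end Comparison

/-! ### The Koszul complex inside the bar resolution -/

section KoszulBasic

variable {k A : Type*} [Field k] [Ring A] [Algebra k A]

variable (k A) in
/-- `a ⊗ t ↦ a · splitL t`. -/
def leftD : A ⊗[k] TensorAlgebra k A →ₗ[A] A ⊗[k] TensorAlgebra k A :=
  TensorProduct.AlgebraTensorModule.lift
    (LinearMap.toSpanSingleton A (TensorAlgebra k A →ₗ[k] A ⊗[k] TensorAlgebra k A) (splitL k A))

@[simp]
theorem leftD_tmul (a : A) (t : TensorAlgebra k A) : leftD k A (a ⊗ₜ t) = a • splitL k A t := rfl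

variable (k A) in
/-- `a ⊗ t ↦ at`. -/
def mulι : A ⊗[k] TensorAlgebra k A →ₗ[k] TensorAlgebra k A :=
  LinearMap.mul' k (TensorAlgebra k A) ∘ₗ LinearMap.rTensor _ (TensorAlgebra.ι k)

@[simp]
theorem mulι_tmul (a : A) (t : TensorAlgebra k A) :
    mulι k A (a ⊗ₜ t) = TensorAlgebra.ι k a * t := rfl

theorem splitL_mulι (z : A ⊗[k] TensorAlgebra k A) : splitL k A (mulι k A z) = z := by
  induction z with
  | zero => simp
  | add x y hx hy => simp only [map_add, hx, hy]
  | tmul a t => rw [mulι_tmul, splitL_ι_mul]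

variable (k A) in
/-- The product of the letters of a tensor. -/
def prodT : TensorAlgebra k A →ₐ[k] A := TensorAlgebra.lift k (LinearMap.id : A →ₗ[k] A)

@[simp]
theorem prodT_ι (a : A) : prodT k A (TensorAlgebra.ι k a) = a := by simp [prodT]

variable (𝒜 : ℕ → Submodule k A)

theorem koszulSp_le_pow (m : ℕ) : koszulSp 𝒜 m ≤ vSp 𝒜 ^ m := inf_le_left

theorem koszulSp_le (m u v : ℕ) (h : u + v + 2 = m) :
    koszulSp 𝒜 m ≤ vSp 𝒜 ^ u * relSp 𝒜 * vSp 𝒜 ^ v :=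
  inf_le_right.trans ((iInf_le _ u).trans ((iInf_le _ v).trans (iInf_le _ h)))

theorem koszulSp_le_rel (m : ℕ) : koszulSp 𝒜 (m + 2) ≤ relSp 𝒜 * vSp 𝒜 ^ m := by
  have := koszulSp_le 𝒜 (m + 2) 0 m (by omega)
  rwa [pow_zero, one_mul] at this

theorem mem_koszulSp {m : ℕ} {t : TensorAlgebra k A} (h : t ∈ vSp 𝒜 ^ m)
    (h' : ∀ u v, u + v + 2 = m → t ∈ vSp 𝒜 ^ u * relSp 𝒜 * vSp 𝒜 ^ v) : t ∈ koszulSp 𝒜 m := by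
  simp only [koszulSp, Submodule.mem_inf, Submodule.mem_iInf]
  exact ⟨h, h'⟩

theorem mulι_splitL_of_mem {Z : Submodule k (TensorAlgebra k A)} {t : TensorAlgebra k A}
    (ht : t ∈ vSp 𝒜 * Z) : mulι k A (splitL k A t) = t := by
  induction ht using Submodule.mul_induction_on' with
  | mem_mul_mem x hx y hy =>
    obtain ⟨a, -, rfl⟩ := hx
    rw [splitL_ι_mul, mulι_tmul]
  | add x _ y _ hx hy => rw [map_add, map_add, hx, hy]

/-- A tensor in `A ⊗ T` all of whose contractions lie in `W ⊆ T` lies in `A ⊗ W`. -/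
theorem mem_range_lTensor_of_contr {T : Type*} [AddCommGroup T] [Module k T] (W : Submodule k T)
    (z : A ⊗[k] T)
    (hz : ∀ φ : A →ₗ[k] k, TensorProduct.lid k T (LinearMap.rTensor T φ z) ∈ W) :
    z ∈ LinearMap.range (LinearMap.lTensor A W.subtype) := by
  classical
  let b := Module.Basis.ofVectorSpace k A
  have h : ∀ z i, TensorProduct.equivFinsuppOfBasisLeft (N := T) b z i =
      TensorProduct.lid k T (LinearMap.rTensor T (b.coord i) z) := by
    intro z i
    induction z with
    | zero => simp
    | add x y hx hy => simp only [map_add, Finsupp.add_apply, hx, hy]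
    | tmul a t => simp
  rw [← (TensorProduct.equivFinsuppOfBasisLeft (N := T) b).symm_apply_apply z,
    TensorProduct.equivFinsuppOfBasisLeft_symm_apply, Finsupp.sum]
  refine Submodule.sum_mem _ fun i _ => ?_
  have hi : TensorProduct.equivFinsuppOfBasisLeft (N := T) b z i ∈ W := by rw [h]; exact hz _
  exact ⟨b i ⊗ₜ ⟨_, hi⟩, LinearMap.lTensor_tmul _ _ _ _⟩

/-- Contracting the first letter maps `V · Z` into `Z`. The conditions that define the Koszul
tensors of length `m + 1` and do not involve the first letter have the form `t ∈ V · Z`, where `Z`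
runs through the conditions for length `m`. -/
theorem splitL_mem {m : ℕ} {t : TensorAlgebra k A} (ht : t ∈ koszulSp 𝒜 (m + 1)) :
    splitL k A t ∈ LinearMap.range (LinearMap.lTensor A (koszulSp 𝒜 m).subtype) := by
  refine mem_range_lTensor_of_contr _ _ fun φ => ?_
  have key : ∀ Z : Submodule k (TensorAlgebra k A), t ∈ vSp 𝒜 * Z →
      TensorProduct.lid k _ (LinearMap.rTensor _ φ (splitL k A t)) ∈ Z := by
    intro Z h
    have : vSp 𝒜 * Z ≤ Z.comap ((TensorProduct.lid k _).toLinearMap ∘ₗ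
        LinearMap.rTensor _ φ ∘ₗ splitL k A) := by
      refine Submodule.mul_le.2 fun x hx y hy => ?_
      obtain ⟨a, -, rfl⟩ := hx
      simpa [splitL_ι_mul] using Z.smul_mem _ hy
    exact this h
  refine mem_koszulSp 𝒜 (key _ (by rw [← pow_succ']; exact koszulSp_le_pow 𝒜 _ ht))
    fun u v h => key _ ?_
  have := koszulSp_le 𝒜 (m + 1) (u + 1) v (by omega) ht
  rwa [pow_succ', mul_assoc, mul_assoc, ← mul_assoc (vSp 𝒜 ^ u)] at this

theorem leftD_splitL_mul {x : TensorAlgebra k A} (hx : x ∈ vSp 𝒜 ^ 2) (t : TensorAlgebra k A) :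
    leftD k A (splitL k A (x * t)) = prodT k A x ⊗ₜ t := by
  rw [pow_two] at hx
  induction hx using Submodule.mul_induction_on' with
  | mem_mul_mem x hx y hy =>
    obtain ⟨a, -, rfl⟩ := hx
    obtain ⟨b, -, rfl⟩ := hy
    rw [mul_assoc, splitL_ι_mul, leftD_tmul, splitL_ι_mul, TensorProduct.smul_tmul', map_mul]
    simp
  | add x _ y _ hx hy => rw [add_mul, map_add, map_add, map_add, hx, hy, TensorProduct.add_tmul]

/-- The first two letters form a relation, and `leftD` after `splitL` multiplies them. -/
theorem leftD_splitL_of_mem {m : ℕ} {t : TensorAlgebra k A} (ht : t ∈ koszulSp 𝒜 (m + 2)) :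
    leftD k A (splitL k A t) = 0 := by
  have h := koszulSp_le_rel 𝒜 m ht
  clear ht
  induction h using Submodule.mul_induction_on' with
  | mem_mul_mem x hx y hy =>
    have h0 : prodT k A x = 0 := hx.2
    rw [leftD_splitL_mul 𝒜 hx.1, h0, TensorProduct.zero_tmul]
  | add x _ y _ hx hy => rw [map_add, map_add, hx, hy, add_zero]

theorem dR_mul_ι (a : A) (t : TensorAlgebra k A) :
    dR k A (t * TensorAlgebra.ι k a) = (1 ⊗ₜ MulOpposite.op a : Env k A) ⊗ₜ t := by
  simp [dR, splitR_mul_ι]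

/-- Positive length is essential: for `t = 1` the last letter of the product is `a` itself. -/
theorem dR_ι_mul {m : ℕ} (a : A) {t : TensorAlgebra k A} (ht : t ∈ vSp 𝒜 ^ (m + 1)) :
    dR k A (TensorAlgebra.ι k a * t) = midMul k A a (dR k A t) := by
  rw [pow_succ] at ht
  induction ht using Submodule.mul_induction_on' with
  | mem_mul_mem x hx y hy =>
    obtain ⟨b, -, rfl⟩ := hy
    rw [← mul_assoc, dR_mul_ι, dR_mul_ι, midMul_tmul]
  | add x _ y _ hx hy => rw [mul_add, map_add, map_add, map_add, hx, hy]

theorem algebraMapInv_of_mem {m : ℕ} {t : TensorAlgebra k A} (ht : t ∈ vSp 𝒜 ^ (m + 1)) :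
    TensorAlgebra.algebraMapInv (R := k) t = 0 := by
  rw [pow_succ] at ht
  induction ht using Submodule.mul_induction_on' with
  | mem_mul_mem x hx y hy =>
    obtain ⟨b, -, rfl⟩ := hy
    simp [TensorAlgebra.algebraMapInv]
  | add x _ y _ hx hy => rw [map_add, hx, hy, add_zero]

theorem contr_splitL (a : A) (z : A ⊗[k] TensorAlgebra k A) :
    contr k A a z = mulι k A (a • z) := by
  induction z with
  | zero => simp
  | add x y hx hy => rw [map_add, hx, hy, smul_add, map_add]
  | tmul b t => rw [contr_tmul, TensorProduct.smul_tmul', mulι_tmul, smul_eq_mul]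

/-- The inner terms of the bar differential multiply adjacent letters, and a Koszul tensor has a
relation in every pair of adjacent places. Only the term that splits off the last letter survives.
-/
theorem tailD_of_mem {m : ℕ} {t : TensorAlgebra k A} (ht : t ∈ koszulSp 𝒜 (m + 1)) :
    tailD k A t = (-1 : k) ^ (m + 1) • dR k A t := by
  induction m generalizing t with
  | zero =>
    have := koszulSp_le_pow 𝒜 _ ht
    rw [zero_add, pow_one] at this
    obtain ⟨a, -, rfl⟩ := this
    have h1 := tailD_ι_mul (k := k) a 1
    have h2 := dR_mul_ι (k := k) a 1
    rw [mul_one, tailD_one, headMul_one, map_zero, sub_zero] at h1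
    rw [one_mul] at h2
    rw [h1, h2, zero_add, pow_one, neg_one_smul]
  | succ m ih =>
    obtain ⟨z, hz⟩ := splitL_mem 𝒜 ht
    have hw : mulι k A (splitL k A t) = t := by
      refine mulι_splitL_of_mem 𝒜 (Z := vSp 𝒜 ^ (m + 1)) ?_
      rw [← pow_succ']
      exact koszulSp_le_pow 𝒜 _ ht
    -- Individual products of a letter with a Koszul tensor are not Koszul, so the claim cannot be
    -- checked on them. With the head products added it is linear in `z` and holds on all of `A ⊗
    -- (A^!_{m+1})^*`; for the `z` that comes from `t` the head products vanish.
    have key : ∀ z : A ⊗[k] koszulSp 𝒜 (m + 1),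
        tailD k A (mulι k A (LinearMap.lTensor A (koszulSp 𝒜 (m + 1)).subtype z)) +
          (1 : Env k A) ⊗ₜ[k]
            mulι k A (leftD k A (LinearMap.lTensor A (koszulSp 𝒜 (m + 1)).subtype z)) =
        (-1 : k) ^ (m + 2) •
          dR k A (mulι k A (LinearMap.lTensor A (koszulSp 𝒜 (m + 1)).subtype z)) := by
      intro z
      induction z with
      | zero => simp
      | add x y hx hy =>
        simp only [map_add, TensorProduct.tmul_add, smul_add, ← hx, ← hy]
        abel
      | tmul a t =>
        rw [LinearMap.lTensor_tmul, mulι_tmul, tailD_ι_mul, Submodule.subtype_apply, ih t.2,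
          dR_ι_mul 𝒜 a (koszulSp_le_pow 𝒜 _ t.2), leftD_tmul, ← contr_splitL]
        have : headMul k A a (t : TensorAlgebra k A) =
            (1 : Env k A) ⊗ₜ[k] contr k A a (splitL k A (t : TensorAlgebra k A)) := by
          simp [headMul, algebraMapInv_of_mem 𝒜 (koszulSp_le_pow 𝒜 _ t.2)]
        rw [this, LinearMap.map_smul_of_tower, pow_succ _ (m + 1), mul_neg_one, neg_smul]
        abel
    have := key z
    rw [hz, leftD_splitL_of_mem 𝒜 ht, hw, map_zero, TensorProduct.tmul_zero, add_zero] at this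
    exact this

theorem barD_of_mem {m : ℕ} {t : TensorAlgebra k A} (ht : t ∈ koszulSp 𝒜 (m + 1)) :
    barD k A t = dL k A t + (-1 : k) ^ (m + 1) • dR k A t := by
  rw [barD, LinearMap.add_apply, tailD_of_mem 𝒜 ht]

/-- The element `1 ⊗ w ⊗ 1` of the Koszul complex. -/
def KC.of {m : ℕ} : koszulSp 𝒜 m →ₗ[k] KC 𝒜 m where
  toFun w := ⟨(1 : Env k A) ⊗ₜ (w : TensorAlgebra k A), Submodule.tmul_mem_baseChange_of_mem _ w.2⟩
  map_add' _ _ := Subtype.ext (TensorProduct.tmul_add _ _ _)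
  map_smul' _ _ := Subtype.ext (TensorProduct.tmul_smul _ _ _)

theorem KC.val_of {m : ℕ} (w : koszulSp 𝒜 m) :
    KC.val 𝒜 (KC.of 𝒜 w) = (1 : Env k A) ⊗ₜ (w : TensorAlgebra k A) := rfl

theorem KC.val_injective {m : ℕ} : Function.Injective (KC.val 𝒜 (m := m)) :=
  Subtype.val_injective

instance (m : ℕ) : IsScalarTower k (Env k A) (KC 𝒜 m) :=
  inferInstanceAs (IsScalarTower k (Env k A) (koszul 𝒜 m))

theorem KC.induction {m : ℕ} {P : KC 𝒜 m → Prop} (x : KC 𝒜 m)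
    (smul : ∀ (a : A) (b : Aᵐᵒᵖ) (w : koszulSp 𝒜 m), P ((a ⊗ₜ b : Env k A) • KC.of 𝒜 w))
    (add : ∀ x y, P x → P y → P (x + y)) : P x := by
  obtain ⟨x, hx⟩ := x
  have zero : P 0 := by
    have := smul 0 0 0
    rwa [TensorProduct.zero_tmul, map_zero, smul_zero] at this
  have hs : ∀ (e : Env k A) (w : koszulSp 𝒜 m), P (e • KC.of 𝒜 w) := by
    intro e w
    refine TensorProduct.induction_on (motive := fun e : Env k A => P (e • KC.of 𝒜 w)) e ?_
      (fun a b => smul a b w) (fun x y hx hy => ?_)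
    · have := smul 0 0 w
      rwa [TensorProduct.zero_tmul] at this
    · have : (x + y : Env k A) • KC.of 𝒜 w = x • KC.of 𝒜 w + y • KC.of 𝒜 w := add_smul _ _ _
      exact this ▸ add _ _ hx hy
  have hx' := hx
  rw [koszul, Submodule.baseChange_eq_span] at hx'
  suffices h : ∀ y ∈ Submodule.span (Env k A)
      (((koszulSp 𝒜 m).map (TensorProduct.mk k (Env k A) (TensorAlgebra k A) 1) :
        Submodule k _) : Set (Env k A ⊗[k] TensorAlgebra k A)),
      ∀ hy : y ∈ koszul 𝒜 m, P ⟨y, hy⟩ from h x hx' hx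
  intro y hy
  induction hy using Submodule.closure_induction with
  | zero => exact fun _ => zero
  | add x y hx hy hPx hPy =>
    intro h
    have hx' : x ∈ koszul 𝒜 m := by rwa [koszul, Submodule.baseChange_eq_span]
    have hy' : y ∈ koszul 𝒜 m := by rwa [koszul, Submodule.baseChange_eq_span]
    exact add ⟨x, hx'⟩ ⟨y, hy'⟩ (hPx hx') (hPy hy')
  | smul_mem e x hx =>
    obtain ⟨w, hw, rfl⟩ := hx
    exact fun _ => hs e ⟨w, hw⟩

theorem KC.hom_ext {m : ℕ} {N : Type*} [AddCommGroup N] [Module (Env k A) N]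
    {f g : KC 𝒜 m →ₗ[Env k A] N} (h : ∀ w, f (KC.of 𝒜 w) = g (KC.of 𝒜 w)) : f = g := by
  ext1 x
  induction x using KC.induction with
  | smul a b w => rw [map_smul, map_smul, h]
  | add x y hx hy => rw [map_add, map_add, hx, hy]

theorem val_koszulD {m : ℕ} (x : KC 𝒜 (m + 1)) :
    KC.val 𝒜 (koszulD 𝒜 m x) = dTotal k A m (KC.val 𝒜 x) := rfl

theorem dTotal_tmul (m : ℕ) (e : Env k A) (t : TensorAlgebra k A) :
    dTotal k A m (e ⊗ₜ t) = e • (dL k A t + (-1 : k) ^ (m + 1) • dR k A t) := rfl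

theorem val_koszulD_of {m : ℕ} (w : koszulSp 𝒜 (m + 1)) :
    KC.val 𝒜 (koszulD 𝒜 m (KC.of 𝒜 w)) = barD k A (w : TensorAlgebra k A) := by
  rw [val_koszulD, KC.val_of, dTotal_tmul, one_smul, barD_of_mem 𝒜 w.2]

theorem koszulAug_of (w : koszulSp 𝒜 0) : koszulAug 𝒜 (KC.of 𝒜 w) =
    algebraMap k (Reg A) (TensorAlgebra.algebraMapInv (R := k) (w : TensorAlgebra k A)) :=
  one_smul (Env k A) _

/-- The inclusion of the Koszul complex into the bar resolution. -/
def toBar (m : ℕ) : KC 𝒜 m →ₗ[Env k A] BarC k A m := ext (evT (barU k A m)) ∘ₗ KC.val 𝒜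

theorem ext_evT_eq_barHom {N : Type*} [AddCommGroup N] [Module k N] [Module (Env k A) N]
    [IsScalarTower k (Env k A) N] {m : ℕ} (f : Cochain k A N m) (t : TensorAlgebra k A) :
    barHom f (evT (barU k A m) t) = evT f t := by
  have : (barHom f).restrictScalars k ∘ₗ evT (barU k A m) = evT f := by
    refine linearMap_ext_tprod fun n a => ?_
    by_cases h : n = m
    · subst h
      simp [evT_tprod, -TensorAlgebra.tprod_apply]
    · simp [evT_tprod_of_ne h, -TensorAlgebra.tprod_apply]
  exact LinearMap.congr_fun this t

theorem barHom_toBar_of {N : Type*} [AddCommGroup N] [Module k N] [Module (Env k A) N]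
    [IsScalarTower k (Env k A) N] {m : ℕ} (f : Cochain k A N m) (w : koszulSp 𝒜 m) :
    barHom f (toBar 𝒜 m (KC.of 𝒜 w)) = evT f (w : TensorAlgebra k A) := by
  rw [toBar, LinearMap.comp_apply, KC.val_of, ext_tmul, one_smul, ext_evT_eq_barHom]

theorem range_ι_pow_le_span (n : ℕ) : LinearMap.range (TensorAlgebra.ι k (M := A)) ^ n ≤
    Submodule.span k (Set.range (TensorAlgebra.tprod k A n)) := by
  induction n with
  | zero =>
    rw [pow_zero, Submodule.one_le]
    exact Submodule.subset_span ⟨Fin.elim0, tprod_elim0 _⟩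
  | succ n ih =>
    rw [pow_succ']
    refine (mul_le_mul' le_rfl ih).trans ?_
    rw [← Submodule.span_eq (LinearMap.range (TensorAlgebra.ι k (M := A))),
      Submodule.span_mul_span]
    refine Submodule.span_mono ?_
    rintro _ ⟨_, ⟨a, rfl⟩, _, ⟨v, rfl⟩, rfl⟩
    exact ⟨Fin.cons a v, tprod_cons a v⟩

theorem evT_hochDM {N : Type*} [AddCommGroup N] [Module k N] [Module (Env k A) N]
    [IsScalarTower k (Env k A) N] {m : ℕ} (f : Cochain k A N m) {t : TensorAlgebra k A}
    (ht : t ∈ LinearMap.range (TensorAlgebra.ι k (M := A)) ^ (m + 1)) :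
    evT (hochDM f) t = ext (evT f) (barD k A t) := by
  have hspan : LinearMap.range (TensorAlgebra.ι k (M := A)) ^ (m + 1) ≤
      LinearMap.eqLocus (evT (hochDM f)) ((ext (evT f)).restrictScalars k ∘ₗ barD k A) := by
    refine (range_ι_pow_le_span _).trans (Submodule.span_le.2 ?_)
    rintro _ ⟨a, rfl⟩
    change evT _ _ = ext _ _
    rw [evT_tprod, hochDM_apply, ext_barD_tprod]
  exact hspan ht

theorem vSp_le : vSp 𝒜 ≤ LinearMap.range (TensorAlgebra.ι k (M := A)) := by
  rintro _ ⟨a, -, rfl⟩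
  exact ⟨a, rfl⟩

/-- On Koszul tensors the two differentials agree by `barD_of_mem`. Hence `d² = 0` on `K` can be
read off from the bar resolution, and `K → bar` is a comparison map which, unlike a general one, is
compatible with `H`. -/
theorem toBar_isToBar : IsToBar (koszulD 𝒜) (koszulAug 𝒜) (toBar 𝒜) where
  comm m x := by
    have : barDC k A m ∘ₗ toBar 𝒜 (m + 1) = toBar 𝒜 m ∘ₗ koszulD 𝒜 m := by
      refine KC.hom_ext 𝒜 fun w => ?_
      rw [LinearMap.comp_apply, LinearMap.comp_apply, barDC, barHom_toBar_of, toBar,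
        LinearMap.comp_apply, val_koszulD_of]
      exact evT_hochDM _ (pow_le_pow_left' (vSp_le 𝒜) _ (koszulSp_le_pow 𝒜 _ w.2))
    exact LinearMap.congr_fun this x
  aug_eq x := by
    have : barAug k A ∘ₗ toBar 𝒜 0 = koszulAug 𝒜 := by
      refine KC.hom_ext 𝒜 fun w => ?_
      rw [LinearMap.comp_apply, barAug, barHom_toBar_of, koszulAug_of]
      have h : evT (MultilinearMap.constOfIsEmpty k (fun _ : Fin 0 => A) (1 : Reg A)) =
          Algebra.linearMap k (Reg A) ∘ₗ
            (TensorAlgebra.algebraMapInv (R := k) (M := A)).toLinearMap := by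
        refine linearMap_ext_tprod fun n a => ?_
        cases n with
        | zero => rw [evT_tprod, tprod_elim0]; simp
        | succ n =>
          rw [evT_tprod_of_ne n.succ_ne_zero, ← Fin.cons_self_tail a, tprod_cons]
          simp [TensorAlgebra.algebraMapInv]
      exact LinearMap.congr_fun h _
    exact LinearMap.congr_fun this x

theorem toBar_injective (m : ℕ) : Function.Injective (toBar 𝒜 m) := by
  let incl : TensorAlgebra k A →ₗ[k] Env k A ⊗[k] TensorAlgebra k A := TensorProduct.mk k _ _ 1
  let j : BarC k A m →ₗ[Env k A] Env k A ⊗[k] TensorAlgebra k A :=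
    barHom (incl.compMultilinearMap (TensorAlgebra.tprod k A m))
  have : j ∘ₗ toBar 𝒜 m = KC.val 𝒜 := by
    refine KC.hom_ext 𝒜 fun w => ?_
    rw [LinearMap.comp_apply, barHom_toBar_of, KC.val_of]
    have hgen : LinearMap.range (TensorAlgebra.ι k (M := A)) ^ m ≤
        LinearMap.eqLocus (evT (incl.compMultilinearMap (TensorAlgebra.tprod k A m))) incl := by
      refine (range_ι_pow_le_span _).trans (Submodule.span_le.2 ?_)
      rintro _ ⟨a, rfl⟩
      exact evT_tprod _ _
    exact hgen (pow_le_pow_left' (vSp_le 𝒜) _ (koszulSp_le_pow 𝒜 _ w.2))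
  intro x y h
  refine KC.val_injective 𝒜 ?_
  rw [← this, LinearMap.comp_apply, LinearMap.comp_apply, h]

end KoszulBasic

/-! ### Projections to homogeneous components -/

section Projections

variable {k : Type*} [Field k]

/-- `π i` is the projection of a graded space to its component of degree `i`. -/
structure IsProjs {M : Type*} [AddCommGroup M] [Module k M] (gr : ℕ → Submodule k M)
    (π : ℕ → M →ₗ[k] M) : Prop where
  mem : ∀ i x, π i x ∈ gr i
  of_mem : ∀ i j x, x ∈ gr i → π j x = if j = i then x else 0
  sum : ∀ x, ∃ N, ∀ n, N ≤ n → ∑ i ∈ Finset.range n, π i x = x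

variable {M : Type*} [AddCommGroup M] [Module k M] {gr : ℕ → Submodule k M}
  {π : ℕ → M →ₗ[k] M}

theorem exists_isProjs (h : DirectSum.IsInternal gr) : ∃ π, IsProjs gr π := by
  classical
  let := h.chooseDecomposition
  refine ⟨fun i => (gr i).subtype ∘ₗ DirectSum.component k ℕ (fun i => gr i) i ∘ₗ
    (DirectSum.decomposeLinearEquiv gr).toLinearMap, fun i x => Subtype.prop _,
    fun i j x hx => ?_, fun x => ?_⟩
  · change ((DirectSum.decompose gr x) j : M) = _
    split_ifs with h
    · subst h; exact DirectSum.decompose_of_mem_same gr hx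
    · exact DirectSum.decompose_of_mem_ne gr hx (Ne.symm h)
  · refine ⟨(DirectSum.decompose gr x).support.sup id + 1, fun n hn => ?_⟩
    change ∑ i ∈ Finset.range n, ((DirectSum.decompose gr x) i : M) = x
    conv_rhs => rw [← DirectSum.sum_support_decompose gr x]
    symm
    refine Finset.sum_subset (fun i hi => ?_) (fun i _ hi => ?_)
    · have := Finset.le_sup (f := id) hi
      simp only [id, Finset.mem_range] at *
      omega
    · simpa using hi

theorem IsProjs.induction (h : IsProjs gr π) {P : M → Prop} (x : M) (hom : ∀ i, ∀ x ∈ gr i, P x)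
    (add : ∀ x y, P x → P y → P (x + y)) : P x := by
  obtain ⟨N, hN⟩ := h.sum x
  rw [← hN N le_rfl]
  exact Finset.sum_induction _ P add (hom 0 0 (zero_mem _)) fun i _ => hom i _ (h.mem i x)

theorem IsProjs.comp_apply (h : IsProjs gr π) (i j : ℕ) (x : M) :
    π i (π j x) = if i = j then π j x else 0 := h.of_mem _ _ _ (h.mem j x)

theorem IsProjs.rTensor_sum (h : IsProjs gr π) {U : Type*} [AddCommGroup U] [Module k U]
    (z : M ⊗[k] U) :
    ∃ N, ∀ n, N ≤ n → ∑ i ∈ Finset.range n, LinearMap.rTensor U (π i) z = z := by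
  induction z with
  | zero => exact ⟨0, by simp⟩
  | add x y hx hy =>
    obtain ⟨N, hN⟩ := hx
    obtain ⟨N', hN'⟩ := hy
    refine ⟨max N N', fun n hn => ?_⟩
    simp only [map_add, Finset.sum_add_distrib]
    rw [hN n (le_trans (le_max_left _ _) hn), hN' n (le_trans (le_max_right _ _) hn)]
  | tmul a u =>
    obtain ⟨N, hN⟩ := h.sum a
    refine ⟨N, fun n hn => ?_⟩
    simp only [LinearMap.rTensor_tmul]
    rw [← TensorProduct.sum_tmul, hN n hn]

theorem IsProjs.eq_zero_of_rTensor (h : IsProjs gr π) {U : Type*} [AddCommGroup U] [Module k U]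
    (z : M ⊗[k] U) (hz : ∀ i, LinearMap.rTensor U (π i) z = 0) : z = 0 := by
  obtain ⟨N, hN⟩ := h.rTensor_sum z
  rw [← hN N le_rfl]
  exact Finset.sum_eq_zero fun i _ => hz i

theorem IsProjs.rTensor_comp_apply (h : IsProjs gr π) {U : Type*} [AddCommGroup U] [Module k U]
    (i j : ℕ) (z : M ⊗[k] U) : LinearMap.rTensor U (π i) (LinearMap.rTensor U (π j) z) =
      if i = j then LinearMap.rTensor U (π j) z else 0 := by
  rw [← LinearMap.comp_apply, ← LinearMap.rTensor_comp]
  have : π i ∘ₗ π j = if i = j then π j else 0 := by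
    ext x
    rw [LinearMap.comp_apply, h.comp_apply]
    split_ifs <;> rfl
  rw [this]
  split_ifs <;> simp

variable {A : Type*} [Ring A] [Algebra k A] {𝒜 : ℕ → Submodule k A} {p : ℕ → A →ₗ[k] A}
  [Module A M]

theorem IsProjs.smul (hA : IsProjs 𝒜 p) (h : IsProjs gr π)
    (hs : ∀ i j a x, a ∈ 𝒜 i → x ∈ gr j → a • x ∈ gr (i + j)) (j : ℕ) (a : A) (x : M) :
    π j (a • x) = ∑ i ∈ Finset.range (j + 1), p i a • π (j - i) x := by
  induction a using hA.induction with
  | add a b ha hb => simp only [add_smul, map_add, ha, hb, Finset.sum_add_distrib]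
  | hom r a ha =>
    induction x using h.induction with
    | add x y hx hy => simp only [smul_add, map_add, hx, hy, Finset.sum_add_distrib]
    | hom s x hx =>
      rw [h.of_mem _ _ _ (hs r s a x ha hx)]
      simp only [hA.of_mem _ _ _ ha, h.of_mem _ _ _ hx, ite_smul, zero_smul, smul_ite, smul_zero]
      have e : ∀ i, (if j - i = s then if i = r then a • x else 0 else 0) =
          if i = r then (if j - i = s then a • x else 0) else 0 := fun i => by split_ifs <;> rfl
      simp only [e]
      rw [Finset.sum_ite_eq']
      by_cases h1 : r < j + 1
      · simp only [Finset.mem_range, h1, if_true]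
        exact if_congr (by omega) rfl rfl
      · simp only [Finset.mem_range, h1, if_false]
        rw [if_neg (by omega)]

end Projections

section GradedFree

variable {k A : Type*} [Field k] [Ring A] [Algebra k A] {𝒜 : ℕ → Submodule k A}
  {p : ℕ → A →ₗ[k] A} {M : Type*} [AddCommGroup M] [Module k M] [Module A M] [IsScalarTower k A M]
  {gr : ℕ → Submodule k M} {π : ℕ → M →ₗ[k] M}

/-- The map `a ⊗ u ↦ a φ(u)`. -/
def extA {U : Type*} [AddCommGroup U] [Module k U] (φ : U →ₗ[k] M) : A ⊗[k] U →ₗ[A] M :=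
  TensorProduct.AlgebraTensorModule.lift (LinearMap.toSpanSingleton A (U →ₗ[k] M) φ)

@[simp]
theorem extA_tmul {U : Type*} [AddCommGroup U] [Module k U] (φ : U →ₗ[k] M) (a : A) (u : U) :
    extA φ (a ⊗ₜ[k] u) = a • φ u := rfl

theorem IsProjs.extA_apply (hA : IsProjs 𝒜 p) (h : IsProjs gr π)
    (hs : ∀ i j a x, a ∈ 𝒜 i → x ∈ gr j → a • x ∈ gr (i + j)) {U : Type*} [AddCommGroup U]
    [Module k U] {m : ℕ} {φ : U →ₗ[k] M} (hφ : ∀ u, φ u ∈ gr m) (i : ℕ) (z : A ⊗[k] U) :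
    π (m + i) (extA φ z) = extA φ (LinearMap.rTensor U (p i) z) := by
  induction z with
  | zero => simp
  | add x y hx hy => simp only [map_add, hx, hy]
  | tmul a u =>
    rw [extA_tmul, hA.smul h hs, LinearMap.rTensor_tmul, extA_tmul,
      Finset.sum_eq_single_of_mem i (Finset.mem_range.2 (by omega))]
    · rw [h.of_mem _ _ _ (hφ u), if_pos (by omega)]
    · intro j hj hji
      rw [h.of_mem _ _ _ (hφ u), if_neg (by have := Finset.mem_range.1 hj; omega), smul_zero]

theorem IsProjs.extA_of_lt (hA : IsProjs 𝒜 p) (h : IsProjs gr π)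
    (hs : ∀ i j a x, a ∈ 𝒜 i → x ∈ gr j → a • x ∈ gr (i + j)) {U : Type*} [AddCommGroup U]
    [Module k U] {m : ℕ} {φ : U →ₗ[k] M} (hφ : ∀ u, φ u ∈ gr m) {j : ℕ} (hj : j < m)
    (z : A ⊗[k] U) : π j (extA φ z) = 0 := by
  induction z with
  | zero => simp
  | add x y hx hy => simp only [map_add, hx, hy, add_zero]
  | tmul a u =>
    rw [extA_tmul, hA.smul h hs]
    refine Finset.sum_eq_zero fun i _ => ?_
    rw [h.of_mem _ _ _ (hφ u), if_neg (by omega), smul_zero]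

theorem rTensor_proj_zero (hA : IsProjs 𝒜 p) (h0 : 𝒜 0 ≤ Submodule.span k {1}) {U : Type*}
    [AddCommGroup U] [Module k U] (z : A ⊗[k] U) :
    ∃ u : U, LinearMap.rTensor U (p 0) z = 1 ⊗ₜ u := by
  induction z with
  | zero => exact ⟨0, by simp⟩
  | add x y hx hy =>
    obtain ⟨u, hu⟩ := hx
    obtain ⟨v, hv⟩ := hy
    exact ⟨u + v, by rw [map_add, hu, hv, TensorProduct.tmul_add]⟩
  | tmul a u =>
    obtain ⟨c, hc⟩ := Submodule.mem_span_singleton.1 (h0 (hA.mem 0 a))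
    exact ⟨c • u, by rw [LinearMap.rTensor_tmul, ← hc, TensorProduct.smul_tmul]⟩

/-- A graded projective module generated in one degree is free on its generators. -/
theorem extA_bijective (hA : IsProjs 𝒜 p)
    (hm : ∀ i j a b, a ∈ 𝒜 i → b ∈ 𝒜 j → a * b ∈ 𝒜 (i + j))
    (h0 : 𝒜 0 ≤ Submodule.span k {1}) (h : IsProjs gr π)
    (hs : ∀ i j a x, a ∈ 𝒜 i → x ∈ gr j → a • x ∈ gr (i + j)) [Module.Projective A M]
    {U : Type*} [AddCommGroup U] [Module k U] {m : ℕ} {φ : U →ₗ[k] M}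
    (hφ : LinearMap.range φ = gr m) (hi : Function.Injective φ)
    (hg : Submodule.span A (gr m : Set M) = ⊤) : Function.Bijective (extA (A := A) φ) := by
  have hmem : ∀ u, φ u ∈ gr m := fun u => hφ ▸ LinearMap.mem_range_self φ u
  have hsurj : Function.Surjective (extA (A := A) φ) := by
    rw [← LinearMap.range_eq_top, ← top_le_iff, ← hg, Submodule.span_le]
    intro x hx
    rw [SetLike.mem_coe, ← hφ] at hx
    obtain ⟨u, rfl⟩ := hx
    exact ⟨1 ⊗ₜ u, by rw [extA_tmul, one_smul]⟩
  refine ⟨?_, hsurj⟩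
  obtain ⟨σ, hσ⟩ := Module.projective_lifting_property (extA (A := A) φ) LinearMap.id hsurj
  rw [injective_iff_map_eq_zero]
  intro z hz
  -- The map `n` is an `A`-linear projection onto the kernel of `extA φ`. The section `σ` need not
  -- be graded, but values of `n` have no component of degree zero, since there `extA φ` is the
  -- injective map `φ`. By linearity each component of `n y` depends only on lower components of
  -- `y`, so an element fixed by `n` vanishes degree by degree.
  let n : A ⊗[k] U →ₗ[A] A ⊗[k] U := LinearMap.id - σ ∘ₗ extA φ
  have hn : ∀ y, extA φ (n y) = 0 := by
    intro y
    have := LinearMap.congr_fun hσ (extA φ y)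
    simp only [LinearMap.comp_apply, LinearMap.id_apply] at this
    simp [n, this]
  have hnz : n z = z := by simp [n, hz]
  have hn0 : ∀ y, LinearMap.rTensor U (p 0) (n y) = 0 := by
    intro y
    have h1 := hA.extA_apply h hs hmem 0 (n y)
    obtain ⟨u, hu⟩ := rTensor_proj_zero hA h0 (n y)
    rw [hn, map_zero, hu, extA_tmul, one_smul] at h1
    rw [hu, hi (h1.symm.trans (map_zero φ).symm), TensorProduct.tmul_zero]
  have hsm : ∀ (j : ℕ) (a : A) (y : A ⊗[k] U), LinearMap.rTensor U (p j) (a • y) =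
      ∑ i ∈ Finset.range (j + 1), p i a • LinearMap.rTensor U (p (j - i)) y := by
    intro j a y
    induction y with
    | zero => simp
    | add x y hx hy => simp only [smul_add, map_add, hx, hy, Finset.sum_add_distrib]
    | tmul b u =>
      simp only [TensorProduct.smul_tmul', LinearMap.rTensor_tmul]
      rw [← TensorProduct.sum_tmul, hA.smul hA hm]
  have key : ∀ (j : ℕ) (y : A ⊗[k] U), LinearMap.rTensor U (p j) (n y) =
      ∑ i ∈ Finset.range j, extA ((LinearMap.rTensor U (p (j - i))) ∘ₗ
        n.restrictScalars k ∘ₗ TensorProduct.mk k A U 1) (LinearMap.rTensor U (p i) y) := by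
    intro j y
    induction y with
    | zero => simp
    | add x y hx hy => simp only [map_add, hx, hy, Finset.sum_add_distrib]
    | tmul a u =>
      have : n (a ⊗ₜ u) = a • n (1 ⊗ₜ u) := by
        rw [← map_smul, TensorProduct.smul_tmul', smul_eq_mul, mul_one]
      rw [this, hsm, Finset.sum_range_succ, Nat.sub_self, hn0, smul_zero, add_zero]
      rfl
  refine hA.eq_zero_of_rTensor z fun j => ?_
  induction j using Nat.strong_induction_on with
  | _ j ih =>
    rw [← hnz, key]
    refine Finset.sum_eq_zero fun i hi => ?_
    rw [ih i (Finset.mem_range.1 hi), map_zero]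

end GradedFree

/-! ### The left Koszul complex -/

section LeftKoszul

variable {k A : Type*} [Field k] [Ring A] [Algebra k A] (𝒜 : ℕ → Submodule k A)

/-- The inclusion of `A ⊗ (A^!_m)^*` into `A ⊗ T(A)`. -/
def lkIncl (m : ℕ) : A ⊗[k] koszulSp 𝒜 m →ₗ[A] A ⊗[k] TensorAlgebra k A :=
  extA (TensorProduct.mk k A (TensorAlgebra k A) 1 ∘ₗ (koszulSp 𝒜 m).subtype)

@[simp]
theorem lkIncl_tmul (m : ℕ) (a : A) (w : koszulSp 𝒜 m) :
    lkIncl 𝒜 m (a ⊗ₜ w) = a ⊗ₜ (w : TensorAlgebra k A) := by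
  rw [lkIncl, extA_tmul, LinearMap.comp_apply, TensorProduct.mk_apply, TensorProduct.smul_tmul',
    smul_eq_mul, mul_one, Submodule.subtype_apply]

theorem lkIncl_eq (m : ℕ) (z : A ⊗[k] koszulSp 𝒜 m) :
    lkIncl 𝒜 m z = LinearMap.lTensor A (koszulSp 𝒜 m).subtype z := by
  induction z with
  | zero => simp
  | add x y hx hy => rw [map_add, map_add, hx, hy]
  | tmul a w => rw [lkIncl_tmul, LinearMap.lTensor_tmul, Submodule.subtype_apply]

theorem lTensor_subtype_injective {T : Type*} [AddCommMonoid T] [Module k T] (W : Submodule k T) :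
    Function.Injective (LinearMap.lTensor A W.subtype) :=
  Module.Flat.lTensor_preserves_injective_linearMap _ W.injective_subtype

theorem lkIncl_injective (m : ℕ) : Function.Injective (lkIncl 𝒜 m) := by
  intro x y h
  rw [lkIncl_eq, lkIncl_eq] at h
  exact lTensor_subtype_injective _ h

/-- Stated for additive monoids so that no particular subtraction on the modules is part of the
statement; over a field, negation is multiplication by a scalar. -/
theorem rTensor_exact_of_field (Z : Type*) {X Y M : Type*} [AddCommMonoid Z] [Module k Z]
    [AddCommMonoid X] [Module k X] [AddCommMonoid Y] [Module k Y] [AddCommMonoid M] [Module k M]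
    {f : X →ₗ[k] Y} {g : Y →ₗ[k] M} (h : Function.Exact f g) :
    Function.Exact (LinearMap.rTensor Z f) (LinearMap.rTensor Z g) := by
  let _ : AddCommGroup Z := Module.addCommMonoidToAddCommGroup k
  let _ : AddCommGroup X := Module.addCommMonoidToAddCommGroup k
  let _ : AddCommGroup Y := Module.addCommMonoidToAddCommGroup k
  let _ : AddCommGroup M := Module.addCommMonoidToAddCommGroup k
  exact Module.Flat.rTensor_exact Z h

/-- A linear map to `A ⊗ T` with values in `A ⊗ W`, as a map to `A ⊗ W`. -/
def factorThrough {T X : Type*} [AddCommMonoid T] [Module k T] [AddCommMonoid X] [Module k X]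
    (W : Submodule k T) (f : X →ₗ[k] A ⊗[k] T)
    (h : ∀ x, f x ∈ LinearMap.range (LinearMap.lTensor A W.subtype)) : X →ₗ[k] A ⊗[k] W :=
  (LinearEquiv.ofInjective (LinearMap.lTensor A W.subtype)
    (lTensor_subtype_injective _)).symm.toLinearMap ∘ₗ f.codRestrict _ h

theorem lTensor_factorThrough {T X : Type*} [AddCommMonoid T] [Module k T] [AddCommMonoid X]
    [Module k X] (W : Submodule k T) (f : X →ₗ[k] A ⊗[k] T)
    (h : ∀ x, f x ∈ LinearMap.range (LinearMap.lTensor A W.subtype)) (x : X) :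
    LinearMap.lTensor A W.subtype (factorThrough W f h x) = f x :=
  congrArg Subtype.val ((LinearEquiv.ofInjective (LinearMap.lTensor A W.subtype)
    (lTensor_subtype_injective _)).apply_symm_apply ⟨f x, h x⟩)

/-- The differential of the left Koszul complex on generators. -/
def lkD₀ (m : ℕ) : koszulSp 𝒜 (m + 1) →ₗ[k] A ⊗[k] koszulSp 𝒜 m :=
  factorThrough _ (splitL k A ∘ₗ (koszulSp 𝒜 (m + 1)).subtype) fun w => by
    rw [LinearMap.comp_apply, Submodule.subtype_apply]
    exact splitL_mem 𝒜 w.2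

theorem lkIncl_lkD₀ (m : ℕ) (w : koszulSp 𝒜 (m + 1)) :
    lkIncl 𝒜 m (lkD₀ 𝒜 m w) = splitL k A w := by
  rw [lkIncl_eq, lkD₀, lTensor_factorThrough, LinearMap.comp_apply, Submodule.subtype_apply]

/-- The differential of the left Koszul complex `A ⊗ (A^!_m)^*`. -/
def lkD (m : ℕ) : A ⊗[k] koszulSp 𝒜 (m + 1) →ₗ[A] A ⊗[k] koszulSp 𝒜 m := extA (lkD₀ 𝒜 m)

theorem lkD_tmul (m : ℕ) (a : A) (w : koszulSp 𝒜 (m + 1)) :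
    lkD 𝒜 m (a ⊗ₜ w) = a • lkD₀ 𝒜 m w := by
  rw [lkD, extA_tmul]

theorem lkIncl_lkD (m : ℕ) (z : A ⊗[k] koszulSp 𝒜 (m + 1)) :
    lkIncl 𝒜 m (lkD 𝒜 m z) = leftD k A (lkIncl 𝒜 (m + 1) z) := by
  induction z with
  | zero => simp only [map_zero]
  | add x y hx hy => simp only [map_add, hx, hy]
  | tmul a w => rw [lkD_tmul, map_smul, lkIncl_lkD₀, lkIncl_tmul, leftD_tmul]

theorem koszulSp_succ_le (m : ℕ) : koszulSp 𝒜 (m + 1) ≤ vSp 𝒜 * vSp 𝒜 ^ m := by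
  rw [← pow_succ']
  exact koszulSp_le_pow 𝒜 _

theorem lkD₀_injective (m : ℕ) : Function.Injective (lkD₀ 𝒜 m) := by
  intro v w h
  have := congrArg (fun z => mulι k A (lkIncl 𝒜 m z)) h
  simp only [lkIncl_lkD₀] at this
  rw [mulι_splitL_of_mem 𝒜 (koszulSp_succ_le 𝒜 m v.2),
    mulι_splitL_of_mem 𝒜 (koszulSp_succ_le 𝒜 m w.2)] at this
  exact Subtype.ext this

theorem lkD_lkD₀ (m : ℕ) (w : koszulSp 𝒜 (m + 2)) : lkD 𝒜 m (lkD₀ 𝒜 (m + 1) w) = 0 := by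
  refine lkIncl_injective 𝒜 m ?_
  rw [lkIncl_lkD, lkIncl_lkD₀, leftD_splitL_of_mem 𝒜 w.2, map_zero]

variable {𝒜} {p : ℕ → A →ₗ[k] A}

theorem rTensor_lkIncl (f : A →ₗ[k] A) (m : ℕ) (z : A ⊗[k] koszulSp 𝒜 m) :
    LinearMap.rTensor _ f (lkIncl 𝒜 m z) = lkIncl 𝒜 m (LinearMap.rTensor _ f z) := by
  induction z with
  | zero => simp
  | add x y hx hy => simp only [map_add, hx, hy]
  | tmul a w => simp

/-- The letter that is split off lies in `V = A₁`, so on generators the differential has values of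
degree exactly one in the left factor. -/
theorem rTensor_lkD₀ (hA : IsProjs 𝒜 p) (m : ℕ) (w : koszulSp 𝒜 (m + 1)) :
    LinearMap.rTensor _ (p 1) (lkD₀ 𝒜 m w) = lkD₀ 𝒜 m w := by
  refine lkIncl_injective 𝒜 m ?_
  rw [← rTensor_lkIncl, lkIncl_lkD₀]
  have h := koszulSp_succ_le 𝒜 m w.2
  obtain ⟨w, hw⟩ := w
  change w ∈ _ at h
  change LinearMap.rTensor _ (p 1) (splitL k A w) = splitL k A w
  clear hw
  induction h using Submodule.mul_induction_on' with
  | mem_mul_mem x hx y hy =>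
    obtain ⟨a, ha, rfl⟩ := hx
    rw [splitL_ι_mul, LinearMap.rTensor_tmul, hA.of_mem 1 1 a ha, if_pos rfl]
  | add x _ y _ hx hy => rw [map_add, map_add, hx, hy]

theorem mulι_rTensor_mem (hA : IsProjs 𝒜 p) (m : ℕ) {Z : Submodule k (TensorAlgebra k A)}
    (hZ : koszulSp 𝒜 m ≤ Z) (z : A ⊗[k] koszulSp 𝒜 m) :
    mulι k A (lkIncl 𝒜 m (LinearMap.rTensor _ (p 1) z)) ∈ vSp 𝒜 * Z := by
  induction z with
  | zero => simp
  | add x y hx hy => simp only [map_add]; exact add_mem hx hy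
  | tmul a w => 
    rw [LinearMap.rTensor_tmul, lkIncl_tmul, mulι_tmul]
    exact Submodule.mul_mem_mul ⟨_, hA.mem 1 a, rfl⟩ (hZ w.2)

/-- An element of `V ⊗ V ⊗ Z` on which the first two letters multiply to zero lies in `R ⊗ Z`. -/
theorem mem_relSp_mul {Z : Submodule k (TensorAlgebra k A)} {x : TensorAlgebra k A}
    (hx : x ∈ vSp 𝒜 ^ 2 * Z) (h : leftD k A (splitL k A x) = 0) : x ∈ relSp 𝒜 * Z := by
  rw [← Submodule.mulMap_range] at hx
  obtain ⟨ξ, rfl⟩ := hx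
  -- The relations are the kernel of `q`. Multiplying the first two letters of an element of `V² ⊗
  -- Z` is `q ⊗ Z` followed by the injection `A ⊗ Z → A ⊗ T(A)`, and over a field the kernel of `q ⊗
  -- Z` comes from `R ⊗ Z`.
  let q : ↥(vSp 𝒜 ^ 2) →ₗ[k] A := (prodT k A).toLinearMap ∘ₗ (vSp 𝒜 ^ 2).subtype
  have h1 : ∀ ξ, leftD k A (splitL k A (Submodule.mulMap (vSp 𝒜 ^ 2) Z ξ)) =
      LinearMap.lTensor A Z.subtype (LinearMap.rTensor Z q ξ) := by
    intro ξ
    induction ξ with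
    | zero => simp
    | add x y hx hy => simp only [map_add, hx, hy]
    | tmul x z =>
      rw [Submodule.mulMap_tmul, leftD_splitL_mul 𝒜 x.2]
      rfl
  rw [h1] at h
  have h2 : LinearMap.rTensor Z q ξ = 0 :=
    lTensor_subtype_injective Z (h.trans (map_zero _).symm)
  have hex : Function.Exact (LinearMap.ker q).subtype q := fun x =>
    ⟨fun hx => ⟨⟨x, hx⟩, rfl⟩, fun ⟨y, hy⟩ => hy ▸ y.2⟩
  obtain ⟨η, rfl⟩ := (rTensor_exact_of_field Z hex ξ).1 h2
  clear h h1 h2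
  induction η with
  | zero => simp
  | add x y hx hy => simp only [map_add]; exact add_mem hx hy
  | tmul x z =>
    rw [LinearMap.rTensor_tmul, Submodule.mulMap_tmul]
    exact Submodule.mul_mem_mul ⟨x.1.2, x.2⟩ z.2

variable (𝒜 p) in
/-- The kernel of the differential of the augmented left Koszul complex. -/
def lkKer : ∀ m, Submodule k (A ⊗[k] koszulSp 𝒜 m)
  -- The projection to degree zero of the left factor takes the place of the augmentation, in view
  -- of `A₀ = k`.
  | 0 => LinearMap.ker (LinearMap.rTensor _ (p 0))
  | m + 1 => (LinearMap.ker (lkD 𝒜 m)).restrictScalars k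

theorem lkD₀_mem_lkKer (hA : IsProjs 𝒜 p) (m : ℕ) (w : koszulSp 𝒜 (m + 1)) :
    lkD₀ 𝒜 m w ∈ lkKer 𝒜 p m := by
  cases m with
  | zero =>
    change LinearMap.rTensor _ (p 0) _ = 0
    rw [← rTensor_lkD₀ hA, hA.rTensor_comp_apply, if_neg (by omega)]
  | succ m => exact lkD_lkD₀ 𝒜 m w

/-- An element of `V ⊗ (A^!_m)^*` satisfies every condition on a Koszul tensor of length `m + 1`
except the one that the first two letters form a relation, and being a cycle says just this. For `m
= 0` that condition is absent. It is here that the description of `(A^!_m)^*` as an intersection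
enters. -/
theorem exists_lkD₀_eq (hA : IsProjs 𝒜 p) (m : ℕ) (y : A ⊗[k] koszulSp 𝒜 m)
    (hy : LinearMap.rTensor _ (p 1) y = y) (hk : y ∈ lkKer 𝒜 p m) : ∃ w, lkD₀ 𝒜 m w = y := by
  have hmem : ∀ {Z : Submodule k (TensorAlgebra k A)}, koszulSp 𝒜 m ≤ Z →
      mulι k A (lkIncl 𝒜 m y) ∈ vSp 𝒜 * Z := fun hZ => by
    rw [← hy]; exact mulι_rTensor_mem hA m hZ y
  have hw : mulι k A (lkIncl 𝒜 m y) ∈ koszulSp 𝒜 (m + 1) := by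
    refine mem_koszulSp 𝒜 ?_ fun u v huv => ?_
    · rw [pow_succ']; exact hmem (koszulSp_le_pow 𝒜 m)
    -- For `u > 0` the condition concerns only the factor `(A^!_m)^*`; for `u = 0` it is the cycle
    -- condition.
    · cases u with
      | succ u =>
        have := hmem (koszulSp_le 𝒜 m u v (by omega))
        rwa [← mul_assoc, ← mul_assoc, ← pow_succ'] at this
      | zero =>
        obtain rfl : m = v + 1 := by omega
        rw [pow_zero, one_mul]
        refine mem_relSp_mul ?_ ?_
        · have := hmem (koszulSp_succ_le 𝒜 v)
          rwa [← mul_assoc, ← pow_two] at this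
        · rw [splitL_mulι, ← lkIncl_lkD, show lkD 𝒜 v y = 0 from hk, map_zero]
  refine ⟨⟨_, hw⟩, lkIncl_injective 𝒜 m ?_⟩
  rw [lkIncl_lkD₀, splitL_mulι]

theorem tprod_lift_mem (hm : ∀ i j a b, a ∈ 𝒜 i → b ∈ 𝒜 j → a * b ∈ 𝒜 (i + j)) (h1 : 1 ∈ 𝒜 0)
    (n : ℕ) (v : Fin n → 𝒜 1) :
    TensorAlgebra.lift k (𝒜 1).subtype (TensorAlgebra.tprod k (𝒜 1) n v) ∈ 𝒜 n := by
  induction n with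
  | zero => simpa [tprod_elim0] using h1
  | succ n ih =>
    have e : TensorAlgebra.tprod k (𝒜 1) (n + 1) v =
        TensorAlgebra.ι k (v 0) * TensorAlgebra.tprod k (𝒜 1) n (Fin.tail v) := by
      simp [TensorAlgebra.tprod_apply, List.ofFn_succ, Fin.tail]
    rw [e, map_mul, TensorAlgebra.lift_ι_apply]
    have := hm 1 n _ _ (v 0).2 (ih (Fin.tail v))
    rwa [add_comm 1 n] at this

end LeftKoszul

/-! ### Identification of a linear resolution with the left Koszul complex. -/

section LeftKoszulExact

variable {k A : Type*} [Field k] [Ring A] [Algebra k A] {𝒜 : ℕ → Submodule k A}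
  {p : ℕ → A →ₗ[k] A}

namespace LinearResolution

variable (L : LinearResolution 𝒜)

attribute [instance] addCommGroup moduleK module tower

/-- The kernel of the differential of the augmented resolution. -/
def kerD : ∀ m, Submodule k (L.P m)
  | 0 => LinearMap.ker L.aug
  | m + 1 => (LinearMap.ker (L.d m)).restrictScalars k

theorem mem_kerD (m : ℕ) (x : L.P m) : x ∈ L.kerD m ↔ ∃ y, L.d m y = x := by
  cases m with
  | zero => exact L.exact_zero x
  | succ m => exact L.exact_succ m x

theorem proj_d {q : ∀ m, ℕ → L.P m →ₗ[k] L.P m} (hq : ∀ m, IsProjs (L.gr m) (q m)) (m j : ℕ)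
    (x : L.P (m + 1)) : q m j (L.d m x) = L.d m (q (m + 1) j x) := by
  induction x using (hq (m + 1)).induction with
  | add x y hx hy => simp only [map_add, hx, hy]
  | hom i x hx =>
    rw [(hq m).of_mem i j _ (L.d_mem m i x hx), (hq (m + 1)).of_mem i j x hx]
    split_ifs <;> simp

/-- Everything in `P m` is a combination of elements of degree `m` with coefficients of nonnegative
degree. Applied to `P (m + 1)` in degree `m`, this leaves no boundaries in the lowest degree of `P
m`, so the differential is injective on the generators. -/
theorem gr_eq_bot (hA : IsProjs 𝒜 p) {q : ∀ m, ℕ → L.P m →ₗ[k] L.P m}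
    (hq : ∀ m, IsProjs (L.gr m) (q m)) {m j : ℕ} (hj : j < m) (x : L.P m) (hx : x ∈ L.gr m j) :
    x = 0 := by
  have hs : Function.Surjective (extA (A := A) (L.gr m m).subtype) := by
    rw [← LinearMap.range_eq_top, ← top_le_iff, ← L.generated m, Submodule.span_le]
    exact fun x hx => ⟨1 ⊗ₜ ⟨x, hx⟩, by rw [extA_tmul, one_smul, Submodule.subtype_apply]⟩
  obtain ⟨z, rfl⟩ := hs x
  have := hA.extA_of_lt (hq m) (L.smul_mem m) (φ := (L.gr m m).subtype) (fun u => u.2) hj z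
  rwa [(hq m).of_mem j j _ hx, if_pos rfl] at this

/-- The map `φ` identifies `(A^!_m)^*` with the space of generators of the `m`-th term of the
linear resolution, compatibly with the kernels of the differentials. -/
structure IsGen (p : ℕ → A →ₗ[k] A) (m : ℕ) (φ : koszulSp 𝒜 m →ₗ[k] L.P m) : Prop where
  injective : Function.Injective φ
  range : LinearMap.range φ = L.gr m m
  ker : ∀ y, extA (A := A) φ y ∈ L.kerD m ↔ y ∈ lkKer 𝒜 p m

variable {L}

theorem IsGen.mem {m : ℕ} {φ : koszulSp 𝒜 m →ₗ[k] L.P m} (h : L.IsGen p m φ) (w) :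
    φ w ∈ L.gr m m := h.range ▸ LinearMap.mem_range_self φ w

/-- The augmentation restricts to an isomorphism from the degree zero part of `P 0` to `k`: it is
onto because it ignores positive degrees, and injective because `P 1` has nothing in degree zero.
The map `φ` sends `1` to the degree zero component of a preimage of `1`. -/
theorem exists_isGen_zero (hA : IsProjs 𝒜 p) (h0 : 𝒜 0 ≤ Submodule.span k {1})
    {q : ∀ m, ℕ → L.P m →ₗ[k] L.P m} (hq : ∀ m, IsProjs (L.gr m) (q m)) :
    ∃ φ, L.IsGen p 0 φ := by
  have haug : ∀ x, L.aug (q 0 0 x) = L.aug x := by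
    intro x
    induction x using (hq 0).induction with
    | add x y hx hy => simp only [map_add, hx, hy]
    | hom i x hx =>
      rw [(hq 0).of_mem _ _ _ hx]
      split_ifs with h
      · rfl
      · rw [map_zero, L.aug_gr i x (by omega) hx]
  have hinj : ∀ x ∈ L.gr 0 0, L.aug x = 0 → x = 0 := by
    intro x hx h
    obtain ⟨y, rfl⟩ := (L.exact_zero x).1 h
    have := L.proj_d hq 0 0 y
    rwa [(hq 0).of_mem 0 0 _ hx, if_pos rfl,
      L.gr_eq_bot hA hq (m := 1) (j := 0) (by omega) _ ((hq 1).mem 0 y), map_zero] at this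
  obtain ⟨x₀, hx₀⟩ := L.surjective 1
  have hx₁ : L.aug (q 0 0 x₀) = 1 := (haug x₀).trans hx₀
  have hW : ∀ w : koszulSp 𝒜 0, (w : TensorAlgebra k A) =
      algebraMap k _ (TensorAlgebra.algebraMapInv (R := k) (w : TensorAlgebra k A)) := by
    intro w
    have := koszulSp_le_pow 𝒜 0 w.2
    rw [pow_zero, Submodule.mem_one] at this
    obtain ⟨c, hc⟩ := this
    rw [← hc, TensorAlgebra.algebraMap_leftInverse]
  let φ : koszulSp 𝒜 0 →ₗ[k] L.P 0 := LinearMap.toSpanSingleton k _ (q 0 0 x₀) ∘ₗ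
    TensorAlgebra.algebraMapInv.toLinearMap ∘ₗ (koszulSp 𝒜 0).subtype
  have hφ : ∀ w : koszulSp 𝒜 0,
      φ w = TensorAlgebra.algebraMapInv (R := k) (w : TensorAlgebra k A) • q 0 0 x₀ := fun _ => rfl
  have hφa : ∀ w : koszulSp 𝒜 0,
      L.aug (φ w) = TensorAlgebra.algebraMapInv (R := k) (w : TensorAlgebra k A) := fun w => by
    rw [hφ, map_smul, hx₁, smul_eq_mul, mul_one]
  have hφi : ∀ w, L.aug (φ w) = 0 → w = 0 := fun w hw => by
    rw [hφa] at hw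
    have := hW w
    rw [hw, map_zero] at this
    exact Subtype.ext this
  have hmem : ∀ w, φ w ∈ L.gr 0 0 := fun w => Submodule.smul_mem _ _ ((hq 0).mem 0 x₀)
  have hAug : ∀ y, L.aug (extA φ y) = L.aug (extA φ (LinearMap.rTensor _ (p 0) y)) := fun y => by
    rw [← haug]
    exact congrArg L.aug (hA.extA_apply (hq 0) (L.smul_mem 0) hmem 0 y)
  refine ⟨φ, ?_, le_antisymm ?_ ?_, fun y => ?_⟩
  · rw [injective_iff_map_eq_zero]
    exact fun w hw => hφi w (by rw [hw, map_zero])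
  · rintro _ ⟨w, rfl⟩
    exact hmem w
  · intro x hx
    have h1 : algebraMap k (TensorAlgebra k A) (L.aug x) ∈ koszulSp 𝒜 0 := by
      refine mem_koszulSp 𝒜 ?_ fun u v h => absurd h (by omega)
      rw [pow_zero]
      exact Submodule.mem_one.2 ⟨_, rfl⟩
    refine ⟨⟨_, h1⟩, sub_eq_zero.1 (hinj _ (sub_mem (hmem _) hx) ?_)⟩
    rw [map_sub, hφa, TensorAlgebra.algebraMap_leftInverse, sub_self]
  · change L.aug _ = 0 ↔ LinearMap.rTensor _ (p 0) y = 0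
    rw [hAug]
    obtain ⟨w, hw⟩ := rTensor_proj_zero hA h0 y
    rw [hw, extA_tmul, one_smul]
    refine ⟨fun h => by rw [hφi w h, TensorProduct.tmul_zero], fun h => ?_⟩
    rw [← one_smul A (φ w), ← extA_tmul, h, map_zero, map_zero]

variable [GradedAlgebra 𝒜]

theorem mul_mem' (i j : ℕ) (a b : A) (ha : a ∈ 𝒜 i) (hb : b ∈ 𝒜 j) : a * b ∈ 𝒜 (i + j) :=
  SetLike.mul_mem_graded ha hb

/-- The algebra is generated by `A₁`, and a word of positive length has positive degree, so only
constants remain in degree zero. -/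
theorem _root_.KoszulSmash.grade_zero_le_span_one (hA : IsProjs 𝒜 p) (hq : IsQuadratic 𝒜) :
    𝒜 0 ≤ Submodule.span k {1} := by
  have key : ∀ t : TensorAlgebra k (𝒜 1),
      p 0 (TensorAlgebra.lift k (𝒜 1).subtype t) ∈ Submodule.span k {(1 : A)} := by
    intro t
    induction t using tensor_induction with
    | tprod n v =>
      rw [hA.of_mem _ _ _ (tprod_lift_mem (fun i j a b ha hb => SetLike.mul_mem_graded ha hb)
        SetLike.GradedOne.one_mem n v)]
      split_ifs with h
      · subst h
        rw [tprod_elim0, map_one]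
        exact Submodule.mem_span_singleton_self 1
      · exact zero_mem _
    | add x y hx hy => rw [map_add, map_add]; exact add_mem hx hy
    | smul c x hx => rw [map_smul, map_smul]; exact Submodule.smul_mem _ _ hx
  intro a ha
  obtain ⟨t, rfl⟩ := hq.generated a
  have := key t
  rwa [hA.of_mem 0 0 _ ha, if_pos rfl] at this

theorem IsGen.bijective (hA : IsProjs 𝒜 p) (h0 : 𝒜 0 ≤ Submodule.span k {1})
    {q : ∀ m, ℕ → L.P m →ₗ[k] L.P m} (hq : ∀ m, IsProjs (L.gr m) (q m))
    {m : ℕ} {φ : koszulSp 𝒜 m →ₗ[k] L.P m} (h : L.IsGen p m φ) :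
    Function.Bijective (extA (A := A) φ) :=
  have := L.projective m
  extA_bijective hA mul_mem' h0 (hq m) (L.smul_mem m) h.range h.injective (L.generated m)

/-- The differential maps the generators of `P (m + 1)` bijectively onto the cycles of degree `m +
1` in `P m`. Under `P m ≅ A ⊗ (A^!_m)^*` these are the cycles of degree one in the left factor, that
is, the image of `(A^!_{m+1})^*` by `exists_lkD₀_eq`. -/
theorem exists_isGen_succ (hA : IsProjs 𝒜 p) (h0 : 𝒜 0 ≤ Submodule.span k {1})
    {q : ∀ m, ℕ → L.P m →ₗ[k] L.P m} (hq : ∀ m, IsProjs (L.gr m) (q m)) (m : ℕ)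
    (φ : koszulSp 𝒜 m →ₗ[k] L.P m) (h : L.IsGen p m φ) :
    ∃ φ' : koszulSp 𝒜 (m + 1) →ₗ[k] L.P (m + 1), L.IsGen p (m + 1) φ' ∧
      ∀ z, L.d m (extA φ' z) = extA φ (lkD 𝒜 m z) := by
  have hΦ := h.bijective hA h0 hq
  have hinj : ∀ x ∈ L.gr (m + 1) (m + 1), L.d m x = 0 → x = 0 := by
    intro x hx hd
    obtain ⟨y, rfl⟩ := (L.exact_succ m x).1 hd
    have := L.proj_d hq (m + 1) (m + 1) y
    rwa [(hq (m + 1)).of_mem _ _ _ hx, if_pos rfl,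
      L.gr_eq_bot hA hq (m := m + 2) (j := m + 1) (by omega) _ ((hq (m + 2)).mem _ y),
      map_zero] at this
  have hex : ∀ w, ∃ x ∈ L.gr (m + 1) (m + 1), L.d m x = extA φ (lkD₀ 𝒜 m w) := by
    intro w
    obtain ⟨x, hx⟩ := (L.mem_kerD m _).1 ((h.ker _).2 (lkD₀_mem_lkKer hA m w))
    refine ⟨q (m + 1) (m + 1) x, (hq _).mem _ _, ?_⟩
    rw [← L.proj_d hq, hx, hA.extA_apply (hq m) (L.smul_mem m) h.mem 1, rTensor_lkD₀ hA]
  choose f hf hfd using hex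
  -- The chosen preimages depend linearly on `w` because they are unique in the lowest degree.
  let φ' : koszulSp 𝒜 (m + 1) →ₗ[k] L.P (m + 1) :=
    { toFun := f
      map_add' := fun v w => sub_eq_zero.1 (hinj _
        (sub_mem (hf _) (add_mem (hf _) (hf _))) (by
          rw [map_sub, map_add, hfd, hfd, hfd, map_add, map_add, sub_self]))
      map_smul' := fun c w => sub_eq_zero.1 (hinj _
        (sub_mem (hf _) (Submodule.smul_mem _ _ (hf _))) (by
          rw [RingHom.id_apply, map_sub, LinearMap.map_smul_of_tower, hfd, hfd, map_smul,
            LinearMap.map_smul_of_tower, sub_self])) }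
  have hd : ∀ z, L.d m (extA φ' z) = extA φ (lkD 𝒜 m z) := by
    intro z
    induction z with
    | zero => simp only [map_zero]
    | add x y hx hy => simp only [map_add, hx, hy]
    | tmul a w =>
      rw [extA_tmul, map_smul, lkD_tmul, map_smul]
      exact congrArg (a • ·) (hfd w)
  refine ⟨φ', ⟨?_, le_antisymm ?_ ?_, fun y => ?_⟩, hd⟩
  · rw [injective_iff_map_eq_zero]
    intro w hw
    have h1 : L.d m (f w) = 0 := by
      have : f w = 0 := hw
      rw [this, map_zero]
    rw [hfd] at h1
    exact lkD₀_injective 𝒜 m (hΦ.1 (h1.trans (map_zero _).symm) |>.trans (map_zero _).symm)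
  · rintro _ ⟨w, rfl⟩
    exact hf w
  · intro x hx
    obtain ⟨y, hy⟩ := hΦ.2 (L.d m x)
    have hy1 : LinearMap.rTensor _ (p 1) y = y := by
      apply hΦ.1
      rw [← hA.extA_apply (hq m) (L.smul_mem m) h.mem 1, hy,
        (hq m).of_mem _ _ _ (L.d_mem m _ x hx), if_pos rfl]
    obtain ⟨w, hw⟩ := exists_lkD₀_eq hA m y hy1
      ((h.ker y).1 (hy ▸ (L.mem_kerD m _).2 ⟨x, rfl⟩))
    refine ⟨w, sub_eq_zero.1 (hinj _ (sub_mem (hf w) hx) ?_)⟩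
    rw [map_sub, ← hy, ← hw]
    exact sub_eq_zero.2 (hfd w)
  · change L.d m _ = 0 ↔ lkD 𝒜 m y = 0
    rw [hd]
    exact map_eq_zero_iff _ hΦ.1

end LinearResolution

variable [GradedAlgebra 𝒜]

/-- The left Koszul complex of a Koszul algebra is exact. -/
theorem leftKoszul_exact (hA : IsProjs 𝒜 p) (hK : IsKoszul 𝒜) :
    (∀ z : A ⊗[k] koszulSp 𝒜 0, LinearMap.rTensor _ (p 0) z = 0 → ∃ y, lkD 𝒜 0 y = z) ∧
    ∀ m (z : A ⊗[k] koszulSp 𝒜 (m + 1)), lkD 𝒜 m z = 0 → ∃ y, lkD 𝒜 (m + 1) y = z := by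
  obtain ⟨L⟩ := hK.resolution
  have h0 := grade_zero_le_span_one hA hK.quadratic
  choose q hq using fun m => exists_isProjs (L.internal m)
  have step := LinearResolution.exists_isGen_succ hA h0 hq
  choose nxt hnxt hd using step
  obtain ⟨φ₀, hφ₀⟩ := LinearResolution.exists_isGen_zero hA h0 hq
  let s : ∀ m, {φ // L.IsGen p m φ} := fun m =>
    Nat.rec ⟨φ₀, hφ₀⟩ (fun m φ => ⟨nxt m φ.1 φ.2, hnxt m φ.1 φ.2⟩) m
  have hs : ∀ m z, L.d m (extA (s (m + 1)).1 z) = extA (s m).1 (lkD 𝒜 m z) :=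
    fun m z => hd m (s m).1 (s m).2 z
  have hb := fun m => (s m).2.bijective hA h0 hq
  have key : ∀ m z, z ∈ lkKer 𝒜 p m → ∃ y, lkD 𝒜 m y = z := by
    intro m z hz
    obtain ⟨x, hx⟩ := (L.mem_kerD m _).1 (((s m).2.ker z).2 hz)
    obtain ⟨y, rfl⟩ := (hb (m + 1)).2 x
    rw [hs] at hx
    exact ⟨y, (hb m).1 hx⟩
  exact ⟨fun z hz => key 0 z hz, fun m z hz => key (m + 1) z hz⟩

end LeftKoszulExact

/-! ### Exactness of the Koszul bimodule complex -/

section Filtered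

variable {k : Type*} [Field k] {M : Type*} [AddCommGroup M] [Module k M] {gr : ℕ → Submodule k M}
  {π : ℕ → M →ₗ[k] M}

/-- Gradings are recorded by their projections because those pass to tensor products directly. -/
theorem IsProjs.rTensor (h : IsProjs gr π) (U : Type*) [AddCommGroup U] [Module k U] :
    IsProjs (fun i => LinearMap.range (LinearMap.rTensor U (π i)))
      fun i => LinearMap.rTensor U (π i) where
  mem i x := ⟨x, rfl⟩
  of_mem := by
    rintro i j _ ⟨x, rfl⟩
    exact h.rTensor_comp_apply j i x
  sum := h.rTensor_sum

theorem IsProjs.exists_bound (h : IsProjs gr π) (x : M) : ∃ N, ∀ i, N ≤ i → π i x = 0 := by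
  obtain ⟨N, hN⟩ := h.sum x
  refine ⟨N, fun i hi => ?_⟩
  have h1 := hN i hi
  have h2 := hN (i + 1) (by omega)
  rwa [Finset.sum_range_succ, h1, add_eq_left] at h2

theorem IsProjs.eq_zero (h : IsProjs gr π) (x : M) (hx : ∀ i, π i x = 0) : x = 0 := by
  obtain ⟨N, hN⟩ := h.sum x
  rw [← hN N le_rfl]
  exact Finset.sum_eq_zero fun i _ => hx i

/-- Exactness of a filtered map whose top component raises the degree by one and is exact. -/
theorem exists_of_top_component {M' : Type*} [AddCommGroup M'] [Module k M']
    {gr' : ℕ → Submodule k M'} {π' : ℕ → M' →ₗ[k] M'} (h : IsProjs gr π) (h' : IsProjs gr' π')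
    (DL R : M' →ₗ[k] M) (hDL : ∀ i x, π (i + 1) (DL x) = DL (π' i x)) (hDL0 : ∀ x, π 0 (DL x) = 0)
    (hR : ∀ i x, π i (R x) = R (π' i x)) (Z : Submodule k M) (hZ : ∀ x, DL x + R x ∈ Z)
    (htop : ∀ ξ ∈ Z, ∀ N, (∀ i, N < i → π i ξ = 0) → ∃ η, DL η = π N ξ) (ξ : M) (hξ : ξ ∈ Z) :
    ∃ η, DL η + R η = ξ := by
  obtain ⟨N, hN⟩ := h.exists_bound ξ
  induction N generalizing ξ with
  | zero => exact ⟨0, by rw [h.eq_zero ξ fun i => hN i (Nat.zero_le i), map_zero, map_zero, add_zero]⟩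
  | succ N ih =>
    obtain ⟨η, hη⟩ := htop ξ hξ N fun i hi => hN i hi
    -- The preimage is cut down to its component of degree `N - 1`, so that subtracting its full
    -- image creates no new components of degree `N` or higher. For `N = 0` the top component
    -- vanishes, since `DL` only reaches positive degrees.
    obtain ⟨η', hη', hη0⟩ : ∃ η', DL η' = π N ξ ∧ ∀ i, N ≤ i → π' i η' = 0 := by
      cases N with
      | zero =>
        refine ⟨0, ?_, fun i _ => map_zero _⟩
        rw [← hη, map_zero, ← hDL0 η, hη, h.comp_apply, if_pos rfl]
      | succ N =>
        refine ⟨π' N η, ?_, fun i hi => ?_⟩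
        · rw [← hDL, hη, h.comp_apply, if_pos rfl]
        · rw [h'.comp_apply, if_neg (by omega)]
    obtain ⟨ζ, hζ⟩ := ih (ξ - (DL η' + R η')) (sub_mem hξ (hZ η')) fun i hi => by
      rw [map_sub, map_add, hR, hη0 i hi, map_zero, add_zero, hη', h.comp_apply]
      split_ifs with hiN
      · rw [hiN, sub_self]
      · rw [hN i (by omega), sub_zero]
    refine ⟨ζ + η', ?_⟩
    rw [map_add, map_add, add_add_add_comm, hζ, sub_add_cancel]

end Filtered

section KoszulExact

variable {k A : Type*} [Field k] [Ring A] [Algebra k A] (𝒜 : ℕ → Submodule k A)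

theorem ext_of_injective (m : ℕ) : Function.Injective (ext (A := A) (KC.of 𝒜 (m := m))) := by
  have : ∀ z, KC.val 𝒜 (ext (A := A) (KC.of 𝒜 (m := m)) z) =
      LinearMap.lTensor (Env k A) (koszulSp 𝒜 m).subtype z := by
    intro z
    induction z with
    | zero => simp only [map_zero]
    | add x y hx hy => simp only [map_add, hx, hy]
    | tmul e w =>
      rw [ext_tmul, map_smul, KC.val_of, LinearMap.lTensor_tmul, TensorProduct.smul_tmul',
        smul_eq_mul, mul_one, Submodule.subtype_apply]
  intro x y h
  have h' := congrArg (KC.val 𝒜) h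
  rw [this, this] at h'
  exact lTensor_subtype_injective _ h'

theorem ext_of_surjective (m : ℕ) : Function.Surjective (ext (A := A) (KC.of 𝒜 (m := m))) := by
  intro x
  induction x using KC.induction with
  | smul a b w => exact ⟨(a ⊗ₜ b) ⊗ₜ w, rfl⟩
  | add x y hx hy =>
    obtain ⟨x, rfl⟩ := hx
    obtain ⟨y, rfl⟩ := hy
    exact ⟨x + y, map_add _ _ _⟩

/-- The terms of the Koszul complex are free bimodules. -/
def kcEquiv (m : ℕ) : Env k A ⊗[k] koszulSp 𝒜 m ≃ₗ[Env k A] KC 𝒜 m :=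
  LinearEquiv.ofBijective _ ⟨ext_of_injective 𝒜 m, ext_of_surjective 𝒜 m⟩

theorem kcEquiv_tmul (m : ℕ) (e : Env k A) (w : koszulSp 𝒜 m) :
    kcEquiv 𝒜 m (e ⊗ₜ w) = e • KC.of 𝒜 w := rfl

instance (m : ℕ) : Module.Projective (Env k A) (KC 𝒜 m) :=
  Module.Projective.of_equiv (kcEquiv 𝒜 m)

/-- The description `(A ⊗ (A^!_m)^*) ⊗ A` of the terms of the Koszul complex. -/
def kcEquiv' (m : ℕ) : (A ⊗[k] koszulSp 𝒜 m) ⊗[k] Aᵐᵒᵖ ≃ₗ[k] KC 𝒜 m :=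
  TensorProduct.rightComm k A (koszulSp 𝒜 m) Aᵐᵒᵖ ≪≫ₗ (kcEquiv 𝒜 m).restrictScalars k

theorem kcEquiv'_tmul (m : ℕ) (a : A) (w : koszulSp 𝒜 m) (b : Aᵐᵒᵖ) :
    kcEquiv' 𝒜 m ((a ⊗ₜ w) ⊗ₜ b) = (a ⊗ₜ b : Env k A) • KC.of 𝒜 w := by
  rw [kcEquiv', LinearEquiv.trans_apply, TensorProduct.rightComm_tmul]
  rfl

theorem val_kcEquiv' (m : ℕ) (z : A ⊗[k] koszulSp 𝒜 m) (b : Aᵐᵒᵖ) :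
    KC.val 𝒜 (kcEquiv' 𝒜 m (z ⊗ₜ b)) =
      LinearMap.rTensor _ ((TensorProduct.mk k A Aᵐᵒᵖ).flip b) (lkIncl 𝒜 m z) := by
  induction z with
  | zero => simp only [TensorProduct.zero_tmul, map_zero]
  | add x y hx hy => simp only [TensorProduct.add_tmul, map_add, hx, hy]
  | tmul a w =>
    rw [kcEquiv'_tmul, map_smul, KC.val_of, lkIncl_tmul, LinearMap.rTensor_tmul,
      TensorProduct.smul_tmul', smul_eq_mul, mul_one]
    rfl

/-- The projection of `A ⊗ T(A) ⊗ A` given by an endomorphism of the first factor. -/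
def leftMap (f : A →ₗ[k] A) : Env k A ⊗[k] TensorAlgebra k A →ₗ[k] Env k A ⊗[k] TensorAlgebra k A :=
  LinearMap.rTensor _ (LinearMap.rTensor _ f)

theorem leftMap_val (f : A →ₗ[k] A) (m : ℕ) (z : (A ⊗[k] koszulSp 𝒜 m) ⊗[k] Aᵐᵒᵖ) :
    leftMap f (KC.val 𝒜 (kcEquiv' 𝒜 m z)) =
      KC.val 𝒜 (kcEquiv' 𝒜 m (LinearMap.rTensor _ (LinearMap.rTensor _ f) z)) := by
  induction z with
  | zero => simp only [map_zero]
  | add x y hx hy => simp only [map_add, hx, hy]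
  | tmul y b =>
    rw [LinearMap.rTensor_tmul]
    induction y with
    | zero => simp only [TensorProduct.zero_tmul, map_zero]
    | add x y hx hy => simp only [TensorProduct.add_tmul, map_add, hx, hy]
    | tmul a w =>
      rw [LinearMap.rTensor_tmul, val_kcEquiv', val_kcEquiv', lkIncl_tmul, lkIncl_tmul]
      rfl

theorem leftMap_smul_dR (f : A →ₗ[k] A) (z : Env k A ⊗[k] TensorAlgebra k A) :
    leftMap f (ext (dR k A) z) = ext (dR k A) (leftMap f z) := by
  have key : ∀ (a : A) (b : Aᵐᵒᵖ) (y : A ⊗[k] TensorAlgebra k A),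
      leftMap f ((a ⊗ₜ b : Env k A) • LinearMap.rTensor _
        ((Algebra.TensorProduct.includeRight : Aᵐᵒᵖ →ₐ[k] Env k A).toLinearMap ∘ₗ
          (MulOpposite.opLinearEquiv k).toLinearMap) y) =
      (f a ⊗ₜ b : Env k A) • LinearMap.rTensor _
        ((Algebra.TensorProduct.includeRight : Aᵐᵒᵖ →ₐ[k] Env k A).toLinearMap ∘ₗ
          (MulOpposite.opLinearEquiv k).toLinearMap) y := by
    intro a b y
    induction y with
    | zero => simp only [map_zero, smul_zero]
    | add x y hx hy => simp only [map_add, smul_add, hx, hy]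
    | tmul c t => simp [leftMap, TensorProduct.smul_tmul']
  induction z with
  | zero => simp only [map_zero]
  | add x y hx hy => simp only [map_add, hx, hy]
  | tmul e t =>
    refine TensorProduct.induction_on (motive := fun e : Env k A =>
      leftMap f (ext (dR k A) (e ⊗ₜ t)) = ext (dR k A) (leftMap f (e ⊗ₜ t))) e ?_
      (fun a b => ?_) (fun x y hx hy => ?_)
    · simp only [TensorProduct.zero_tmul, map_zero]
    · rw [ext_tmul, leftMap, LinearMap.rTensor_tmul, LinearMap.rTensor_tmul, ext_tmul]
      exact key a b _
    · simp only [TensorProduct.add_tmul, map_add, hx, hy]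

theorem dTotal_eq (m : ℕ) (z : Env k A ⊗[k] TensorAlgebra k A) :
    dTotal k A m z = ext (dL k A) z + (-1 : k) ^ (m + 1) • ext (dR k A) z := by
  induction z with
  | zero => simp only [map_zero, smul_zero, add_zero]
  | add x y hx hy => simp only [map_add, smul_add, hx, hy]; abel
  | tmul e t => rw [dTotal_tmul, ext_tmul, ext_tmul, smul_add, smul_comm e]

theorem smul_dL (a : A) (b : Aᵐᵒᵖ) (t : TensorAlgebra k A) :
    (a ⊗ₜ b : Env k A) • dL k A t =
      LinearMap.rTensor _ ((TensorProduct.mk k A Aᵐᵒᵖ).flip b) (a • splitL k A t) := by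
  rw [dL, LinearMap.comp_apply]
  induction splitL k A t with
  | zero => simp only [map_zero, smul_zero]
  | add x y hx hy => simp only [map_add, smul_add, hx, hy]
  | tmul c t => simp [TensorProduct.smul_tmul']

/-- The part of the Koszul differential that splits off the first letter. -/
def kcL (m : ℕ) : (A ⊗[k] koszulSp 𝒜 (m + 1)) ⊗[k] Aᵐᵒᵖ →ₗ[k] (A ⊗[k] koszulSp 𝒜 m) ⊗[k] Aᵐᵒᵖ :=
  LinearMap.rTensor _ ((lkD 𝒜 m).restrictScalars k)

theorem val_kcL (m : ℕ) (z : (A ⊗[k] koszulSp 𝒜 (m + 1)) ⊗[k] Aᵐᵒᵖ) :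
    KC.val 𝒜 (kcEquiv' 𝒜 m (kcL 𝒜 m z)) =
      ext (dL k A) (KC.val 𝒜 (kcEquiv' 𝒜 (m + 1) z)) := by
  induction z with
  | zero => simp only [map_zero]
  | add x y hx hy => simp only [map_add, hx, hy]
  | tmul y b =>
    rw [kcL, LinearMap.rTensor_tmul, LinearMap.restrictScalars_apply, val_kcEquiv', lkIncl_lkD]
    induction y with
    | zero => simp only [TensorProduct.zero_tmul, map_zero]
    | add x y hx hy => simp only [TensorProduct.add_tmul, map_add, hx, hy]
    | tmul a w =>
      rw [lkIncl_tmul, leftD_tmul, kcEquiv'_tmul, (KC.val 𝒜).map_smul, (ext (dL k A)).map_smul,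
        KC.val_of, ext_tmul, one_smul, smul_dL]

theorem add_add_neg_one_smul {M : Type*} [AddCommMonoid M] [Module k M] (x y : M) :
    x + (y + (-1 : k) • x) = y := by
  rw [add_left_comm]
  nth_rewrite 1 [← one_smul k x]
  rw [← add_smul, add_neg_cancel, zero_smul, add_zero]

/-- The part of the Koszul differential that splits off the last letter. -/
def kcR (m : ℕ) : (A ⊗[k] koszulSp 𝒜 (m + 1)) ⊗[k] Aᵐᵒᵖ →ₗ[k] (A ⊗[k] koszulSp 𝒜 m) ⊗[k] Aᵐᵒᵖ :=
  -- This is what remains of the full differential after the first-letter part; `val_kcR` identifies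
  -- it with the last-letter part.
  (kcEquiv' 𝒜 m).symm.toLinearMap ∘ₗ (koszulD 𝒜 m).restrictScalars k ∘ₗ
    (kcEquiv' 𝒜 (m + 1)).toLinearMap + (-1 : k) • kcL 𝒜 m

theorem kcL_add_kcR (m : ℕ) (z : (A ⊗[k] koszulSp 𝒜 (m + 1)) ⊗[k] Aᵐᵒᵖ) :
    kcL 𝒜 m z + kcR 𝒜 m z = (kcEquiv' 𝒜 m).symm (koszulD 𝒜 m (kcEquiv' 𝒜 (m + 1) z)) := by
  rw [kcR, LinearMap.add_apply, LinearMap.smul_apply, add_add_neg_one_smul]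
  rfl

theorem val_kcR (m : ℕ) (z : (A ⊗[k] koszulSp 𝒜 (m + 1)) ⊗[k] Aᵐᵒᵖ) :
    KC.val 𝒜 (kcEquiv' 𝒜 m (kcR 𝒜 m z)) =
      (-1 : k) ^ (m + 1) • ext (dR k A) (KC.val 𝒜 (kcEquiv' 𝒜 (m + 1) z)) := by
  have h := congrArg (fun y => KC.val 𝒜 (kcEquiv' 𝒜 m y)) (kcL_add_kcR 𝒜 m z)
  simp only [map_add, LinearEquiv.apply_symm_apply, val_koszulD, dTotal_eq, val_kcL] at h
  exact add_left_cancel h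

variable {𝒜} {p : ℕ → A →ₗ[k] A}

theorem kcR_rTensor (f : A →ₗ[k] A) (m : ℕ) (z : (A ⊗[k] koszulSp 𝒜 (m + 1)) ⊗[k] Aᵐᵒᵖ) :
    LinearMap.rTensor _ (LinearMap.rTensor _ f) (kcR 𝒜 m z) =
      kcR 𝒜 m (LinearMap.rTensor _ (LinearMap.rTensor _ f) z) := by
  apply (kcEquiv' 𝒜 m).injective
  apply KC.val_injective
  rw [← leftMap_val, val_kcR, val_kcR, ← leftMap_val, map_smul, leftMap_smul_dR]

theorem rTensor_smul_rTensor (hA : IsProjs 𝒜 p)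
    (hm : ∀ i j a b, a ∈ 𝒜 i → b ∈ 𝒜 j → a * b ∈ 𝒜 (i + j)) {U : Type*} [AddCommGroup U]
    [Module k U] (i : ℕ) (a : A) (y : A ⊗[k] U) :
    LinearMap.rTensor U (p (i + 1)) (a • LinearMap.rTensor U (p 1) y) =
      p i a • LinearMap.rTensor U (p 1) y := by
  induction y with
  | zero => simp only [map_zero, smul_zero]
  | add x y hx hy => simp only [map_add, smul_add, hx, hy]
  | tmul b u =>
    rw [LinearMap.rTensor_tmul, TensorProduct.smul_tmul', LinearMap.rTensor_tmul,
      TensorProduct.smul_tmul', smul_eq_mul, ← smul_eq_mul, hA.smul hA hm,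
      Finset.sum_eq_single_of_mem i (Finset.mem_range.2 (by omega))]
    · rw [hA.comp_apply, if_pos (by omega)]
    · intro j hj hji
      rw [hA.comp_apply, if_neg (by have := Finset.mem_range.1 hj; omega), smul_zero]

theorem rTensor_zero_smul_rTensor (hA : IsProjs 𝒜 p)
    (hm : ∀ i j a b, a ∈ 𝒜 i → b ∈ 𝒜 j → a * b ∈ 𝒜 (i + j)) {U : Type*} [AddCommGroup U]
    [Module k U] (a : A) (y : A ⊗[k] U) :
    LinearMap.rTensor U (p 0) (a • LinearMap.rTensor U (p 1) y) = 0 := by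
  induction y with
  | zero => simp only [map_zero, smul_zero]
  | add x y hx hy => simp only [map_add, smul_add, hx, hy, add_zero]
  | tmul b u =>
    rw [LinearMap.rTensor_tmul, TensorProduct.smul_tmul', LinearMap.rTensor_tmul, hA.smul hA hm]
    simp [hA.comp_apply]

/-- The first letter has degree one and is multiplied into the left factor, whereas `kcR` leaves
that factor alone (`kcR_rTensor`). These are the degree hypotheses of `exists_of_top_component`. -/
theorem rTensor_kcL (hA : IsProjs 𝒜 p)
    (hm : ∀ i j a b, a ∈ 𝒜 i → b ∈ 𝒜 j → a * b ∈ 𝒜 (i + j)) (i m : ℕ)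
    (z : (A ⊗[k] koszulSp 𝒜 (m + 1)) ⊗[k] Aᵐᵒᵖ) :
    LinearMap.rTensor _ (LinearMap.rTensor _ (p (i + 1))) (kcL 𝒜 m z) =
      kcL 𝒜 m (LinearMap.rTensor _ (LinearMap.rTensor _ (p i)) z) := by
  induction z with
  | zero => simp only [map_zero]
  | add x y hx hy => simp only [map_add, hx, hy]
  | tmul y b =>
    rw [kcL, LinearMap.rTensor_tmul, LinearMap.rTensor_tmul, LinearMap.rTensor_tmul,
      LinearMap.rTensor_tmul, LinearMap.restrictScalars_apply, LinearMap.restrictScalars_apply]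
    congr 1
    induction y with
    | zero => simp only [map_zero]
    | add x y hx hy => simp only [map_add, hx, hy]
    | tmul a w =>
      rw [LinearMap.rTensor_tmul, lkD_tmul, lkD_tmul, ← rTensor_lkD₀ hA,
        rTensor_smul_rTensor hA hm]

theorem rTensor_zero_lkD (hA : IsProjs 𝒜 p)
    (hm : ∀ i j a b, a ∈ 𝒜 i → b ∈ 𝒜 j → a * b ∈ 𝒜 (i + j)) (m : ℕ)
    (y : A ⊗[k] koszulSp 𝒜 (m + 1)) : LinearMap.rTensor _ (p 0) (lkD 𝒜 m y) = 0 := by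
  induction y with
  | zero => simp only [map_zero]
  | add x y hx hy => simp only [map_add, hx, hy, add_zero]
  | tmul a w => rw [lkD_tmul, ← rTensor_lkD₀ hA, rTensor_zero_smul_rTensor hA hm]

theorem lkD_lkD (m : ℕ) (y : A ⊗[k] koszulSp 𝒜 (m + 2)) : lkD 𝒜 m (lkD 𝒜 (m + 1) y) = 0 := by
  induction y with
  | zero => simp only [map_zero]
  | add x y hx hy => simp only [map_add, hx, hy, add_zero]
  | tmul a w => rw [lkD_tmul, map_smul, lkD_lkD₀, smul_zero]

theorem rTensor_zero_kcL (hA : IsProjs 𝒜 p)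
    (hm : ∀ i j a b, a ∈ 𝒜 i → b ∈ 𝒜 j → a * b ∈ 𝒜 (i + j)) (m : ℕ)
    (z : (A ⊗[k] koszulSp 𝒜 (m + 1)) ⊗[k] Aᵐᵒᵖ) :
    LinearMap.rTensor _ (LinearMap.rTensor _ (p 0)) (kcL 𝒜 m z) = 0 := by
  induction z with
  | zero => simp only [map_zero]
  | add x y hx hy => simp only [map_add, hx, hy, add_zero]
  | tmul y b =>
    rw [kcL, LinearMap.rTensor_tmul, LinearMap.rTensor_tmul, LinearMap.restrictScalars_apply]
    rw [rTensor_zero_lkD hA hm, TensorProduct.zero_tmul]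

variable (𝒜) in
theorem koszulD_koszulD (m : ℕ) (x : KC 𝒜 (m + 2)) : koszulD 𝒜 m (koszulD 𝒜 (m + 1) x) = 0 := by
  have h := toBar_isToBar 𝒜
  apply toBar_injective 𝒜 m
  rw [← h.comm, ← h.comm, barDC_barDC, map_zero]

variable (𝒜) in
theorem koszulAug_koszulD (x : KC 𝒜 1) : koszulAug 𝒜 (koszulD 𝒜 0 x) = 0 := by
  have h := toBar_isToBar 𝒜
  rw [← h.aug_eq, ← h.comm, barAug_barDC]

variable (𝒜) in
theorem one_mem_koszulSp : 1 ∈ koszulSp 𝒜 0 := by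
  refine mem_koszulSp 𝒜 ?_ fun u v h => absurd h (by omega)
  rw [pow_zero]
  exact Submodule.mem_one.2 ⟨1, map_one _⟩

theorem koszulSp_zero (w : koszulSp 𝒜 0) : ∃ c : k, w = c • ⟨1, one_mem_koszulSp 𝒜⟩ := by
  have := koszulSp_le_pow 𝒜 0 w.2
  rw [pow_zero, Submodule.mem_one] at this
  obtain ⟨c, hc⟩ := this
  exact ⟨c, Subtype.ext (by rw [← hc, Algebra.algebraMap_eq_smul_one]; rfl)⟩

variable (𝒜) in
theorem koszulAug_smul_of_one (a b : A) :
    koszulAug 𝒜 ((a ⊗ₜ MulOpposite.op b : Env k A) • KC.of 𝒜 ⟨1, one_mem_koszulSp 𝒜⟩) =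
      toReg k A (a * b) := by
  rw [map_smul, koszulAug_of, map_one, map_one, reg_smul_one, MulOpposite.unop_op]

variable [GradedAlgebra 𝒜]

/-- Exactness of the Koszul bimodule complex at a term, on a space `Z` of cycles for which the top
components are cycles of the left Koszul complex. -/
theorem koszul_exact_of_top (hA : IsProjs 𝒜 p) (m : ℕ)
    (Z : Submodule k ((A ⊗[k] koszulSp 𝒜 m) ⊗[k] Aᵐᵒᵖ))
    (hZ : ∀ x, (kcEquiv' 𝒜 m).symm (koszulD 𝒜 m (kcEquiv' 𝒜 (m + 1) x)) ∈ Z)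
    (htop : ∀ ξ ∈ Z, ∀ N, (∀ i, N < i → LinearMap.rTensor _ (LinearMap.rTensor _ (p i)) ξ = 0) →
      ∃ η, kcL 𝒜 m η = LinearMap.rTensor _ (LinearMap.rTensor _ (p N)) ξ) (x : KC 𝒜 m)
    (hx : (kcEquiv' 𝒜 m).symm x ∈ Z) : ∃ y, koszulD 𝒜 m y = x := by
  obtain ⟨η, hη⟩ := exists_of_top_component ((hA.rTensor _).rTensor _) ((hA.rTensor _).rTensor _)
    (kcL 𝒜 m) (kcR 𝒜 m) (fun i z => rTensor_kcL hA LinearResolution.mul_mem' i m z)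
    (rTensor_zero_kcL hA LinearResolution.mul_mem' m)
    (fun i z => kcR_rTensor (p i) m z) Z (fun z => by rw [kcL_add_kcR]; exact hZ z) htop
    _ hx
  rw [kcL_add_kcR] at hη
  exact ⟨_, (kcEquiv' 𝒜 m).symm.injective hη⟩

/-- Let `N` be the highest left degree in a cycle. In degree `N + 1` the cycle equation involves
only the first-letter part of the component of degree `N`, so this component is a cycle of the left
Koszul complex tensored with `Aᵐᵒᵖ`, hence a boundary there. -/
theorem koszul_exact_succ (hA : IsProjs 𝒜 p) (hK : IsKoszul 𝒜) (m : ℕ) :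
    Function.Exact (koszulD 𝒜 (m + 1)) (koszulD 𝒜 m) := by
  intro x
  refine ⟨fun hx => ?_, ?_⟩
  · refine koszul_exact_of_top hA (m + 1) (LinearMap.ker ((koszulD 𝒜 m).restrictScalars k ∘ₗ
      (kcEquiv' 𝒜 (m + 1)).toLinearMap)) (fun z => ?_) (fun ξ hξ N hN => ?_) x ?_
    · change koszulD 𝒜 m (kcEquiv' 𝒜 (m + 1) _) = 0
      rw [LinearEquiv.apply_symm_apply, koszulD_koszulD]
    · have hξ' : kcL 𝒜 m ξ + kcR 𝒜 m ξ = 0 := by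
        rw [kcL_add_kcR, show koszulD 𝒜 m (kcEquiv' 𝒜 (m + 1) ξ) = 0 from hξ, map_zero]
      have h1 := congrArg (LinearMap.rTensor _ (LinearMap.rTensor _ (p (N + 1)))) hξ'
      rw [map_add, map_zero, kcR_rTensor, hN _ (Nat.lt_succ_self N), map_zero, add_zero,
        rTensor_kcL hA LinearResolution.mul_mem'] at h1
      refine (rTensor_exact_of_field (k := k) Aᵐᵒᵖ
        (f := (lkD 𝒜 (m + 1)).restrictScalars k) (g := (lkD 𝒜 m).restrictScalars k)
        (fun z => ⟨fun hz => (leftKoszul_exact hA hK).2 m z hz, ?_⟩) _).1 h1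
      rintro ⟨y, rfl⟩
      exact lkD_lkD m y
    · change koszulD 𝒜 m (kcEquiv' 𝒜 (m + 1) _) = 0
      rw [LinearEquiv.apply_symm_apply, hx]
  · rintro ⟨y, rfl⟩
    exact koszulD_koszulD 𝒜 m y

/-- A top component of positive degree is killed by the projection to degree zero, so the left
Koszul complex supplies a preimage. An element concentrated in left degree zero has the form `1 ⊗ 1
⊗ b`, and its augmentation `b` vanishes. -/
theorem koszul_exact_zero (hA : IsProjs 𝒜 p) (hK : IsKoszul 𝒜) :
    Function.Exact (koszulD 𝒜 0) (koszulAug 𝒜) := by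
  intro x
  refine ⟨fun hx => ?_, ?_⟩
  · have h0 := grade_zero_le_span_one hA hK.quadratic
    refine koszul_exact_of_top hA 0 (LinearMap.ker ((koszulAug 𝒜).restrictScalars k ∘ₗ
      (kcEquiv' 𝒜 0).toLinearMap)) (fun z => ?_) (fun ξ hξ N hN => ?_) x ?_
    · change koszulAug 𝒜 (kcEquiv' 𝒜 0 _) = 0
      rw [LinearEquiv.apply_symm_apply, koszulAug_koszulD]
    · have hP := (hA.rTensor (koszulSp 𝒜 0)).rTensor Aᵐᵒᵖ
      cases N with
      | zero =>
        have hp0 : ∀ ξ : (A ⊗[k] koszulSp 𝒜 0) ⊗[k] Aᵐᵒᵖ, ∃ b : Aᵐᵒᵖ,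
            LinearMap.rTensor _ (LinearMap.rTensor _ (p 0)) ξ =
              (1 ⊗ₜ ⟨1, one_mem_koszulSp 𝒜⟩) ⊗ₜ b := by
          intro ξ
          induction ξ with
          | zero => exact ⟨0, by rw [map_zero, TensorProduct.tmul_zero]⟩
          | add x y hx hy =>
            obtain ⟨b, hb⟩ := hx
            obtain ⟨c, hc⟩ := hy
            exact ⟨b + c, by rw [map_add, hb, hc, TensorProduct.tmul_add]⟩
          | tmul z b =>
            obtain ⟨w, hw⟩ := rTensor_proj_zero hA h0 z
            obtain ⟨c, rfl⟩ := koszulSp_zero w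
            exact ⟨c • b, by rw [LinearMap.rTensor_tmul, hw, TensorProduct.tmul_smul,
              TensorProduct.smul_tmul]⟩
        have hξ0 : LinearMap.rTensor _ (LinearMap.rTensor _ (p 0)) ξ = ξ := by
          obtain ⟨n, hn⟩ := hP.sum ξ
          have := hn (n + 1) (by omega)
          rwa [Finset.sum_range_succ', Finset.sum_eq_zero (fun i _ => hN (i + 1) (by omega)),
            zero_add] at this
        obtain ⟨b, hb⟩ := hp0 ξ
        have h1 : koszulAug 𝒜 (kcEquiv' 𝒜 0 ξ) = 0 := hξ
        rw [← hξ0, hb, kcEquiv'_tmul, ← MulOpposite.op_unop b, koszulAug_smul_of_one, one_mul] at h1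
        have h2 : b = 0 := MulOpposite.unop_injective ((toReg k A).injective h1)
        exact ⟨0, by rw [hb, h2, TensorProduct.tmul_zero, map_zero]⟩
      | succ N =>
        refine (rTensor_exact_of_field (k := k) Aᵐᵒᵖ
          (f := (lkD 𝒜 0).restrictScalars k) (g := LinearMap.rTensor (koszulSp 𝒜 0) (p 0))
          (fun z => ⟨fun hz => (leftKoszul_exact hA hK).1 z hz, ?_⟩) _).1 ?_
        · rintro ⟨y, rfl⟩
          exact rTensor_zero_lkD hA LinearResolution.mul_mem' 0 y
        · have := hP.comp_apply 0 (N + 1) ξ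
          rwa [if_neg (by omega)] at this
    · change koszulAug 𝒜 (kcEquiv' 𝒜 0 _) = 0
      rw [LinearEquiv.apply_symm_apply, hx]
  · rintro ⟨y, rfl⟩
    exact koszulAug_koszulD 𝒜 y

/-- The Koszul bimodule complex is a projective resolution. -/
theorem koszul_isProjRes (hK : IsKoszul 𝒜) :
    IsProjRes (Env k A) (fun m => KC 𝒜 m) (koszulD 𝒜) (koszulAug 𝒜) := by
  obtain ⟨p, hA⟩ := exists_isProjs (DirectSum.Decomposition.isInternal 𝒜)
  refine ⟨fun m => inferInstance, fun a => ?_, koszul_exact_zero hA hK, koszul_exact_succ hA hK⟩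
  refine ⟨((toReg k A).symm a ⊗ₜ MulOpposite.op 1 : Env k A) •
    KC.of 𝒜 ⟨1, one_mem_koszulSp 𝒜⟩, ?_⟩
  rw [koszulAug_smul_of_one, mul_one, AlgEquiv.apply_symm_apply]

end KoszulExact

/-! ### Sweedler calculus -/

section SweedlerSums

variable {k H M : Type*} [Field k] [Ring H] [HopfAlgebra k H] [AddCommGroup M]

theorem sw₂_congr {F G : H → H → M} (h : H) (hFG : ∀ x y, F x y = G x y) :
    sw₂ k h F = sw₂ k h G := Finset.sum_congr rfl fun _ _ => hFG _ _

theorem map_sw₂ {N G : Type*} [AddCommGroup N] [FunLike G M N]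
    [AddMonoidHomClass G M N] (f : G) (h : H) (F : H → H → M) :
    f (sw₂ k h F) = sw₂ k h fun x y => f (F x y) := map_sum f _ _

theorem sw₂_comm (g h : H) (F : H → H → H → H → M) :
    (sw₂ k g fun x y => sw₂ k h fun u v => F x y u v) =
      sw₂ k h fun u v => sw₂ k g fun x y => F x y u v := Finset.sum_comm

theorem sw₂_add_fun (h : H) (F G : H → H → M) :
    (sw₂ k h fun x y => F x y + G x y) = sw₂ k h F + sw₂ k h G := Finset.sum_add_distrib

theorem sw₂_neg_fun (h : H) (F : H → H → M) :
    (sw₂ k h fun x y => -F x y) = -sw₂ k h F := Finset.sum_neg_distrib _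

theorem sw₂_zero_fun (h : H) : (sw₂ k h fun _ _ => (0 : M)) = 0 := Finset.sum_const_zero

end SweedlerSums

section SweedlerCalculus

variable {k H M : Type*} [Field k] [Ring H] [HopfAlgebra k H] [AddCommGroup M] [Module k M]

/-- Bilinearity of a function on `H × H`. -/
structure IsBilin (k : Type*) {H M : Type*} [Field k] [Ring H] [HopfAlgebra k H] [AddCommGroup M]
    [Module k M] (F : H → H → M) : Prop where
  add₁ : ∀ x x' y, F (x + x') y = F x y + F x' y
  smul₁ : ∀ (c : k) x y, F (c • x) y = c • F x y
  add₂ : ∀ x y y', F x (y + y') = F x y + F x y'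
  smul₂ : ∀ (c : k) x y, F x (c • y) = c • F x y

/-- Trilinearity of a function on `H × H × H`. -/
structure IsTrilin (k : Type*) {H M : Type*} [Field k] [Ring H] [HopfAlgebra k H] [AddCommGroup M]
    [Module k M] (F : H → H → H → M) : Prop where
  bilin : ∀ z, IsBilin k fun x y => F x y z
  add₃ : ∀ x y z z', F x y (z + z') = F x y z + F x y z'
  smul₃ : ∀ (c : k) x y z, F x y (c • z) = c • F x y z

/-- A bilinear function, as a bilinear map. -/
def IsBilin.toLin {F : H → H → M} (hF : IsBilin k F) : H →ₗ[k] H →ₗ[k] M :=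
  LinearMap.mk₂ k F hF.add₁ hF.smul₁ hF.add₂ hF.smul₂

/-- `sw₂` uses an arbitrary representation of the coproduct as a sum of pure tensors; for a bilinear
function the result depends on the coproduct alone. The verifications of `IsBilin` and `IsTrilin`
throughout serve this purpose. -/
theorem IsBilin.sw₂_eq {F : H → H → M} (hF : IsBilin k F) (h : H) :
    sw₂ k h F = TensorProduct.lift hF.toLin (Coalgebra.comul h) := KoszulSmash.sw₂_eq k h hF.toLin

theorem IsBilin.sw₂_add {F : H → H → M} (hF : IsBilin k F) (h h' : H) :
    sw₂ k (h + h') F = sw₂ k h F + sw₂ k h' F := by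
  rw [hF.sw₂_eq, hF.sw₂_eq, hF.sw₂_eq, map_add, map_add]

theorem IsBilin.sw₂_smul {F : H → H → M} (hF : IsBilin k F) (c : k) (h : H) :
    sw₂ k (c • h) F = c • sw₂ k h F := by
  rw [hF.sw₂_eq, hF.sw₂_eq, map_smul, map_smul]

theorem IsBilin.sw₂_one {F : H → H → M} (hF : IsBilin k F) : sw₂ k 1 F = F 1 1 := by
  rw [hF.sw₂_eq, Bialgebra.comul_one]
  rfl

theorem IsBilin.sw₂_mul {F : H → H → M} (hF : IsBilin k F) (g h : H) :
    sw₂ k (g * h) F = sw₂ k g fun x y => sw₂ k h fun u v => F (x * u) (y * v) := by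
  rw [hF.sw₂_eq, Bialgebra.comul_mul]
  conv_lhs => rw [← (Coalgebra.Repr.arbitrary k g).eq, ← (Coalgebra.Repr.arbitrary k h).eq]
  rw [Finset.sum_mul_sum, map_sum]
  refine Finset.sum_congr rfl fun i _ => ?_
  rw [map_sum]
  refine Finset.sum_congr rfl fun j _ => ?_
  rw [Algebra.TensorProduct.tmul_mul_tmul, TensorProduct.lift.tmul]
  rfl

theorem sw₂_smul_fun (c : k) (h : H) (F : H → H → M) :
    (sw₂ k h fun x y => c • F x y) = c • sw₂ k h F := Finset.smul_sum.symm

/-- Coassociativity. The right-hand nesting is the one by which `sw₃` is defined. -/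
theorem IsTrilin.sw₂_assoc {F : H → H → H → M} (hF : IsTrilin k F) (h : H) :
    (sw₂ k h fun x z => sw₂ k x fun u v => F u v z) =
      sw₂ k h fun x y => sw₂ k y fun u v => F x u v := by
  let R := fun x : H => Coalgebra.Repr.arbitrary k x
  have key := Coalgebra.sum_tmul_tmul_eq (R h) (fun i => R ((R h).left i))
    (fun i => R ((R h).right i))
  let G : H →ₗ[k] H →ₗ[k] H →ₗ[k] M := LinearMap.flip
    { toFun := fun z => (hF.bilin z).toLin.flip
      map_add' := fun z z' => by
        ext x y; exact hF.add₃ _ _ _ _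
      map_smul' := fun c z => by
        ext x y; exact hF.smul₃ _ _ _ _ } |>.flip |>.flip
  let G' : H ⊗[k] (H ⊗[k] H) →ₗ[k] M := TensorProduct.lift
    { toFun := fun x => TensorProduct.lift ((LinearMap.mk₂ k (fun y z => F x y z)
        (fun y y' z => (hF.bilin z).add₂ x y y') (fun c y z => (hF.bilin z).smul₂ c x y)
        (fun y z z' => hF.add₃ x y z z') (fun c y z => hF.smul₃ c x y z)))
      map_add' := fun x x' => by
        ext y z; exact (hF.bilin z).add₁ x x' y
      map_smul' := fun c x => by
        ext y z; exact (hF.bilin z).smul₁ c x y }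
  have := congrArg G' key
  simp only [map_sum] at this
  exact this

theorem sw₂_counit_left (h : H) (f : H →ₗ[k] M) :
    (sw₂ k h fun x y => Coalgebra.counit (R := k) x • f y) = f h := by
  conv_rhs => rw [← Coalgebra.sum_counit_smul (Coalgebra.Repr.arbitrary k h), map_sum]
  simp only [map_smul]
  rfl

theorem sw₂_counit_right (h : H) (f : H →ₗ[k] M) :
    (sw₂ k h fun x y => Coalgebra.counit (R := k) y • f x) = f h := by
  have : (∑ i ∈ (Coalgebra.Repr.arbitrary k h).index, Coalgebra.counit (R := k)
      ((Coalgebra.Repr.arbitrary k h).right i) • (Coalgebra.Repr.arbitrary k h).left i) = h := by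
    have := congrArg (TensorProduct.rid k H) (Coalgebra.sum_tmul_counit_eq
      (Coalgebra.Repr.arbitrary k h))
    simpa only [map_sum, TensorProduct.rid_tmul, one_smul] using this
  conv_rhs => rw [← this, map_sum]
  simp only [map_smul]
  rfl

theorem sw₂_antipode_left (h : H) (f : H →ₗ[k] M) :
    (sw₂ k h fun x y => f (HopfAlgebra.antipode k x * y)) = Coalgebra.counit (R := k) h • f 1 := by
  rw [← map_smul, ← HopfAlgebra.sum_antipode_mul_eq_smul (Coalgebra.Repr.arbitrary k h), map_sum]
  rfl

theorem sw₂_antipode_right (h : H) (f : H →ₗ[k] M) :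
    (sw₂ k h fun x y => f (x * HopfAlgebra.antipode k y)) = Coalgebra.counit (R := k) h • f 1 := by
  rw [← map_smul, ← HopfAlgebra.sum_mul_antipode_eq_smul (Coalgebra.Repr.arbitrary k h), map_sum]
  rfl

end SweedlerCalculus

/-! ### The action of `H` on the bar resolution -/

section TensorAction

variable {k A H : Type*} [Field k] [Ring A] [Algebra k A] [Ring H] [HopfAlgebra k H]
  [Module H A] [IsScalarTower k H A]

theorem tAct_one_right (h : H) :
    tAct h (1 : TensorAlgebra k A) = Coalgebra.counit (R := k) h • 1 := by
  change (tensorAct k A H 1).ofConv h = _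
  rw [map_one]
  simp [Algebra.algebraMap_eq_smul_one]

theorem tAct_ι (h : H) (a : A) : tAct h (TensorAlgebra.ι k a) = TensorAlgebra.ι k (h • a) := by
  change (tensorAct k A H _).ofConv h = _
  simp [tensorAct]

theorem tAct_mul (h : H) (s t : TensorAlgebra k A) :
    tAct h (s * t) = sw₂ k h fun x y => tAct x s * tAct y t := by
  change (tensorAct k A H _).ofConv h = _
  rw [map_mul]
  exact (Coalgebra.Repr.arbitrary k h).convMul_apply _ _

theorem tensor_induction_left {P : TensorAlgebra k A → Prop} (t : TensorAlgebra k A)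
    (one : P 1) (ι_mul : ∀ a t, P t → P (TensorAlgebra.ι k a * t))
    (add : ∀ x y, P x → P y → P (x + y)) (smul : ∀ (c : k) x, P x → P (c • x)) : P t := by
  induction t using tensor_induction with
  | tprod m a =>
    induction m with
    | zero => rwa [tprod_elim0]
    | succ m ih =>
      rw [← Fin.cons_self_tail a, tprod_cons]
      exact ι_mul _ _ (ih _)
  | add x y hx hy => exact add x y hx hy
  | smul c x hx => exact smul c x hx

theorem tAct_add_left (h h' : H) (t : TensorAlgebra k A) :
    tAct (h + h') t = tAct h t + tAct h' t := map_add (tensorAct k A H t).ofConv h h'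

theorem tAct_smul_left (c : k) (h : H) (t : TensorAlgebra k A) :
    tAct (c • h) t = c • tAct h t := map_smul (tensorAct k A H t).ofConv c h

theorem tAct_one_left (t : TensorAlgebra k A) : tAct (1 : H) t = t := by
  induction t using tensor_induction_left with
  | one => rw [tAct_one_right, Bialgebra.counit_one, one_smul]
  | ι_mul a t ih =>
    rw [tAct_mul, IsBilin.sw₂_one, tAct_ι, ih, one_smul]
    constructor <;> intros <;> simp [tAct_add_left, tAct_smul_left, add_mul, mul_add]
  | add x y hx hy => rw [map_add, hx, hy]
  | smul c x hx => rw [map_smul, hx]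

theorem tAct_mul_left (g h : H) (t : TensorAlgebra k A) : tAct (g * h) t = tAct g (tAct h t) := by
  induction t using tensor_induction_left generalizing g h with
  | one =>
    rw [tAct_one_right, tAct_one_right, map_smul, tAct_one_right, smul_smul, Bialgebra.counit_mul,
      mul_comm]
  | ι_mul a t ih =>
    rw [tAct_mul, IsBilin.sw₂_mul, tAct_mul, map_sw₂, sw₂_comm]
    · refine sw₂_congr _ fun u v => ?_
      rw [tAct_mul]
      refine sw₂_congr _ fun x y => ?_
      rw [tAct_ι, tAct_ι, tAct_ι, mul_smul, ih]
    · constructor <;> intros <;> simp [tAct_add_left, tAct_smul_left, add_mul, mul_add]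
  | add x y hx hy => rw [map_add, hx, hy, map_add, map_add]
  | smul c x hx => rw [map_smul, hx, map_smul, map_smul]

end TensorAction

section SweedlerThreeSums

variable {k H M : Type*} [Field k] [Ring H] [HopfAlgebra k H] [AddCommGroup M]

theorem map_sw₃ {N G : Type*} [AddCommGroup N] [FunLike G M N] [AddMonoidHomClass G M N] (f : G)
    (h : H) (F : H → H → H → M) : f (sw₃ k h F) = sw₃ k h fun x y z => f (F x y z) := by
  rw [sw₃, map_sw₂]
  exact sw₂_congr _ fun x y => map_sw₂ f _ _

theorem sw₃_congr {F G : H → H → H → M} (h : H) (hFG : ∀ x y z, F x y z = G x y z) :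
    sw₃ k h F = sw₃ k h G := sw₂_congr _ fun _ _ => sw₂_congr _ fun _ _ => hFG _ _ _

theorem sw₃_comm (g h : H) (F : H → H → H → H → H → H → M) :
    (sw₃ k g fun x y z => sw₃ k h fun u v w => F x y z u v w) =
      sw₃ k h fun u v w => sw₃ k g fun x y z => F x y z u v w := by
  -- The inner index set depends on the outer index, so each triple sum is first flattened over a
  -- sigma type.
  have : ∀ F : H → H → H → M, ∀ g : H, sw₃ k g F =
      ∑ i ∈ (Coalgebra.Repr.arbitrary k g).index.sigma fun i =>
        (Coalgebra.Repr.arbitrary k ((Coalgebra.Repr.arbitrary k g).right i)).index,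
        F ((Coalgebra.Repr.arbitrary k g).left i.1)
          ((Coalgebra.Repr.arbitrary k ((Coalgebra.Repr.arbitrary k g).right i.1)).left i.2)
          ((Coalgebra.Repr.arbitrary k ((Coalgebra.Repr.arbitrary k g).right i.1)).right i.2) := by
    intro F g
    rw [Finset.sum_sigma]
    rfl
  simp only [this]
  exact Finset.sum_comm

theorem smul_sw₂ {R : Type*} [Monoid R] [DistribMulAction R M] (e : R) (h : H) (F : H → H → M) :
    e • sw₂ k h F = sw₂ k h fun x y => e • F x y := Finset.smul_sum

theorem smul_sw₃ {R : Type*} [Monoid R] [DistribMulAction R M] (e : R) (h : H)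
    (F : H → H → H → M) : e • sw₃ k h F = sw₃ k h fun x y z => e • F x y z := by
  rw [sw₃, smul_sw₂]
  exact sw₂_congr _ fun x y => smul_sw₂ _ _ _

end SweedlerThreeSums

section SweedlerThree

variable {k H M : Type*} [Field k] [Ring H] [HopfAlgebra k H] [AddCommGroup M] [Module k M]

theorem isTrilin_sw₂ {G : H → H → H → H → M} (h₁ : ∀ u v, IsBilin k (G u v))
    (h₂ : ∀ y z, IsBilin k fun u v => G u v y z) :
    IsTrilin k fun u v w => sw₂ k w fun y z => G u v y z where
  bilin w :=
    { add₁ := fun x x' y => by simp only [(h₂ _ _).add₁, sw₂_add_fun]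
      smul₁ := fun c x y => by simp only [(h₂ _ _).smul₁, sw₂_smul_fun]
      add₂ := fun x y y' => by simp only [(h₂ _ _).add₂, sw₂_add_fun]
      smul₂ := fun c x y => by simp only [(h₂ _ _).smul₂, sw₂_smul_fun] }
  add₃ x y z z' := (h₁ x y).sw₂_add z z'
  smul₃ c x y z := (h₁ x y).sw₂_smul c z

theorem IsTrilin.right {F : H → H → H → M} (hF : IsTrilin k F) (x : H) : IsBilin k (F x) where
  add₁ := fun y y' z => (hF.bilin z).add₂ x y y'
  smul₁ := fun c y z => (hF.bilin z).smul₂ c x y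
  add₂ := fun y z z' => hF.add₃ x y z z'
  smul₂ := fun c y z => hF.smul₃ c x y z

theorem IsTrilin.sw₂_right {F : H → H → H → M} (hF : IsTrilin k F) :
    IsBilin k fun x z => sw₂ k z fun u v => F x u v where
  add₁ x x' z := by simp only [(hF.bilin _).add₁, sw₂_add_fun]
  smul₁ c x z := by simp only [(hF.bilin _).smul₁, sw₂_smul_fun]
  add₂ x z z' := (hF.right x).sw₂_add z z'
  smul₂ c x z := (hF.right x).sw₂_smul c z

theorem IsTrilin.sw₃_add {F : H → H → H → M} (hF : IsTrilin k F) (h h' : H) :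
    sw₃ k (h + h') F = sw₃ k h F + sw₃ k h' F := hF.sw₂_right.sw₂_add h h'

theorem IsTrilin.sw₃_smul {F : H → H → H → M} (hF : IsTrilin k F) (c : k) (h : H) :
    sw₃ k (c • h) F = c • sw₃ k h F := hF.sw₂_right.sw₂_smul c h

theorem IsTrilin.sw₃_one {F : H → H → H → M} (hF : IsTrilin k F) : sw₃ k 1 F = F 1 1 1 := by
  rw [sw₃, hF.sw₂_right.sw₂_one, (hF.right 1).sw₂_one]

theorem IsTrilin.sw₃_mul {F : H → H → H → M} (hF : IsTrilin k F) (g h : H) :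
    sw₃ k (g * h) F = sw₃ k g fun x y z => sw₃ k h fun u v w => F (x * u) (y * v) (z * w) := by
  rw [sw₃, hF.sw₂_right.sw₂_mul]
  refine sw₂_congr _ fun x y => ?_
  refine (sw₂_congr _ fun u v => (hF.right _).sw₂_mul y v).trans ?_
  rw [sw₂_comm]
  rfl

end SweedlerThree

/-! ### The diagonal action on `A ⊗ T(A) ⊗ A`. -/

section BarAction

variable {k A H : Type*} [Field k] [Ring A] [Algebra k A] [Ring H] [HopfAlgebra k H]
  [Module H A] [IsScalarTower k H A]

theorem barAct_tmul (h : H) (a b : A) (t : TensorAlgebra k A) :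
    barAct h (((a ⊗ₜ MulOpposite.op b : Env k A)) ⊗ₜ[k] t) =
      sw₃ k h fun x y z => ((x • a) ⊗ₜ MulOpposite.op (z • b) : Env k A) ⊗ₜ[k] tAct y t := by
  rw [barAct]
  exact map_sw₃ (LinearMap.applyₗ (R := k) (M₂ := Env k A ⊗[k] TensorAlgebra k A)
    ((a ⊗ₜ MulOpposite.op b : Env k A) ⊗ₜ[k] t)) h _

theorem isTrilin_barAct (a b : A) (t : TensorAlgebra k A) : IsTrilin k fun x y z : H =>
    ((x • a) ⊗ₜ MulOpposite.op (z • b) : Env k A) ⊗ₜ[k] tAct y t := by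
  constructor
  · intro z
    constructor <;> intros <;>
      simp [tAct_add_left, tAct_smul_left, add_smul, TensorProduct.add_tmul,
        TensorProduct.tmul_add, ← TensorProduct.smul_tmul']
  · intros
    simp [add_smul, TensorProduct.add_tmul, TensorProduct.tmul_add]
  · intros
    simp [TensorProduct.smul_tmul']

theorem bar_induction {P : Env k A ⊗[k] TensorAlgebra k A → Prop}
    (x : Env k A ⊗[k] TensorAlgebra k A)
    (tmul : ∀ (a b : A) (t : TensorAlgebra k A),
      P ((a ⊗ₜ MulOpposite.op b : Env k A) ⊗ₜ[k] t))
    (add : ∀ x y, P x → P y → P (x + y)) : P x := by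
  have zero : P 0 := by
    have := tmul 0 0 0
    rwa [TensorProduct.tmul_zero] at this
  induction x with
  | zero => exact zero
  | add x y hx hy => exact add x y hx hy
  | tmul e t =>
    refine TensorProduct.induction_on (motive := fun e : Env k A => P (e ⊗ₜ t)) e ?_
      (fun a b => tmul a b.unop t) (fun x y hx hy => ?_)
    · rwa [TensorProduct.zero_tmul]
    · rw [TensorProduct.add_tmul]; exact add _ _ hx hy

theorem barAct_add_left (g h : H) (x : Env k A ⊗[k] TensorAlgebra k A) :
    barAct (g + h) x = barAct g x + barAct h x := by
  induction x using bar_induction with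
  | tmul a b t =>
    rw [barAct_tmul, barAct_tmul, barAct_tmul, (isTrilin_barAct a b t).sw₃_add]
  | add x y hx hy => rw [map_add, hx, hy, map_add, map_add, add_add_add_comm]

theorem barAct_smul_left (c : k) (h : H) (x : Env k A ⊗[k] TensorAlgebra k A) :
    barAct (c • h) x = c • barAct h x := by
  induction x using bar_induction with
  | tmul a b t => rw [barAct_tmul, barAct_tmul, (isTrilin_barAct a b t).sw₃_smul]
  | add x y hx hy => rw [map_add, hx, hy, map_add, smul_add]

theorem barAct_one_left (x : Env k A ⊗[k] TensorAlgebra k A) : barAct (1 : H) x = x := by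
  induction x using bar_induction with
  | tmul a b t =>
    rw [barAct_tmul, (isTrilin_barAct a b t).sw₃_one, one_smul, one_smul, tAct_one_left]
  | add x y hx hy => rw [map_add, hx, hy]

theorem barAct_mul_left (g h : H) (x : Env k A ⊗[k] TensorAlgebra k A) :
    barAct (g * h) x = barAct g (barAct h x) := by
  induction x using bar_induction with
  | tmul a b t =>
    rw [barAct_tmul, (isTrilin_barAct a b t).sw₃_mul, barAct_tmul, map_sw₃, sw₃_comm]
    refine sw₃_congr _ fun u v w => ?_
    rw [barAct_tmul]
    refine sw₃_congr _ fun x y z => ?_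
    rw [mul_smul, mul_smul, tAct_mul_left]
  | add x y hx hy => rw [map_add, hx, hy, map_add, map_add]

variable (k A H) in
/-- The diagonal action of `H` on `A ⊗ T(A) ⊗ A`, as a linear map. -/
def barActLin : H →ₗ[k] Module.End k (Env k A ⊗[k] TensorAlgebra k A) where
  toFun := barAct
  map_add' g h := LinearMap.ext (barAct_add_left g h)
  map_smul' c h := LinearMap.ext (barAct_smul_left c h)

variable (k A H) in
/-- The diagonal action of `H` on `A ⊗ T(A) ⊗ A`, as a morphism of algebras. -/
def barRep : H →ₐ[k] Module.End k (Env k A ⊗[k] TensorAlgebra k A) :=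
  AlgHom.ofLinearMap (barActLin k A H) (LinearMap.ext barAct_one_left)
    fun g h => LinearMap.ext (barAct_mul_left g h)

theorem barRep_apply (h : H) (x : Env k A ⊗[k] TensorAlgebra k A) :
    barRep k A H h x = barAct h x := rfl

/-- An `A`-bimodule with a compatible action of `H`: `h(axb) = (h₁a)(h₂x)(h₃b)`. -/
structure IsHBimod {M : Type*} [AddCommGroup M] [Module k M] [Module (Env k A) M]
    (ρ : H →ₐ[k] Module.End k M) : Prop where
  left : ∀ (h : H) (a : A) (x : M), ρ h ((a ⊗ₜ 1 : Env k A) • x) =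
    sw₂ k h fun y z => ((y • a) ⊗ₜ 1 : Env k A) • ρ z x
  right : ∀ (h : H) (a : A) (x : M), ρ h ((1 ⊗ₜ MulOpposite.op a : Env k A) • x) =
    sw₂ k h fun y z => (1 ⊗ₜ MulOpposite.op (z • a) : Env k A) • ρ y x

variable [HModuleAlgebra k H A]

/-- Both rules regroup the fourfold coproduct of `h`. Expanding the leftmost leg takes one
application of coassociativity; expanding the rightmost leg takes two, as it lies at the end of the
nesting of `sw₃`. -/
theorem barRep_isHBimod : IsHBimod (k := k) (A := A) (barRep k A H) where
  left h c x := by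
    induction x using bar_induction with
    | add x y hx hy => simp only [smul_add, map_add, hx, hy, sw₂_add_fun]
    | tmul a b t =>
      rw [TensorProduct.smul_tmul', smul_eq_mul, Algebra.TensorProduct.tmul_mul_tmul, one_mul,
        barRep_apply, barAct_tmul]
      have hT : IsTrilin k fun u v w : H => sw₂ k w fun y z =>
          (((u • c) * (v • a)) ⊗ₜ MulOpposite.op (z • b) : Env k A) ⊗ₜ[k] tAct y t := by
        refine isTrilin_sw₂ (fun u v => ?_) fun y z => ?_ <;> constructor <;> intros <;>
          simp [tAct_add_left, tAct_smul_left, add_smul, add_mul, mul_add, TensorProduct.add_tmul,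
            TensorProduct.tmul_add, ← TensorProduct.smul_tmul']
      have h1 : ∀ x y z : H, ((x • (c * a)) ⊗ₜ MulOpposite.op (z • b) : Env k A) ⊗ₜ[k] tAct y t =
          sw₂ k x fun u v =>
            (((u • c) * (v • a)) ⊗ₜ MulOpposite.op (z • b) : Env k A) ⊗ₜ[k] tAct y t := by
        intro x y z
        rw [HModuleAlgebra.smul_mul' (k := k)]
        simp only [sw₂, TensorProduct.sum_tmul]
      rw [sw₃_congr _ h1, sw₃]
      refine (sw₂_congr _ fun x y => sw₂_comm _ _ _).trans (hT.sw₂_assoc h |>.trans ?_)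
      refine sw₂_congr _ fun x y => ?_
      rw [barRep_apply, barAct_tmul, smul_sw₃]
      refine sw₃_congr _ fun u v w => ?_
      rw [TensorProduct.smul_tmul', smul_eq_mul, Algebra.TensorProduct.tmul_mul_tmul, one_mul]
  right h c x := by
    induction x using bar_induction with
    | add x y hx hy => simp only [smul_add, map_add, hx, hy, sw₂_add_fun]
    | tmul a b t =>
      rw [TensorProduct.smul_tmul', smul_eq_mul, Algebra.TensorProduct.tmul_mul_tmul, one_mul,
        ← MulOpposite.op_mul, barRep_apply, barAct_tmul]
      have hT : ∀ x : H, IsTrilin k fun y u v : H =>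
          ((x • a) ⊗ₜ MulOpposite.op ((u • b) * (v • c)) : Env k A) ⊗ₜ[k] tAct y t := by
        intro x
        constructor
        · intro z
          constructor <;> intros <;>
            simp [tAct_add_left, tAct_smul_left, add_smul, add_mul, mul_add,
              TensorProduct.add_tmul, TensorProduct.tmul_add, ← TensorProduct.smul_tmul']
        all_goals intros
        all_goals simp [add_smul, mul_add, TensorProduct.add_tmul, TensorProduct.tmul_add,
          ← TensorProduct.smul_tmul']
      have hT' : IsTrilin k fun x w v : H => sw₂ k w fun y u =>
          ((x • a) ⊗ₜ MulOpposite.op ((u • b) * (v • c)) : Env k A) ⊗ₜ[k] tAct y t := by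
        refine ⟨fun z => IsTrilin.sw₂_right (F := fun x y u => ((x • a) ⊗ₜ
          MulOpposite.op ((u • b) * (z • c)) : Env k A) ⊗ₜ[k] tAct y t) ?_, ?_, ?_⟩
        · constructor
          · intro z
            constructor <;> intros <;>
              simp [tAct_add_left, tAct_smul_left, add_smul, add_mul, mul_add,
                TensorProduct.add_tmul, TensorProduct.tmul_add, ← TensorProduct.smul_tmul']
          all_goals intros
          all_goals simp [add_smul, add_mul, TensorProduct.add_tmul, TensorProduct.tmul_add,
            ← TensorProduct.smul_tmul']
        · intro x y z z'
          simp [add_smul, mul_add, TensorProduct.add_tmul, TensorProduct.tmul_add, sw₂_add_fun]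
        · intro d x y z
          simp [← TensorProduct.smul_tmul', sw₂_smul_fun]
      have h1 : ∀ x y z : H, ((x • a) ⊗ₜ MulOpposite.op (z • (b * c)) : Env k A) ⊗ₜ[k] tAct y t =
          sw₂ k z fun u v =>
            ((x • a) ⊗ₜ MulOpposite.op ((u • b) * (v • c)) : Env k A) ⊗ₜ[k] tAct y t := by
        intro x y z
        rw [HModuleAlgebra.smul_mul' (k := k)]
        simp only [sw₂, TensorProduct.sum_tmul, TensorProduct.tmul_sum, Finset.op_sum]
      rw [sw₃_congr _ h1, sw₃]
      refine (sw₂_congr _ fun x y => ((hT x).sw₂_assoc y).symm).trans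
        ((hT'.sw₂_assoc h).symm.trans ?_)
      refine sw₂_congr _ fun x y => ?_
      rw [barRep_apply, barAct_tmul, smul_sw₃]
      refine sw₃_congr _ fun u v w => ?_
      rw [TensorProduct.smul_tmul', smul_eq_mul, Algebra.TensorProduct.tmul_mul_tmul, one_mul,
        ← MulOpposite.op_mul]

end BarAction

section Counit

variable {k H M : Type*} [Field k] [Ring H] [HopfAlgebra k H] [AddCommGroup M] [Module k M]

theorem sw₂_counit_left_of {f : H → M} (hf : IsLinearMap k f) (h : H) :
    (sw₂ k h fun x y => Coalgebra.counit (R := k) x • f y) = f h := sw₂_counit_left h hf.mk'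

theorem sw₂_counit_right_of {f : H → M} (hf : IsLinearMap k f) (h : H) :
    (sw₂ k h fun x y => Coalgebra.counit (R := k) y • f x) = f h := sw₂_counit_right h hf.mk'

theorem IsBilin.isLinearMap_sw₂ {F : H → H → M} (hF : IsBilin k F) :
    IsLinearMap k fun h => sw₂ k h F := ⟨hF.sw₂_add, hF.sw₂_smul⟩

end Counit

/-! ### Equivariance of the bar differential. -/

section BarEquivariance

variable {k A H : Type*} [Field k] [Ring A] [Algebra k A] [Ring H] [HopfAlgebra k H]
  [Module H A] [IsScalarTower k H A] [HModuleAlgebra k H A]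

/-- Since `h` acts on `1` by `ε(h)`, the leg of the coproduct that hits `1` is absorbed by the
counit axiom. -/
theorem barAct_one_tmul (h : H) (b : A) (t : TensorAlgebra k A) :
    barAct h ((1 ⊗ₜ MulOpposite.op b : Env k A) ⊗ₜ[k] t) =
      sw₂ k h fun y z => (1 ⊗ₜ MulOpposite.op (z • b) : Env k A) ⊗ₜ[k] tAct y t := by
  have hB : IsBilin k fun y z : H =>
      (1 ⊗ₜ MulOpposite.op (z • b) : Env k A) ⊗ₜ[k] tAct y t := by
    constructor <;> intros <;>
      simp [tAct_add_left, tAct_smul_left, add_smul, TensorProduct.add_tmul,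
        TensorProduct.tmul_add, ← TensorProduct.smul_tmul']
  rw [barAct_tmul, ← sw₂_counit_left_of hB.isLinearMap_sw₂ h, sw₃]
  refine sw₂_congr _ fun x y => ?_
  rw [← sw₂_smul_fun]
  refine sw₂_congr _ fun y z => ?_
  rw [HModuleAlgebra.smul_one' (k := k), ← TensorProduct.smul_tmul', ← TensorProduct.smul_tmul']

theorem barAct_tmul_one (h : H) (a : A) (t : TensorAlgebra k A) :
    barAct h ((a ⊗ₜ 1 : Env k A) ⊗ₜ[k] t) =
      sw₂ k h fun x y => ((x • a) ⊗ₜ 1 : Env k A) ⊗ₜ[k] tAct y t := by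
  rw [← MulOpposite.op_one, barAct_tmul, sw₃]
  refine sw₂_congr _ fun x y => ?_
  have hB : IsLinearMap k fun y : H =>
      ((x • a) ⊗ₜ MulOpposite.op 1 : Env k A) ⊗ₜ[k] tAct y t := by
    constructor <;> intros <;>
      simp [tAct_add_left, tAct_smul_left, TensorProduct.tmul_add]
  rw [← sw₂_counit_right_of hB y]
  refine sw₂_congr _ fun y z => ?_
  rw [HModuleAlgebra.smul_one' (k := k), MulOpposite.op_smul, TensorProduct.tmul_smul,
    ← TensorProduct.smul_tmul']

theorem barAct_one_one_tmul (h : H) (t : TensorAlgebra k A) :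
    barAct h ((1 : Env k A) ⊗ₜ[k] t) = (1 : Env k A) ⊗ₜ[k] tAct h t := by
  have hB : IsLinearMap k fun y : H => (1 : Env k A) ⊗ₜ[k] tAct y t := by
    constructor <;> intros <;>
      simp [tAct_add_left, tAct_smul_left, TensorProduct.tmul_add]
  rw [Algebra.TensorProduct.one_def, barAct_tmul_one, ← Algebra.TensorProduct.one_def,
    ← sw₂_counit_left_of hB h]
  refine sw₂_congr _ fun x y => ?_
  rw [HModuleAlgebra.smul_one' (k := k), ← TensorProduct.smul_tmul', ← TensorProduct.smul_tmul',
    Algebra.TensorProduct.one_def]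

theorem tAct_ι_mul (h : H) (a : A) (t : TensorAlgebra k A) :
    tAct h (TensorAlgebra.ι k a * t) =
      sw₂ k h fun x y => TensorAlgebra.ι k (x • a) * tAct y t := by
  rw [tAct_mul]
  exact sw₂_congr _ fun x y => by rw [tAct_ι]

theorem barAct_dL (h : H) (t : TensorAlgebra k A) :
    barAct h (dL k A t) = dL k A (tAct h t) := by
  induction t using tensor_induction_left with
  | one => rw [tAct_one_right, dL_one, map_zero, map_smul, dL_one, smul_zero]
  | ι_mul a t ih =>
    rw [dL_ι_mul, barAct_tmul_one, tAct_ι_mul, map_sw₂]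
    exact sw₂_congr _ fun x y => (dL_ι_mul _ _).symm
  | add x y hx hy => simp only [map_add, hx, hy]
  | smul c x hx => simp only [map_smul, hx]

theorem barAct_headMul (h : H) (a : A) (t : TensorAlgebra k A) :
    barAct h (headMul k A a t) = sw₂ k h fun x y => headMul k A (x • a) (tAct y t) := by
  induction t using tensor_induction_left with
  | one =>
    rw [headMul_one, barAct_one_tmul]
    have hB : IsLinearMap k fun z : H =>
        (1 ⊗ₜ MulOpposite.op (z • a) : Env k A) ⊗ₜ[k] (1 : TensorAlgebra k A) := by
      constructor <;> intros <;>
        simp [add_smul, TensorProduct.add_tmul, TensorProduct.tmul_add,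
          ← TensorProduct.smul_tmul']
    refine Eq.trans ((sw₂_congr _ fun x y => ?_).trans (sw₂_counit_left_of hB h))
      ((sw₂_congr _ fun x y => ?_).trans (sw₂_counit_right_of hB h)).symm
    · rw [tAct_one_right, TensorProduct.tmul_smul]
    · rw [tAct_one_right, map_smul, headMul_one]
  | ι_mul b t ih =>
    have hT : IsTrilin k fun u v w : H => (1 : Env k A) ⊗ₜ[k]
        (TensorAlgebra.ι k ((u • a) * (v • b)) * tAct w t) := by
      constructor
      · intro z
        constructor <;> intros <;>
          simp [add_smul, add_mul, mul_add, TensorProduct.tmul_add]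
      all_goals intros
      all_goals simp [tAct_add_left, tAct_smul_left, mul_add, TensorProduct.tmul_add]
    rw [headMul_ι_mul, barAct_one_one_tmul, tAct_ι_mul]
    refine (map_sw₂ (TensorProduct.mk k (Env k A) (TensorAlgebra k A) 1) h _).trans ?_
    refine Eq.trans (sw₂_congr _ fun x y => ?_) ((hT.sw₂_assoc h).trans
      (sw₂_congr _ fun x y => ?_))
    · rw [HModuleAlgebra.smul_mul' (k := k), map_sw₂, ← LinearMap.mulRight_apply (R := k),
        map_sw₂, map_sw₂]
      rfl
    · rw [tAct_ι_mul, map_sw₂]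
      exact sw₂_congr _ fun u v => (headMul_ι_mul _ _ _).symm
  | add x y hx hy => simp only [map_add, hx, hy, sw₂_add_fun]
  | smul c x hx => simp only [map_smul, hx, sw₂_smul_fun]

variable (k A) in
/-- The subspace `1 ⊗ T(A) ⊗ A` of `A ⊗ T(A) ⊗ A`. -/
def rightSp : Submodule k (Env k A ⊗[k] TensorAlgebra k A) :=
  Submodule.span k (Set.range fun p : A × TensorAlgebra k A =>
    ((1 ⊗ₜ MulOpposite.op p.1 : Env k A) ⊗ₜ[k] p.2))

theorem mem_rightSp (a : A) (t : TensorAlgebra k A) :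
    ((1 ⊗ₜ MulOpposite.op a : Env k A) ⊗ₜ[k] t) ∈ rightSp k A := Submodule.subset_span ⟨(a, t), rfl⟩

theorem headMul_mem_rightSp (a : A) (t : TensorAlgebra k A) : headMul k A a t ∈ rightSp k A := by
  induction t using tensor_induction_left with
  | one => rw [headMul_one]; exact mem_rightSp _ _
  | ι_mul b t ih => rw [headMul_ι_mul]; exact mem_rightSp 1 _
  | add x y hx hy => rw [map_add]; exact add_mem hx hy
  | smul c x hx => rw [map_smul]; exact Submodule.smul_mem _ _ hx

theorem midMul_mem_rightSp (a : A) {z : Env k A ⊗[k] TensorAlgebra k A} (hz : z ∈ rightSp k A) :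
    midMul k A a z ∈ rightSp k A := by
  induction hz using Submodule.span_induction with
  | mem x h => obtain ⟨⟨b, t⟩, rfl⟩ := h; rw [midMul_tmul]; exact mem_rightSp _ _
  | zero => rw [map_zero]; exact zero_mem _
  | add x y _ _ hx hy => rw [map_add]; exact add_mem hx hy
  | smul c x _ hx =>
    rw [← LinearMap.coe_restrictScalars k, map_smul]; exact Submodule.smul_mem _ _ hx

theorem tailD_mem_rightSp (t : TensorAlgebra k A) : tailD k A t ∈ rightSp k A := by
  induction t using tensor_induction_left with
  | one => rw [tailD_one]; exact zero_mem _
  | ι_mul b t ih =>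
    rw [tailD_ι_mul]
    exact sub_mem (neg_mem (headMul_mem_rightSp _ _)) (midMul_mem_rightSp _ ih)
  | add x y hx hy => rw [map_add]; exact add_mem hx hy
  | smul c x hx => rw [map_smul]; exact Submodule.smul_mem _ _ hx

/-- The restriction to `1 ⊗ T(A) ⊗ A` is needed: with a nontrivial left factor the first leg of `h`
would act on that factor and not on the inserted letter, and `H` is not assumed cocommutative. The
differential without its first term takes values in this subspace (`tailD_mem_rightSp`). -/
theorem barAct_midMul (h : H) (a : A) {z : Env k A ⊗[k] TensorAlgebra k A}
    (hz : z ∈ rightSp k A) : barAct h (midMul k A a z) =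
      sw₂ k h fun x y => midMul k A (x • a) (barAct y z) := by
  induction hz using Submodule.span_induction with
  | mem x hx =>
    obtain ⟨⟨b, t⟩, rfl⟩ := hx
    have hT : IsTrilin k fun u v w : H => (1 ⊗ₜ MulOpposite.op (w • b) : Env k A) ⊗ₜ[k]
        (TensorAlgebra.ι k (u • a) * tAct v t) := by
      constructor
      · intro z
        constructor <;> intros <;>
          simp [tAct_add_left, tAct_smul_left, add_smul, add_mul, mul_add, TensorProduct.tmul_add]
      all_goals intros
      all_goals simp [add_smul, TensorProduct.tmul_add, TensorProduct.add_tmul,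
        ← TensorProduct.smul_tmul']
    rw [midMul_tmul, barAct_one_tmul]
    refine Eq.trans (sw₂_congr _ fun x y => ?_) ((hT.sw₂_assoc h).trans
      (sw₂_congr _ fun x y => ?_))
    · rw [tAct_ι_mul]
      exact map_sw₂ (TensorProduct.mk k (Env k A) (TensorAlgebra k A) _) _ _
    · rw [barAct_one_tmul, map_sw₂]
      exact sw₂_congr _ fun u v => (midMul_tmul _ _ _).symm
  | zero => simp only [map_zero, sw₂_zero_fun]
  | add x y _ _ hx hy => simp only [map_add, hx, hy, sw₂_add_fun]
  | smul c x _ hx =>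
    have e : ∀ (b : A) (z : Env k A ⊗[k] TensorAlgebra k A),
        midMul k A b (c • z) = c • midMul k A b z := fun b z =>
      map_smul ((midMul k A b).restrictScalars k) c z
    simp only [e, map_smul, hx, sw₂_smul_fun]

theorem barAct_tailD (h : H) (t : TensorAlgebra k A) :
    barAct h (tailD k A t) = tailD k A (tAct h t) := by
  induction t using tensor_induction_left generalizing h with
  | one => rw [tAct_one_right, tailD_one, map_zero, map_smul, tailD_one, smul_zero]
  | ι_mul a t ih =>
    rw [tailD_ι_mul, map_sub, map_neg, barAct_headMul, barAct_midMul _ _ (tailD_mem_rightSp t),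
      tAct_ι_mul, map_sw₂]
    simp only [tailD_ι_mul, ih, sub_eq_add_neg]
    rw [sw₂_add_fun, sw₂_neg_fun, sw₂_neg_fun]
  | add x y hx hy => simp only [map_add, hx, hy]
  | smul c x hx => simp only [map_smul, hx]

theorem barAct_barD (h : H) (t : TensorAlgebra k A) :
    barAct h (barD k A t) = barD k A (tAct h t) := by
  rw [barD, LinearMap.add_apply, map_add, barAct_dL, barAct_tailD, LinearMap.add_apply]

end BarEquivariance

/-! ### The action of `H` on the Koszul bimodules. -/

section KoszulAction

variable {k A H : Type*} [Field k] [Ring A] [Algebra k A] [Ring H] [HopfAlgebra k H]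
  [Module H A] [IsScalarTower k H A]

theorem tAct_mem_mul {S S' : Submodule k (TensorAlgebra k A)}
    (hS : ∀ (h : H), ∀ t ∈ S, tAct h t ∈ S) (hS' : ∀ (h : H), ∀ t ∈ S', tAct h t ∈ S') (h : H) :
    ∀ t ∈ S * S', tAct h t ∈ S * S' := by
  suffices S * S' ≤ (S * S').comap (tAct h) from this
  refine Submodule.mul_le.2 fun s hs t ht => ?_
  rw [Submodule.mem_comap, tAct_mul]
  exact Submodule.sum_mem _ fun i _ => Submodule.mul_mem_mul (hS _ s hs) (hS' _ t ht)

theorem tAct_mem_pow {S : Submodule k (TensorAlgebra k A)}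
    (hS : ∀ (h : H), ∀ t ∈ S, tAct h t ∈ S) (n : ℕ) : ∀ h : H, ∀ t ∈ S ^ n, tAct h t ∈ S ^ n := by
  induction n with
  | zero =>
    intro h t ht
    rw [pow_zero, Submodule.mem_one] at *
    obtain ⟨c, rfl⟩ := ht
    exact ⟨c * Coalgebra.counit (R := k) h, by
      rw [Algebra.algebraMap_eq_smul_one, Algebra.algebraMap_eq_smul_one, map_smul,
        tAct_one_right, smul_smul]⟩
  | succ n ih =>
    rw [pow_succ]
    exact tAct_mem_mul ih hS

/-- This is the module algebra axiom for products of arbitrary length. It makes `R`, the kernel of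
the multiplication on `V ⊗ V`, stable under `H`. -/
theorem prodT_tAct [HModuleAlgebra k H A] (h : H) (t : TensorAlgebra k A) :
    prodT k A (tAct h t) = h • prodT k A t := by
  induction t using tensor_induction_left generalizing h with
  | one => rw [tAct_one_right, map_smul, map_one, HModuleAlgebra.smul_one' (k := k) h]
  | ι_mul a t ih =>
    rw [tAct_ι_mul, map_sw₂, map_mul, HModuleAlgebra.smul_mul' (k := k)]
    exact sw₂_congr _ fun x y => by rw [map_mul, prodT_ι, prodT_ι, ih]
  | add x y hx hy => rw [map_add, map_add, hx, hy, map_add, smul_add]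
  | smul c x hx =>
    rw [map_smul, map_smul, hx, map_smul]
    exact (map_smul (hEnd k A H h) c _).symm

variable {𝒜 : ℕ → Submodule k A}

theorem tAct_mem_vSp (hhom : ∀ (h : H) (n : ℕ) (a : A), a ∈ 𝒜 n → h • a ∈ 𝒜 n) (h : H) :
    ∀ t ∈ vSp 𝒜, tAct h t ∈ vSp 𝒜 := by
  rintro _ ⟨a, ha, rfl⟩
  rw [tAct_ι]
  exact ⟨_, hhom h 1 a ha, rfl⟩

variable [HModuleAlgebra k H A]

theorem tAct_mem_relSp (hhom : ∀ (h : H) (n : ℕ) (a : A), a ∈ 𝒜 n → h • a ∈ 𝒜 n) (h : H) :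
    ∀ t ∈ relSp 𝒜, tAct h t ∈ relSp 𝒜 := by
  rintro t ⟨ht, ht'⟩
  refine ⟨tAct_mem_pow (tAct_mem_vSp hhom) 2 h t ht, ?_⟩
  have : prodT k A t = 0 := ht'
  change prodT k A (tAct h t) = 0
  rw [prodT_tAct, this, smul_zero]

theorem tAct_mem_koszulSp (hhom : ∀ (h : H) (n : ℕ) (a : A), a ∈ 𝒜 n → h • a ∈ 𝒜 n) (m : ℕ)
    (h : H) : ∀ t ∈ koszulSp 𝒜 m, tAct h t ∈ koszulSp 𝒜 m := fun t ht =>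
  mem_koszulSp 𝒜 (tAct_mem_pow (tAct_mem_vSp hhom) m h t (koszulSp_le_pow 𝒜 m ht))
    fun u v e => tAct_mem_mul (tAct_mem_mul (tAct_mem_pow (tAct_mem_vSp hhom) u)
      (tAct_mem_relSp hhom)) (tAct_mem_pow (tAct_mem_vSp hhom) v) h t (koszulSp_le 𝒜 m u v e ht)

theorem barAct_mem_koszul (hhom : ∀ (h : H) (n : ℕ) (a : A), a ∈ 𝒜 n → h • a ∈ 𝒜 n) {m : ℕ}
    (h : H) (x : KC 𝒜 m) : barAct h (KC.val 𝒜 x) ∈ koszul 𝒜 m := by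
  induction x using KC.induction with
  | smul a b w =>
    rw [LinearMap.map_smul, KC.val_of, TensorProduct.smul_tmul', smul_eq_mul, mul_one,
      ← MulOpposite.op_unop b, barAct_tmul]
    exact Submodule.sum_mem _ fun i _ => Submodule.sum_mem _ fun j _ =>
      Submodule.tmul_mem_baseChange_of_mem _ (tAct_mem_koszulSp hhom m _ _ w.2)
  | add x y hx hy => rw [map_add, map_add]; exact add_mem hx hy

variable (hhom : ∀ (h : H) (n : ℕ) (a : A), a ∈ 𝒜 n → h • a ∈ 𝒜 n) (m : ℕ)

/-- The restriction to a Koszul bimodule of the action of an element of `H`. -/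
def kcAct (h : H) (x : KC 𝒜 m) : KC 𝒜 m :=
  (⟨barAct h (KC.val 𝒜 x), barAct_mem_koszul hhom h x⟩ : koszul 𝒜 m)

theorem val_kcAct (h : H) (x : KC 𝒜 m) :
    KC.val 𝒜 (kcAct hhom m h x) = barAct h (KC.val 𝒜 x) := rfl

theorem KC.val_smul {m : ℕ} (c : k) (x : KC 𝒜 m) : KC.val 𝒜 (c • x) = c • KC.val 𝒜 x := rfl

/-- The restriction to a Koszul bimodule of the action of an element of `H`, as a linear map. -/
def kcActLin (h : H) : KC 𝒜 m →ₗ[k] KC 𝒜 m where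
  toFun := kcAct hhom m h
  map_add' x y := KC.val_injective 𝒜 (by simp only [val_kcAct, map_add])
  map_smul' c x := KC.val_injective 𝒜 (by
    simp only [val_kcAct, KC.val_smul, map_smul, RingHom.id_apply])

theorem kcActLin_add (g h : H) : kcActLin hhom m (g + h) = kcActLin hhom m g + kcActLin hhom m h :=
  LinearMap.ext fun x => KC.val_injective 𝒜 (by
    rw [LinearMap.add_apply, map_add]
    exact barAct_add_left g h _)

/-- The diagonal action of `H` on a term of the Koszul bimodule complex. -/
def kcRep : H →ₐ[k] Module.End k (KC 𝒜 m) :=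
  AlgHom.ofLinearMap
    { toFun := kcActLin hhom m
      map_add' := kcActLin_add hhom m
      map_smul' := fun c h => LinearMap.ext fun x => KC.val_injective 𝒜 (barAct_smul_left c h _) }
    (LinearMap.ext fun x => KC.val_injective 𝒜 (barAct_one_left _))
    fun g h => LinearMap.ext fun x => KC.val_injective 𝒜 (barAct_mul_left g h _)

theorem val_kcRep (h : H) (x : KC 𝒜 m) :
    KC.val 𝒜 (kcRep hhom m h x) = barAct h (KC.val 𝒜 x) := rfl

theorem kcRep_isHBimod : IsHBimod (k := k) (A := A) (kcRep hhom m) where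
  left h a x := KC.val_injective 𝒜 (by
    rw [val_kcRep, LinearMap.map_smul, map_sw₂]
    refine (barRep_isHBimod.left h a (KC.val 𝒜 x)).trans (sw₂_congr _ fun y z => ?_)
    rw [LinearMap.map_smul, val_kcRep, barRep_apply])
  right h a x := KC.val_injective 𝒜 (by
    rw [val_kcRep, LinearMap.map_smul, map_sw₂]
    refine (barRep_isHBimod.right h a (KC.val 𝒜 x)).trans (sw₂_congr _ fun y z => ?_)
    rw [LinearMap.map_smul, val_kcRep, barRep_apply])

/-- The action of `H` on `(A^!_m)^*`. -/
def wAct (h : H) : koszulSp 𝒜 m →ₗ[k] koszulSp 𝒜 m :=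
  (tAct h).restrict (tAct_mem_koszulSp hhom m h)

theorem coe_wAct (h : H) (w : koszulSp 𝒜 m) :
    (wAct hhom m h w : TensorAlgebra k A) = tAct h (w : TensorAlgebra k A) := rfl

theorem kcRep_of (h : H) (w : koszulSp 𝒜 m) :
    kcRep hhom m h (KC.of 𝒜 w) = KC.of 𝒜 (wAct hhom m h w) :=
  KC.val_injective 𝒜 (by rw [val_kcRep, KC.val_of, barAct_one_one_tmul, KC.val_of, coe_wAct])

theorem wAct_add (g h : H) : wAct hhom m (g + h) = wAct hhom m g + wAct hhom m h :=
  LinearMap.ext fun w => Subtype.ext (by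
    rw [LinearMap.add_apply, Submodule.coe_add, coe_wAct, coe_wAct, coe_wAct, tAct_add_left])

theorem wAct_smul (c : k) (h : H) : wAct hhom m (c • h) = c • wAct hhom m h :=
  LinearMap.ext fun w => Subtype.ext (by
    rw [LinearMap.smul_apply, Submodule.coe_smul, coe_wAct, coe_wAct, tAct_smul_left])

theorem wAct_one : wAct hhom m (1 : H) = LinearMap.id :=
  LinearMap.ext fun w => Subtype.ext (by rw [coe_wAct, tAct_one_left, LinearMap.id_apply])

theorem wAct_mul (g h : H) : wAct hhom m (g * h) = wAct hhom m g ∘ₗ wAct hhom m h :=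
  LinearMap.ext fun w => Subtype.ext (by
    rw [LinearMap.comp_apply, coe_wAct, coe_wAct, coe_wAct, tAct_mul_left])

/-- The action of `H` on `(A^!_m)^*`, as a morphism of algebras. -/
def wRep : H →ₐ[k] Module.End k (koszulSp 𝒜 m) :=
  AlgHom.ofLinearMap
    { toFun := wAct hhom m
      map_add' := wAct_add hhom m
      map_smul' := wAct_smul hhom m }
    (wAct_one hhom m) (wAct_mul hhom m)

theorem wRep_apply (h : H) : wRep hhom m h = wAct hhom m h := rfl

end KoszulAction

section Equivariant

variable {k A H : Type*} [Field k] [Ring A] [Algebra k A] [Ring H] [HopfAlgebra k H]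
  [Module H A] [IsScalarTower k H A] {M N : Type*} [AddCommGroup M] [Module k M]
  [Module (Env k A) M] [AddCommGroup N] [Module k N] [Module (Env k A) N]
  {ρ : H →ₐ[k] Module.End k M} {ρ' : H →ₐ[k] Module.End k N}

theorem env_smul_eq {N : Type*} [AddCommGroup N] [Module (Env k A) N] (a b : A) (x : N) :
    (a ⊗ₜ MulOpposite.op b : Env k A) • x =
      (a ⊗ₜ 1 : Env k A) • (1 ⊗ₜ MulOpposite.op b : Env k A) • x := by
  rw [smul_smul, Algebra.TensorProduct.tmul_mul_tmul, mul_one, one_mul]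

/-- Equivariance of a bimodule map propagates from an element to its multiples. -/
theorem equivariant_smul (hρ : IsHBimod (A := A) ρ) (hρ' : IsHBimod (A := A) ρ')
    (f : M →ₗ[Env k A] N) (a b : A) {x : M} (hx : ∀ h, f (ρ h x) = ρ' h (f x)) (h : H) :
    f (ρ h ((a ⊗ₜ MulOpposite.op b : Env k A) • x)) =
      ρ' h (f ((a ⊗ₜ MulOpposite.op b : Env k A) • x)) := by
  rw [env_smul_eq, hρ.left, LinearMap.map_smul, LinearMap.map_smul, hρ'.left, map_sw₂]
  refine sw₂_congr _ fun y z => ?_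
  rw [LinearMap.map_smul, hρ.right, hρ'.right, map_sw₂]
  refine congrArg _ (sw₂_congr _ fun u v => ?_)
  rw [LinearMap.map_smul, hx]

end Equivariant

/-! ### Equivariance of the Koszul differential and augmentation. -/

section KoszulEquivariance

variable {k A H : Type*} [Field k] [Ring A] [Algebra k A] [Ring H] [HopfAlgebra k H]
  [Module H A] [IsScalarTower k H A] [HModuleAlgebra k H A] {𝒜 : ℕ → Submodule k A}
  (hhom : ∀ (h : H) (n : ℕ) (a : A), a ∈ 𝒜 n → h • a ∈ 𝒜 n)

/-- On the elements `1 ⊗ w ⊗ 1` the differential is the bar differential, which commutes with `H`;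
compatibility with the bimodule structure does the rest. -/
theorem koszulD_kcRep (m : ℕ) (h : H) (x : KC 𝒜 (m + 1)) :
    koszulD 𝒜 m (kcRep hhom (m + 1) h x) = kcRep hhom m h (koszulD 𝒜 m x) := by
  induction x using KC.induction with
  | smul a b w =>
    refine equivariant_smul (kcRep_isHBimod hhom _) (kcRep_isHBimod hhom _) _ a b.unop
      (fun h => KC.val_injective 𝒜 ?_) h
    rw [kcRep_of, val_koszulD_of, val_kcRep, val_koszulD_of, barAct_barD, coe_wAct]
  | add x y hx hy => simp only [map_add, hx, hy]

variable (k A H) in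
/-- The action of `H` on the bimodule `A`. -/
def regRep : H →ₐ[k] Module.End k (Reg A) := hEnd k A H

theorem regRep_toReg (h : H) (a : A) : regRep k A H h (toReg k A a) = toReg k A (h • a) := rfl

theorem regRep_isHBimod : IsHBimod (k := k) (A := A) (regRep k A H) where
  left h a x := by
    obtain ⟨x, rfl⟩ := (toReg k A).surjective x
    rw [← MulOpposite.op_one, reg_smul, regRep_toReg, mul_one, HModuleAlgebra.smul_mul' (k := k),
      map_sw₂]
    exact sw₂_congr _ fun y z => by rw [regRep_toReg, reg_smul, mul_one]
  right h a x := by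
    obtain ⟨x, rfl⟩ := (toReg k A).surjective x
    rw [reg_smul, regRep_toReg, one_mul, HModuleAlgebra.smul_mul' (k := k), map_sw₂]
    exact sw₂_congr _ fun y z => by rw [regRep_toReg, reg_smul, one_mul]

theorem koszulAug_kcRep (h : H) (x : KC 𝒜 0) :
    koszulAug 𝒜 (kcRep hhom 0 h x) = regRep k A H h (koszulAug 𝒜 x) := by
  induction x using KC.induction with
  | smul a b w =>
    refine equivariant_smul (kcRep_isHBimod hhom _) regRep_isHBimod _ a b.unop (fun h => ?_) h
    rw [kcRep_of]
    obtain ⟨c, rfl⟩ := koszulSp_zero w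
    have e : ∀ d : k, koszulAug 𝒜 (KC.of 𝒜 (d • ⟨1, one_mem_koszulSp 𝒜⟩)) =
        toReg k A (d • (1 : A)) := by
      intro d
      rw [koszulAug_of, Submodule.coe_smul, map_smul, map_one, smul_eq_mul, mul_one,
        Algebra.algebraMap_eq_smul_one, map_smul, map_one]
    have e' : wAct hhom 0 h (c • ⟨1, one_mem_koszulSp 𝒜⟩) =
        (c * Coalgebra.counit (R := k) h) • ⟨1, one_mem_koszulSp 𝒜⟩ := by
      apply Subtype.ext
      rw [coe_wAct, Submodule.coe_smul, map_smul, tAct_one_right, Submodule.coe_smul, smul_smul]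
    rw [e', e, e, regRep_toReg, mul_smul, ← HModuleAlgebra.smul_one' (k := k) h]
    exact congrArg _ (map_smul (hEnd k A H h) c 1).symm
  | add x y hx hy => simp only [map_add, hx, hy]

end KoszulEquivariance

/-! ### Algebra morphisms out of the smash product. -/

section SmashLift

variable {k A H : Type*} [Field k] [Ring A] [Algebra k A] [Ring H] [HopfAlgebra k H]
  [Module H A] [IsScalarTower k H A] [HModuleAlgebra k H A]

theorem mk_eq_mul (a : A) (h : H) : Smash.mk a h = inA k A H a * inH k A H h := by
  change _ = smashMul k A H (a ⊗ₜ 1) (1 ⊗ₜ h)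
  simp [smashMul]
  rfl

theorem inH_mul_inA (h : H) (a : A) :
    inH k A H h * inA k A H a = sw₂ k h fun x y => inA k A H (x • a) * inH k A H y := by
  change (Smash.mk 1 h * Smash.mk a 1 : Smash k A H) = _
  rw [Smash.mk_mul_mk]
  exact sw₂_congr _ fun x y => by rw [one_mul, mul_one, mk_eq_mul]

/-- The linear map `A # H → E` with `a # h ↦ α(a) β(h)`. -/
def Smash.liftLin {E : Type*} [Ring E] [Algebra k E] (α : A →ₐ[k] E) (β : H →ₐ[k] E) :
    Smash k A H →ₗ[k] E :=
  (TensorProduct.lift ((LinearMap.mul k E).compl₁₂ α.toLinearMap β.toLinearMap) :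
    A ⊗[k] H →ₗ[k] E)

theorem Smash.liftLin_mk {E : Type*} [Ring E] [Algebra k E] (α : A →ₐ[k] E) (β : H →ₐ[k] E)
    (a : A) (h : H) : Smash.liftLin α β (Smash.mk a h) = α a * β h := rfl

theorem Smash.liftLin_mul {E : Type*} [Ring E] [Algebra k E] {α : A →ₐ[k] E} {β : H →ₐ[k] E}
    (hαβ : ∀ h a, β h * α a = sw₂ k h fun x y => α (x • a) * β y) (x y : Smash k A H) :
    Smash.liftLin α β (x * y) = Smash.liftLin α β x * Smash.liftLin α β y := by
  induction x using Smash.induction with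
  | zero => rw [zero_mul, map_zero, zero_mul]
  | add x x' hx hx' => rw [add_mul, map_add, hx, hx', map_add, add_mul]
  | mk a h =>
    induction y using Smash.induction with
    | zero => rw [mul_zero, map_zero, mul_zero]
    | add y y' hy hy' => rw [mul_add, map_add, hy, hy', map_add, mul_add]
    | mk b g =>
      rw [Smash.mk_mul_mk, map_sw₂, Smash.liftLin_mk, Smash.liftLin_mk, mul_assoc,
        ← mul_assoc (β h), hαβ]
      simp only [Smash.liftLin_mk, map_mul]
      rw [sw₂, sw₂, Finset.sum_mul, Finset.mul_sum]
      simp only [mul_assoc]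

/-- The morphism `A # H → E` defined by compatible morphisms `A → E` and `H → E`. -/
def Smash.lift {E : Type*} [Ring E] [Algebra k E] (α : A →ₐ[k] E) (β : H →ₐ[k] E)
    (hαβ : ∀ h a, β h * α a = sw₂ k h fun x y => α (x • a) * β y) : Smash k A H →ₐ[k] E :=
  AlgHom.ofLinearMap (Smash.liftLin α β)
    ((Smash.liftLin_mk α β 1 1).trans (by rw [map_one, map_one, mul_one]))
    (Smash.liftLin_mul hαβ)

theorem Smash.lift_mk {E : Type*} [Ring E] [Algebra k E] (α : A →ₐ[k] E) (β : H →ₐ[k] E)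
    (hαβ : ∀ h a, β h * α a = sw₂ k h fun x y => α (x • a) * β y) (a : A) (h : H) :
    Smash.lift α β hαβ (Smash.mk a h) = α a * β h := rfl

theorem Smash.lift_inA {E : Type*} [Ring E] [Algebra k E] (α : A →ₐ[k] E) (β : H →ₐ[k] E)
    (hαβ : ∀ h a, β h * α a = sw₂ k h fun x y => α (x • a) * β y) (a : A) :
    Smash.lift α β hαβ (inA k A H a) = α a := by
  change Smash.lift α β hαβ (Smash.mk a 1) = _
  rw [Smash.lift_mk, map_one, mul_one]

theorem Smash.lift_inH {E : Type*} [Ring E] [Algebra k E] (α : A →ₐ[k] E) (β : H →ₐ[k] E)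
    (hαβ : ∀ h a, β h * α a = sw₂ k h fun x y => α (x • a) * β y) (h : H) :
    Smash.lift α β hαβ (inH k A H h) = β h := by
  change Smash.lift α β hαβ (Smash.mk 1 h) = _
  rw [Smash.lift_mk, map_one, one_mul]

variable (k A H) in
/-- The linear map `a # h ↦ ε(h) a`. -/
def smashPr : Smash k A H →ₗ[k] A :=
  (TensorProduct.rid k A).toLinearMap ∘ₗ LinearMap.lTensor A (Coalgebra.counit (R := k) (A := H))

theorem smashPr_mk (a : A) (h : H) :
    smashPr k A H (Smash.mk a h) = Coalgebra.counit (R := k) h • a := rfl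

end SmashLift

/-! ### Generators of `Γ`. -/

section GammaSpan

variable {k A H : Type*} [Field k] [Ring A] [Algebra k A] [Ring H] [HopfAlgebra k H]
  [Module H A] [IsScalarTower k H A] [HModuleAlgebra k H A]

variable (k A H) in
/-- The linear map `b ⊗ g ⊗ y ↦ b ⊗ π(y) g`, where `π(a # h) = ε(h) a`. -/
def gammaFold : Smash k A H ⊗[k] (Hᵐᵒᵖ ⊗[k] (Smash k A H)ᵐᵒᵖ) →ₗ[k] Env k (Smash k A H) :=
  TensorProduct.map LinearMap.id (TensorProduct.lift (LinearMap.mk₂ k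
    (fun g y => MulOpposite.op
      (inA k A H (smashPr k A H y.unop) * inH k A H g.unop))
    (fun g g' y => by simp [mul_add]) (fun c g y => by simp)
    (fun g y y' => by simp [add_mul]) (fun c g y => by simp)))

theorem gammaFold_tmul (b : Smash k A H) (g : H) (y : Smash k A H) :
    gammaFold k A H (b ⊗ₜ (MulOpposite.op g ⊗ₜ MulOpposite.op y)) =
      b ⊗ₜ MulOpposite.op (inA k A H (smashPr k A H y) * inH k A H g) := rfl

/-- The counit inside `smashPr` removes the leg of the coproduct left in the `B`-factor, and the
other leg puts the element of `H` back in its place. -/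
theorem gammaFold_gammaRight (e : Env k (Smash k A H)) :
    gammaFold k A H (gammaRight k A H e) = e := by
  refine TensorProduct.induction_on (motive := fun e : Env k (Smash k A H) =>
    gammaFold k A H (gammaRight k A H e) = e) e (by rw [map_zero, map_zero]) (fun b y => ?_)
    fun x y hx hy => by rw [map_add, map_add, hx, hy]
  induction y using MulOpposite.rec' with | _ y => ?_
  induction y using Smash.induction with
  | zero => rw [MulOpposite.op_zero, TensorProduct.tmul_zero, map_zero, map_zero]
  | add y y' hy hy' =>
    rw [MulOpposite.op_add, TensorProduct.tmul_add, map_add, map_add, hy, hy']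
  | mk a g =>
    have e1 : gammaRight k A H (b ⊗ₜ MulOpposite.op (Smash.mk a g)) = sw₂ k g fun u v =>
        b ⊗ₜ (MulOpposite.op v ⊗ₜ MulOpposite.op (Smash.mk a u)) := by
      simp only [gammaRight, Algebra.TensorProduct.map_tmul, AlgHom.comp_apply,
        AlgHom.op_apply_apply, MulOpposite.unop_op]
      have : coact k A H (Smash.mk a g) = sw₂ k g fun x y => Smash.mk a x ⊗ₜ y :=
        coactLin_mk k A H a g
      rw [this]
      simp only [sw₂, map_sum, TensorProduct.tmul_sum, Finset.op_sum]
      rfl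
    have hf : IsLinearMap k fun v : H => (b ⊗ₜ MulOpposite.op (Smash.mk a v) :
        Env k (Smash k A H)) := by
      constructor <;> intros <;>
        simp [mk_eq_mul, mul_add, TensorProduct.tmul_add]
    rw [e1, map_sw₂, ← sw₂_counit_left_of hf g]
    refine sw₂_congr _ fun u v => ?_
    rw [gammaFold_tmul, smashPr_mk, mk_eq_mul, map_smul, smul_mul_assoc, MulOpposite.op_smul,
      TensorProduct.tmul_smul]

/-- `Γ` is spanned by the elements `a h₁ ⊗ a' S(h₂)`. -/
theorem gammaFold_gammaLeft (a : A) (h : H) (y : Smash k A H) :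
    gammaFold k A H (gammaLeft k A H (Smash.mk a h ⊗ₜ MulOpposite.op y)) =
      ((envGam k A H (a ⊗ₜ 1) * hopfGam k A H h *
        envGam k A H (1 ⊗ₜ MulOpposite.op (smashPr k A H y)) : Gam k A H) :
          Env k (Smash k A H)) := by
  have e1 : gammaLeft k A H (Smash.mk a h ⊗ₜ MulOpposite.op y) = sw₂ k h fun u v =>
      Smash.mk a u ⊗ₜ (MulOpposite.op (HopfAlgebra.antipode k v) ⊗ₜ MulOpposite.op y) := by
    simp only [gammaLeft, Algebra.TensorProduct.map_tmul, AlgHom.comp_apply]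
    have : coact k A H (Smash.mk a h) = sw₂ k h fun x y => Smash.mk a x ⊗ₜ y :=
      coactLin_mk k A H a h
    rw [this]
    simp only [sw₂, map_sum, TensorProduct.sum_tmul]
    rfl
  have e2 : ∀ e, ((envGam k A H e : Gam k A H) : Env k (Smash k A H)) = envIn k A H e :=
    fun _ => rfl
  have e3 : ((hopfGam k A H h : Gam k A H) : Env k (Smash k A H)) = sw₂ k h fun x y =>
    inH k A H x ⊗ₜ MulOpposite.op (inH k A H (HopfAlgebra.antipode k y)) := rfl
  rw [e1, map_sw₂, Subalgebra.coe_mul, Subalgebra.coe_mul, e2, e2, e3, sw₂, sw₂, Finset.mul_sum,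
    Finset.sum_mul]
  refine Finset.sum_congr rfl fun i _ => ?_
  rw [gammaFold_tmul, mk_eq_mul]
  simp [envIn]

/-- The two maps whose equalizer is `Γ` agree on `γ`. Folding one of the values returns `γ`, and
folding the other gives a sum of the products in question (`gammaFold_gammaLeft`). So `Γ` is spanned
by these products. -/
theorem Gam.induction {P : Gam k A H → Prop} (γ : Gam k A H)
    (gen : ∀ (a : A) (h : H) (a' : A), P (envGam k A H (a ⊗ₜ 1) * hopfGam k A H h *
        envGam k A H (1 ⊗ₜ MulOpposite.op a')))
    (add : ∀ x y, P x → P y → P (x + y)) : P γ := by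
  have zero : P 0 := by
    have := gen 0 0 0
    rwa [TensorProduct.zero_tmul, map_zero, zero_mul, zero_mul] at this
  have key : ∀ e : Env k (Smash k A H), ∃ γ : Gam k A H, P γ ∧
      gammaFold k A H (gammaLeft k A H e) = γ := by
    intro e
    refine TensorProduct.induction_on (motive := fun e : Env k (Smash k A H) =>
      ∃ γ : Gam k A H, P γ ∧ gammaFold k A H (gammaLeft k A H e) = γ) e
      ⟨0, zero, by rw [map_zero, map_zero]; rfl⟩ (fun b y => ?_) ?_
    · induction y using MulOpposite.rec' with | _ y => ?_
      induction b using Smash.induction with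
      | zero => exact ⟨0, zero, by rw [TensorProduct.zero_tmul, map_zero, map_zero]; rfl⟩
      | add b b' hb hb' =>
        obtain ⟨γ, h, e⟩ := hb
        obtain ⟨γ', h', e'⟩ := hb'
        exact ⟨γ + γ', add _ _ h h', by rw [TensorProduct.add_tmul, map_add, map_add, e, e']; rfl⟩
      | mk a h => exact ⟨_, gen a h _, gammaFold_gammaLeft a h y⟩
    · rintro x y ⟨γ, h, e⟩ ⟨γ', h', e'⟩
      exact ⟨γ + γ', add _ _ h h', by rw [map_add, map_add, e, e']; rfl⟩
  obtain ⟨γ', h, e⟩ := key γ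
  have hγ : gammaLeft k A H γ = gammaRight k A H γ := γ.2
  rw [hγ, gammaFold_gammaRight] at e
  rwa [Subtype.ext e]

end GammaSpan

/-! ### The one-sided actions of `B` on `M ⊗ H`, where `x ⊗ g` stands for `xg`. -/

section Sigma

variable {k A H : Type*} [Field k] [Ring A] [Algebra k A] [Ring H] [HopfAlgebra k H]
  [Module H A] [IsScalarTower k H A]
  {M : Type*} [AddCommGroup M] [Module k M] [Module (Env k A) M] [IsScalarTower k (Env k A) M]

theorem sw₂_apply {X Y : Type*} [AddCommGroup X] [Module k X] [AddCommGroup Y] [Module k Y] (h : H)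
    (F : H → H → X →ₗ[k] Y) (x : X) : sw₂ k h F x = sw₂ k h fun u v => F u v x :=
  LinearMap.sum_apply _ _ _

variable (k A M) in
/-- The action of `Aᵉ` on a bimodule, as a morphism of algebras. -/
def envEnd : Env k A →ₐ[k] Module.End k M := Algebra.lsmul k k M

variable (k A H M) in
/-- The action `a(x ⊗ g) = ax ⊗ g` of `A` on `M ⊗ H`. -/
def indL : A →ₐ[k] Module.End k (M ⊗[k] H) :=
  (Module.End.rTensorAlgHom k M H).comp ((envEnd k A M).comp Algebra.TensorProduct.includeLeft)

theorem indL_tmul (a : A) (x : M) (g : H) :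
    indL k A H M a (x ⊗ₜ g) = ((a ⊗ₜ 1 : Env k A) • x) ⊗ₜ g := rfl

/-- The action `h(x ⊗ g) = h₁x ⊗ h₂g` of `H` on `M ⊗ H`. -/
def indDiag (ρ : H →ₐ[k] Module.End k M) : H →ₐ[k] Module.End k (M ⊗[k] H) :=
  (Module.endTensorEndAlgHom (R := k) (S := k) (A := k) (M := M) (N := H)).comp
    ((Algebra.TensorProduct.map ρ (Algebra.lmul k H)).comp (Bialgebra.comulAlgHom k H))

theorem indDiag_tmul (ρ : H →ₐ[k] Module.End k M) (h : H) (x : M) (g : H) :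
    indDiag ρ h (x ⊗ₜ g) = sw₂ k h fun u v => ρ u x ⊗ₜ (v * g) := by
  change Module.endTensorEndAlgHom (R := k) (S := k) (A := k) (M := M) (N := H)
      (Algebra.TensorProduct.map ρ (Algebra.lmul k H) (Coalgebra.comul h)) _ = _
  conv_lhs => rw [← (Coalgebra.Repr.arbitrary k h).eq]
  rw [map_sum, map_sum, LinearMap.sum_apply]
  rfl

theorem isBilin_indR (a : A) (x : M) : IsBilin k fun u v : H =>
    ((1 ⊗ₜ MulOpposite.op (u • a) : Env k A) • x) ⊗ₜ[k] v := by
  constructor <;> intros <;>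
    simp [add_smul, TensorProduct.add_tmul, TensorProduct.tmul_add, ← TensorProduct.smul_tmul']

/-- The right action `(x ⊗ g)a = x(g₁a) ⊗ g₂` of an element of `A` on `M ⊗ H`. -/
def indRAux (a : A) : M ⊗[k] H →ₗ[k] M ⊗[k] H :=
  TensorProduct.lift (LinearMap.mk₂ k
    (fun x g => sw₂ k g fun u v => ((1 ⊗ₜ MulOpposite.op (u • a) : Env k A) • x) ⊗ₜ[k] v)
    (fun x y g => by simp only [smul_add, TensorProduct.add_tmul, sw₂_add_fun])
    (fun c x g => by simp only [smul_comm _ c x, ← TensorProduct.smul_tmul', sw₂_smul_fun])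
    (fun x g g' => (isBilin_indR a x).sw₂_add g g')
    (fun c x g => (isBilin_indR a x).sw₂_smul c g))

theorem indRAux_tmul (a : A) (x : M) (g : H) : indRAux a (x ⊗ₜ[k] g) =
    sw₂ k g fun u v => ((1 ⊗ₜ MulOpposite.op (u • a) : Env k A) • x) ⊗ₜ[k] v := rfl

theorem indRAux_add (a b : A) :
    (indRAux (a + b) : M ⊗[k] H →ₗ[k] M ⊗[k] H) = indRAux a + indRAux b := by
  refine TensorProduct.ext' fun x g => ?_
  rw [LinearMap.add_apply, indRAux_tmul, indRAux_tmul, indRAux_tmul, ← sw₂_add_fun]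
  refine sw₂_congr _ fun u v => ?_
  rw [smul_add, MulOpposite.op_add, TensorProduct.tmul_add, add_smul, TensorProduct.add_tmul]

theorem indRAux_smul (c : k) (a : A) :
    (indRAux (c • a) : M ⊗[k] H →ₗ[k] M ⊗[k] H) = c • indRAux a := by
  refine TensorProduct.ext' fun x g => ?_
  rw [LinearMap.smul_apply, indRAux_tmul, indRAux_tmul, ← sw₂_smul_fun]
  refine sw₂_congr _ fun u v => ?_
  have : u • c • a = c • u • a := map_smul (hEnd k A H u) c a
  rw [this, MulOpposite.op_smul, TensorProduct.tmul_smul, smul_assoc, TensorProduct.smul_tmul']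

variable [HModuleAlgebra k H A]

theorem indRAux_one : (indRAux (1 : A) : M ⊗[k] H →ₗ[k] M ⊗[k] H) = LinearMap.id := by
  refine TensorProduct.ext' fun x g => ?_
  have hf : IsLinearMap k fun v : H => x ⊗ₜ[k] v :=
    ⟨TensorProduct.tmul_add x, fun c v => TensorProduct.tmul_smul c x v⟩
  rw [LinearMap.id_apply, indRAux_tmul, ← sw₂_counit_left_of hf g]
  refine sw₂_congr _ fun u v => ?_
  rw [HModuleAlgebra.smul_one' (k := k), MulOpposite.op_smul, TensorProduct.tmul_smul, smul_assoc,
    MulOpposite.op_one, ← Algebra.TensorProduct.one_def, one_smul, TensorProduct.smul_tmul']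

theorem indRAux_mul (a b : A) :
    (indRAux (a * b) : M ⊗[k] H →ₗ[k] M ⊗[k] H) = indRAux b ∘ₗ indRAux a := by
  refine TensorProduct.ext' fun x g => ?_
  have hT : IsTrilin k fun u v w : H =>
      ((1 ⊗ₜ MulOpposite.op ((u • a) * (v • b)) : Env k A) • x) ⊗ₜ[k] w := by
    constructor
    · intro w
      constructor <;> intros <;>
        simp [add_smul, add_mul, mul_add, TensorProduct.add_tmul, TensorProduct.tmul_add,
          ← TensorProduct.smul_tmul']
    all_goals intros
    all_goals simp [TensorProduct.tmul_add]
  rw [LinearMap.comp_apply, indRAux_tmul, indRAux_tmul, map_sw₂]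
  refine Eq.trans (sw₂_congr _ fun u v => ?_) ((hT.sw₂_assoc g).trans (sw₂_congr _ fun u v => ?_))
  · rw [HModuleAlgebra.smul_mul' (k := k)]
    simp only [sw₂, Finset.op_sum, TensorProduct.tmul_sum, Finset.sum_smul, TensorProduct.sum_tmul]
  · rw [indRAux_tmul]
    refine sw₂_congr _ fun v w => ?_
    rw [smul_smul, Algebra.TensorProduct.tmul_mul_tmul, one_mul, ← MulOpposite.op_mul]

variable (k A H M) in
/-- The right action `(x ⊗ g)a = x(g₁a) ⊗ g₂` of `A` on `M ⊗ H`. -/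
def indR : A →ₐ[k] (Module.End k (M ⊗[k] H))ᵐᵒᵖ :=
  AlgHom.ofLinearMap
    { toFun := fun a => MulOpposite.op (indRAux a)
      map_add' := fun a b => congrArg MulOpposite.op (indRAux_add a b)
      map_smul' := fun c a => congrArg MulOpposite.op (indRAux_smul c a) }
    (congrArg MulOpposite.op indRAux_one)
    fun a b => congrArg MulOpposite.op (indRAux_mul a b)

variable (k H M) in
/-- The right action `(x ⊗ g)h = x ⊗ gh` of `H` on `M ⊗ H`. -/
def indRH : H →ₐ[k] (Module.End k (M ⊗[k] H))ᵐᵒᵖ :=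
  AlgHom.ofLinearMap
    { toFun := fun h => MulOpposite.op (LinearMap.lTensor M (LinearMap.mulRight k h))
      map_add' := fun a b => congrArg MulOpposite.op (by
        refine TensorProduct.ext' fun x g => ?_
        simp [mul_add, TensorProduct.tmul_add])
      map_smul' := fun c a => congrArg MulOpposite.op (by
        refine TensorProduct.ext' fun x g => ?_
        simp) }
    (congrArg MulOpposite.op (by
      refine TensorProduct.ext' fun x g => ?_
      simp))
    fun a b => congrArg MulOpposite.op (by
      refine TensorProduct.ext' fun x g => ?_
      simp [mul_assoc])

theorem indRH_tmul (h : H) (x : M) (g : H) : (indRH k H M h).unop (x ⊗ₜ g) = x ⊗ₜ (g * h) := rfl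

theorem indR_tmul (a : A) (x : M) (g : H) : (indR k A H M a).unop (x ⊗ₜ[k] g) =
    sw₂ k g fun u v => ((1 ⊗ₜ MulOpposite.op (u • a) : Env k A) • x) ⊗ₜ[k] v := rfl

/-- The left action of `A # H` on `M ⊗ H`. -/
def sigmaL {ρ : H →ₐ[k] Module.End k M} (hρ : IsHBimod (A := A) ρ) :
    Smash k A H →ₐ[k] Module.End k (M ⊗[k] H) :=
  Smash.lift (indL k A H M) (indDiag ρ) fun h a => by
    refine TensorProduct.ext' fun x g => ?_
    have hT : IsTrilin k fun u v w : H =>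
        (((u • a) ⊗ₜ 1 : Env k A) • ρ v x) ⊗ₜ[k] (w * g) := by
      have hc : ∀ (e : Env k A) (c : k) (y : M), e • c • y = c • e • y := fun e c y =>
        smul_comm e c y
      constructor
      · intro w
        constructor <;> intros <;>
          simp [hc, add_smul, TensorProduct.add_tmul, ← TensorProduct.smul_tmul']
      all_goals intros
      all_goals simp [add_mul, TensorProduct.tmul_add]
    rw [Module.End.mul_apply, indL_tmul, indDiag_tmul, sw₂_apply]
    refine Eq.trans (sw₂_congr _ fun u v => ?_) ((hT.sw₂_assoc h).trans
      (sw₂_congr _ fun u v => ?_))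
    · rw [hρ.left]
      simp only [sw₂, TensorProduct.sum_tmul]
    · rw [Module.End.mul_apply, indDiag_tmul, map_sw₂]
      rfl

variable (k A H M) in
/-- The right action of `A # H` on `M ⊗ H`. -/
def sigmaR : Smash k A H →ₐ[k] (Module.End k (M ⊗[k] H))ᵐᵒᵖ :=
  Smash.lift (indR k A H M) (indRH k H M) fun h a => by
    apply MulOpposite.unop_injective
    refine TensorProduct.ext' fun x g => ?_
    have e : (sw₂ k h fun u v => indR k A H M (u • a) * indRH k H M v).unop (x ⊗ₜ[k] g) =
        sw₂ k h fun u v => (indRH k H M v).unop ((indR k A H M (u • a)).unop (x ⊗ₜ[k] g)) := by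
      simp only [sw₂, Finset.unop_sum, LinearMap.sum_apply]
      rfl
    rw [e, MulOpposite.unop_mul, Module.End.mul_apply, indRH_tmul, indR_tmul,
      (isBilin_indR a x).sw₂_mul, sw₂_comm]
    refine sw₂_congr _ fun u v => ?_
    rw [indR_tmul, map_sw₂]
    refine sw₂_congr _ fun y z => ?_
    rw [indRH_tmul, mul_smul]

end Sigma

/-! ### From a compatible `H`-action to a `Γ`-action. -/

section GammaAction

variable {k A H : Type*} [Field k] [Ring A] [Algebra k A] [Ring H] [HopfAlgebra k H]
  [Module H A] [IsScalarTower k H A] [HModuleAlgebra k H A]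
  {M : Type*} [AddCommGroup M] [Module k M] [Module (Env k A) M] [IsScalarTower k (Env k A) M]
  {ρ : H →ₐ[k] Module.End k M} (hρ : IsHBimod (A := A) ρ)

theorem commute_smash {E : Type*} [Ring E] [Algebra k E] {φ : Smash k A H →ₐ[k] E} {e : E}
    (hA : ∀ a, Commute (φ (inA k A H a)) e) (hH : ∀ h, Commute (φ (inH k A H h)) e)
    (b : Smash k A H) : Commute (φ b) e := by
  induction b using Smash.induction with
  | zero => rw [map_zero]; exact Commute.zero_left _
  | mk a h => rw [mk_eq_mul, map_mul]; exact (hA a).mul_left (hH h)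
  | add x y hx hy => rw [map_add]; exact hx.add_left hy

theorem sigmaL_inA (a : A) : sigmaL hρ (inA k A H a) = indL k A H M a := Smash.lift_inA _ _ _ a

theorem sigmaL_inH (h : H) : sigmaL hρ (inH k A H h) = indDiag ρ h := Smash.lift_inH _ _ _ h

theorem sigmaR_inA (a : A) : sigmaR k A H M (inA k A H a) = indR k A H M a :=
  Smash.lift_inA _ _ _ a

theorem sigmaR_inH (h : H) : sigmaR k A H M (inH k A H h) = indRH k H M h :=
  Smash.lift_inH _ _ _ h

theorem indL_comm_indR (a b : A) : indL k A H M a * (indR k A H M b).unop =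
    (indR k A H M b).unop * indL k A H M a := by
  refine TensorProduct.ext' fun x g => ?_
  rw [Module.End.mul_apply, Module.End.mul_apply, indR_tmul, indL_tmul, indR_tmul, map_sw₂]
  refine sw₂_congr _ fun u v => ?_
  rw [indL_tmul, smul_smul, smul_smul, Algebra.TensorProduct.tmul_mul_tmul,
    Algebra.TensorProduct.tmul_mul_tmul, one_mul, one_mul, mul_one, mul_one]

theorem indL_comm_indRH (a : A) (h : H) : indL k A H M a * (indRH k H M h).unop =
    (indRH k H M h).unop * indL k A H M a :=
  TensorProduct.ext' fun _ _ => rfl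

theorem indDiag_comm_indRH (ρ : H →ₐ[k] Module.End k M) (g h : H) :
    indDiag ρ g * (indRH k H M h).unop = (indRH k H M h).unop * indDiag ρ g := by
  refine TensorProduct.ext' fun x u => ?_
  rw [Module.End.mul_apply, Module.End.mul_apply, indRH_tmul, indDiag_tmul, indDiag_tmul, map_sw₂]
  refine sw₂_congr _ fun u v => ?_
  rw [indRH_tmul, mul_assoc]

include hρ in
-- Both composites send `x ⊗ g` to `∑ (h₁x)(h₂g₁a) ⊗ h₃g₂`.
theorem indDiag_comm_indR (h : H) (a : A) :
    indDiag ρ h * (indR k A H M a).unop = (indR k A H M a).unop * indDiag ρ h := by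
  refine TensorProduct.ext' fun x g => ?_
  have hc : ∀ (e : Env k A) (c : k) (y : M), e • c • y = c • e • y := fun e c y =>
    smul_comm e c y
  have hT : ∀ u v : H, IsTrilin k fun y z w : H =>
      ((1 ⊗ₜ MulOpposite.op (z • u • a) : Env k A) • ρ y x) ⊗ₜ[k] (w * v) := by
    intro u v
    constructor
    · intro w
      constructor <;> intros <;>
        simp [hc, add_smul, TensorProduct.add_tmul, TensorProduct.tmul_add,
          ← TensorProduct.smul_tmul']
    all_goals intros
    all_goals simp [add_mul, TensorProduct.tmul_add]
  rw [Module.End.mul_apply, Module.End.mul_apply, indR_tmul, indDiag_tmul, map_sw₂, map_sw₂]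
  have e1 : ∀ u v : H, indDiag ρ h (((1 ⊗ₜ MulOpposite.op (u • a) : Env k A) • x) ⊗ₜ[k] v) =
      sw₂ k h fun y z => sw₂ k z fun z w =>
        ((1 ⊗ₜ MulOpposite.op (z • u • a) : Env k A) • ρ y x) ⊗ₜ[k] (w * v) := by
    intro u v
    rw [indDiag_tmul, ← (hT u v).sw₂_assoc h]
    refine sw₂_congr _ fun y z => ?_
    rw [hρ.right]
    simp only [sw₂, TensorProduct.sum_tmul]
  rw [sw₂_congr _ e1, sw₂_comm]
  refine sw₂_congr _ fun y z => ?_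
  rw [indR_tmul, (isBilin_indR a _).sw₂_mul, sw₂_comm]
  simp only [mul_smul]

/-- The action of `Bᵉ` on `M ⊗ H`, for `B = A # H`. -/
def sigma : Env k (Smash k A H) →ₐ[k] Module.End k (M ⊗[k] H) :=
  Algebra.TensorProduct.lift (sigmaL hρ) (AlgHom.opComm (sigmaR k A H M)) fun b y => by
    -- The left and right actions of `B` need only be seen to commute on the generators from `A` and
    -- `H`, which leaves four relations.
    have hR : ∀ e : Module.End k (M ⊗[k] H),
        (∀ a, Commute (MulOpposite.op e) (indR k A H M a)) →
        (∀ h, Commute (MulOpposite.op e) (indRH k H M h)) →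
        Commute e (AlgHom.opComm (sigmaR k A H M) y) := fun e h1 h2 => by
      have := commute_smash (φ := sigmaR k A H M) (e := MulOpposite.op e)
        (fun a => by rw [sigmaR_inA]; exact (h1 a).symm)
        (fun h => by rw [sigmaR_inH]; exact (h2 h).symm) y.unop
      exact (congrArg MulOpposite.unop this.eq)
    refine commute_smash (fun a => ?_) (fun h => ?_) b
    · rw [sigmaL_inA]
      exact hR _ (fun a' => MulOpposite.unop_injective (indL_comm_indR a a').symm)
        fun h => MulOpposite.unop_injective (indL_comm_indRH a h).symm
    · rw [sigmaL_inH]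
      exact hR _ (fun a' => MulOpposite.unop_injective (indDiag_comm_indR hρ h a').symm)
        fun g => MulOpposite.unop_injective (indDiag_comm_indRH ρ h g).symm

theorem sigma_tmul (b y : Smash k A H) (z : M ⊗[k] H) :
    sigma hρ (b ⊗ₜ MulOpposite.op y) z = sigmaL hρ b ((sigmaR k A H M y).unop z) := by
  rw [sigma, Algebra.TensorProduct.lift_tmul]
  rfl

theorem sigma_env (a b : A) (x : M) :
    sigma hρ (envIn k A H (a ⊗ₜ MulOpposite.op b)) (x ⊗ₜ 1) =
      ((a ⊗ₜ MulOpposite.op b : Env k A) • x) ⊗ₜ 1 := by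
  have : envIn k A H (a ⊗ₜ MulOpposite.op b) = inA k A H a ⊗ₜ MulOpposite.op (inA k A H b) := by
    simp [envIn]
  rw [this, sigma_tmul, sigmaL_inA, sigmaR_inA, indR_tmul, (isBilin_indR b x).sw₂_one, indL_tmul,
    one_smul, ← env_smul_eq]

theorem coe_hopfGam (h : H) : ((hopfGam k A H h : Gam k A H) : Env k (Smash k A H)) =
    sw₂ k h fun x y => inH k A H x ⊗ₜ MulOpposite.op (inH k A H (HopfAlgebra.antipode k y)) := rfl

theorem coe_envGam (e : Env k A) :
    ((envGam k A H e : Gam k A H) : Env k (Smash k A H)) = envIn k A H e := rfl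

/-- The element acts on `x ⊗ 1` by `∑ h₁x ⊗ h₂S(h₃)`, and the antipode cancels the second factor. -/
theorem sigma_hopf (h : H) (x : M) :
    sigma hρ (hopfGam k A H h : Env k (Smash k A H)) (x ⊗ₜ 1) = ρ h x ⊗ₜ 1 := by
  have hT : IsTrilin k fun u v w : H => ρ u x ⊗ₜ[k] (v * HopfAlgebra.antipode k w) := by
    constructor
    · intro w
      constructor <;> intros <;>
        simp [add_mul, TensorProduct.add_tmul, TensorProduct.tmul_add, TensorProduct.smul_tmul']
    all_goals intros
    all_goals simp [mul_add, TensorProduct.tmul_add]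
  rw [coe_hopfGam, map_sw₂, sw₂_apply]
  refine Eq.trans (sw₂_congr _ fun u v => ?_) ((hT.sw₂_assoc h).trans ?_)
  · rw [sigma_tmul, sigmaL_inH, sigmaR_inH, ← Module.End.mul_apply, indDiag_comm_indRH,
      Module.End.mul_apply, indDiag_tmul, map_sw₂]
    refine sw₂_congr _ fun y z => ?_
    rw [indRH_tmul, mul_one]
  · have hf : IsLinearMap k fun u : H => ρ u x ⊗ₜ[k] (1 : H) := by
      constructor <;> intros <;> simp [TensorProduct.add_tmul, TensorProduct.smul_tmul']
    rw [← sw₂_counit_right_of hf h]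
    refine sw₂_congr _ fun u v => ?_
    exact sw₂_antipode_right v (TensorProduct.mk k M H (ρ u x))

variable (k H M) in
/-- The linear map `x ⊗ h ↦ ε(h) x`. -/
def tensorPr : M ⊗[k] H →ₗ[k] M :=
  (TensorProduct.rid k M).toLinearMap ∘ₗ LinearMap.lTensor M (Coalgebra.counit (R := k) (A := H))

theorem tensorPr_tmul_one (x : M) : tensorPr k H M (x ⊗ₜ 1) = x := by
  simp [tensorPr]

/-- The subspace `M ⊗ 1` is stable under `Aᵉ` and the elements `∑ h₁ ⊗ S h₂`, hence under `Γ`.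
Restricting an existing action of `Bᵉ` to it defines the action of `Γ` on `M` without any relations
of `Γ` having to be checked. -/
theorem sigma_gam (γ : Gam k A H) (x : M) :
    sigma hρ (γ : Env k (Smash k A H)) (x ⊗ₜ 1) =
      tensorPr k H M (sigma hρ (γ : Env k (Smash k A H)) (x ⊗ₜ 1)) ⊗ₜ 1 := by
  suffices ∃ y : M, sigma hρ (γ : Env k (Smash k A H)) (x ⊗ₜ 1) = y ⊗ₜ 1 by
    obtain ⟨y, hy⟩ := this
    rw [hy, tensorPr_tmul_one]
  induction γ using Gam.induction with
  | gen a h a' =>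
    refine ⟨(a ⊗ₜ MulOpposite.op 1 : Env k A) • ρ h ((1 ⊗ₜ MulOpposite.op a' : Env k A) • x), ?_⟩
    rw [Subalgebra.coe_mul, Subalgebra.coe_mul, map_mul, map_mul, Module.End.mul_apply,
      Module.End.mul_apply, coe_envGam, coe_envGam, sigma_env, sigma_hopf, ← MulOpposite.op_one, sigma_env]
  | add γ γ' h h' =>
    obtain ⟨y, hy⟩ := h
    obtain ⟨y', hy'⟩ := h'
    exact ⟨y + y', by
      rw [Subalgebra.coe_add, map_add, LinearMap.add_apply, hy, hy', TensorProduct.add_tmul]⟩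

/-- The action of `Γ` on a bimodule with a compatible action of `H`. -/
def gamAct : Gam k A H →ₐ[k] Module.End k M :=
  AlgHom.ofLinearMap
    { toFun := fun γ => tensorPr k H M ∘ₗ sigma hρ (γ : Env k (Smash k A H)) ∘ₗ
        (TensorProduct.mk k M H).flip 1
      map_add' := fun γ γ' => by
        refine LinearMap.ext fun x => ?_
        simp
      map_smul' := fun c γ => by
        refine LinearMap.ext fun x => ?_
        simp }
    (by
      refine LinearMap.ext fun x => ?_
      change tensorPr k H M (sigma hρ 1 (x ⊗ₜ 1)) = x
      rw [map_one, Module.End.one_apply, tensorPr_tmul_one])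
    fun γ γ' => by
      refine LinearMap.ext fun x => ?_
      change tensorPr k H M (sigma hρ (γ * γ') (x ⊗ₜ 1)) =
        tensorPr k H M (sigma hρ γ (tensorPr k H M (sigma hρ γ' (x ⊗ₜ 1)) ⊗ₜ 1))
      rw [← sigma_gam, map_mul, Module.End.mul_apply]

theorem sigma_gam_tmul (γ : Gam k A H) (x : M) :
    sigma hρ (γ : Env k (Smash k A H)) (x ⊗ₜ 1) = gamAct hρ γ x ⊗ₜ 1 := sigma_gam hρ γ x

theorem gamAct_apply (γ : Gam k A H) (x : M) : gamAct hρ γ x =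
    tensorPr k H M (sigma hρ (γ : Env k (Smash k A H)) (x ⊗ₜ 1)) := rfl

theorem gamAct_hopf (h : H) (x : M) : gamAct hρ (hopfGam k A H h) x = ρ h x := by
  rw [gamAct_apply, sigma_hopf, tensorPr_tmul_one]

theorem gamAct_env (e : Env k A) (x : M) : gamAct hρ (envGam k A H e) x = e • x := by
  refine TensorProduct.induction_on (motive := fun e : Env k A =>
    gamAct hρ (envGam k A H e) x = e • x) e ?_ (fun a b => ?_) fun e e' h h' => ?_
  · rw [map_zero, map_zero, LinearMap.zero_apply]
    exact (zero_smul (Env k A) x).symm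
  · rw [← MulOpposite.op_unop b, gamAct_apply, coe_envGam, sigma_env, tensorPr_tmul_one]
  · rw [map_add, map_add, LinearMap.add_apply, h, h', add_smul]

end GammaAction

theorem sw₂_smul {k H M R : Type*} [Field k] [Ring H] [HopfAlgebra k H] [AddCommGroup M] [Ring R]
    [Module R M] (h : H) (F : H → H → R) (x : M) :
    sw₂ k h F • x = sw₂ k h fun u v => F u v • x := Finset.sum_smul

/-! ### The universal property of `Bᵉ ⊗_Γ M`. -/

section Induction

variable {k A H : Type*} [Field k] [Ring A] [Algebra k A] [Ring H] [HopfAlgebra k H]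
  [Module H A] [IsScalarTower k H A] [HModuleAlgebra k H A]
  {M : Type*} [AddCommGroup M] [Module k M] {act : Gam k A H →ₐ[k] Module.End k M}

instance : IsScalarTower k (Env k (Smash k A H)) (Ind act) :=
  inferInstanceAs (IsScalarTower k _ ((Env k (Smash k A H) ⊗[k] M) ⧸ indRel act))

theorem Ind.smul_mk (e e' : Env k (Smash k A H)) (x : M) :
    e • Ind.mk act e' x = Ind.mk act (e * e') x := rfl

theorem Ind.mk_eq_smul (e : Env k (Smash k A H)) (x : M) :
    Ind.mk act e x = e • Ind.mk act 1 x := by rw [Ind.smul_mk, mul_one]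

theorem Ind.mk_add (e : Env k (Smash k A H)) (x y : M) :
    Ind.mk act e (x + y) = Ind.mk act e x + Ind.mk act e y :=
  congrArg (Submodule.Quotient.mk (p := indRel act)) (TensorProduct.tmul_add e x y)

theorem Ind.mk_smul (c : k) (e : Env k (Smash k A H)) (x : M) :
    Ind.mk act e (c • x) = c • Ind.mk act e x :=
  congrArg (Submodule.Quotient.mk (p := indRel act)) (TensorProduct.tmul_smul c e x)

theorem Ind.mk_mul_gam (e : Env k (Smash k A H)) (γ : Gam k A H) (x : M) :
    Ind.mk act (e * γ) x = Ind.mk act e (act γ x) :=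
  (Submodule.Quotient.eq _).2 (Submodule.subset_span ⟨e, γ, x, rfl⟩)

theorem Ind.gam_smul_mk (γ : Gam k A H) (x : M) :
    (γ : Env k (Smash k A H)) • Ind.mk act 1 x = Ind.mk act 1 (act γ x) := by
  rw [Ind.smul_mk, mul_one, ← Ind.mk_mul_gam, one_mul]

theorem Ind.induction {P : Ind act → Prop} (z : Ind act)
    (mk : ∀ (e : Env k (Smash k A H)) (x : M), P (Ind.mk act e x))
    (add : ∀ x y, P x → P y → P (x + y)) : P z := by
  obtain ⟨z, rfl⟩ := Submodule.Quotient.mk_surjective (indRel act) z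
  refine TensorProduct.induction_on (motive := fun z => P (Submodule.Quotient.mk z)) z ?_ mk
    fun x y hx hy => add _ _ hx hy
  have := mk 0 0
  rwa [Ind.mk, TensorProduct.zero_tmul] at this

/-- Reduction to the generators `(1 ⊗ g) a h ⊗_Γ x`. -/
theorem Ind.induction' {P : Ind act → Prop} (z : Ind act)
    (mk : ∀ (g : H) (a a' : A) (h : H) (x : M),
      P (Ind.mk act (Smash.mk a h ⊗ₜ MulOpposite.op (Smash.mk a' g)) x))
    (add : ∀ x y, P x → P y → P (x + y)) : P z := by
  have zero : P 0 := by
    have := mk 0 0 0 0 0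
    rwa [Ind.mk, TensorProduct.tmul_zero] at this
  induction z using Ind.induction with
  | add x y hx hy => exact add x y hx hy
  | mk e x =>
    have hadd : ∀ e e' : Env k (Smash k A H), Ind.mk act (e + e') x =
        Ind.mk act e x + Ind.mk act e' x := fun e e' =>
      congrArg (Submodule.Quotient.mk (p := indRel act)) (TensorProduct.add_tmul e e' x)
    have hzero : Ind.mk act 0 x = 0 :=
      congrArg (Submodule.Quotient.mk (p := indRel act)) (TensorProduct.zero_tmul _ x)
    refine TensorProduct.induction_on (motive := fun e => P (Ind.mk act e x)) e ?_ (fun b y => ?_)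
      fun e e' h h' => by rw [hadd]; exact add _ _ h h'
    · rwa [hzero]
    induction y using MulOpposite.rec' with | _ y => ?_
    induction b using Smash.induction with
    | zero => rwa [TensorProduct.zero_tmul, hzero]
    | add b b' h h' => rw [TensorProduct.add_tmul, hadd]; exact add _ _ h h'
    | mk a h =>
      induction y using Smash.induction with
      | zero => rwa [MulOpposite.op_zero, TensorProduct.tmul_zero, hzero]
      | add y y' h h' =>
        rw [MulOpposite.op_add, TensorProduct.tmul_add, hadd]; exact add _ _ h h'
      | mk a' g => exact mk g a a' h x

theorem Ind.hom_ext {Y : Type*} [AddCommGroup Y] [Module (Env k (Smash k A H)) Y]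
    {f g : Ind act →ₗ[Env k (Smash k A H)] Y}
    (h : ∀ x, f (Ind.mk act 1 x) = g (Ind.mk act 1 x)) : f = g := by
  refine LinearMap.ext fun z => ?_
  induction z using Ind.induction with
  | mk e x => rw [Ind.mk_eq_smul, f.map_smul, g.map_smul, h]
  | add x y hx hy => rw [map_add, map_add, hx, hy]

variable {Y : Type*} [AddCommGroup Y] [Module k Y] [Module (Env k (Smash k A H)) Y]
  [IsScalarTower k (Env k (Smash k A H)) Y]

/-- The extension of a morphism of `Γ`-modules `M → Y` to `Bᵉ ⊗_Γ M`. -/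
def Ind.lift (f : M →ₗ[k] Y)
    (hf : ∀ (γ : Gam k A H) (x : M), f (act γ x) = (γ : Env k (Smash k A H)) • f x) :
    Ind act →ₗ[Env k (Smash k A H)] Y :=
  (indRel act).liftQ (ext f) (by
    rw [indRel, Submodule.span_le]
    rintro _ ⟨e, γ, x, rfl⟩
    change ext f (_ - _) = 0
    rw [map_sub, ext_tmul, ext_tmul, hf, smul_smul, sub_self])

theorem Ind.lift_mk (f : M →ₗ[k] Y)
    (hf : ∀ (γ : Gam k A H) (x : M), f (act γ x) = (γ : Env k (Smash k A H)) • f x)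
    (e : Env k (Smash k A H)) (x : M) : Ind.lift f hf (Ind.mk act e x) = e • f x := rfl

/-- The linear map `x ↦ 1 ⊗_Γ x`. -/
def Ind.of (act : Gam k A H →ₐ[k] Module.End k M) : M →ₗ[k] Ind act where
  toFun := Ind.mk act 1
  map_add' := Ind.mk_add (act := act) 1
  map_smul' c x := Ind.mk_smul (act := act) c 1 x

theorem Ind.of_apply (x : M) : Ind.of act x = Ind.mk act 1 x := rfl

/-- The functoriality of induction. -/
def Ind.map {M' : Type*} [AddCommGroup M'] [Module k M'] {act' : Gam k A H →ₐ[k] Module.End k M'}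
    (f : M →ₗ[k] M') (hf : ∀ (γ : Gam k A H) (x : M), f (act γ x) = act' γ (f x)) :
    Ind act →ₗ[Env k (Smash k A H)] Ind act' :=
  Ind.lift (Ind.of act' ∘ₗ f) fun γ x => by
    rw [LinearMap.comp_apply, LinearMap.comp_apply, Ind.of_apply, Ind.of_apply, Ind.gam_smul_mk, hf]

theorem Ind.map_mk {M' : Type*} [AddCommGroup M'] [Module k M']
    {act' : Gam k A H →ₐ[k] Module.End k M'} (f : M →ₗ[k] M')
    (hf : ∀ (γ : Gam k A H) (x : M), f (act γ x) = act' γ (f x)) (e : Env k (Smash k A H)) (x : M) :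
    Ind.map f hf (Ind.mk act e x) = Ind.mk act' e (f x) := by
  rw [Ind.map, Ind.lift_mk, LinearMap.comp_apply, Ind.of_apply, ← Ind.mk_eq_smul]

variable (k A H) in
/-- The element `1 ⊗ g` of `Bᵉ`. -/
def rightH (g : H) : Env k (Smash k A H) := 1 ⊗ₜ MulOpposite.op (inH k A H g)

/-- The linear map `x ⊗ g ↦ (1 ⊗ g) ⊗_Γ x`. -/
def tensorToInd (act : Gam k A H →ₐ[k] Module.End k M) :
    M ⊗[k] H →ₗ[k] Ind act :=
  TensorProduct.lift (LinearMap.mk₂ k (fun x g => rightH k A H g • Ind.mk act 1 x)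
    (fun x y g => by rw [Ind.mk_add, smul_add])
    (fun c x g => by rw [Ind.mk_smul, smul_comm])
    (fun x g g' => by simp [rightH, TensorProduct.tmul_add, add_smul])
    (fun c x g => by simp [rightH]))

theorem tensorToInd_tmul (act : Gam k A H →ₐ[k] Module.End k M) (x : M) (g : H) :
    tensorToInd act (x ⊗ₜ g) = rightH k A H g • Ind.mk act 1 x := rfl

theorem map_tensorToInd {M' : Type*} [AddCommGroup M'] [Module k M']
    {act' : Gam k A H →ₐ[k] Module.End k M'}
    (f : M →ₗ[k] M') (hf : ∀ (γ : Gam k A H) (x : M), f (act γ x) = act' γ (f x))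
    (z : M ⊗[k] H) :
    Ind.map f hf (tensorToInd act z) = tensorToInd act' (LinearMap.rTensor H f z) := by
  induction z with
  | zero => simp only [map_zero]
  | add x y hx hy => simp only [map_add, hx, hy]
  | tmul x g =>
    rw [tensorToInd_tmul, LinearMap.rTensor_tmul, tensorToInd_tmul, LinearMap.map_smul, Ind.map_mk]

end Induction

/-! ### The isomorphism `M ⊗ H ≅ Bᵉ ⊗_Γ M`. -/

section InducedTensor

variable {k A H : Type*} [Field k] [Ring A] [Algebra k A] [Ring H] [HopfAlgebra k H]
  [Module H A] [IsScalarTower k H A] [HModuleAlgebra k H A]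
  {M : Type*} [AddCommGroup M] [Module k M] [Module (Env k A) M] [IsScalarTower k (Env k A) M]
  {ρ : H →ₐ[k] Module.End k M} (hρ : IsHBimod (A := A) ρ)

/-- A bimodule map that is compatible with `H` is a morphism of `Γ`-modules. -/
theorem gamAct_equivariant {Y : Type*} [AddCommGroup Y] [Module k Y]
    [Module (Env k (Smash k A H)) Y] (f : M →ₗ[k] Y)
    (henv : ∀ (e : Env k A) (x : M), f (e • x) = envIn k A H e • f x)
    (hhopf : ∀ (h : H) (x : M), f (ρ h x) = (hopfGam k A H h : Env k (Smash k A H)) • f x)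
    (γ : Gam k A H) (x : M) : f (gamAct hρ γ x) = (γ : Env k (Smash k A H)) • f x := by
  induction γ using Gam.induction with
  | gen a h a' =>
    rw [map_mul, map_mul, Module.End.mul_apply, Module.End.mul_apply, gamAct_env, gamAct_env,
      gamAct_hopf, henv, hhopf, henv, smul_smul, smul_smul, Subalgebra.coe_mul, Subalgebra.coe_mul,
      coe_envGam, coe_envGam, mul_assoc]
  | add γ γ' h h' => rw [map_add, LinearMap.add_apply, map_add, h, h', Subalgebra.coe_add, add_smul]

/-- The linear map `Bᵉ ⊗_Γ M → M ⊗ H`. -/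
def indToTensor : Ind (gamAct hρ) →ₗ[k] M ⊗[k] H :=
  letI : Module (Env k (Smash k A H)) (M ⊗[k] H) := Module.compHom _ (sigma hρ).toRingHom
  haveI : IsScalarTower k (Env k (Smash k A H)) (M ⊗[k] H) :=
    ⟨fun c e z => congrArg (fun f : Module.End k (M ⊗[k] H) => f z) (map_smul (sigma hρ) c e)⟩
  (Ind.lift ((TensorProduct.mk k M H).flip 1) fun γ x =>
    (sigma_gam_tmul hρ γ x).symm).restrictScalars k

theorem indToTensor_mk (e : Env k (Smash k A H)) (x : M) :
    indToTensor hρ (Ind.mk _ e x) = sigma hρ e (x ⊗ₜ 1) := rfl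

theorem indToTensor_tensorToInd (z : M ⊗[k] H) :
    indToTensor hρ (tensorToInd (gamAct hρ) z) = z := by
  induction z with
  | zero => rw [map_zero, map_zero]
  | add x y hx hy => rw [map_add, map_add, hx, hy]
  | tmul x g =>
    rw [tensorToInd_tmul, Ind.smul_mk, mul_one, indToTensor_mk, rightH, sigma_tmul, sigmaR_inH,
      indRH_tmul, one_mul, map_one, Module.End.one_apply]

/-- The right-hand side is `∑ h₁ ⊗ S(h₂)h₃`, which collapses. Thus an element of `H` acting from the
left can be traded for elements of `Γ` and of `1 ⊗ H`, so that `Bᵉ ⊗_Γ M` is spanned by the elements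
`(1 ⊗ g) ⊗_Γ x`. -/
theorem inH_tmul_one (h : H) : (inH k A H h ⊗ₜ 1 : Env k (Smash k A H)) =
    sw₂ k h fun u v => rightH k A H v * (hopfGam k A H u : Env k (Smash k A H)) := by
  have hT : IsTrilin k fun u v w : H => (inH k A H u ⊗ₜ MulOpposite.op
      (inH k A H (HopfAlgebra.antipode k v * w)) : Env k (Smash k A H)) := by
    constructor
    · intro w
      constructor <;> intros <;>
        simp [add_mul, TensorProduct.add_tmul, TensorProduct.tmul_add, ← TensorProduct.smul_tmul']
    all_goals intros
    all_goals simp [mul_add, TensorProduct.tmul_add]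
  symm
  refine (Eq.trans (sw₂_congr _ fun u v => ?_) (hT.sw₂_assoc h)).trans ?_
  · rw [coe_hopfGam, ← LinearMap.mulLeft_apply (R := k), map_sw₂]
    refine sw₂_congr _ fun x y => ?_
    rw [LinearMap.mulLeft_apply, rightH, Algebra.TensorProduct.tmul_mul_tmul, one_mul,
      ← MulOpposite.op_mul, ← map_mul]
  · have hf : IsLinearMap k fun u : H => (inH k A H u ⊗ₜ 1 : Env k (Smash k A H)) := by
      constructor <;> intros <;> simp [TensorProduct.add_tmul, ← TensorProduct.smul_tmul']
    rw [← sw₂_counit_right_of hf h]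
    refine sw₂_congr _ fun u v => ?_
    refine (sw₂_antipode_left v ((TensorProduct.mk k (Smash k A H) (Smash k A H)ᵐᵒᵖ (inH k A H u)) ∘ₗ
      (MulOpposite.opLinearEquiv k).toLinearMap ∘ₗ (inH k A H).toLinearMap)).trans ?_
    simp

theorem tensorToInd_surjective : Function.Surjective (tensorToInd (gamAct hρ)) := by
  intro z
  induction z using Ind.induction' with
  | add x y hx hy =>
    obtain ⟨x, rfl⟩ := hx
    obtain ⟨y, rfl⟩ := hy
    exact ⟨x + y, map_add _ _ _⟩
  | mk g a a' h x =>
    -- The aim is to write the element of `Bᵉ` with factors from `1 ⊗ H` on the left and factors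
    -- from `Γ` on the right, where they act on `x`. The factor `h ⊗ 1` is rewritten by
    -- `inH_tmul_one`, and `e2` moves the resulting `1 ⊗ v` past `a`.
    have e1 : (Smash.mk a h ⊗ₜ MulOpposite.op (Smash.mk a' g) : Env k (Smash k A H)) =
        rightH k A H g * ((envGam k A H (a ⊗ₜ 1) : Gam k A H) : Env k (Smash k A H)) *
          (inH k A H h ⊗ₜ 1) *
          ((envGam k A H (1 ⊗ₜ MulOpposite.op a') : Gam k A H) : Env k (Smash k A H)) := by
      rw [coe_envGam, coe_envGam, rightH, mk_eq_mul, mk_eq_mul]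
      simp [envIn]
    have e2 : ∀ v : H, rightH k A H g *
        ((envGam k A H (a ⊗ₜ 1) : Gam k A H) : Env k (Smash k A H)) * rightH k A H v =
          rightH k A H (v * g) * ((envGam k A H (a ⊗ₜ 1) : Gam k A H) : Env k (Smash k A H)) := by
      intro v
      rw [coe_envGam, rightH, rightH, rightH]
      simp [envIn]
    refine ⟨sw₂ k h fun u v =>
      ((a ⊗ₜ 1 : Env k A) • ρ u ((1 ⊗ₜ MulOpposite.op a' : Env k A) • x)) ⊗ₜ (v * g), ?_⟩
    rw [e1, Ind.mk_mul_gam, gamAct_env, map_sw₂, Ind.mk_eq_smul, inH_tmul_one,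
      ← LinearMap.mulLeft_apply (R := k), map_sw₂]
    refine Eq.trans (sw₂_congr _ fun u v => ?_) (sw₂_smul h _ _).symm
    rw [tensorToInd_tmul, LinearMap.mulLeft_apply, ← mul_assoc, e2, mul_assoc, mul_smul, mul_smul,
      Ind.gam_smul_mk, Ind.gam_smul_mk, gamAct_hopf, gamAct_env]

/-- The linear isomorphism `M ⊗ H ≅ Bᵉ ⊗_Γ M`. -/
def tensorIndEquiv : M ⊗[k] H ≃ₗ[k] Ind (gamAct hρ) :=
  LinearEquiv.ofBijective (tensorToInd (gamAct hρ))
    ⟨Function.LeftInverse.injective (indToTensor_tensorToInd hρ), tensorToInd_surjective hρ⟩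

end InducedTensor

/-! ### `B`-bimodules as `A`-bimodules with a compatible `H`-action. -/

section HopfRestriction

variable {k A H : Type*} [Field k] [Ring A] [Algebra k A] [Ring H] [HopfAlgebra k H]
  [Module H A] [IsScalarTower k H A] [HModuleAlgebra k H A]

theorem isBilin_hopf : IsBilin k fun x y : H =>
    (inH k A H x ⊗ₜ MulOpposite.op (inH k A H (HopfAlgebra.antipode k y)) :
      Env k (Smash k A H)) := by
  constructor <;> intros <;>
    simp [TensorProduct.add_tmul, TensorProduct.tmul_add, ← TensorProduct.smul_tmul']

variable (k A H) in
/-- The morphism `h ↦ ∑ h₁ ⊗ S h₂`. -/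
def hopfHom : H →ₐ[k] Env k (Smash k A H) :=
  AlgHom.ofLinearMap
    { toFun := fun h => (hopfGam k A H h : Env k (Smash k A H))
      map_add' := isBilin_hopf.sw₂_add
      map_smul' := isBilin_hopf.sw₂_smul }
    (by
      refine isBilin_hopf.sw₂_one.trans ?_
      rw [map_one, HopfAlgebra.antipode_one, map_one]
      rfl)
    fun g h => by
      refine (isBilin_hopf.sw₂_mul g h).trans ?_
      change _ = (hopfGam k A H g : Env k (Smash k A H)) * (hopfGam k A H h)
      rw [coe_hopfGam, coe_hopfGam, sw₂, sw₂, Finset.sum_mul]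
      refine Finset.sum_congr rfl fun i _ => ?_
      rw [sw₂, sw₂, Finset.mul_sum]
      refine Finset.sum_congr rfl fun j _ => ?_
      rw [Algebra.TensorProduct.tmul_mul_tmul, ← MulOpposite.op_mul, ← map_mul, ← map_mul,
        HopfAlgebra.antipode_mul_antidistrib]

theorem hopfHom_apply (h : H) : hopfHom k A H h = (hopfGam k A H h : Env k (Smash k A H)) := rfl

/-- `h ▷ a = ∑ h₁ a S(h₂)` in `A # H`. -/
theorem inA_smul (h : H) (a : A) : inA k A H (h • a) =
    sw₂ k h fun x y => inH k A H x * inA k A H a * inH k A H (HopfAlgebra.antipode k y) := by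
  have hT : IsTrilin k fun u v w : H =>
      inA k A H (u • a) * inH k A H (v * HopfAlgebra.antipode k w) := by
    constructor
    · intro w
      constructor <;> intros <;> simp [add_smul, add_mul, mul_add]
    all_goals intros
    all_goals simp [mul_add]
  symm
  refine Eq.trans (sw₂_congr _ fun x y => ?_) ((hT.sw₂_assoc h).trans ?_)
  · rw [inH_mul_inA, ← LinearMap.mulRight_apply (R := k), map_sw₂]
    exact sw₂_congr _ fun u v => by rw [LinearMap.mulRight_apply, mul_assoc, ← map_mul]
  · have hf : IsLinearMap k fun u : H => inA k A H (u • a) := by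
      constructor <;> intros <;> simp [add_smul]
    rw [← sw₂_counit_right_of hf h]
    refine sw₂_congr _ fun u v => ?_
    refine (sw₂_antipode_right v
      (LinearMap.mulLeft k (inA k A H (u • a)) ∘ₗ (inH k A H).toLinearMap)).trans ?_
    simp

theorem sum_antipode_mul_inA_smul (h : H) (a : A) :
    (sw₂ k h fun x y => inH k A H (HopfAlgebra.antipode k x) * inA k A H (y • a)) =
      inA k A H a * inH k A H (HopfAlgebra.antipode k h) := by
  have hT : IsTrilin k fun u v w : H => inH k A H (HopfAlgebra.antipode k u * v) *
      inA k A H a * inH k A H (HopfAlgebra.antipode k w) := by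
    constructor
    · intro w
      constructor <;> intros <;> simp [add_mul, mul_add]
    all_goals intros
    all_goals simp [mul_add]
  refine Eq.trans (sw₂_congr _ fun x y => ?_) ((hT.sw₂_assoc h).symm.trans ?_)
  · rw [inA_smul, ← LinearMap.mulLeft_apply (R := k), map_sw₂]
    exact sw₂_congr _ fun u v => by rw [LinearMap.mulLeft_apply, map_mul, mul_assoc, mul_assoc,
      mul_assoc]
  · have hf : IsLinearMap k fun w : H =>
        inA k A H a * inH k A H (HopfAlgebra.antipode k w) := by
      constructor <;> intros <;> simp [mul_add]
    rw [← sw₂_counit_left_of hf h]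
    refine sw₂_congr _ fun u v => ?_
    refine Eq.trans (sw₂_congr _ fun x y => ?_) ((sw₂_antipode_left u ((LinearMap.mulRight k
      (inA k A H a * inH k A H (HopfAlgebra.antipode k v))) ∘ₗ (inH k A H).toLinearMap)).trans ?_)
    · rw [LinearMap.comp_apply, LinearMap.mulRight_apply, ← mul_assoc]
      rfl
    · simp

theorem envIn_tmul (a b : A) : envIn k A H (a ⊗ₜ MulOpposite.op b) =
    inA k A H a ⊗ₜ MulOpposite.op (inA k A H b) := by
  simp [envIn]

theorem hopfHom_mul_left (h : H) (a : A) : hopfHom k A H h * envIn k A H (a ⊗ₜ 1) =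
    sw₂ k h fun x y => envIn k A H ((x • a) ⊗ₜ 1) * hopfHom k A H y := by
  have hT : IsTrilin k fun u v w : H => ((inA k A H (u • a) * inH k A H v) ⊗ₜ
      MulOpposite.op (inH k A H (HopfAlgebra.antipode k w)) : Env k (Smash k A H)) := by
    constructor
    · intro w
      constructor <;> intros <;>
        simp [add_smul, add_mul, mul_add, TensorProduct.add_tmul, ← TensorProduct.smul_tmul']
    all_goals intros
    all_goals simp [TensorProduct.tmul_add]
  rw [hopfHom_apply, coe_hopfGam, ← LinearMap.mulRight_apply (R := k), map_sw₂]
  refine Eq.trans (sw₂_congr _ fun x y => ?_) ((hT.sw₂_assoc h).trans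
    (sw₂_congr _ fun x y => ?_))
  · rw [LinearMap.mulRight_apply, ← MulOpposite.op_one, envIn_tmul, map_one, MulOpposite.op_one,
      Algebra.TensorProduct.tmul_mul_tmul, mul_one, inH_mul_inA]
    simp only [sw₂, TensorProduct.sum_tmul]
  · rw [hopfHom_apply, coe_hopfGam, ← LinearMap.mulLeft_apply (R := k), map_sw₂]
    refine sw₂_congr _ fun u v => ?_
    rw [LinearMap.mulLeft_apply, ← MulOpposite.op_one, envIn_tmul, map_one, MulOpposite.op_one,
      Algebra.TensorProduct.tmul_mul_tmul, one_mul]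

theorem hopfHom_mul_right (h : H) (a : A) :
    hopfHom k A H h * envIn k A H (1 ⊗ₜ MulOpposite.op a) =
      sw₂ k h fun x y => envIn k A H (1 ⊗ₜ MulOpposite.op (y • a)) * hopfHom k A H x := by
  have hT : IsTrilin k fun u v w : H => (inH k A H u ⊗ₜ MulOpposite.op
      (inH k A H (HopfAlgebra.antipode k v) * inA k A H (w • a)) : Env k (Smash k A H)) := by
    constructor
    · intro w
      constructor <;> intros <;>
        simp [add_mul, mul_add, TensorProduct.add_tmul, TensorProduct.tmul_add,
          ← TensorProduct.smul_tmul']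
    all_goals intros
    all_goals simp [add_smul, mul_add, TensorProduct.tmul_add]
  rw [hopfHom_apply, coe_hopfGam, ← LinearMap.mulRight_apply (R := k), map_sw₂]
  refine Eq.trans (sw₂_congr _ fun x y => ?_) ((hT.sw₂_assoc h).symm.trans
    (sw₂_congr _ fun x y => ?_))
  · rw [LinearMap.mulRight_apply, envIn_tmul, map_one, Algebra.TensorProduct.tmul_mul_tmul,
      mul_one, ← MulOpposite.op_mul, ← sum_antipode_mul_inA_smul]
    simp only [sw₂, Finset.op_sum, TensorProduct.tmul_sum]
  · rw [hopfHom_apply, coe_hopfGam, ← LinearMap.mulLeft_apply (R := k), map_sw₂]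
    refine sw₂_congr _ fun u v => ?_
    rw [LinearMap.mulLeft_apply, envIn_tmul, map_one, Algebra.TensorProduct.tmul_mul_tmul,
      one_mul, ← MulOpposite.op_mul]

variable {Y : Type*} [AddCommGroup Y] [Module k Y] [Module (Env k (Smash k A H)) Y]
  [IsScalarTower k (Env k (Smash k A H)) Y]

variable (k A H Y) in
/-- The action of `H` on a `B`-bimodule through the elements `∑ h₁ ⊗ S h₂`. -/
def hopfRep : H →ₐ[k] Module.End k Y := (Algebra.lsmul k k Y).comp (hopfHom k A H)

theorem hopfRep_apply (h : H) (y : Y) :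
    hopfRep k A H Y h y = (hopfGam k A H h : Env k (Smash k A H)) • y := rfl

/-- This makes any `B`-bimodule an admissible target for `equivariant_smul`, so that equivariance of
a bimodule map on the free generators propagates to all of `K_m`. -/
theorem hopfRep_isHBimod [Module (Env k A) Y]
    (hY : ∀ (e : Env k A) (y : Y), e • y = envIn k A H e • y) :
    IsHBimod (A := A) (hopfRep k A H Y) where
  left h a y := by
    rw [hopfRep_apply, ← hopfHom_apply, hY, smul_smul, hopfHom_mul_left, sw₂_smul]
    exact sw₂_congr _ fun u v => by rw [hY, hopfRep_apply, mul_smul, hopfHom_apply]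
  right h a y := by
    rw [hopfRep_apply, ← hopfHom_apply, hY, smul_smul, hopfHom_mul_right, sw₂_smul]
    exact sw₂_congr _ fun u v => by rw [hY, hopfRep_apply, mul_smul, hopfHom_apply]

theorem envIn_smul_inA (e : Env k A) (x : Reg A) :
    envIn k A H e • toReg k _ (inA k A H ((toReg k A).symm x)) =
      toReg k _ (inA k A H ((toReg k A).symm (e • x))) := by
  refine TensorProduct.induction_on (motive := fun e : Env k A =>
    envIn k A H e • toReg k _ (inA k A H ((toReg k A).symm x)) =
      toReg k _ (inA k A H ((toReg k A).symm (e • x)))) e ?_ (fun a b => ?_) fun e e' h h' => ?_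
  · have : (0 : Env k A) • x = 0 := zero_smul (Env k A) x
    rw [this, map_zero, map_zero, map_zero, map_zero]
    exact zero_smul (Env k (Smash k A H)) (toReg k (Smash k A H) (inA k A H ((toReg k A).symm x)))
  · obtain ⟨x, rfl⟩ := (toReg k A).surjective x
    rw [← MulOpposite.op_unop b, envIn_tmul, reg_smul, reg_smul, AlgEquiv.symm_apply_apply,
      AlgEquiv.symm_apply_apply, map_mul (inA k A H), map_mul (inA k A H)]
  · rw [map_add, add_smul, h, h', ← map_add, ← map_add, ← map_add, ← add_smul]

theorem hopfGam_smul_inA (h : H) (x : Reg A) :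
    (hopfGam k A H h : Env k (Smash k A H)) • toReg k _ (inA k A H ((toReg k A).symm x)) =
      toReg k _ (inA k A H ((toReg k A).symm (regRep k A H h x))) := by
  obtain ⟨x, rfl⟩ := (toReg k A).surjective x
  rw [regRep_toReg, AlgEquiv.symm_apply_apply, AlgEquiv.symm_apply_apply, coe_hopfGam, sw₂_smul,
    inA_smul, map_sw₂]
  exact sw₂_congr _ fun u v => reg_smul _ _ _

end HopfRestriction

/-! ### Exactness of the induced complex. -/

section InducedKoszul

variable {k A H : Type*} [Field k] [Ring A] [Algebra k A] [Ring H] [HopfAlgebra k H]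
  [Module H A] [IsScalarTower k H A] [HModuleAlgebra k H A]

theorem gamAct_map {M N : Type*} [AddCommGroup M] [Module k M] [Module (Env k A) M]
    [IsScalarTower k (Env k A) M] [AddCommGroup N] [Module k N] [Module (Env k A) N]
    [IsScalarTower k (Env k A) N] {ρ : H →ₐ[k] Module.End k M} {ρ' : H →ₐ[k] Module.End k N}
    (hρ : IsHBimod (A := A) ρ) (hρ' : IsHBimod (A := A) ρ') (f : M →ₗ[Env k A] N)
    (hf : ∀ h x, f (ρ h x) = ρ' h (f x)) (γ : Gam k A H) (x : M) :
    f (gamAct hρ γ x) = gamAct hρ' γ (f x) := by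
  induction γ using Gam.induction with
  | gen a h a' =>
    simp only [map_mul, Module.End.mul_apply, gamAct_env, gamAct_hopf, LinearMap.map_smul, hf]
  | add γ γ' h h' => simp only [map_add, LinearMap.add_apply, h, h']

theorem exact_of_bijective {X Y Z X' Y' Z' : Type*} [Zero Z] [Zero Z'] {f : X → Y} {g : Y → Z}
    {f' : X' → Y'} {g' : Y' → Z'} (p : X → X') (q : Y → Y') (r : Z → Z')
    (hf : ∀ x, f' (p x) = q (f x)) (hg : ∀ y, g' (q y) = r (g y)) (hp : Function.Surjective p)
    (hq : Function.Surjective q) (hr : Function.Injective r) (hr0 : r 0 = 0)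
    (h : Function.Exact f g) : Function.Exact f' g' := by
  intro y'
  constructor
  · intro hy
    obtain ⟨y, rfl⟩ := hq y'
    rw [hg, ← hr0] at hy
    obtain ⟨x, rfl⟩ := (h y).1 (hr hy)
    exact ⟨p x, hf x⟩
  · rintro ⟨x', rfl⟩
    obtain ⟨x, rfl⟩ := hp x'
    rw [hf, hg, (h _).2 ⟨x, rfl⟩, hr0]

variable {𝒜 : ℕ → Submodule k A}
  (hhom : ∀ (h : H) (n : ℕ) (a : A), a ∈ 𝒜 n → h • a ∈ 𝒜 n)

/-- The action of `Γ` on a term of the Koszul bimodule complex. -/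
abbrev kcGam (m : ℕ) : Gam k A H →ₐ[k] Module.End k (KC 𝒜 m) := gamAct (kcRep_isHBimod hhom m)

theorem koszulD_kcGam (m : ℕ) (γ : Gam k A H) (x : KC 𝒜 (m + 1)) :
    koszulD 𝒜 m (kcGam hhom (m + 1) γ x) = kcGam hhom m γ (koszulD 𝒜 m x) :=
  gamAct_map _ _ _ (koszulD_kcRep hhom m) γ x

variable (𝒜 H) in
/-- The augmentation of the Koszul complex, with values in `A # H`. -/
def koszulAugB : KC 𝒜 0 →ₗ[k] Reg (Smash k A H) :=
  (toReg k (Smash k A H)).toLinearMap ∘ₗ (inA k A H).toLinearMap ∘ₗ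
    (toReg k A).symm.toLinearMap ∘ₗ (koszulAug 𝒜).restrictScalars k

theorem koszulAugB_apply (x : KC 𝒜 0) : koszulAugB H 𝒜 x =
    toReg k _ (inA k A H ((toReg k A).symm (koszulAug 𝒜 x))) := rfl

theorem koszulAugB_kcGam (γ : Gam k A H) (x : KC 𝒜 0) :
    koszulAugB H 𝒜 (kcGam hhom 0 γ x) = (γ : Env k (Smash k A H)) • koszulAugB H 𝒜 x :=
  gamAct_equivariant _ _
    (fun e x => by
      rw [koszulAugB_apply, koszulAugB_apply, envIn_smul_inA, LinearMap.map_smul])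
    (fun h x => by
      rw [koszulAugB_apply, koszulAugB_apply, hopfGam_smul_inA, koszulAug_kcRep]) γ x

/-- The differential of `Bᵉ ⊗_Γ K(A)`. -/
def indD (m : ℕ) : Ind (kcGam hhom (m + 1)) →ₗ[Env k (Smash k A H)] Ind (kcGam hhom m) :=
  Ind.map ((koszulD 𝒜 m).restrictScalars k) (koszulD_kcGam hhom m)

theorem indD_mk (m : ℕ) (e : Env k (Smash k A H)) (x : KC 𝒜 (m + 1)) :
    indD hhom m (Ind.mk _ e x) = Ind.mk _ e (koszulD 𝒜 m x) :=
  Ind.map_mk ((koszulD 𝒜 m).restrictScalars k) (koszulD_kcGam hhom m) e x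

/-- The augmentation of `Bᵉ ⊗_Γ K(A)`. -/
def indAug : Ind (kcGam hhom 0) →ₗ[Env k (Smash k A H)] Reg (Smash k A H) :=
  Ind.lift (koszulAugB H 𝒜) (koszulAugB_kcGam hhom)

theorem indAug_mk (e : Env k (Smash k A H)) (x : KC 𝒜 0) :
    indAug hhom (Ind.mk _ e x) = e • toReg k _ (inA k A H ((toReg k A).symm (koszulAug 𝒜 x))) :=
  rfl

variable (k A H) in
/-- The linear isomorphism `A ⊗ H ≅ A # H`. -/
def tensorToReg : A ⊗[k] H ≃ₗ[k] Reg (Smash k A H) :=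
  (LinearEquiv.refl k (A ⊗[k] H) : A ⊗[k] H ≃ₗ[k] Smash k A H) ≪≫ₗ
    (toReg k (Smash k A H)).toLinearEquiv

theorem tensorToReg_tmul (a : A) (h : H) :
    tensorToReg k A H (a ⊗ₜ h) = toReg k _ (Smash.mk a h) := rfl

/-- Under `K_0 ⊗ H ≅ Bᵉ ⊗_Γ K_0` and `A ⊗ H = B` the augmentation becomes the augmentation of `K`
tensored with `H`. -/
theorem indAug_tensorToInd (z : KC 𝒜 0 ⊗[k] H) :
    indAug hhom (tensorToInd _ z) = tensorToReg k A H
      (LinearMap.rTensor H ((toReg k A).symm.toLinearMap ∘ₗ (koszulAug 𝒜).restrictScalars k) z) := by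
  induction z with
  | zero => simp only [map_zero]
  | add x y hx hy => simp only [map_add, hx, hy]
  | tmul x g =>
    rw [tensorToInd_tmul, LinearMap.map_smul, indAug_mk, LinearMap.rTensor_tmul,
      tensorToReg_tmul, mk_eq_mul, one_smul, rightH, reg_smul, one_mul]
    rfl

/-- The induced complex is `K ⊗ H` as a complex of vector spaces, and tensoring over a field is
exact. Flatness of `Bᵉ` over `Γ` is not required. -/
theorem indD_exact (hA : IsKoszul 𝒜) [GradedAlgebra 𝒜] (m : ℕ) :
    Function.Exact (indD hhom (m + 1)) (indD hhom m) :=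
  exact_of_bijective (tensorToInd (kcGam hhom (m + 2))) (tensorToInd (kcGam hhom (m + 1)))
    (tensorToInd (kcGam hhom m)) (fun z => map_tensorToInd _ _ z) (fun z => map_tensorToInd _ _ z)
    (tensorToInd_surjective _) (tensorToInd_surjective _)
    (tensorIndEquiv (kcRep_isHBimod hhom m)).injective (map_zero _)
    (rTensor_exact_of_field H (f := (koszulD 𝒜 (m + 1)).restrictScalars k)
      (g := (koszulD 𝒜 m).restrictScalars k) ((koszul_isProjRes hA).exact_succ m))

theorem indAug_exact (hA : IsKoszul 𝒜) [GradedAlgebra 𝒜] :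
    Function.Exact (indD hhom 0) (indAug hhom) :=
  exact_of_bijective (tensorToInd (kcGam hhom 1)) (tensorToInd (kcGam hhom 0))
    (tensorToReg k A H) (fun z => map_tensorToInd _ _ z)
    (indAug_tensorToInd hhom)
    (tensorToInd_surjective _) (tensorToInd_surjective _)
    (tensorToReg k A H).injective (map_zero _)
    (rTensor_exact_of_field H (f := (koszulD 𝒜 0).restrictScalars k) fun y =>
      Iff.trans (toReg k A).symm.toLinearEquiv.map_eq_zero_iff
        ((koszul_isProjRes hA).exact_zero y))

theorem indAug_surjective (hA : IsKoszul 𝒜) [GradedAlgebra 𝒜] :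
    Function.Surjective (indAug hhom) := by
  intro b
  have h : Function.Surjective ((toReg k A).symm.toLinearMap ∘ₗ
      (koszulAug 𝒜).restrictScalars k) :=
    (toReg k A).symm.surjective.comp (koszul_isProjRes hA).surjective
  obtain ⟨z, hz⟩ := LinearMap.rTensor_surjective H h ((tensorToReg k A H).symm b)
  refine ⟨tensorToInd _ z, ?_⟩
  rw [indAug_tensorToInd, hz, LinearEquiv.apply_symm_apply]

end InducedKoszul

/-! ### Projectivity of the induced terms. -/

section Projective

/-- Over a semisimple ring every module is projective. The actions are given as representations, so
that several actions of `H` can be used without competing module instances. -/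
theorem exists_equivariant_lift {k H : Type*} [Field k] [Ring H] [Algebra k H] [IsSemisimpleRing H]
    {W F P : Type*} [AddCommGroup W] [Module k W] [AddCommGroup F] [Module k F] [AddCommGroup P]
    [Module k P] (τ : H →ₐ[k] Module.End k W) (φ : H →ₐ[k] Module.End k F)
    (χ : H →ₐ[k] Module.End k P) (p : F →ₗ[k] P) (hp : ∀ h y, p (φ h y) = χ h (p y))
    (hs : Function.Surjective p) (i : W →ₗ[k] P) (hi : ∀ h w, i (τ h w) = χ h (i w)) :
    ∃ s : W →ₗ[k] F, (∀ w, p (s w) = i w) ∧ ∀ h w, s (τ h w) = φ h (s w) := by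
  let _ : Module H W := Module.compHom W τ.toRingHom
  let _ : Module H F := Module.compHom F φ.toRingHom
  let _ : Module H P := Module.compHom P χ.toRingHom
  have : Module.Projective H W := Module.projective_of_isSemisimpleRing H W
  let p' : F →ₗ[H] P := { toFun := p, map_add' := map_add p, map_smul' := hp }
  let i' : W →ₗ[H] P := { toFun := i, map_add' := map_add i, map_smul' := hi }
  obtain ⟨s, h⟩ := Module.projective_lifting_property p' i' hs
  refine ⟨{ toFun := s, map_add' := map_add s, map_smul' := fun c w => ?_ }, fun w =>
    congrArg (fun f : W →ₗ[H] P => f w) h, fun h w => s.map_smul h w⟩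
  -- The lift is a priori only linear over `H`; it is linear over `k` since scalars act through
  -- `algebraMap k H`.
  have h1 : τ (algebraMap k H c) w = c • w := by rw [AlgHom.commutes]; rfl
  have h2 : φ (algebraMap k H c) (s w) = c • s w := by rw [AlgHom.commutes]; rfl
  rw [RingHom.id_apply, ← h1, ← h2]
  exact s.map_smul (algebraMap k H c) w

variable {k A H : Type*} [Field k] [Ring A] [Algebra k A] [Ring H] [HopfAlgebra k H]
  [Module H A] [IsScalarTower k H A] [HModuleAlgebra k H A] {𝒜 : ℕ → Submodule k A}
  (hhom : ∀ (h : H) (n : ℕ) (a : A), a ∈ 𝒜 n → h • a ∈ 𝒜 n) (m : ℕ)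

/-- The extension of an `H`-linear map `(A^!_m)^* → Y` to `Bᵉ ⊗_Γ K_m`. -/
theorem exists_indLift {Y : Type*} [AddCommGroup Y] [Module k Y] [Module (Env k (Smash k A H)) Y]
    [IsScalarTower k (Env k (Smash k A H)) Y] (s : koszulSp 𝒜 m →ₗ[k] Y)
    (hs : ∀ h w, s (wAct hhom m h w) = hopfRep k A H Y h (s w)) :
    ∃ f : Ind (kcGam hhom m) →ₗ[Env k (Smash k A H)] Y,
      ∀ w, f (Ind.mk _ 1 (KC.of 𝒜 w)) = s w := by
  let _ : Module (Env k A) Y := Module.compHom Y (envIn k A H).toRingHom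
  have hY : ∀ (e : Env k A) (y : Y), e • y = envIn k A H e • y := fun _ _ => rfl
  have : IsScalarTower k (Env k A) Y := ⟨fun c e y => by
    rw [hY, hY, map_smul, smul_assoc]⟩
  let f : KC 𝒜 m →ₗ[Env k A] Y := ext s ∘ₗ (kcEquiv 𝒜 m).symm.toLinearMap
  have hf : ∀ w, f (KC.of 𝒜 w) = s w := by
    intro w
    have : KC.of 𝒜 w = kcEquiv 𝒜 m (1 ⊗ₜ w) := by rw [kcEquiv_tmul, one_smul]
    change ext s ((kcEquiv 𝒜 m).symm (KC.of 𝒜 w)) = _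
    rw [this, LinearEquiv.symm_apply_apply, ext_tmul, one_smul]
  have hρ : ∀ h x, f (kcRep hhom m h x) = hopfRep k A H Y h (f x) := by
    intro h x
    induction x using KC.induction with
    | smul a b w =>
      exact equivariant_smul (kcRep_isHBimod hhom m) (hopfRep_isHBimod hY) f a b.unop
        (fun h => by rw [kcRep_of, hf, hf, hs]) h
    | add x y hx hy => simp only [map_add, hx, hy]
  refine ⟨Ind.lift (f.restrictScalars k) (gamAct_equivariant _ _ (fun e x => ?_) hρ), fun w => ?_⟩
  · exact f.map_smul e x
  · rw [Ind.lift_mk, one_smul]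
    exact hf w

/-- Maps out of `Bᵉ ⊗_Γ K_m` are determined by `H`-linear maps on the generating space `(A^!_m)^*`,
and every such map extends (`exists_indLift`). A lifting problem for bimodules thus becomes one for
`H`-modules, where semisimplicity solves it. -/
theorem ind_projective [IsSemisimpleRing H] :
    Module.Projective (Env k (Smash k A H)) (Ind (kcGam hhom m)) := by
  refine Module.Projective.of_lifting_property'' fun p hp => ?_
  obtain ⟨s, hs, hs'⟩ := exists_equivariant_lift (wRep hhom m)
    (hopfRep k A H (Ind (kcGam hhom m) →₀ Env k (Smash k A H)))
    (hopfRep k A H (Ind (kcGam hhom m))) (p.restrictScalars k)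
    (fun h y => p.map_smul _ y) hp (Ind.of (kcGam hhom m) ∘ₗ KC.of 𝒜) (fun h w => by
      rw [hopfRep_apply, LinearMap.comp_apply, LinearMap.comp_apply, Ind.of_apply, Ind.of_apply,
        Ind.gam_smul_mk, gamAct_hopf, kcRep_of, wRep_apply])
  obtain ⟨f, hf⟩ := exists_indLift hhom m s hs'
  refine ⟨f, Ind.hom_ext fun x => ?_⟩
  rw [LinearMap.comp_apply, LinearMap.id_apply]
  induction x using KC.induction with
  | smul a b w =>
    rw [← gamAct_env (kcRep_isHBimod hhom m), ← Ind.gam_smul_mk, f.map_smul, p.map_smul, hf]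
    exact congrArg _ (hs w)
  | add x y hx hy => rw [Ind.mk_add, map_add, map_add, hx, hy]

theorem ind_isProjRes [IsSemisimpleRing H] (hA : IsKoszul 𝒜) [GradedAlgebra 𝒜] :
    IsProjRes (Env k (Smash k A H)) (fun m => Ind (kcGam hhom m)) (indD hhom) (indAug hhom) where
  projective m := ind_projective hhom m
  surjective := indAug_surjective hhom hA
  exact_zero := indAug_exact hhom hA
  exact_succ := indD_exact hhom hA

end Projective

section SweedlerMul

variable {k H R : Type*} [Field k] [Ring H] [HopfAlgebra k H] [Ring R]

theorem mul_sw₂ (c : R) (h : H) (F : H → H → R) :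
    c * sw₂ k h F = sw₂ k h fun x y => c * F x y := Finset.mul_sum _ _ _

theorem sw₂_mul_const (c : R) (h : H) (F : H → H → R) :
    sw₂ k h F * c = sw₂ k h fun x y => F x y * c := Finset.sum_mul _ _ _

theorem mul_sw₃ (c : R) (h : H) (F : H → H → H → R) :
    c * sw₃ k h F = sw₃ k h fun x y z => c * F x y z :=
  (mul_sw₂ _ _ _).trans (sw₂_congr _ fun _ _ => mul_sw₂ _ _ _)

theorem sw₃_mul_const (c : R) (h : H) (F : H → H → H → R) :
    sw₃ k h F * c = sw₃ k h fun x y z => F x y z * c :=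
  (sw₂_mul_const _ _ _).trans (sw₂_congr _ fun _ _ => sw₂_mul_const _ _ _)

end SweedlerMul

/-! ### The operation `∑ S(h₁) F(h₂) h₃`. -/

section Conjugation

variable {k A H : Type*} [Field k] [Ring A] [Algebra k A] [Ring H] [HopfAlgebra k H]
  [Module H A] [IsScalarTower k H A] [HModuleAlgebra k H A]

variable (k A) in
/-- `∑ S(h₁) F(h₂) h₃`, for `F : H → A # H`. -/
def conj (F : H → Smash k A H) (h : H) : Smash k A H :=
  sw₃ k h fun x y z => inH k A H (HopfAlgebra.antipode k x) * F y * inH k A H z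

theorem conj_add (F G : H → Smash k A H) (h : H) :
    conj k A (fun y => F y + G y) h = conj k A F h + conj k A G h := by
  simp only [conj, sw₃, mul_add, add_mul, sw₂_add_fun]

variable {F : H → Smash k A H} (hF : IsLinearMap k F)
include hF

theorem isTrilin_conj : IsTrilin k fun x y z =>
    inH k A H (HopfAlgebra.antipode k x) * F y * inH k A H z := by
  constructor
  · intro w
    constructor <;> intros <;> simp [hF.map_add, hF.map_smul, add_mul, mul_add]
  all_goals intros
  all_goals simp [mul_add]

theorem isLinearMap_conj : IsLinearMap k (conj k A F) :=
  ⟨(isTrilin_conj hF).sw₃_add, (isTrilin_conj hF).sw₃_smul⟩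

/-- For `F(y) = f(yx)` this says `(f ↼ t) ↼ h = f ↼ th`, so `↼` is a right action. -/
theorem conj_mul (t h : H) : conj k A (fun y => conj k A (fun z => F (z * y)) t) h =
    conj k A F (t * h) := by
  refine Eq.trans ?_ ((isTrilin_conj hF).sw₃_mul t h).symm
  rw [sw₃_comm]
  refine sw₃_congr _ fun x y z => ?_
  beta_reduce
  rw [conj, mul_sw₃, sw₃_mul_const]
  refine sw₃_congr _ fun u v w => ?_
  rw [HopfAlgebra.antipode_mul_antidistrib, map_mul, map_mul]
  simp only [mul_assoc]

/-- The identity `∑ S(h₁)(h₂a) = a S(h)` moves `a` to the far left. With `conj_mul_inA`, which uses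
the commutation rule of `B` on the other side, it shows that `f ↼ h` is again a bimodule map. -/
theorem conj_inA_mul (a : A) (h : H) :
    conj k A (fun y => sw₂ k y fun u v => inA k A H (u • a) * F v) h =
      inA k A H a * conj k A F h := by
  have hT : ∀ x : H, IsTrilin k fun u v z => inH k A H (HopfAlgebra.antipode k x) *
      (inA k A H (u • a) * F v) * inH k A H z := by
    intro x
    constructor
    · intro w
      constructor <;> intros <;> simp [hF.map_add, hF.map_smul, add_smul, add_mul, mul_add]
    all_goals intros
    all_goals simp [mul_add]
  have hB : IsBilin k fun v z => F v * inH k A H z := by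
    constructor <;> intros <;> simp [hF.map_add, hF.map_smul, add_mul, mul_add]
  have hT' : IsTrilin k fun x u w => inH k A H (HopfAlgebra.antipode k x) * inA k A H (u • a) *
      sw₂ k w fun v z => F v * inH k A H z := by
    constructor
    · intro w
      constructor <;> intros <;> simp [add_smul, add_mul, mul_add]
    all_goals intros
    · rw [hB.sw₂_add, mul_add]
    · rw [hB.sw₂_smul, mul_smul_comm]
  calc conj k A (fun y => sw₂ k y fun u v => inA k A H (u • a) * F v) h
      = sw₂ k h fun x y => sw₂ k y fun y z => sw₂ k y fun u v =>
        inH k A H (HopfAlgebra.antipode k x) * (inA k A H (u • a) * F v) * inH k A H z := by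
        refine sw₃_congr _ fun x y z => ?_
        beta_reduce
        rw [mul_sw₂, sw₂_mul_const]
    _ = sw₂ k h fun x y => sw₂ k y fun u w => inH k A H (HopfAlgebra.antipode k x) *
          inA k A H (u • a) * sw₂ k w fun v z => F v * inH k A H z := by
        refine sw₂_congr _ fun x y => ((hT x).sw₂_assoc y).trans (sw₂_congr _ fun u w => ?_)
        rw [mul_sw₂]
        refine sw₂_congr _ fun v z => ?_
        simp only [mul_assoc]
    _ = sw₂ k h fun y w => inA k A H a * inH k A H (HopfAlgebra.antipode k y) *
          sw₂ k w fun v z => F v * inH k A H z := by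
        refine (hT'.sw₂_assoc h).symm.trans (sw₂_congr _ fun y w => ?_)
        rw [← sum_antipode_mul_inA_smul, sw₂_mul_const]
    _ = _ := by
        rw [conj, mul_sw₃]
        refine sw₂_congr _ fun y w => ?_
        rw [mul_sw₂]
        refine sw₂_congr _ fun v z => ?_
        simp only [mul_assoc]

theorem conj_mul_inA (a : A) (h : H) :
    conj k A (fun y => sw₂ k y fun u v => F u * inA k A H (v • a)) h =
      conj k A F h * inA k A H a := by
  have hT : ∀ x : H, IsTrilin k fun u v z => inH k A H (HopfAlgebra.antipode k x) *
      (F u * inA k A H (v • a)) * inH k A H z := by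
    intro x
    constructor
    · intro w
      constructor <;> intros <;> simp [hF.map_add, hF.map_smul, add_smul, add_mul, mul_add]
    all_goals intros
    all_goals simp [mul_add]
  rw [conj, conj, sw₃_mul_const]
  refine sw₂_congr _ fun x y => ?_
  refine Eq.trans (sw₂_congr _ fun u v => ?_) (((hT x).sw₂_assoc y).trans
    (sw₂_congr _ fun u v => ?_))
  · beta_reduce
    rw [mul_sw₂, sw₂_mul_const]
  · beta_reduce
    rw [mul_assoc _ (inH k A H v), inH_mul_inA, mul_sw₂]
    refine sw₂_congr _ fun y z => ?_
    simp only [mul_assoc]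

omit hF in
theorem conv_apply {B : Type*} [Ring B] [Algebra k B] (f g : WithConv (H →ₗ[k] B)) (h : H) :
    (f * g).ofConv h = sw₂ k h fun x y => f.ofConv x * g.ofConv y :=
  (Coalgebra.Repr.arbitrary k h).convMul_apply f g

/-- `∑ S(h₁) F(h₂) h₃ = ε(h) b` if and only if `F(h) = ∑ h₁ b S(h₂)`. -/
theorem conj_eq_counit_iff (b : Smash k A H) :
    (∀ h, conj k A F h = Coalgebra.counit (R := k) h • b) ↔
      ∀ h, F h = sw₂ k h fun x y => inH k A H x * b * inH k A H (HopfAlgebra.antipode k y) := by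
  -- In the convolution algebra `Hom(H, B)` the two sides of the equivalence read `S * F' * J = c`
  -- and `F' = J * c * S`, and `S` is the inverse of `J`.
  let J : WithConv (H →ₗ[k] Smash k A H) := WithConv.toConv (inH k A H).toLinearMap
  let S : WithConv (H →ₗ[k] Smash k A H) :=
    WithConv.toConv ((inH k A H).toLinearMap ∘ₗ HopfAlgebra.antipode k)
  let F' : WithConv (H →ₗ[k] Smash k A H) := WithConv.toConv hF.mk'
  let c : WithConv (H →ₗ[k] Smash k A H) :=
    WithConv.toConv ((LinearMap.toSpanSingleton k _ b) ∘ₗ Coalgebra.counit)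
  have hSJ : S * J = 1 := by
    apply WithConv.ofConv_injective
    refine LinearMap.ext fun h => ?_
    rw [conv_apply]
    refine Eq.trans (sw₂_congr _ fun x y => ?_) ((sw₂_antipode_left h
      (inH k A H).toLinearMap).trans ?_)
    · exact (map_mul (inH k A H) _ _).symm
    · simp [Algebra.algebraMap_eq_smul_one]
  have hJS : J * S = 1 := by
    apply WithConv.ofConv_injective
    refine LinearMap.ext fun h => ?_
    rw [conv_apply]
    refine Eq.trans (sw₂_congr _ fun x y => ?_) ((sw₂_antipode_right h
      (inH k A H).toLinearMap).trans ?_)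
    · exact (map_mul (inH k A H) _ _).symm
    · simp [Algebra.algebraMap_eq_smul_one]
  have h1 : ∀ h, (S * (F' * J)).ofConv h = conj k A F h := by
    intro h
    rw [conv_apply, conj, sw₃]
    refine sw₂_congr _ fun x y => ?_
    rw [conv_apply, mul_sw₂]
    exact sw₂_congr _ fun u v => (mul_assoc _ _ _).symm
  have h2 : ∀ h, (J * (c * S)).ofConv h =
      sw₂ k h fun x y => inH k A H x * b * inH k A H (HopfAlgebra.antipode k y) := by
    intro h
    rw [conv_apply]
    refine sw₂_congr _ fun x y => ?_
    rw [conv_apply, mul_assoc]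
    refine congrArg _ (Eq.trans (sw₂_congr _ fun u v => ?_) (sw₂_counit_left y
      (LinearMap.mulLeft k b ∘ₗ (inH k A H).toLinearMap ∘ₗ HopfAlgebra.antipode k)))
    exact smul_mul_assoc (Coalgebra.counit (R := k) u) b (inH k A H (HopfAlgebra.antipode k v))
  have hl : (∀ h, conj k A F h = Coalgebra.counit (R := k) h • b) ↔ S * (F' * J) = c :=
    ⟨fun h => WithConv.ofConv_injective (LinearMap.ext fun x => (h1 x).trans (h x)),
      fun h x => by rw [← h1, h]; rfl⟩
  have hr : (∀ h, F h = sw₂ k h fun x y => inH k A H x * b *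
      inH k A H (HopfAlgebra.antipode k y)) ↔ F' = J * (c * S) :=
    ⟨fun h => WithConv.ofConv_injective (LinearMap.ext fun x => (h x).trans (h2 x).symm),
      fun h x => by rw [← h2, ← h]; rfl⟩
  rw [hl, hr]
  constructor
  · intro h
    rw [← h, mul_assoc S, mul_assoc F', hJS, mul_one, ← mul_assoc, hJS, one_mul]
  · intro h
    rw [h, mul_assoc J, mul_assoc c, hSJ, mul_one, ← mul_assoc, hSJ, one_mul]

end Conjugation

/-- By semisimplicity the counit splits as a map of right `H`-modules; the image of `1` under the
section is a right integral, normalized by the splitting. -/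
theorem exists_integral (k H : Type*) [Field k] [Ring H] [HopfAlgebra k H] [IsSemisimpleRing H] :
    ∃ t : H, Coalgebra.counit (R := k) t = 1 ∧
      ∀ h, t * h = Coalgebra.counit (R := k) h • t := by
  let χ : Hᵐᵒᵖ →ₐ[k] Module.End k k := (Algebra.lmul k k).comp
    (AlgHom.fromOpposite (Bialgebra.counitAlgHom k H) fun _ _ => Commute.all _ _)
  have hχ : ∀ (h : H) (c : k), χ (MulOpposite.op h) c = Coalgebra.counit (R := k) h * c :=
    fun _ _ => rfl
  let φ : Hᵐᵒᵖ →ₐ[k] Module.End k H := Algebra.lsmul k k H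
  have hφ : ∀ (h : H) (x : H), φ (MulOpposite.op h) x = x * h := fun _ _ => rfl
  obtain ⟨s, hs, hs'⟩ := exists_equivariant_lift χ φ χ (Coalgebra.counit (R := k) (A := H))
    (fun h y => by
      rw [← MulOpposite.op_unop h, hφ, hχ, Bialgebra.counit_mul, mul_comm])
    (fun c => ⟨c • 1, by simp⟩) LinearMap.id (fun _ _ => rfl)
  refine ⟨s 1, hs 1, fun h => ?_⟩
  rw [← hφ, ← hs', hχ, mul_one, ← map_smul, smul_eq_mul, mul_one]

/-! ### Invariants as morphisms of `Γ`-modules, and the bijection `Θ`. -/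

section Theta

variable {k A H : Type*} [Field k] [Ring A] [Algebra k A] [Ring H] [HopfAlgebra k H]
  [Module H A] [IsScalarTower k H A] [HModuleAlgebra k H A]
  {M : Type*} [AddCommGroup M] [Module k M] [Module (Env k A) M] [IsScalarTower k (Env k A) M]

theorem toReg_smul (e : Env k A) (b : Smash k A H) :
    toReg k _ (e • b) = envIn k A H e • toReg k _ b := rfl

theorem hopfGam_smul_toReg (h : H) (b : Smash k A H) :
    (hopfGam k A H h : Env k (Smash k A H)) • toReg k _ b = toReg k _
      (sw₂ k h fun x y => inH k A H x * b * inH k A H (HopfAlgebra.antipode k y)) := by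
  rw [coe_hopfGam, sw₂_smul, map_sw₂]
  exact sw₂_congr _ fun x y => reg_smul _ _ _

variable {ρ : H →ₐ[k] Module.End k M}

theorem isLinearMap_orbit (ρ : H →ₐ[k] Module.End k M) (f : M →ₗ[Env k A] Smash k A H) (x : M) :
    IsLinearMap k fun y => f (ρ y x) := by
  constructor
  · intro y y'
    rw [map_add, LinearMap.add_apply, map_add]
  · intro c y
    rw [map_smul, LinearMap.smul_apply]
    exact map_smul (f.restrictScalars k) c _

variable (hρ : IsHBimod (A := A) ρ)

theorem isHInv_iff_conj (f : M →ₗ[Env k A] Smash k A H) : IsHInv (gamAct hρ) f ↔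
    ∀ x h, conj k A (fun y => f (ρ y x)) h = Coalgebra.counit (R := k) h • f x := by
  rw [forall_comm]
  refine forall_congr' fun h => forall_congr' fun x => ?_
  simp only [gamAct_hopf, conj]

/-- By `conj_eq_counit_iff`, invariance is equivariance for the action `b ↦ ∑ h₁ b S(h₂)` on `B`.
The invariants of `Hom_{Aᵉ}(M, B)` are thus the `Γ`-linear maps, and `Θ` is the adjunction of
induction and restriction. -/
theorem isHInv_iff (f : M →ₗ[Env k A] Smash k A H) : IsHInv (gamAct hρ) f ↔
    ∀ h x, toReg k _ (f (ρ h x)) = (hopfGam k A H h : Env k (Smash k A H)) • toReg k _ (f x) := by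
  rw [isHInv_iff_conj, forall_comm]
  refine Iff.trans (forall_comm.trans (forall_congr' fun x =>
    conj_eq_counit_iff (isLinearMap_orbit ρ f x) (f x))) (forall_comm.trans
      (forall_congr' fun h => forall_congr' fun x => ?_))
  rw [hopfGam_smul_toReg, EmbeddingLike.apply_eq_iff_eq]

/-- The map `Θ(f)`. -/
def theta (f : M →ₗ[Env k A] Smash k A H) (hf : IsHInv (gamAct hρ) f) :
    Ind (gamAct hρ) →ₗ[Env k (Smash k A H)] Reg (Smash k A H) :=
  Ind.lift ((toReg k (Smash k A H)).toLinearMap ∘ₗ f.restrictScalars k)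
    (gamAct_equivariant hρ _
      (fun e x => by
        change toReg k (Smash k A H) (f (e • x)) = _
        rw [f.map_smul, toReg_smul]
        rfl)
      ((isHInv_iff hρ f).1 hf))

theorem theta_mk (f : M →ₗ[Env k A] Smash k A H) (hf : IsHInv (gamAct hρ) f)
    (e : Env k (Smash k A H)) (x : M) : theta hρ f hf (Ind.mk _ e x) = e • toReg k _ (f x) := rfl

theorem isTheta_iff (f : M →ₗ[Env k A] Smash k A H)
    (g : Ind (gamAct hρ) →ₗ[Env k (Smash k A H)] Reg (Smash k A H)) :
    IsTheta (gamAct hρ) f g ↔ ∀ x, g (Ind.mk _ 1 x) = toReg k _ (f x) := by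
  constructor
  · intro h x
    have := h 1 1 x
    rwa [MulOpposite.op_one, ← Algebra.TensorProduct.one_def, one_mul, mul_one] at this
  · intro h b b' x
    rw [Ind.mk_eq_smul, g.map_smul, h, reg_smul]

theorem existsUnique_theta (f : M →ₗ[Env k A] Smash k A H) (hf : IsHInv (gamAct hρ) f) :
    ∃! g : Ind (gamAct hρ) →ₗ[Env k (Smash k A H)] Reg (Smash k A H),
      IsTheta (gamAct hρ) f g := by
  refine ⟨theta hρ f hf, (isTheta_iff hρ _ _).2 fun x => by rw [theta_mk, one_smul], fun g hg => ?_⟩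
  refine Ind.hom_ext fun x => ?_
  rw [(isTheta_iff hρ _ _).1 hg, theta_mk, one_smul]

theorem existsUnique_of_theta
    (g : Ind (gamAct hρ) →ₗ[Env k (Smash k A H)] Reg (Smash k A H)) :
    ∃! f : M →ₗ[Env k A] Smash k A H, IsHInv (gamAct hρ) f ∧ IsTheta (gamAct hρ) f g := by
  let f : M →ₗ[Env k A] Smash k A H :=
    { toFun := fun x => (toReg k (Smash k A H)).symm (g (Ind.of _ x))
      map_add' := fun x y => by simp only [map_add]
      map_smul' := fun e x => by
        apply (toReg k (Smash k A H)).injective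
        rw [RingHom.id_apply, toReg_smul, AlgEquiv.apply_symm_apply, AlgEquiv.apply_symm_apply,
          Ind.of_apply, ← gamAct_env hρ, ← Ind.gam_smul_mk, g.map_smul]
        rfl }
  have hf : ∀ x, toReg k _ (f x) = g (Ind.mk _ 1 x) := fun x => AlgEquiv.apply_symm_apply _ _
  refine ⟨f, ⟨(isHInv_iff hρ f).2 fun h x => ?_, (isTheta_iff hρ _ _).2 fun x => (hf x).symm⟩,
    fun f' hf' => LinearMap.ext fun x => ?_⟩
  · rw [hf, hf, ← gamAct_hopf hρ, ← Ind.gam_smul_mk, g.map_smul]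
  · apply (toReg k (Smash k A H)).injective
    rw [← (isTheta_iff hρ _ _).1 hf'.2, hf]

include hρ in
/-- The map `f ↼ h`. -/
theorem exists_conj (f : M →ₗ[Env k A] Smash k A H) (h : H) : ∃ f' : M →ₗ[Env k A] Smash k A H,
    ∀ x, f' x = conj k A (fun y => f (ρ y x)) h := by
  have hadd : ∀ x x', conj k A (fun y => f (ρ y (x + x'))) h =
      conj k A (fun y => f (ρ y x)) h + conj k A (fun y => f (ρ y x')) h := fun x x' => by
    simp only [map_add, conj_add]
  refine ⟨{ toFun := fun x => conj k A (fun y => f (ρ y x)) h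
            map_add' := hadd
            map_smul' := fun e x => ?_ }, fun x => rfl⟩
  rw [RingHom.id_apply]
  refine TensorProduct.induction_on (motive := fun e : Env k A =>
    conj k A (fun y => f (ρ y (e • x))) h = e • conj k A (fun y => f (ρ y x)) h) e ?_
      (fun a b => ?_) fun e e' he he' => ?_
  · have h0 : (0 : Env k A) • x = 0 := zero_smul (Env k A) x
    have h1 : (0 : Env k A) • conj k A (fun y => f (ρ y x)) h = 0 :=
      zero_smul (Env k A) (conj k A (fun y => f (ρ y x)) h)
    rw [h1]
    simp only [h0, map_zero, conj, mul_zero, zero_mul, sw₃, sw₂_zero_fun]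
  · rw [← MulOpposite.op_unop b]
    generalize b.unop = b
    have h1 : ∀ y, f (ρ y ((a ⊗ₜ MulOpposite.op b : Env k A) • x)) =
        sw₂ k y fun u v => inA k A H (u • a) *
          f (ρ v ((1 ⊗ₜ MulOpposite.op b : Env k A) • x)) := by
      intro y
      rw [env_smul_eq, hρ.left, map_sw₂]
      refine sw₂_congr _ fun u v => ?_
      rw [f.map_smul, ← MulOpposite.op_one, smash_smul, map_one, mul_one]
    have h2 : ∀ y, f (ρ y ((1 ⊗ₜ MulOpposite.op b : Env k A) • x)) =
        sw₂ k y fun u v => f (ρ u x) * inA k A H (v • b) := by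
      intro y
      rw [hρ.right, map_sw₂]
      refine sw₂_congr _ fun u v => ?_
      rw [f.map_smul, smash_smul, map_one, one_mul]
    simp only [h1]
    rw [conj_inA_mul (isLinearMap_orbit ρ f _)]
    simp only [h2]
    rw [conj_mul_inA (isLinearMap_orbit ρ f _), smash_smul, mul_assoc]
  · rw [add_smul, hadd, he, he', add_smul]

/-- Averaging over a right integral yields invariants. -/
theorem isHInv_of_conj {t : H} (ht : ∀ h, t * h = Coalgebra.counit (R := k) h • t)
    {f f' : M →ₗ[Env k A] Smash k A H} (hf' : ∀ x, f' x = conj k A (fun y => f (ρ y x)) t) :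
    IsHInv (gamAct hρ) f' := by
  rw [isHInv_iff_conj]
  intro x h
  simp only [hf']
  rw [← (isLinearMap_conj (isLinearMap_orbit ρ f x)).map_smul, ← ht,
    ← conj_mul (isLinearMap_orbit ρ f x)]
  simp only [map_mul, Module.End.mul_apply]

theorem conj_of_isHInv {t : H} (ht : Coalgebra.counit (R := k) t = 1)
    {f : M →ₗ[Env k A] Smash k A H} (hf : IsHInv (gamAct hρ) f) (x : M) :
    conj k A (fun y => f (ρ y x)) t = f x := by
  rw [(isHInv_iff_conj hρ f).1 hf, ht, one_smul]

end Theta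

/-! ### The action of `H` on Hochschild cochains and its restriction to `K`. -/

section CochainAction

variable {k A H : Type*} [Field k] [Ring A] [Algebra k A] [Ring H] [HopfAlgebra k H]
  [Module H A] [IsScalarTower k H A] [HModuleAlgebra k H A]

theorem hochAct_eq_conj {m : ℕ} (f : Cochain k A (Smash k A H) m) (h : H) (a : Fin m → A) :
    hochAct f h a = conj k A (fun y => evT f (tAct y (TensorAlgebra.tprod k A m a))) h := rfl

theorem evT_of_mem_pow_of_ne {N : Type*} [AddCommGroup N] [Module k N] {m n : ℕ} (hne : n ≠ m)
    (f : Cochain k A N m) {t : TensorAlgebra k A}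
    (ht : t ∈ LinearMap.range (TensorAlgebra.ι k (M := A)) ^ n) : evT f t = 0 := by
  have hspan : LinearMap.range (TensorAlgebra.ι k (M := A)) ^ n ≤ LinearMap.ker (evT f) := by
    refine (range_ι_pow_le_span _).trans (Submodule.span_le.2 ?_)
    rintro _ ⟨a, rfl⟩
    exact evT_tprod_of_ne hne f a
  exact hspan ht

theorem tprod_mem_pow {m : ℕ} (a : Fin m → A) :
    TensorAlgebra.tprod k A m a ∈ LinearMap.range (TensorAlgebra.ι k (M := A)) ^ m := by
  induction m with
  | zero => rw [tprod_elim0, pow_zero]; exact Submodule.one_le.1 le_rfl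
  | succ m ih =>
    rw [← Fin.cons_self_tail a, tprod_cons, pow_succ']
    exact Submodule.mul_mem_mul ⟨_, rfl⟩ (ih _)

theorem tAct_tprod_mem_pow {m : ℕ} (h : H) (a : Fin m → A) :
    tAct h (TensorAlgebra.tprod k A m a) ∈ LinearMap.range (TensorAlgebra.ι k (M := A)) ^ m := by
  refine tAct_mem_pow (fun h t ht => ?_) m h _ (tprod_mem_pow a)
  obtain ⟨a, rfl⟩ := ht
  rw [tAct_ι]
  exact ⟨_, rfl⟩

/-- The cochain `f ↼ h`, and the corresponding map of bimodules. -/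
theorem exists_hochAct {m : ℕ} (f : Cochain k A (Smash k A H) m) (h : H) :
    ∃ f' : Cochain k A (Smash k A H) m, ⇑f' = hochAct f h ∧
      ∀ x, ext (evT f') x = conj k A (fun y => ext (evT f) (barAct y x)) h := by
  obtain ⟨g, hg⟩ := exists_conj (barRep_isHBimod (k := k) (A := A) (H := H)) (ext (evT f)) h
  let T : TensorAlgebra k A →ₗ[k] Smash k A H :=
    g.restrictScalars k ∘ₗ TensorProduct.mk k (Env k A) (TensorAlgebra k A) 1
  have hT : ∀ t, T t = conj k A (fun y => evT f (tAct y t)) h := fun t => by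
    refine (hg _).trans ?_
    simp only [barRep_apply, TensorProduct.mk_apply, barAct_one_one_tmul, ext_tmul, one_smul]
  let f' : Cochain k A (Smash k A H) m := T.compMultilinearMap (TensorAlgebra.tprod k A m)
  have hf' : ⇑f' = hochAct f h := funext fun a => hT _
  have hev : evT f' = T := by
    refine linearMap_ext_tprod fun n a => ?_
    by_cases hn : n = m
    · subst hn
      rw [evT_tprod]
      rfl
    -- The action of `H` preserves the length of tensors, so both sides vanish on other lengths.
    · rw [evT_tprod_of_ne hn, hT]
      simp only [evT_of_mem_pow_of_ne hn f (tAct_tprod_mem_pow _ a), conj, mul_zero, zero_mul,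
        sw₃, sw₂_zero_fun]
  refine ⟨f', hf', fun x => (LinearMap.congr_fun (f := ext (evT f')) (g := g) ?_ x).trans (hg x)⟩
  refine LinearMap.ext fun x => ?_
  induction x with
  | zero => simp only [map_zero]
  | add x y hx hy => simp only [map_add, hx, hy]
  | tmul e t =>
    have : (e ⊗ₜ t : Env k A ⊗[k] TensorAlgebra k A) = e • ((1 : Env k A) ⊗ₜ t) := by
      rw [TensorProduct.smul_tmul', smul_eq_mul, mul_one]
    rw [this, LinearMap.map_smul, LinearMap.map_smul, ext_tmul, hev, one_smul]
    rfl

/-- The diagonal action commutes with the bar differential (`barAct_barD`), so the action on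
cochains commutes with the Hochschild differential. -/
theorem hochD_hochAct {m : ℕ} (f : Cochain k A (Smash k A H) m) (h : H) :
    hochD k (hochAct f h) = hochAct (hochDM f) h := by
  obtain ⟨f', hf', he⟩ := exists_hochAct f h
  funext a
  rw [← hf', ← ext_barD_tprod, he, hochAct_eq_conj]
  simp only [barAct_barD, evT_hochDM f (tAct_tprod_mem_pow _ a)]

theorem hochAct_zero {m : ℕ} (h : H) : hochAct (0 : Cochain k A (Smash k A H) m) h = 0 := by
  have := hochAct_smul k A H 0 (0 : Cochain k A (Smash k A H) m) h
  rwa [zero_smul, zero_smul] at this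

theorem hochD_hochAct_eq_zero {m : ℕ} {f : Cochain k A (Smash k A H) m} (hf : hochD k f = 0)
    (h : H) : hochD k (hochAct f h) = 0 := by
  have : hochDM f = 0 := MultilinearMap.ext fun a => by rw [hochDM_apply, hf]; rfl
  rw [hochD_hochAct, this, hochAct_zero]

variable {𝒜 : ℕ → Submodule k A}

theorem barHom_toBar {N : Type*} [AddCommGroup N] [Module k N] [Module (Env k A) N]
    [IsScalarTower k (Env k A) N] {m : ℕ} (f : Cochain k A N m) (x : KC 𝒜 m) :
    barHom f (toBar 𝒜 m x) = ext (evT f) (KC.val 𝒜 x) := by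
  rw [toBar, LinearMap.comp_apply]
  generalize KC.val 𝒜 x = z
  induction z with
  | zero => simp only [map_zero]
  | add x y hx hy => simp only [map_add, hx, hy]
  | tmul e t => rw [ext_tmul, ext_tmul, LinearMap.map_smul, ext_evT_eq_barHom]

/-- The inclusion of `K` into the bar resolution is equivariant, so restriction of cochains to `K`
intertwines the two actions exactly. A comparison map in the other direction need not be
equivariant, and none such has to be found. -/
theorem barHom_toBar_hochAct (hhom : ∀ (h : H) (n : ℕ) (a : A), a ∈ 𝒜 n → h • a ∈ 𝒜 n) {m : ℕ}
    {f f' : Cochain k A (Smash k A H) m} {h : H} (hf : ⇑f' = hochAct f h) (x : KC 𝒜 m) :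
    barHom f' (toBar 𝒜 m x) =
      conj k A (fun y => barHom f (toBar 𝒜 m (kcRep hhom m y x))) h := by
  obtain ⟨f'', hf'', he⟩ := exists_hochAct f h
  obtain rfl : f' = f'' := MultilinearMap.coe_injective (hf.trans hf''.symm)
  simp only [barHom_toBar, he, val_kcRep]

end CochainAction

section Functoriality

variable {k A N A' N' : Type*} [Field k] [Ring A] [Algebra k A] [AddCommGroup N]
  [Module (Env k A) N] [Module k N] [IsScalarTower k (Env k A) N] [Ring A'] [Algebra k A']
  [AddCommGroup N'] [Module (Env k A') N'] [Module k N'] [IsScalarTower k (Env k A') N']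

/-- The map on Hochschild cohomology that is induced by a map on cocycles. -/
def hochMap {m : ℕ} (φ : cocycles k A N m →ₗ[k] cocycles k A' N' m)
    (h : coboundaries k A N m ≤ (coboundaries k A' N' m).comap φ) :
    HochCoh k A N m →ₗ[k] HochCoh k A' N' m :=
  Submodule.mapQ _ _ φ h

theorem hochMap_mk {m : ℕ} (φ : cocycles k A N m →ₗ[k] cocycles k A' N' m)
    (h : coboundaries k A N m ≤ (coboundaries k A' N' m).comap φ) (f : cocycles k A N m) :
    hochMap φ h (Submodule.Quotient.mk f) = Submodule.Quotient.mk (φ f) := rfl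

end Functoriality

/-! ### Restriction of Hochschild cohomology along `A → A # H`. -/

section Restriction

variable {k A H : Type*} [Field k] [Ring A] [Algebra k A] [Ring H] [HopfAlgebra k H]
  [Module H A] [IsScalarTower k H A] [HModuleAlgebra k H A]

theorem inA_comp_contractNth {m : ℕ} (j : Fin (m + 1)) (a : Fin (m + 1) → A) :
    (fun i => inA k A H (Fin.contractNth j (· * ·) a i)) =
      Fin.contractNth j (· * ·) fun i => inA k A H (a i) := by
  funext i
  unfold Fin.contractNth
  split_ifs <;> simp only [map_mul]

/-- Restriction of Hochschild cochains along `A → A # H`. -/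
def resC {m : ℕ} (F : Cochain k (Smash k A H) (Reg (Smash k A H)) m) :
    Cochain k A (Smash k A H) m :=
  (toReg k (Smash k A H)).symm.toLinearMap.compMultilinearMap
    (F.compLinearMap fun _ => (inA k A H).toLinearMap)

theorem resC_apply {m : ℕ} (F : Cochain k (Smash k A H) (Reg (Smash k A H)) m) (a : Fin m → A) :
    resC F a = (toReg k (Smash k A H)).symm (F fun i => inA k A H (a i)) := rfl

theorem smul_toReg_symm (a b : A) (x : Reg (Smash k A H)) :
    (a ⊗ₜ MulOpposite.op b : Env k A) • (toReg k (Smash k A H)).symm x =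
      (toReg k (Smash k A H)).symm
        ((inA k A H a ⊗ₜ MulOpposite.op (inA k A H b) : Env k (Smash k A H)) • x) :=
  (smash_smul k A H a b _).trans (reg_smul (k := k) _ _ ((toReg k (Smash k A H)).symm x)).symm

theorem hochD_resC {m : ℕ} (F : Cochain k (Smash k A H) (Reg (Smash k A H)) m)
    (a : Fin (m + 1) → A) : hochD k (resC F) a =
      (toReg k (Smash k A H)).symm (hochD k F fun i => inA k A H (a i)) := by
  simp only [hochD, resC_apply, map_add, map_sum, map_zsmul, inA_comp_contractNth]
  rw [← MulOpposite.op_one, smul_toReg_symm, smul_toReg_symm, map_one, MulOpposite.op_one]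
  rfl

theorem IsCobdry.resC {m : ℕ} {F : Cochain k (Smash k A H) (Reg (Smash k A H)) m}
    (hF : IsCobdry k F) : IsCobdry k (resC F) := by
  cases m with
  | zero =>
    obtain rfl : F = 0 := MultilinearMap.coe_injective hF
    exact funext fun a => map_zero (toReg k (Smash k A H)).symm
  | succ m =>
    obtain ⟨G, hG⟩ := hF
    exact ⟨KoszulSmash.resC G, funext fun a => by rw [hochD_resC, ← hG, resC_apply]⟩

variable (k A H) in
/-- Restriction of Hochschild cocycles along `A → A # H`. -/
def resZ (m : ℕ) : cocycles k (Smash k A H) (Reg (Smash k A H)) m →ₗ[k]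
    cocycles k A (Smash k A H) m where
  toFun F := ⟨resC F.1, funext fun a => by
    have h : hochD k F.1 = 0 := F.2
    rw [hochD_resC, h]
    exact map_zero _⟩
  map_add' F G := Subtype.ext (MultilinearMap.ext fun a => map_add (toReg k (Smash k A H)).symm _ _)
  map_smul' c F := Subtype.ext (MultilinearMap.ext fun a => map_smul (toReg k (Smash k A H)).symm _ _)

theorem resZ_mem {m : ℕ} : coboundaries k (Smash k A H) (Reg (Smash k A H)) m ≤
    (coboundaries k A (Smash k A H) m).comap (resZ k A H m) := by
  intro F hF
  have h : IsCobdry k F.1 := hF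
  exact h.resC

variable (k A H) in
/-- The restriction map `HH^•(A # H) → H^•(A, A # H)`. -/
def resHoch (m : ℕ) : HochCoh k (Smash k A H) (Reg (Smash k A H)) m →ₗ[k]
    HochCoh k A (Smash k A H) m :=
  hochMap (resZ k A H m) resZ_mem

end Restriction

section General

variable {k A N : Type*} [Field k] [Ring A] [Algebra k A] [AddCommGroup N] [Module (Env k A) N]
  [Module k N]

theorem IsCobdry.neg {m : ℕ} {f : (Fin m → A) → N} (hf : IsCobdry k f) : IsCobdry k (-f) := by
  cases m with
  | zero => simp only [IsCobdry] at hf ⊢; rw [hf, neg_zero]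
  | succ m =>
    obtain ⟨g, rfl⟩ := hf
    refine ⟨-g, funext fun a => ?_⟩
    have := congrFun (hochD_add k (-⇑g) ⇑g) a
    rw [neg_add_cancel, hochD_zero] at this
    exact (eq_neg_of_add_eq_zero_left this.symm).symm

theorem IsCobdry.symm {m : ℕ} {f g : (Fin m → A) → N} (h : IsCobdry k (f - g)) :
    IsCobdry k (g - f) := by
  rw [← neg_sub]
  exact h.neg

theorem IsCobdry.trans {m : ℕ} {f g l : (Fin m → A) → N} (h : IsCobdry k (f - g))
    (h' : IsCobdry k (g - l)) : IsCobdry k (f - l) := by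
  rw [← sub_add_sub_cancel f g l]
  exact h.add k h'

theorem mk_eq_mk_iff [IsScalarTower k (Env k A) N] {m : ℕ} (f g : cocycles k A N m) :
    (Submodule.Quotient.mk f : HochCoh k A N m) = Submodule.Quotient.mk g ↔
      IsCobdry k (⇑f.1 - ⇑g.1) :=
  Submodule.Quotient.eq (coboundaries k A N m)

end General

/-! ### The restriction of the class of `Θ(f)`. -/

section Koszul

variable {k A H : Type*} [Field k] [Ring A] [Algebra k A] [Ring H] [HopfAlgebra k H]
  [Module H A] [IsScalarTower k H A] [HModuleAlgebra k H A] {𝒜 : ℕ → Submodule k A}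
  (hhom : ∀ (h : H) (n : ℕ) (a : A), a ∈ 𝒜 n → h • a ∈ 𝒜 n)

/-- The `A`-bimodule underlying an induced `A # H`-bimodule. -/
@[reducible]
def indModule {M : Type*} [AddCommGroup M] [Module k M] (act : Gam k A H →ₐ[k] Module.End k M) :
    Module (Env k A) (Ind act) :=
  Module.compHom (Ind act) (envIn k A H).toRingHom

/-- The map `x ↦ 1 ⊗_Γ x` after `ψA` and the restriction of `ψB` to `A` are two chain maps from the
bar resolution of `A` to `Bᵉ ⊗_Γ K`, and both lift the inclusion `A → B`. Their target is exact, so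
they are homotopic over `Aᵉ`; composing with the cocycle `g` gives a coboundary. -/
theorem isCobdry_comparison_sub_resC [GradedAlgebra 𝒜] [IsSemisimpleRing H] (hA : IsKoszul 𝒜)
    {ψA : ∀ m, Cochain k A (KC 𝒜 m) m}
    (hψA : IsComparison k (fun m => KC 𝒜 m) (koszulD 𝒜) (koszulAug 𝒜) ψA)
    {ψB : ∀ m, Cochain k (Smash k A H) (Ind (kcGam hhom m)) m}
    (hψB : IsComparison k (fun m => Ind (kcGam hhom m)) (indD hhom) (indAug hhom) ψB) {m : ℕ}
    {f : KC 𝒜 m →ₗ[Env k A] Smash k A H}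
    {g : Ind (kcGam hhom m) →ₗ[Env k (Smash k A H)] Reg (Smash k A H)}
    (hg : ∀ x, g (indD hhom m x) = 0) (hfg : IsTheta (kcGam hhom m) f g) :
    IsCobdry k (⇑(compCochain f (ψA m)) - ⇑(resC (compCochain g (ψB m)))) := by
  let _ : ∀ m, Module (Env k A) (Ind (kcGam hhom m)) := fun m => indModule (kcGam hhom m)
  have hsm : ∀ (m) (e : Env k A) (x : Ind (kcGam hhom m)), e • x = envIn k A H e • x :=
    fun _ _ _ => rfl
  have : ∀ m, IsScalarTower k (Env k A) (Ind (kcGam hhom m)) := fun m =>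
    ⟨fun c e x => by rw [hsm, hsm, map_smul, smul_assoc]⟩
  let dY : ∀ m, Ind (kcGam hhom (m + 1)) →ₗ[Env k A] Ind (kcGam hhom m) := fun m =>
    { toFun := indD hhom m
      map_add' := map_add _
      map_smul' := fun e x => (indD hhom m).map_smul (envIn k A H e) x }
  let toS : ∀ m, (Ind (kcGam hhom m) →ₗ[Env k (Smash k A H)] Reg (Smash k A H)) →
      (Ind (kcGam hhom m) →ₗ[Env k A] Smash k A H) := fun m g =>
    { toFun := fun x => (toReg k (Smash k A H)).symm (g x)
      map_add' := fun x y => by rw [map_add, map_add]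
      map_smul' := fun e x => congrArg (toReg k (Smash k A H)).symm
        (g.map_smul (envIn k A H e) x) }
  have hres := ind_isProjRes hhom hA
  let ι : ∀ m, KC 𝒜 m →ₗ[Env k A] Ind (kcGam hhom m) := fun m =>
    { toFun := Ind.mk _ 1
      map_add' := Ind.mk_add _
      map_smul' := fun e x => by
        rw [RingHom.id_apply, hsm, ← gamAct_env (kcRep_isHBimod hhom m), ← Ind.gam_smul_mk]
        rfl }
  let ψ' : ∀ m, Cochain k A (Ind (kcGam hhom m)) m := fun m =>
    (ψB m).compLinearMap fun _ => (inA k A H).toLinearMap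
  have h := isCobdry_comparison_sub (N := Smash k A H) dY (toS 0 (indAug hhom))
    (fun x => hres.exact_zero x)
    (fun m => hres.exact_succ m) (ψ := fun m => compCochain (ι m) (ψA m)) (ψ' := ψ')
    (fun m a => by
      have e : dY m ∘ₗ ι (m + 1) = ι m ∘ₗ koszulD 𝒜 m := LinearMap.ext fun x => indD_mk hhom m 1 x
      rw [compCochain_apply, ← LinearMap.comp_apply, e, LinearMap.comp_apply, hψA.comm,
        ← hochD_comp]
      rfl)
    (fun m a => by
      refine (hψB.comm m fun i => inA k A H (a i)).trans ?_
      simp only [hochD, ψ', MultilinearMap.compLinearMap_apply, AlgHom.toLinearMap_apply,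
        inA_comp_contractNth, hsm]
      have e : envIn k A H (a 0 ⊗ₜ 1) = inA k A H (a 0) ⊗ₜ 1 := by
        rw [← MulOpposite.op_one, envIn_tmul, map_one, MulOpposite.op_one]
      rw [envIn_tmul, e, map_one]
      rfl) (fun a => ?_) (toS m g) (fun x => by
        exact congrArg (toReg k (Smash k A H)).symm (hg x))
  · convert h using 1
    funext a
    refine congrArg₂ (· - ·) (congrArg (toReg k (Smash k A H)).symm
      ((isTheta_iff _ _ _).1 hfg (ψA m a))).symm rfl
  · refine congrArg (toReg k (Smash k A H)).symm (((indAug_mk hhom 1 (ψA 0 a)).trans ?_).trans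
      (hψB.aug_eq _).symm)
    rw [hψA.aug_eq, one_smul]
    rfl

end Koszul

/-! ### Invariant classes and invariant cocycles. -/

section Invariants

variable {k A H : Type*} [Field k] [Ring A] [Algebra k A] [Ring H] [HopfAlgebra k H]
  [Module H A] [IsScalarTower k H A] [HModuleAlgebra k H A] {𝒜 : ℕ → Submodule k A}
  (hhom : ∀ (h : H) (n : ℕ) (a : A), a ∈ 𝒜 n → h • a ∈ 𝒜 n)

/-- `f ↼ h` for a coboundary `f`, where the preimage can be chosen as `v ↼ h`. -/
theorem exists_conj_comp {m : ℕ} {f : KC 𝒜 (m + 1) →ₗ[Env k A] Smash k A H}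
    {v : KC 𝒜 m →ₗ[Env k A] Smash k A H} (hv : f = v ∘ₗ koszulD 𝒜 m) (h : H) :
    ∃ v' : KC 𝒜 m →ₗ[Env k A] Smash k A H,
      (∀ x, v' x = conj k A (fun y => v (kcRep hhom m y x)) h) ∧
      ∀ x, conj k A (fun y => f (kcRep hhom (m + 1) y x)) h = v' (koszulD 𝒜 m x) := by
  obtain ⟨v', hv'⟩ := exists_conj (kcRep_isHBimod hhom m) v h
  refine ⟨v', hv', fun x => ?_⟩
  rw [hv', hv]
  simp only [LinearMap.comp_apply, koszulD_kcRep]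

theorem IsHomCobdry.conj {m : ℕ} {f f' : KC 𝒜 m →ₗ[Env k A] Smash k A H}
    (hf : IsHomCobdry (koszulD 𝒜) f) {h : H}
    (hf' : ∀ x, f' x = conj k A (fun y => f (kcRep hhom m y x)) h) :
    IsHomCobdry (koszulD 𝒜) f' := by
  cases m with
  | zero =>
    obtain rfl : f = 0 := hf
    refine LinearMap.ext fun x => ?_
    rw [hf']
    simp only [LinearMap.zero_apply, KoszulSmash.conj, mul_zero, zero_mul, sw₃, sw₂_zero_fun]
  | succ m =>
    obtain ⟨v, hv⟩ := hf
    obtain ⟨v', -, hv'⟩ := exists_conj_comp hhom hv h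
    exact ⟨v', LinearMap.ext fun x => by rw [hf', hv', LinearMap.comp_apply]⟩

theorem hochD_compCochain_comparison {R : Type*} [Ring R] [Algebra k R] {N : Type*}
    [AddCommGroup N] [Module k N] [Module (Env k R) N] [IsScalarTower k (Env k R) N]
    {X : ℕ → Type*} [∀ m, AddCommGroup (X m)] [∀ m, Module k (X m)]
    [∀ m, Module (Env k R) (X m)] [∀ m, IsScalarTower k (Env k R) (X m)]
    {dX : ∀ m, X (m + 1) →ₗ[Env k R] X m} {augX : X 0 →ₗ[Env k R] Reg R}
    {ψ : ∀ m, Cochain k R (X m) m} (hψ : IsComparison k X dX augX ψ) {m : ℕ}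
    {f : X m →ₗ[Env k R] N} (hf : ∀ x, f (dX m x) = 0) : hochD k (compCochain f (ψ m)) = 0 :=
  funext fun a => by
    refine (hochD_comp _ f (ψ m) a).trans ?_
    rw [← hψ.comm, hf]
    rfl

variable [GradedAlgebra 𝒜] (hA : IsKoszul 𝒜)
  {ψA : ∀ m, Cochain k A (KC 𝒜 m) m}
  (hψA : IsComparison k (fun m => KC 𝒜 m) (koszulD 𝒜) (koszulAug 𝒜) ψA)
include hA hψA

/-- The class of an invariant cocycle of `Hom(K, B)` is invariant. -/
theorem isCobdry_hochAct_sub {m : ℕ} {f : KC 𝒜 m →ₗ[Env k A] Smash k A H}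
    (hf : ∀ x, f (koszulD 𝒜 m x) = 0) (hinv : IsHInv (kcGam hhom m) f) (h : H) :
    IsCobdry k (hochAct (compCochain f (ψA m)) h -
      Coalgebra.counit (R := k) h • ⇑(compCochain f (ψA m))) := by
  have hres := koszul_isProjRes hA
  obtain ⟨φ, hφ, -⟩ := exists_hochAct (compCochain f (ψA m)) h
  have h0 : hochD k (compCochain f (ψA m)) = 0 := hochD_compCochain_comparison hψA hf
  have h1 := isCobdry_sub_comparison (toBar_isToBar 𝒜) hψA φ
    (by rw [hφ, hochD_hochAct_eq_zero h0])
  -- Since `ψA` need not be equivariant, the comparison takes place on `K`: there `f` differs from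
  -- the restriction of `f ∘ ψA` by a coboundary, and applying `↼ h`, which commutes with this
  -- restriction, turns the difference into the one for `ε(h) f` and `φ`.
  have h2 := isHomCobdry_sub hres (toBar_isToBar 𝒜) hψA f hf
  obtain ⟨u, hu⟩ := exists_conj (kcRep_isHBimod hhom m)
    (f - barHom (compCochain f (ψA m)) ∘ₗ toBar 𝒜 m) h
  have h3 := (h2.conj hhom hu).comp hψA.comm
  have h4 : ∀ x, u x = Coalgebra.counit (R := k) h • f x - barHom φ (toBar 𝒜 m x) := by
    intro x
    rw [hu, barHom_toBar_hochAct hhom hφ, ← (isHInv_iff_conj (kcRep_isHBimod hhom m) f).1 hinv,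
      eq_sub_iff_add_eq, ← conj_add]
    simp only [LinearMap.sub_apply, LinearMap.comp_apply, sub_add_cancel]
  rw [← hφ]
  refine IsCobdry.trans (g := fun a => barHom φ (toBar 𝒜 m (ψA m a))) h1 ?_
  refine IsCobdry.symm ?_
  convert h3 using 1
  funext a
  rw [h4]
  rfl

omit [GradedAlgebra 𝒜] hA in
/-- An invariant class comes from an invariant cocycle of `Hom(K, B)`. -/
theorem exists_isHInv [IsSemisimpleRing H] {m : ℕ} {φ : Cochain k A (Smash k A H) m}
    (hφ : hochD k φ = 0) (hinv : ∀ h, IsCobdry k (hochAct φ h -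
      Coalgebra.counit (R := k) h • ⇑φ)) :
    ∃ f : KC 𝒜 m →ₗ[Env k A] Smash k A H, IsHInv (kcGam hhom m) f ∧
      (∀ x, f (koszulD 𝒜 m x) = 0) ∧ IsCobdry k (⇑φ - ⇑(compCochain f (ψA m))) := by
  -- Acting by the integral makes the restriction of `φ` to `K` strictly invariant. It does not
  -- change the class, because that class is invariant and `ε(t) = 1`.
  obtain ⟨t, ht1, ht⟩ := exists_integral k H
  obtain ⟨φ', hφ', -⟩ := exists_hochAct φ t
  have hd : hochD k φ' = 0 := by rw [hφ', hochD_hochAct_eq_zero hφ]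
  refine ⟨barHom φ' ∘ₗ toBar 𝒜 m, isHInv_of_conj (kcRep_isHBimod hhom m) ht
    (f := barHom φ ∘ₗ toBar 𝒜 m) (fun x => barHom_toBar_hochAct hhom hφ' x), fun x => ?_, ?_⟩
  · have : barHom φ' ∘ₗ barDC k A m = 0 := barC_hom_ext fun a => by
      rw [LinearMap.comp_apply, barHom_comp_barDC, hd]
      rfl
    rw [LinearMap.comp_apply, ← (toBar_isToBar 𝒜).comm]
    exact LinearMap.congr_fun this _
  · refine IsCobdry.trans (g := ⇑φ') (IsCobdry.symm ?_)
      (isCobdry_sub_comparison (toBar_isToBar 𝒜) hψA φ' hd)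
    have := hinv t
    rwa [ht1, one_smul, ← hφ'] at this

omit [GradedAlgebra 𝒜] hA hψA in
theorem koszulD_eq_zero_of_isTheta {m : ℕ} {f : KC 𝒜 m →ₗ[Env k A] Smash k A H}
    {g : Ind (kcGam hhom m) →ₗ[Env k (Smash k A H)] Reg (Smash k A H)}
    (hfg : IsTheta (kcGam hhom m) f g) :
    (∀ x, f (koszulD 𝒜 m x) = 0) ↔ ∀ x, g (indD hhom m x) = 0 := by
  have key : ∀ x, g (indD hhom m (Ind.mk _ 1 x)) = toReg k _ (f (koszulD 𝒜 m x)) := fun x => by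
    rw [indD_mk, (isTheta_iff (kcRep_isHBimod hhom m) f g).1 hfg]
  constructor
  · intro h x
    have : g ∘ₗ indD hhom m = 0 := Ind.hom_ext fun x => by
      rw [LinearMap.comp_apply, key, h, map_zero]
      rfl
    exact LinearMap.congr_fun this x
  · intro h x
    apply (toReg k (Smash k A H)).injective
    rw [← key, h, map_zero]

variable [IsSemisimpleRing H]
  {ψB : ∀ m, Cochain k (Smash k A H) (Ind (kcGam hhom m)) m}
  (hψB : IsComparison k (fun m => Ind (kcGam hhom m)) (indD hhom) (indAug hhom) ψB)
include hψB

omit hψA in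
/-- Every class of `HH^•(B)` comes from an invariant cocycle of `Hom(K, B)`. -/
theorem exists_isTheta {m : ℕ} (F : Cochain k (Smash k A H) (Reg (Smash k A H)) m)
    (hF : hochD k F = 0) : ∃ (f : KC 𝒜 m →ₗ[Env k A] Smash k A H)
      (g : Ind (kcGam hhom m) →ₗ[Env k (Smash k A H)] Reg (Smash k A H)),
      IsHInv (kcGam hhom m) f ∧ IsTheta (kcGam hhom m) f g ∧ (∀ x, g (indD hhom m x) = 0) ∧
      IsCobdry k (⇑F - ⇑(compCochain g (ψB m))) := by
  obtain ⟨κ, hκ⟩ := exists_isToBar (ind_isProjRes hhom hA)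
  obtain ⟨f, ⟨hf, hfg⟩, -⟩ := existsUnique_of_theta (kcRep_isHBimod hhom m) (barHom F ∘ₗ κ m)
  refine ⟨f, _, hf, hfg, fun x => ?_, isCobdry_sub_comparison hκ hψB F hF⟩
  have : barHom F ∘ₗ barDC k (Smash k A H) m = 0 := barC_hom_ext fun a => by
    rw [LinearMap.comp_apply, barHom_comp_barDC, hF]
    rfl
  rw [LinearMap.comp_apply, ← hκ.comm]
  exact LinearMap.congr_fun this _

/-- `Θ(f)` is a coboundary if `f` is. -/
theorem isCobdry_theta {m : ℕ} {f : KC 𝒜 m →ₗ[Env k A] Smash k A H}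
    {g : Ind (kcGam hhom m) →ₗ[Env k (Smash k A H)] Reg (Smash k A H)}
    (hinv : IsHInv (kcGam hhom m) f) (hfg : IsTheta (kcGam hhom m) f g)
    (hg : ∀ x, g (indD hhom m x) = 0) (hf : IsCobdry k (compCochain f (ψA m))) :
    IsCobdry k (compCochain g (ψB m)) := by
  have hfd := (koszulD_eq_zero_of_isTheta hhom hfg).2 hg
  have h1 : IsHomCobdry (koszulD 𝒜) f :=
    isHomCobdry_of_isCobdry (koszul_isProjRes hA) hψA f hfd hf
  have hfg' := (isTheta_iff (kcRep_isHBimod hhom m) f g).1 hfg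
  suffices IsHomCobdry (indD hhom) g from
    this.comp (X := fun m => Ind (kcGam hhom m)) (ψ := ψB) hψB.comm
  cases m with
  | zero =>
    obtain rfl : f = 0 := h1
    refine Ind.hom_ext fun x => ?_
    rw [hfg', LinearMap.zero_apply, map_zero]
    rfl
  | succ m =>
    obtain ⟨v, hv⟩ := h1
    -- The primitive `v` of `f` need not be invariant, so `Θ` does not apply to it. Averaging by `t`
    -- makes it invariant and leaves `f`, which is invariant already, unchanged.
    obtain ⟨t, ht1, ht⟩ := exists_integral k H
    obtain ⟨v', hv', hv''⟩ := exists_conj_comp hhom hv t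
    refine ⟨theta (kcRep_isHBimod hhom m) v' (isHInv_of_conj _ ht hv'), Ind.hom_ext fun x => ?_⟩
    rw [hfg', LinearMap.comp_apply, indD_mk, theta_mk, one_smul, ← hv'',
      conj_of_isHInv (kcRep_isHBimod hhom (m + 1)) ht1 hinv]

end Invariants

/-! ### Cup products and the Leibniz rule. -/

section Cup

variable {k A N : Type*} [Field k] [Ring A] [Algebra k A] [Ring N] [Algebra k N]
  [Module (Env k A) N]

/-- Needed for `(m + 1) + n`, which is not a successor by definition when `n` is a variable. -/
theorem isCobdry_of_eq_hochD {p q : ℕ} (e : p = q + 1) {f : (Fin p → A) → N}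
    (g : Cochain k A N q)
    (h : ∀ a : Fin (q + 1) → A, f (fun i => a (Fin.cast e i)) = hochD k g a) : IsCobdry k f := by
  subst e
  exact ⟨g, funext h⟩

/-- The cup product of cochains. -/
def cupC {m n : ℕ} (f : Cochain k A N m) (g : Cochain k A N n) : Cochain k A N (m + n) :=
  (LinearMap.mul' k N).compMultilinearMap ((f.domCoprod g).domDomCongr finSumFinEquiv)

theorem coe_cupC {m n : ℕ} (f : Cochain k A N m) (g : Cochain k A N n) :
    ⇑(cupC f g) = cup f g := rfl

theorem contractNth_castAdd {m n : ℕ} (i : Fin m) (a : Fin (m + n + 1) → A) :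
    (fun j : Fin m => Fin.contractNth (Fin.castAdd n i).castSucc (· * ·) a (Fin.castAdd n j)) =
      Fin.contractNth i.castSucc (· * ·) fun j : Fin (m + 1) => a (Fin.castLE (by omega) j) := by
  funext j
  simp only [Fin.contractNth, Fin.val_castSucc, Fin.val_castAdd]
  split_ifs <;> rfl

theorem contractNth_castAdd_natAdd {m n : ℕ} (i : Fin m) (a : Fin (m + n + 1) → A) (j : Fin n) :
    Fin.contractNth (Fin.castAdd n i).castSucc (· * ·) a (Fin.natAdd m j) =
      a (Fin.natAdd m j.succ) := by
  have := i.2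
  simp only [Fin.contractNth, Fin.val_castSucc, Fin.val_castAdd, Fin.val_natAdd]
  rw [if_neg (by omega), if_neg (by omega)]
  rfl

theorem contractNth_natAdd_castAdd {m n : ℕ} (i : Fin n) (a : Fin (m + n + 1) → A) (j : Fin m) :
    Fin.contractNth (Fin.natAdd m i).castSucc (· * ·) a (Fin.castAdd n j) =
      a (Fin.castAdd (n + 1) j) := by
  have := j.2
  simp only [Fin.contractNth, Fin.val_castSucc, Fin.val_castAdd, Fin.val_natAdd]
  rw [if_pos (by omega)]
  rfl

theorem contractNth_natAdd {m n : ℕ} (i : Fin n) (a : Fin (m + n + 1) → A) :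
    (fun j : Fin n => Fin.contractNth (Fin.natAdd m i).castSucc (· * ·) a (Fin.natAdd m j)) =
      Fin.contractNth i.castSucc (· * ·) fun j : Fin (n + 1) => a (Fin.natAdd m j) := by
  funext j
  simp only [Fin.contractNth, Fin.val_castSucc, Fin.val_natAdd, Nat.add_lt_add_iff_left,
    Nat.add_left_cancel_iff]
  split_ifs <;> rfl

variable {j : A →ₐ[k] N}
  (hj : ∀ (a b : A) (x : N), (a ⊗ₜ MulOpposite.op b : Env k A) • x = j a * x * j b)
include hj

theorem hochD_eq_mul {m : ℕ} (f : (Fin m → A) → N) (a : Fin (m + 1) → A) :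
    hochD k f a = j (a 0) * f (Fin.tail a)
      + ∑ i : Fin m, (-1 : ℤ) ^ ((i : ℕ) + 1) • f (Fin.contractNth i.castSucc (· * ·) a)
      + (-1 : ℤ) ^ (m + 1) • (f (Fin.init a) * j (a (Fin.last m))) := by
  rw [hochD, ← MulOpposite.op_one, hj, hj, map_one, one_mul, mul_one]

/-- The Leibniz rule for the cup product. -/
theorem hochD_cup {m n : ℕ} (f : (Fin m → A) → N) (g : (Fin n → A) → N)
    (a : Fin (m + n + 1) → A) : hochD k (cup f g) a =
      hochD k f (fun i : Fin (m + 1) => a (Fin.castLE (by omega) i)) *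
        g (fun i => a (Fin.natAdd m i.succ)) +
      (-1 : ℤ) ^ m • (f (fun i => a (Fin.castAdd (n + 1) i)) *
        hochD k g (fun i : Fin (n + 1) => a (Fin.natAdd m i))) := by
  rw [hochD_eq_mul hj, hochD_eq_mul hj, hochD_eq_mul hj, Fin.sum_univ_add]
  simp only [cup, contractNth_castAdd, contractNth_castAdd_natAdd, contractNth_natAdd_castAdd,
    contractNth_natAdd, add_mul, mul_add, smul_add, Finset.sum_mul, Finset.mul_sum,
    Finset.smul_sum, smul_mul_assoc, mul_smul_comm, smul_smul, Fin.val_castAdd, Fin.val_natAdd]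
  have e0 : a (Fin.castLE (by omega) (0 : Fin (m + 1))) = a 0 := rfl
  have e1 : a (Fin.natAdd m (0 : Fin (n + 1))) = a (Fin.castLE (by omega) (Fin.last m)) := rfl
  have e2 : a (Fin.natAdd m (Fin.last n)) = a (Fin.last (m + n)) := rfl
  have e3 : Fin.tail (fun i : Fin (m + 1) => a (Fin.castLE (by omega) i)) =
      fun i => Fin.tail a (Fin.castAdd n i) := rfl
  have e4 : Fin.init (fun i : Fin (m + 1) => a (Fin.castLE (by omega) i)) =
      fun i => a (Fin.castAdd (n + 1) i) := rfl
  have e5 : Fin.tail (fun i : Fin (n + 1) => a (Fin.natAdd m i)) =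
      fun i => a (Fin.natAdd m i.succ) := rfl
  have e6 : Fin.init (fun i : Fin (n + 1) => a (Fin.natAdd m i)) =
      fun i => Fin.init a (Fin.natAdd m i) := rfl
  have e7 : (fun i => Fin.init a (Fin.castAdd n i)) =
      fun i : Fin m => a (Fin.castAdd (n + 1) i) := rfl
  have e8 : (fun i => Fin.tail a (Fin.natAdd m i)) =
      fun i : Fin n => a (Fin.natAdd m i.succ) := rfl
  rw [e0, e1, e2, e3, e4, e5, e6, e7, e8]
  simp only [add_assoc m, pow_add (-1 : ℤ) m, pow_one, mul_neg, mul_one, neg_smul, mul_assoc]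
  abel

theorem hochD_cup_eq_zero {m n : ℕ} {f : (Fin m → A) → N} {g : (Fin n → A) → N}
    (hf : hochD k f = 0) (hg : hochD k g = 0) : hochD k (cup f g) = 0 := by
  funext a
  rw [hochD_cup hj, hf, hg]
  simp

theorem IsCobdry.cup_left {m n : ℕ} {f : (Fin m → A) → N} (hf : IsCobdry k f)
    (g : Cochain k A N n) (hg : hochD k g = 0) : IsCobdry k (cup f g) := by
  cases m with
  | zero =>
    obtain rfl : f = 0 := hf
    convert IsCobdry.zero k using 1
    funext a
    exact zero_mul _
  | succ m =>
    obtain ⟨u, rfl⟩ := hf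
    refine isCobdry_of_eq_hochD (by omega) (cupC u g) fun a => ?_
    rw [coe_cupC, hochD_cup hj, hg, Pi.zero_apply, mul_zero, smul_zero, add_zero, cup]
    congr 2
    funext i
    congr 1
    ext
    simp only [Fin.val_cast, Fin.val_natAdd, Fin.val_succ]
    omega

theorem IsCobdry.cup_right {m n : ℕ} {g : (Fin n → A) → N} (hg : IsCobdry k g)
    (f : Cochain k A N m) (hf : hochD k f = 0) : IsCobdry k (cup f g) := by
  cases n with
  | zero =>
    obtain rfl : g = 0 := hg
    convert IsCobdry.zero k using 1
    funext a
    exact mul_zero _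
  | succ n =>
    obtain ⟨u, rfl⟩ := hg
    -- The sign cancels the one that the Leibniz rule puts in front of the term with the
    -- differential of the second factor.
    refine ⟨(-1 : ℤ) ^ m • cupC f u, funext fun a => ?_⟩
    have h : hochD k ((-1 : ℤ) ^ m • cup f u) a = (-1 : ℤ) ^ m • hochD k (cup f u) a := by
      simp only [hochD, Pi.smul_apply, smul_add, Finset.smul_sum, smul_comm ((-1 : ℤ) ^ m)]
    refine Eq.trans ?_ h.symm
    rw [hochD_cup hj, hf, Pi.zero_apply, zero_mul, zero_add, smul_smul, ← mul_pow]
    simp only [mul_neg, mul_one, neg_neg, one_pow, one_smul]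
    rfl

end Cup

/-! ### The isomorphism `E`. -/

section Iso

theorem exists_equiv_of_range {k V W : Type*} [Field k] [AddCommGroup V] [Module k V]
    [AddCommGroup W] [Module k W] (φ : V →ₗ[k] W) (U : Submodule k W)
    (hinj : ∀ v, φ v = 0 → v = 0) (hU : ∀ v, φ v ∈ U) (hsurj : ∀ u ∈ U, ∃ v, φ v = u) :
    ∃ E : U ≃ₗ[k] V, ∀ u, φ (E u) = u := by
  let e : V ≃ₗ[k] U := LinearEquiv.ofBijective (φ.codRestrict U hU)
    ⟨(injective_iff_map_eq_zero _).2 fun v hv => hinj v (congrArg Subtype.val hv),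
      fun u => (hsurj u u.2).imp fun v hv => Subtype.ext hv⟩
  exact ⟨e.symm, fun u => congrArg Subtype.val (e.apply_symm_apply u)⟩

theorem mk_eq_zero_iff {k A N : Type*} [Field k] [Ring A] [Algebra k A] [AddCommGroup N]
    [Module (Env k A) N] [Module k N] [IsScalarTower k (Env k A) N] {m : ℕ}
    (f : cocycles k A N m) :
    (Submodule.Quotient.mk f : HochCoh k A N m) = 0 ↔ IsCobdry k f.1 :=
  Submodule.Quotient.mk_eq_zero (coboundaries k A N m)

variable {k A H : Type*} [Field k] [Ring A] [Algebra k A] [Ring H] [HopfAlgebra k H]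
  [Module H A] [IsScalarTower k H A] [HModuleAlgebra k H A]

theorem resHoch_mk {m : ℕ} (F : cocycles k (Smash k A H) (Reg (Smash k A H)) m) :
    resHoch k A H m (Submodule.Quotient.mk F) = Submodule.Quotient.mk (resZ k A H m F) :=
  hochMap_mk _ _ _

theorem coe_resZ {m : ℕ} (F : cocycles k (Smash k A H) (Reg (Smash k A H)) m) :
    (resZ k A H m F).1 = resC F.1 := rfl

variable {𝒜 : ℕ → Submodule k A}
  [GradedAlgebra 𝒜] [IsSemisimpleRing H] (hA : IsKoszul 𝒜)
  (hhom : ∀ (h : H) (n : ℕ) (a : A), a ∈ 𝒜 n → h • a ∈ 𝒜 n)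

include hA hhom

/-- Taking `E` as the inverse of restriction makes it independent of comparison maps. Every class of
`HH^•(B)` is represented by some `Θ(f)` with `f` invariant, and its restriction is the class of `f`.
The kernel is zero by `isCobdry_theta`, the image lies in the invariants by `isCobdry_hochAct_sub`,
and it is all of them by `exists_isHInv`. -/
theorem exists_resHoch_equiv (m : ℕ) :
    ∃ E : hochInv k A H m ≃ₗ[k] HochCoh k (Smash k A H) (Reg (Smash k A H)) m,
      ∀ x, resHoch k A H m (E x) = x := by
  have hB := ind_isProjRes hhom hA
  obtain ⟨ψA, hψA⟩ := exists_isComparison (k := k) (Y := fun m => KC 𝒜 m) (koszulD 𝒜) (koszulAug 𝒜)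
    (koszul_isProjRes hA).surjective (koszul_isProjRes hA).exact_zero
    (koszul_isProjRes hA).exact_succ
  obtain ⟨ψB, hψB⟩ := exists_isComparison (k := k) (Y := fun m => Ind (kcGam hhom m))
    (indD hhom) (indAug hhom) hB.surjective hB.exact_zero hB.exact_succ
  refine exists_equiv_of_range _ _ (fun X => ?_) (fun X => ?_) fun x hx => ?_
  · obtain ⟨F, rfl⟩ := Submodule.Quotient.mk_surjective _ X
    obtain ⟨f, g, hf, hfg, hg, hF⟩ := exists_isTheta hhom hA hψB F.1 F.2
    rw [resHoch_mk, mk_eq_zero_iff, mk_eq_zero_iff, coe_resZ]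
    intro h0
    have h1 := isCobdry_comparison_sub_resC hhom hA hψA hψB hg hfg
    have h2 : IsCobdry k (⇑(resC F.1) - ⇑(resC (compCochain g (ψB m)))) :=
      IsCobdry.resC (F := F.1 - compCochain g (ψB m)) hF
    have h3 := isCobdry_theta hhom hA hψA hψB hf hfg hg (by
      have := (h1.trans h2.symm).add k h0
      rwa [sub_add_cancel] at this)
    have := hF.add k h3
    rwa [sub_add_cancel] at this
  · obtain ⟨F, rfl⟩ := Submodule.Quotient.mk_surjective _ X
    obtain ⟨f, g, hf, hfg, hg, hF⟩ := exists_isTheta hhom hA hψB F.1 F.2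
    have hfd := (koszulD_eq_zero_of_isTheta hhom hfg).2 hg
    refine ⟨⟨compCochain f (ψA m), hochD_compCochain_comparison hψA hfd⟩, ?_,
      isCobdry_hochAct_sub hhom hA hψA hfd hf⟩
    have h2 : IsCobdry k (⇑(resC F.1) - ⇑(resC (compCochain g (ψB m)))) :=
      IsCobdry.resC (F := F.1 - compCochain g (ψB m)) hF
    rw [resHoch_mk, mk_eq_mk_iff]
    exact (isCobdry_comparison_sub_resC hhom hA hψA hψB hg hfg).trans h2.symm
  · obtain ⟨φ, rfl, hφ⟩ := hx
    obtain ⟨f, hf, hfd, hφf⟩ := exists_isHInv hhom hψA φ.2 hφ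
    obtain ⟨g, hfg, -⟩ := existsUnique_theta (kcRep_isHBimod hhom m) f hf
    have hg := (koszulD_eq_zero_of_isTheta hhom hfg).1 hfd
    refine ⟨Submodule.Quotient.mk ⟨compCochain g (ψB m), hochD_compCochain_comparison hψB hg⟩, ?_⟩
    rw [resHoch_mk, mk_eq_mk_iff]
    exact (hφf.trans (isCobdry_comparison_sub_resC hhom hA hψA hψB hg hfg)).symm

/-- A right inverse of the restriction is induced by `Θ`. -/
theorem exists_isRep_theta {m : ℕ}
    {E : hochInv k A H m ≃ₗ[k] HochCoh k (Smash k A H) (Reg (Smash k A H)) m}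
    (hE : ∀ x, resHoch k A H m (E x) = x) {ψA : ∀ m, Cochain k A (KC 𝒜 m) m}
    (hψA : IsComparison k (fun m => KC 𝒜 m) (koszulD 𝒜) (koszulAug 𝒜) ψA)
    {ψB : ∀ m, Cochain k (Smash k A H) (Ind (kcGam hhom m)) m}
    (hψB : IsComparison k (fun m => Ind (kcGam hhom m)) (indD hhom) (indAug hhom) ψB)
    {f : KC 𝒜 m →ₗ[Env k A] Smash k A H}
    {g : Ind (kcGam hhom m) →ₗ[Env k (Smash k A H)] Reg (Smash k A H)}
    (hfd : f ∘ₗ koszulD 𝒜 m = 0) (hfg : IsTheta (kcGam hhom m) f g) :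
    ∃ x : hochInv k A H m,
      IsRep k (fun a => f (ψA m a)) (x : HochCoh k A (Smash k A H) m) ∧
      IsRep k (fun b => g (ψB m b)) (E x) := by
  have hf : ∀ x, f (koszulD 𝒜 m x) = 0 := LinearMap.congr_fun hfd
  have hg := (koszulD_eq_zero_of_isTheta hhom hfg).1 hf
  let Z : cocycles k (Smash k A H) (Reg (Smash k A H)) m :=
    ⟨compCochain g (ψB m), hochD_compCochain_comparison hψB hg⟩
  -- The invariant class is found from the side of `B`, as the one that `E` sends to the class of
  -- `Θ(f)`; that it is the class of `f` then follows by restricting.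
  obtain ⟨x, hx⟩ := E.surjective (Submodule.Quotient.mk Z)
  refine ⟨x, ⟨⟨compCochain f (ψA m), hochD_compCochain_comparison hψA hf⟩, rfl, ?_⟩,
    ⟨Z, rfl, hx.symm⟩⟩
  rw [← hE x, hx, resHoch_mk, mk_eq_mk_iff]
  exact isCobdry_comparison_sub_resC hhom hA hψA hψB hg hfg

omit hA hhom [GradedAlgebra 𝒜] [IsSemisimpleRing H]

/-- A right inverse of the restriction preserves cup products. -/
theorem exists_isRep_cup {E : ∀ m, hochInv k A H m ≃ₗ[k]
      HochCoh k (Smash k A H) (Reg (Smash k A H)) m}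
    (hE : ∀ m x, resHoch k A H m (E m x) = x) {m n : ℕ} (x : hochInv k A H m)
    (y : hochInv k A H n) {f : (Fin m → A) → Smash k A H} {g : (Fin n → A) → Smash k A H}
    {F : (Fin m → Smash k A H) → Reg (Smash k A H)}
    {G : (Fin n → Smash k A H) → Reg (Smash k A H)}
    (hf : IsRep k f (x : HochCoh k A (Smash k A H) m))
    (hg : IsRep k g (y : HochCoh k A (Smash k A H) n))
    (hF : IsRep k F (E m x)) (hG : IsRep k G (E n y)) :
    ∃ z : hochInv k A H (m + n),
      IsRep k (cup f g) (z : HochCoh k A (Smash k A H) (m + n)) ∧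
      IsRep k (cup F G) (E (m + n) z) := by
  obtain ⟨f, rfl, hf⟩ := hf
  obtain ⟨g, rfl, hg⟩ := hg
  obtain ⟨F, rfl, hF⟩ := hF
  obtain ⟨G, rfl, hG⟩ := hG
  have hA' : ∀ (a b : A) (x : Smash k A H),
      (a ⊗ₜ MulOpposite.op b : Env k A) • x = inA k A H a * x * inA k A H b := smash_smul k A H
  have hB' : ∀ (a b : Smash k A H) (x : Reg (Smash k A H)),
      (a ⊗ₜ MulOpposite.op b : Env k (Smash k A H)) • x =
        (toReg k (Smash k A H)).toAlgHom a * x * (toReg k (Smash k A H)).toAlgHom b :=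
    fun a b x => reg_smul a b x
  have hxF : IsCobdry k (⇑f.1 - ⇑(resC F.1)) := by
    have := hE m x
    rwa [← hF, resHoch_mk, ← hf, eq_comm, mk_eq_mk_iff] at this
  have hyG : IsCobdry k (⇑g.1 - ⇑(resC G.1)) := by
    have := hE n y
    rwa [← hG, resHoch_mk, ← hg, eq_comm, mk_eq_mk_iff] at this
  let Z : cocycles k (Smash k A H) (Reg (Smash k A H)) (m + n) :=
    ⟨cupC F.1 G.1, hochD_cup_eq_zero hB' F.2 G.2⟩
  obtain ⟨z, hz⟩ := (E (m + n)).surjective (Submodule.Quotient.mk Z)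
  refine ⟨z, ⟨⟨cupC f.1 g.1, hochD_cup_eq_zero hA' f.2 g.2⟩, rfl, ?_⟩, ⟨Z, rfl, hz.symm⟩⟩
  rw [← hE _ z, hz, resHoch_mk, mk_eq_mk_iff]
  have h := (hxF.cup_left hA' g.1 g.2).add k
    (hyG.cup_right hA' (resC F.1) (resZ k A H m F).2)
  -- Restriction commutes with the cup product of cochains on the nose, so it remains to exchange
  -- representatives one factor at a time; each exchange costs a coboundary, by the Leibniz rule.
  have e : cup (⇑f.1 - ⇑(resC F.1)) ⇑g.1 + cup (⇑(resC F.1)) (⇑g.1 - ⇑(resC G.1)) =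
      cup ⇑f.1 ⇑g.1 - ⇑(resC (cupC F.1 G.1)) := funext fun a => by
    simp only [Pi.add_apply, Pi.sub_apply, cup, sub_mul, mul_sub, sub_add_sub_cancel]
    rfl
  rw [e] at h
  exact h

end Iso

end KoszulSmash

end

theorem mainTheorem5 {k A H : Type*} [Field k]
    -- a Koszul algebra `A` with its grading
    [Ring A] [Algebra k A] (𝒜 : ℕ → Submodule k A) [GradedAlgebra 𝒜] (hA : IsKoszul 𝒜)
    -- a finite dimensional semisimple Hopf algebra `H`, acting homogeneously on `A`
    [Ring H] [HopfAlgebra k H] [FiniteDimensional k H] [IsSemisimpleRing H]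
    [Module H A] [IsScalarTower k H A] [HModuleAlgebra k H A]
    (hhom : ∀ (h : H) (n : ℕ) (a : A), a ∈ 𝒜 n → h • a ∈ 𝒜 n) :
    -- the left `Γ`-module structure of the Koszul complex `K = K(A)`
    ∃ act : ∀ m, Gam k A H →ₐ[k] Module.End k (KC 𝒜 m),
      (∀ (m : ℕ) (e : Env k A) (x : KC 𝒜 m), act m (envGam k A H e) x = e • x) ∧
      (∀ (m : ℕ) (h : H) (x : KC 𝒜 m),
        KC.val 𝒜 (act m (hopfGam k A H h) x) = barAct h (KC.val 𝒜 x)) ∧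
      -- `K` is a complex of left `Γ`-modules and a resolution of `A`, projective over `Aᵉ`
      IsProjRes (Env k A) (fun m => KC 𝒜 m) (koszulD 𝒜) (koszulAug 𝒜) ∧
      (∀ (m : ℕ) (γ : Gam k A H) (x : KC 𝒜 (m + 1)),
        koszulD 𝒜 m (act (m + 1) γ x) = act m γ (koszulD 𝒜 m x)) ∧
      (∀ (γ : Gam k A H) (x : KC 𝒜 0),
        toReg k _ (inA k A H ((toReg k A).symm (koszulAug 𝒜 (act 0 γ x)))) =
          (γ : Env k (Smash k A H)) •
            toReg k _ (inA k A H ((toReg k A).symm (koszulAug 𝒜 x)))) ∧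
      -- `Bᵉ ⊗_Γ K` is a projective resolution of `B = A # H` over `Bᵉ`
      ∃ (dB : ∀ m, Ind (act (m + 1)) →ₗ[Env k (Smash k A H)] Ind (act m))
        (augB : Ind (act 0) →ₗ[Env k (Smash k A H)] Reg (Smash k A H)),
        (∀ (m : ℕ) (e : Env k (Smash k A H)) (x : KC 𝒜 (m + 1)),
          dB m (Ind.mk (act (m + 1)) e x) = Ind.mk (act m) e (koszulD 𝒜 m x)) ∧
        (∀ (e : Env k (Smash k A H)) (x : KC 𝒜 0),
          augB (Ind.mk (act 0) e x) =
            e • toReg k _ (inA k A H ((toReg k A).symm (koszulAug 𝒜 x)))) ∧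
        IsProjRes (Env k (Smash k A H)) (fun m => Ind (act m)) dB augB ∧
        -- `Θ : Hom_{Aᵉ}(K, B)^H → Hom_{Bᵉ}(Bᵉ ⊗_Γ K, B)` is well defined and bijective
        (∀ (m : ℕ) (f : KC 𝒜 m →ₗ[Env k A] Smash k A H), IsHInv (act m) f →
          ∃! g : Ind (act m) →ₗ[Env k (Smash k A H)] Reg (Smash k A H), IsTheta (act m) f g) ∧
        (∀ (m : ℕ) (g : Ind (act m) →ₗ[Env k (Smash k A H)] Reg (Smash k A H)),
          ∃! f : KC 𝒜 m →ₗ[Env k A] Smash k A H, IsHInv (act m) f ∧ IsTheta (act m) f g) ∧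
        -- `K` and `Bᵉ ⊗_Γ K` are comparable with the bar resolutions of `A` and `B`
        (∃ ψA, IsComparison k (fun m => KC 𝒜 m) (koszulD 𝒜) (koszulAug 𝒜) ψA) ∧
        (∃ ψB, IsComparison k (fun m => Ind (act m)) dB augB ψB) ∧
        -- the isomorphism `E : H^•(A, B)^H ≅ HH^•(B)`
        ∃ E : ∀ m, hochInv k A H m ≃ₗ[k] HochCoh k (Smash k A H) (Reg (Smash k A H)) m,
          -- `E` is induced by `Θ`
          (∀ ψA ψB,
            IsComparison k (fun m => KC 𝒜 m) (koszulD 𝒜) (koszulAug 𝒜) ψA →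
            IsComparison k (fun m => Ind (act m)) dB augB ψB →
            ∀ (m : ℕ) (f : KC 𝒜 m →ₗ[Env k A] Smash k A H)
              (g : Ind (act m) →ₗ[Env k (Smash k A H)] Reg (Smash k A H)),
              IsHInv (act m) f → f ∘ₗ koszulD 𝒜 m = 0 → IsTheta (act m) f g →
              ∃ x : hochInv k A H m,
                IsRep k (fun a => f (ψA m a)) (x : HochCoh k A (Smash k A H) m) ∧
                IsRep k (fun b => g (ψB m b)) (E m x)) ∧
          -- `E` preserves cup products
          (∀ (m n : ℕ) (x : hochInv k A H m) (y : hochInv k A H n)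
            (f : (Fin m → A) → Smash k A H) (g : (Fin n → A) → Smash k A H)
            (F : (Fin m → Smash k A H) → Reg (Smash k A H))
            (G : (Fin n → Smash k A H) → Reg (Smash k A H)),
            IsRep k f (x : HochCoh k A (Smash k A H) m) →
            IsRep k g (y : HochCoh k A (Smash k A H) n) →
            IsRep k F (E m x) → IsRep k G (E n y) →
            ∃ z : hochInv k A H (m + n),
              IsRep k (cup f g) (z : HochCoh k A (Smash k A H) (m + n)) ∧
              IsRep k (cup F G) (E (m + n) z)) := by
  have hA' := koszul_isProjRes hA
  have hB := ind_isProjRes hhom hA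
  choose E hE using exists_resHoch_equiv hA hhom
  refine ⟨kcGam hhom, fun m e x => gamAct_env _ e x, fun m h x => ?_, hA', koszulD_kcGam hhom,
    koszulAugB_kcGam hhom, indD hhom, indAug hhom, indD_mk hhom, indAug_mk hhom, hB,
    fun m f hf => existsUnique_theta (kcRep_isHBimod hhom m) f hf,
    fun m g => existsUnique_of_theta (kcRep_isHBimod hhom m) g,
    exists_isComparison (Y := fun m => KC 𝒜 m) _ _ hA'.surjective hA'.exact_zero hA'.exact_succ,
    exists_isComparison (Y := fun m => Ind (kcGam hhom m)) _ _ hB.surjective hB.exact_zero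
      hB.exact_succ,
    E, fun ψA ψB hψA hψB m f g _ hf hfg => exists_isRep_theta hA hhom (hE m) hψA hψB hf hfg,
    fun m n x y f g F G => exists_isRep_cup hE x y⟩
  rw [gamAct_hopf, val_kcRep]
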